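/- **Setting.** Work on $\mathbb R^4$, with $\langle y\rangle=(1+|y|^2)^{1/2}$. Fix an orthonormal basis $\mathbf e_1,\dots,\mathbf e_4$ of $\mathbb R^4$; a function $\varphi\in C_c^\infty(\mathbb R^4;\mathbb R)$ with $\varphi(\xi)=1$ for $|\xi|\le 1$ and $\varphi(\xi)=0$ for $|\xi|>2$; a function $\phi\in C_c^\infty((0,\infty);\mathbb R)$; and $\varepsilon>0$ with $\frac13+3\varepsilon<1$. For $N\in 2^{\mathbb Z}$ let $P_N$ and $P_{N,\mathbf e_\ell}$ be the Fourier multipliers in $x$ with symbols $\varphi(\xi/N)-\varphi(2\xi/N)$ and $\phi(|\xi\cdot\mathbf e_\ell|/N)$, where $\phi$ is such that $\prod_{\ell=1}^4(1-P_{N,\mathbf e_\ell})\,P_N=0$ for all $N$. For an interval $I$ let $L^{p,q}_{\mathbf e_\ell}(I\times\mathbb R^4)$ be the space with norm $L^p$ in $x\cdot\mathbf e_\ell$ of the $L^q$ norm in $t\in I$ and in the three remaining coordinates. Put $\|v\|_{X(I)}=(\sum_{N\in 2^{\mathbb Z}}\|P_Nv\|_{X_N(I)}^2)^{1/2}$ and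 $\|F\|_{Y(I)}=(\sum_{N\in 2^{\mathbb Z}}\|P_NF\|_{Y_N(I)}^2)^{1/2}$, where, with all norms over $I\times\mathbb R^4$, $$\|P_Nv\|_{X_N(I)}=N\|P_Nv\|_{L^2_tL^4_x}+N\|P_Nv\|_{L^3_tL^3_x}+N\|P_Nv\|_{L^6_tL^{12/5}_x}+\sum_{\ell=1}^4N^{-\frac12+\varepsilon}\|P_Nv\|_{L^{\frac4{2-\varepsilon},\frac4\varepsilon}_{\mathbf e_\ell}},$$ $$\begin{aligned}\|P_NF\|_{Y_N(I)}&=\langle N\rangle^{\frac13+3\varepsilon}\bigl(\|P_NF\|_{L^3_tL^6_x}+\|P_NF\|_{L^6_tL^6_x}\bigr)+\sum_{\ell=1}^4\langle N\rangle^{\frac13+3\varepsilon}N^{\frac12-\varepsilon}\|P_{N,\mathbf e_\ell}P_NF\|_{L^{\frac4\varepsilon,\frac4{2-\varepsilon}}_{\mathbf e_\ell}}\\&\quad+\sum_{\ell=1}^4N^{-\frac16}\|P_NF\|_{L^{\frac4{2-\varepsilon},\frac4\varepsilon}_{\mathbf e_\ell}}.\end{aligned}$$ The energy is $E(f)=\int_{\mathbb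 R^4}\frac12|\nabla f|^2+\frac14|f|^4\,dx$. **Proposition.** There is an absolute constant $C\ge 1$, independent of all the choices above, with the following property. Let $v_0\in H^1_x(\mathbb R^4)$ and let $F:\mathbb R\times\mathbb R^4\to\mathbb C$ be a solution of the linear Schrödinger equation $(i\partial_t+\Delta)F=0$ such that $$F\in Y(\mathbb R),\qquad F\in \bigl(L^\infty_tL^2_x\cap L^\infty_tL^4_x\cap L^3_tL^6_x\bigr)(\mathbb R\times\mathbb R^4),$$ $$\langle x\rangle^{\frac12}F\in L^2_tL^\infty_x(\mathbb R\times\mathbb R^4),\qquad \langle x\rangle^{\frac12}\nabla F\in L^2_tL^\infty_x(\mathbb R\times\mathbb R^4),\qquad \nabla F\in L^2_tL^4_x(\mathbb R\times\mathbb R^4).$$ Let $v$ be the solution of $$(i\partial_t+\Delta)v=|F+v|^2(F+v),\qquad v(0)=v_0,$$ with maximal (open) time interval of existence $I_*\ni 0$, where a solution on an open interval $I\ni0$ is a distributional solution $v\in C(I;\dot H^1_x(\mathbb R^4))$ with $\|v\|_{X(J)}<\infty$ for every compact interval $J\subset I$. Then, with norms of $F$ over $\mathbb R\times\mathbb R^4$,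 $$\begin{aligned}\sup_{t\in I_*}E(v(t))\le{}& C\exp\Bigl(C\bigl(\|F\|_{L^3_tL^6_x}^3+\|\langle x\rangle^{\frac12}F\|_{L^2_tL^\infty_x}^2+\|\langle x\rangle^{\frac12}\nabla F\|_{L^2_tL^\infty_x}^2+\|\nabla F\|_{L^2_tL^4_x}^2\bigr)\Bigr)\\&\times\bigl(E(v_0)+1+\|v_0\|_{L^2_x}^2+\|F\|_{L^\infty_tL^2_x}^2+\|F\|_{L^\infty_tL^4_x}^4\bigr).\end{aligned}$$ -/

import Mathlib

open MeasureTheory Set Filter Topology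
open scoped ENNReal ContDiff FourierTransform

noncomputable section

namespace ForcedNLS

/-- The space `ℝ⁴` with its Euclidean norm. -/
abbrev E4 : Type := EuclideanSpace ℝ (Fin 4)

/-- The values of a (complex) gradient on `ℝ⁴`, with `|g|² = ∑ⱼ |gⱼ|²`. -/
abbrev G4 : Type := EuclideanSpace ℂ (Fin 4)

/-! ### Weak gradients, Sobolev spaces, energy -/

/-- `g` is the weak (distributional) gradient of `f` on `ℝ⁴`. -/
def HasWeakGradient (f : E4 → ℂ) (g : E4 → G4) : Prop :=
  LocallyIntegrable f ∧ LocallyIntegrable g ∧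
    ∀ φ : E4 → ℝ, ContDiff ℝ ∞ φ → HasCompactSupport φ → ∀ j : Fin 4,
      ∫ x, (fderiv ℝ φ x (EuclideanSpace.single j 1)) • f x = -∫ x, φ x • g x j

open Classical in
/-- The weak gradient `∇f` (unique up to null sets when it exists; `0` otherwise). -/
def weakGrad (f : E4 → ℂ) : E4 → G4 :=
  if h : ∃ g, HasWeakGradient f g then h.choose else 0

/-- The homogeneous Sobolev space `Ḣ¹(ℝ⁴)`, realised as usual (Sobolev embedding) as the space of
`L⁴` functions with weak gradient in `L²`. -/
def MemHdotOne (f : E4 → ℂ) : Prop :=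
  MemLp f 4 ∧ ∃ g, HasWeakGradient f g ∧ MemLp g 2

/-- The Sobolev space `H¹(ℝ⁴)`. -/
def MemHOne (f : E4 → ℂ) : Prop :=
  MemLp f 2 ∧ ∃ g, HasWeakGradient f g ∧ MemLp g 2

/-- The energy `E(f) = ∫ ½|∇f|² + ¼|f|⁴ dx`. -/
def energy (f : E4 → ℂ) : ℝ≥0∞ :=
  ∫⁻ x, ((1 / 2) * ‖weakGrad f x‖ₑ ^ 2 + (1 / 4) * ‖f x‖ₑ ^ 4)

/-- `v ∈ C(I; Ḣ¹(ℝ⁴))`. -/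
def ContinuousHdotOne (I : Set ℝ) (v : ℝ → E4 → ℂ) : Prop :=
  (∀ t ∈ I, MemHdotOne (v t)) ∧
    ∀ t₀ ∈ I, Tendsto (fun t => eLpNorm (weakGrad (fun x => v t x - v t₀ x)) 2 volume)
      (𝓝[I] t₀) (𝓝 0)

/-! ### Space-time norms -/

/-- The mixed norm `‖u‖_{L^q_t L^r_x(I × ℝ⁴)}`. -/
def mixedNorm {V : Type*} [NormedAddCommGroup V] (q r : ℝ≥0∞) (I : Set ℝ) (u : ℝ → E4 → V) :
    ℝ≥0∞ :=
  eLpNorm (fun t => eLpNorm (u t) r volume) q (volume.restrict I)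

/-- The lateral norm `‖h‖_{L^{p,q}_{e_ℓ}(I × ℝ⁴)}`: the norm `L^q` in time and in the three
coordinates orthogonal to `e_ℓ` inside, the norm `L^p` in the coordinate along `e_ℓ` outside. -/
def lateralNorm (e : OrthonormalBasis (Fin 4) ℝ E4) (l : Fin 4) (p q : ℝ≥0∞) (I : Set ℝ)
    (h : ℝ → E4 → ℂ) : ℝ≥0∞ :=
  eLpNorm
    (fun s : ℝ =>
      eLpNorm
        (fun z : ℝ × (Fin 3 → ℝ) =>
          h z.1 (e.repr.symm (WithLp.toLp 2 (Fin.insertNth (α := fun _ => ℝ) l s z.2))))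
        q ((volume.restrict I).prod volume))
    p volume

/-- The Japanese bracket `⟨x⟩ = (1 + |x|²)^{1/2}`. -/
def jap (x : E4) : ℝ := Real.sqrt (1 + ‖x‖ ^ 2)

/-- The Japanese bracket `⟨N⟩ = (1 + N²)^{1/2}` of a number. -/
def japNum (N : ℝ) : ℝ := Real.sqrt (1 + N ^ 2)

/-- `⟨x⟩^{1/2} u(t, x)`. -/
def weighted {V : Type*} [NormedAddCommGroup V] [NormedSpace ℝ V] (u : ℝ → E4 → V) :
    ℝ → E4 → V :=
  fun t x => (jap x ^ (1 / 2 : ℝ)) • u t x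

/-! ### Littlewood–Paley projections and the spaces `X(I)` and `Y(I)` -/

/-- The Fourier multiplier with symbol `m`, i.e. `(m(D) f)^(ξ) = m(ξ) f^(ξ)`, where
`f^(ξ) = ∫ f(x) exp(-i x·ξ) dx`. It is written as convolution with the kernel
`(2π)⁻⁴ ∫ m(ξ) exp(i x·ξ) dξ = ∫ m(2πη) exp(2πi x·η) dη`. -/
def multiplier (m : E4 → ℝ) (f : E4 → ℂ) : E4 → ℂ :=
  fun x => ∫ y, 𝓕⁻ (fun η : E4 => ((m ((2 * Real.pi) • η) : ℝ) : ℂ)) (x - y) * f y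

/-- The symbol `φ(ξ/N) - φ(2ξ/N)` of the projection `P_N`. -/
def dyadicSymbol (φ : E4 → ℝ) (N : ℝ) (ξ : E4) : ℝ :=
  φ (N⁻¹ • ξ) - φ ((2 * N⁻¹) • ξ)

/-- The symbol `ϕ(|ξ · e_ℓ|/N)` of the directional projection `P_{N, e_ℓ}`. -/
def directionalSymbol (ϕ : ℝ → ℝ) (e : OrthonormalBasis (Fin 4) ℝ E4) (l : Fin 4) (N : ℝ)
    (ξ : E4) : ℝ :=
  ϕ (|inner ℝ ξ (e l)| / N)

/-- The choices that are fixed once and for all in the construction of `X(I)` and `Y(I)`: an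
orthonormal basis, the bump function `φ` of the Littlewood–Paley projections, the bump function `ϕ`
of the directional projections, and the small parameter `ε`, for which `1/3 + 3ε ≤ s` for some
`s < 1`. -/
structure Framework where
  /-- the orthonormal basis -/
  e : OrthonormalBasis (Fin 4) ℝ E4
  /-- the Littlewood–Paley bump function -/
  φ : E4 → ℝ
  φ_smooth : ContDiff ℝ ∞ φ
  φ_one : ∀ ξ, ‖ξ‖ ≤ 1 → φ ξ = 1
  φ_zero : ∀ ξ, 2 < ‖ξ‖ → φ ξ = 0
  /-- the directional bump function, supported around `∼ 1` -/
  ϕ : ℝ → ℝ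
  ϕ_smooth : ContDiff ℝ ∞ ϕ
  ϕ_compact : HasCompactSupport ϕ
  ϕ_supp : tsupport ϕ ⊆ Ioi 0
  /-- `(1 - P_{N,e₁}) (1 - P_{N,e₂}) (1 - P_{N,e₃}) (1 - P_{N,e₄}) P_N = 0` -/
  ϕ_cover : ∀ (k : ℤ) (ξ : E4),
    (∏ l : Fin 4, (1 - directionalSymbol ϕ e l ((2 : ℝ) ^ k) ξ)) *
      dyadicSymbol φ ((2 : ℝ) ^ k) ξ = 0
  /-- the small parameter -/
  ε : ℝ
  ε_pos : 0 < ε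
  ε_small : 1 / 3 + 3 * ε < 1

/-- The projection `P_N`, acting in space at each time. -/
def Framework.P (S : Framework) (N : ℝ) (u : ℝ → E4 → ℂ) : ℝ → E4 → ℂ :=
  fun t => multiplier (dyadicSymbol S.φ N) (u t)

/-- The projection `P_{N, e_ℓ} P_N`, acting in space at each time. -/
def Framework.Pdir (S : Framework) (l : Fin 4) (N : ℝ) (u : ℝ → E4 → ℂ) : ℝ → E4 → ℂ :=
  fun t => multiplier (fun ξ => directionalSymbol S.ϕ S.e l N ξ * dyadicSymbol S.φ N ξ) (u t)

/-- `‖P_N v‖_{X_N(I)}`. -/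
def Framework.XNNorm (S : Framework) (N : ℝ) (I : Set ℝ) (v : ℝ → E4 → ℂ) : ℝ≥0∞ :=
  ENNReal.ofReal N * mixedNorm 2 4 I (S.P N v) +
  ENNReal.ofReal N * mixedNorm 3 3 I (S.P N v) +
  ENNReal.ofReal N * mixedNorm 6 (12 / 5) I (S.P N v) +
  ∑ l : Fin 4, ENNReal.ofReal (N ^ (-(1 / 2) + S.ε)) *
    lateralNorm S.e l (ENNReal.ofReal (4 / (2 - S.ε))) (ENNReal.ofReal (4 / S.ε)) I (S.P N v)

/-- `‖v‖_{X(I)}`, the `ℓ²` sum of the dyadic pieces over `N ∈ 2^ℤ`. -/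
def Framework.XNorm (S : Framework) (I : Set ℝ) (v : ℝ → E4 → ℂ) : ℝ≥0∞ :=
  (∑' k : ℤ, S.XNNorm ((2 : ℝ) ^ k) I v ^ 2) ^ (1 / 2 : ℝ)

/-- `‖P_N F‖_{Y_N(I)}`. -/
def Framework.YNNorm (S : Framework) (N : ℝ) (I : Set ℝ) (F : ℝ → E4 → ℂ) : ℝ≥0∞ :=
  ENNReal.ofReal (japNum N ^ (1 / 3 + 3 * S.ε)) * mixedNorm 3 6 I (S.P N F) +
  ENNReal.ofReal (japNum N ^ (1 / 3 + 3 * S.ε)) * mixedNorm 6 6 I (S.P N F) +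
  ∑ l : Fin 4, ENNReal.ofReal (japNum N ^ (1 / 3 + 3 * S.ε) * N ^ (1 / 2 - S.ε)) *
    lateralNorm S.e l (ENNReal.ofReal (4 / S.ε)) (ENNReal.ofReal (4 / (2 - S.ε))) I
      (S.Pdir l N F) +
  ∑ l : Fin 4, ENNReal.ofReal (N ^ (-(1 / 6) : ℝ)) *
    lateralNorm S.e l (ENNReal.ofReal (4 / (2 - S.ε))) (ENNReal.ofReal (4 / S.ε)) I (S.P N F)

/-- `‖F‖_{Y(I)}`, the `ℓ²` sum of the dyadic pieces over `N ∈ 2^ℤ`. -/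
def Framework.YNorm (S : Framework) (I : Set ℝ) (F : ℝ → E4 → ℂ) : ℝ≥0∞ :=
  (∑' k : ℤ, S.YNNorm ((2 : ℝ) ^ k) I F ^ 2) ^ (1 / 2 : ℝ)

/-! ### Solutions -/

/-- `u` solves `(i∂ₜ + Δ) u = h` on `I × ℝ⁴` in the sense of distributions (`I` open). -/
def SolvesSchrodinger (I : Set ℝ) (u h : ℝ → E4 → ℂ) : Prop :=
  LocallyIntegrableOn (Function.uncurry u) (I ×ˢ univ) ∧
  LocallyIntegrableOn (Function.uncurry h) (I ×ˢ univ) ∧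
  ∀ φ : ℝ × E4 → ℝ, ContDiff ℝ ∞ φ → HasCompactSupport φ → tsupport φ ⊆ I ×ˢ univ →
    ∫ z : ℝ × E4, u z.1 z.2 *
        (-Complex.I * ((deriv (fun s => φ (s, z.2)) z.1 : ℝ) : ℂ) +
          ((Laplacian.laplacian (fun y => φ (z.1, y)) z.2 : ℝ) : ℂ)) =
      ∫ z : ℝ × E4, h z.1 z.2 * ((φ z : ℝ) : ℂ)

/-- The forced cubic nonlinearity `|F + v|² (F + v)`. -/
def forcedCubic (F v : ℝ → E4 → ℂ) : ℝ → E4 → ℂ :=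
  fun t x => ((‖F t x + v t x‖ ^ 2 : ℝ) : ℂ) * (F t x + v t x)

/-- `v` is a solution on the open time interval `I ∋ 0` of
`(i∂ₜ + Δ) v = |F + v|² (F + v)`, `v(0) = v₀`, in the class `C(I; Ḣ¹) ∩ X_loc(I)`. -/
structure IsSolution (S : Framework) (F : ℝ → E4 → ℂ) (v₀ : E4 → ℂ) (I : Set ℝ)
    (v : ℝ → E4 → ℂ) : Prop where
  isOpen : IsOpen I
  ordConnected : I.OrdConnected
  zero_mem : (0 : ℝ) ∈ I
  aestronglyMeasurable :
    AEStronglyMeasurable (Function.uncurry v) ((volume.restrict I).prod volume)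
  continuous : ContinuousHdotOne I v
  memX : ∀ a ∈ I, ∀ b ∈ I, S.XNorm (Icc a b) v < ⊤
  equation : SolvesSchrodinger I v (forcedCubic F v)
  initial : v 0 =ᵐ[volume] v₀

/-- `v` is a solution with maximal time interval of existence `I`: it does not extend, as a
solution, to any strictly larger open interval. -/
def IsMaximalSolution (S : Framework) (F : ℝ → E4 → ℂ) (v₀ : E4 → ℂ) (I : Set ℝ)
    (v : ℝ → E4 → ℂ) : Prop :=
  IsSolution S F v₀ I v ∧
    ∀ (J : Set ℝ) (w : ℝ → E4 → ℂ), I ⊆ J → IsSolution S F v₀ J w →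
      (∀ t ∈ I, w t =ᵐ[volume] v t) → J = I

end ForcedNLS

end

/-!
The energy is followed through the modified functional `½ ‖∇v‖₂² + ¼ ‖u‖₄⁴` with `u = F + v`
(`modEnergy`). Since `F` solves the free equation, `i ∂ₜu + Δu = |u|² u`, and everything that does
not involve `∇F` cancels in the time derivative of this functional; what remains is
`∑ⱼ Im ∫ conj (∂ⱼ(|u|² u)) ∂ⱼF` (`RegularL2.hasWeakDeriv_energy`). It has terms `∫ |u|² |∇v| |∇F|`
and `∫ |u|² |∇F|²`. The second is at most `‖u‖₄² ‖∇F‖₄²`, and `∇F ∈ L²ₜ L⁴ₓ`. The first is at most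
`‖∇v‖₂ ‖⟨x⟩^(1/2) ∇F‖_∞ (∫ |u|⁴ / ⟨x⟩)^(1/2)`, so that a bound for `∬ |u|⁴ / ⟨x⟩` is needed.

This bound comes from the Morawetz inequality with the convex weight `⟨x⟩`, for which
`Δ²⟨x⟩ ≤ 0` (`morawetz_inequality`). Applied to `v` it gives `½ ∬ Δ⟨x⟩ |u|⁴`, with `Δ⟨x⟩ ≥ 3/⟨x⟩`,
up to terms linear in `F` and `∇F` that the weighted norms of `F` and the same space-time integral
control (`RegularL2.lintegral_quartic_le`). The boundary terms are at most `‖v‖₂ ‖∇v‖₂`, and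
`‖v‖₂` is bounded because the mass of `u` is conserved (`RegularL2.mass_le`). If `s²` is the
supremum of the modified energy and `r² = ∬ |u|⁴ / ⟨x⟩`, one gets `r² ≲ m s + (A + B) m r` and
`s² ≤ E₀ + C s (B r + D²)`, with `A`, `B`, `D` the norms of `F` in the exponent and `m` the mass
bound. Young's inequality closes this (`bootstrap`), even with a polynomial in the norms instead
of an exponential. Finally the modified energy is comparable with the
energy of `v` up to `‖F‖₄⁴`.

For these computations to be legitimate one needs more than `v ∈ C(I; Ḣ¹)`. Finiteness of `‖v‖_X`
on compact intervals puts `∇v` in `L²ₜ L⁴ₓ` by a square function estimate in `L⁴`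
(`Framework.exists_square_function_bound`), proved by telescoping `‖P_{≤k} g‖₄⁴`. With Sobolev's
inequality all time derivatives are then dominated by an integrable function of time (`control`).
All identities are derived for mollifications in space, which have weak derivatives in time at
every point, and pass to the limit (`hasWeakDeriv_of_tendsto_of_le`). That `v(t)` is square
integrable follows from localized masses, whose time derivatives are bounded uniformly in the
cutoff (`Regular.mass_le`). Solutions and forcing are replaced by jointly measurable
representatives (`Rep`), and statements in time hold almost everywhere until the continuity of
the energy of `v` is used in the last step.
-/

noncomputable section

open Function (uncurry)
open ENNReal (ofReal HolderTriple ofReal_mul ofReal_le_ofReal rpow_mul mul_lt_top rpow_natCast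
  ofReal_pow ofReal_toReal toReal_add ofReal_ofNat ofReal_add toReal_mono toReal_nonneg mul_ne_top
  toReal_eq_toReal_iff' pow_lt_top rpow_one ofReal_le_one mul_rpow_of_nonneg pow_ne_top add_ne_top
  add_lt_top ofReal_ne_top ofReal_sum_of_nonneg ofReal_rpow_of_nonneg rpow_add_of_nonneg
  ofReal_one sum_lt_top pow_lt_top_iff tendsto_nhds_zero)
open Complex (I norm_real reCLM reCLM_apply normSq_eq_norm_sq mul_conj abs_re_le_norm
  re_ofReal_mul continuous_ofReal neg_re sub_re I_mul_re abs_im_le_norm add_im conjCLE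
  continuous_conj continuous_re neg_im ofReal_im re_sum add_re ofReal_re conj_ofReal conj_im
  continuous_im ofRealCLM)
open Real (norm_of_nonneg enorm_eq_ofReal_abs norm_eq_abs fourierInv_eq' enorm_eq_ofReal)
open Finset (sum_le_sum sum_congr mul_sum sum_mul sum_add_distrib sum_nonneg sum_neg_distrib
  single_le_sum)

namespace ForcedNLS

/-- Complex conjugation. -/
local notation "conj" => starRingEnd ℂ
/-- The norm of `Lᵖ(ℝ⁴)`. -/
local notation:max "N[" p "]" f:max => eLpNorm f p volume
/-- Lebesgue measure on the time interval `(a, b)`. -/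
local notation "vol[" a "," b "]" => Measure.restrict (volume : Measure ℝ) (Ioo a b)
/-- The exponent `4/3`. -/
local notation "p₄₃" => ((4 / 3 : NNReal) : ℝ≥0∞)
/-- The pointwise sum of two functions. -/
local notation:65 f:66 "⊞" g:66 => fun x => f x + g x

variable {f g f' g' v F w u d v₀ : E4 → ℂ} {dv dF : Fin 4 → E4 → ℂ} {k : E4 → ℝ} {j : Fin 4}
  {p q r M : ℝ≥0∞} {a b : ℝ}

/-! ### Powers of Lebesgue norms -/

theorem eLpNorm_pow_eq {V : Type*} [NormedAddCommGroup V] {n : ℕ} (hn : n ≠ 0) (w : E4 → V) :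
    N[(n : ℝ≥0∞)] w ^ n = ∫⁻ x, ‖w x‖ₑ ^ n := by
  have := eLpNorm_nnreal_pow_eq_lintegral (f := w) (μ := volume) (p := n) (mod_cast hn)
  simpa only [NNReal.coe_natCast, ENNReal.coe_natCast, rpow_natCast] using this

theorem eLpNorm_pow_eq_ofReal {n : ℕ} (hn : n ≠ 0) (hf : MemLp f n) :
    N[(n : ℝ≥0∞)] f ^ n = ofReal (∫ x, ‖f x‖ ^ n) := by
  rw [eLpNorm_pow_eq hn, ofReal_integral_eq_lintegral_ofReal (hf.integrable_norm_pow hn)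
    (ae_of_all _ fun x => by positivity)]
  exact lintegral_congr fun x => by rw [ofReal_pow (norm_nonneg _), ofReal_norm]

theorem eLpNorm_two_sq {V : Type*} [NormedAddCommGroup V] (w : E4 → V) :
    N[2] w ^ 2 = ∫⁻ x, ‖w x‖ₑ ^ 2 := eLpNorm_pow_eq two_ne_zero w

theorem eLpNorm_two_sq_eq (hf : MemLp f 2) : N[2] f ^ 2 = ofReal (∫ x, ‖f x‖ ^ 2) :=
  eLpNorm_pow_eq_ofReal two_ne_zero hf

theorem eLpNorm_four_pow (w : E4 → ℂ) : N[4] w ^ 4 = ∫⁻ x, ‖w x‖ₑ ^ 4 :=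
  eLpNorm_pow_eq four_ne_zero w

theorem eLpNorm_four_pow_eq (hf : MemLp f 4) : N[4] f ^ 4 = ofReal (∫ x, ‖f x‖ ^ 4) :=
  eLpNorm_pow_eq_ofReal four_ne_zero hf

/-! ### Convolutions on `ℝ⁴` and mollification -/

/-- The convolution `K * f` of complex functions on `ℝ⁴`. -/
def cv (K f : E4 → ℂ) : E4 → ℂ := fun x => ∫ y, K (x - y) * f y

/-- A real kernel, regarded as a complex one. -/
def rk (k : E4 → ℝ) : E4 → ℂ := fun x => (k x : ℂ)

/-- The partial derivative `∂ⱼ f` of a function on `ℝ⁴`. -/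
def pd {V : Type*} [NormedAddCommGroup V] [NormedSpace ℝ V] (j : Fin 4) (f : E4 → V) : E4 → V :=
  fun x => fderiv ℝ f x (EuclideanSpace.single j 1)

theorem cv_rk_eq_convolution (k : E4 → ℝ) (f : E4 → ℂ) :
    cv (rk k) f = MeasureTheory.convolution k f (ContinuousLinearMap.lsmul ℝ ℝ) volume := by
  ext x
  rw [convolution_eq_swap]
  simp [cv, rk]

theorem aestronglyMeasurable_cv_integrand {K : E4 → ℂ} (hK : AEStronglyMeasurable K)
    (hf : AEStronglyMeasurable f) :
    AEStronglyMeasurable (fun p : E4 × E4 => K (p.1 - p.2) * f p.2) (volume.prod volume) := by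
  have := hf.convolution_integrand (ContinuousLinearMap.mul ℝ ℂ).flip hK (μ := volume) (ν := volume)
  simpa [mul_comm] using this

theorem aestronglyMeasurable_cv {K : E4 → ℂ} (hK : AEStronglyMeasurable K)
    (hf : AEStronglyMeasurable f) : AEStronglyMeasurable (cv K f) :=
  (aestronglyMeasurable_cv_integrand hK hf).integral_prod_right'

theorem lintegral_mul_rpow_le {α : Type*} [MeasurableSpace α] {μ : Measure α} {k f : α → ℝ≥0∞}
    (hk : AEMeasurable k μ) (hf : AEMeasurable f μ) {p : ℝ} (hp : 1 ≤ p) :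
    (∫⁻ x, k x * f x ∂μ) ^ p ≤ (∫⁻ x, k x ∂μ) ^ (p - 1) * ∫⁻ x, k x * f x ^ p ∂μ := by
  rcases hp.eq_or_lt with rfl | hp
  · simp
  have hp0 : 0 < p := by linarith
  have hpq := Real.HolderConjugate.conjExponent hp
  set q := p.conjExponent with hq
  have hq0 : 0 < q := hpq.symm.pos
  have h := ENNReal.lintegral_mul_le_Lp_mul_Lq μ hpq (f := fun x => k x ^ (1 / p) * f x)
    (g := fun x => k x ^ (1 / q)) ((hk.pow_const _).mul hf) (hk.pow_const _)
  have e1 : ∀ x, ((fun x => k x ^ (1 / p) * f x) * fun x => k x ^ (1 / q)) x = k x * f x := by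
    intro x
    have : k x ^ (1 / p) * k x ^ (1 / q) = k x := by
      rw [← rpow_add_of_nonneg _ _ (by positivity) (by positivity)]
      have := hpq.inv_add_inv_eq_one
      rw [one_div, one_div, this, rpow_one]
    simp only [Pi.mul_apply]
    rw [mul_right_comm, this]
  have e2 : ∀ x, (k x ^ (1 / p) * f x) ^ p = k x * f x ^ p := by
    intro x
    rw [mul_rpow_of_nonneg _ _ hp0.le, ← rpow_mul, one_div,
      inv_mul_cancel₀ hp0.ne', rpow_one]
  have e3 : ∀ x, (k x ^ (1 / q)) ^ q = k x := by
    intro x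
    rw [← rpow_mul, one_div, inv_mul_cancel₀ hq0.ne', rpow_one]
  simp only [e1, e2, e3] at h
  calc (∫⁻ x, k x * f x ∂μ) ^ p
      ≤ ((∫⁻ x, k x * f x ^ p ∂μ) ^ (1 / p) * (∫⁻ x, k x ∂μ) ^ (1 / q)) ^ p := by gcongr
    _ = _ := by
      rw [mul_rpow_of_nonneg _ _ hp0.le, ← rpow_mul, ← rpow_mul, one_div,
        inv_mul_cancel₀ hp0.ne', rpow_one, mul_comm]
      congr 2
      have := hpq.div_conj_eq_sub_one
      rw [← this]; ring

theorem enorm_cv_le (K f : E4 → ℂ) (x : E4) : ‖cv K f x‖ₑ ≤ ∫⁻ y, ‖K (x - y)‖ₑ * ‖f y‖ₑ := by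
  refine (enorm_integral_le_lintegral_enorm _).trans (le_of_eq ?_)
  simp [enorm_mul]

theorem measurePreserving_sub_left (x : E4) :
    MeasurePreserving (fun y : E4 => x - y) volume volume :=
  Measure.measurePreserving_sub_left volume x

theorem lintegral_enorm_sub_left {K : E4 → ℂ} (x : E4) : ∫⁻ y, ‖K (x - y)‖ₑ = N[1] K := by
  rw [eLpNorm_one_eq_lintegral_enorm]
  exact lintegral_sub_left_eq_self (fun y => ‖K y‖ₑ) x

/-- Young's inequality `‖K * f‖_p ≤ ‖K‖₁ ‖f‖_p`. -/
theorem eLpNorm_cv_le {K : E4 → ℂ} (hK : AEStronglyMeasurable K) (hf : AEStronglyMeasurable f)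
    (hp : 1 ≤ p) : N[p] (cv K f) ≤ N[1] K * N[p] f := by
  have hKx : ∀ x, AEStronglyMeasurable (fun y => K (x - y)) volume := fun x =>
    hK.comp_measurePreserving (measurePreserving_sub_left x)
  rcases eq_or_ne p ⊤ with rfl | hpt
  · rw [eLpNorm_exponent_top, eLpNorm_exponent_top]
    refine eLpNormEssSup_le_of_ae_enorm_bound (ae_of_all _ fun x => ?_)
    refine (enorm_cv_le K f x).trans ?_
    calc ∫⁻ y, ‖K (x - y)‖ₑ * ‖f y‖ₑ ≤ ∫⁻ y, ‖K (x - y)‖ₑ * eLpNormEssSup f volume := by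
          refine lintegral_mono_ae ?_
          filter_upwards [enorm_ae_le_eLpNormEssSup f volume] with y hy
          gcongr
      _ = _ := by rw [lintegral_mul_const'' _ (hKx x).enorm, lintegral_enorm_sub_left]
  have hp0 : p ≠ 0 := (zero_lt_one.trans_le hp).ne'
  set r := p.toReal with hr
  have hr1 : 1 ≤ r := by rw [hr, ← ENNReal.toReal_one]; exact toReal_mono hpt hp
  have hr0 : 0 < r := by linarith
  rw [eLpNorm_eq_lintegral_rpow_enorm_toReal hp0 hpt,
    eLpNorm_eq_lintegral_rpow_enorm_toReal (f := f) hp0 hpt, ← hr]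
  have key : ∫⁻ x, ‖cv K f x‖ₑ ^ r ≤ (N[1] K) ^ r * ∫⁻ y, ‖f y‖ₑ ^ r := by
    calc ∫⁻ x, ‖cv K f x‖ₑ ^ r ≤ ∫⁻ x, (N[1] K) ^ (r - 1) * ∫⁻ y, ‖K (x - y)‖ₑ * ‖f y‖ₑ ^ r := by
          refine lintegral_mono fun x => ?_
          refine (ENNReal.rpow_le_rpow (enorm_cv_le K f x) hr0.le).trans ?_
          refine (lintegral_mul_rpow_le (hKx x).enorm hf.enorm hr1).trans ?_
          rw [lintegral_enorm_sub_left]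
      _ = (N[1] K) ^ (r - 1) * ∫⁻ x, ∫⁻ y, ‖K (x - y)‖ₑ * ‖f y‖ₑ ^ r := by
          refine lintegral_const_mul'' _ ?_
          refine AEMeasurable.lintegral_prod_right'
            (f := fun z : E4 × E4 => ‖K (z.1 - z.2)‖ₑ * ‖f z.2‖ₑ ^ r) ?_
          refine AEMeasurable.mul ?_ ?_
          · exact (hK.comp_quasiMeasurePreserving
              (quasiMeasurePreserving_sub_of_right_invariant volume volume)).enorm
          · exact (hf.comp_snd.enorm).pow_const _
      _ = (N[1] K) ^ (r - 1) * ∫⁻ y, ∫⁻ x, ‖K (x - y)‖ₑ * ‖f y‖ₑ ^ r := by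
          rw [lintegral_lintegral_swap]
          refine AEMeasurable.mul ?_ ?_
          · exact (hK.comp_quasiMeasurePreserving
              (quasiMeasurePreserving_sub_of_right_invariant volume volume)).enorm
          · exact (hf.comp_snd.enorm).pow_const _
      _ = (N[1] K) ^ (r - 1) * (N[1] K * ∫⁻ y, ‖f y‖ₑ ^ r) := by
          congr 1
          rw [← lintegral_const_mul'' _ (hf.enorm.pow_const _)]
          refine lintegral_congr fun y => ?_
          rw [lintegral_mul_const'', eLpNorm_one_eq_lintegral_enorm,
            lintegral_sub_right_eq_self (fun x => ‖K x‖ₑ)]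
          exact (hK.comp_measurePreserving (measurePreserving_sub_right volume y)).enorm
      _ = _ := by
          rw [← mul_assoc]
          congr 1
          conv_lhs => rw [← rpow_one (N[1] K), ← rpow_mul]
          rw [← rpow_add_of_nonneg _ _ (by linarith) zero_le_one]
          congr 1; ring
  calc (∫⁻ x, ‖cv K f x‖ₑ ^ r) ^ (1 / r) ≤ ((N[1] K) ^ r * ∫⁻ y, ‖f y‖ₑ ^ r) ^ (1 / r) := by gcongr
    _ = _ := by
      rw [mul_rpow_of_nonneg _ _ (by positivity), ← rpow_mul, one_div,
        mul_inv_cancel₀ hr0.ne', rpow_one]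

theorem memLp_cv {K : E4 → ℂ} (hK : MemLp K 1) (hp : 1 ≤ p) (hf : MemLp f p) :
    MemLp (cv K f) p :=
  ⟨aestronglyMeasurable_cv hK.1 hf.1, (eLpNorm_cv_le hK.1 hf.1 hp).trans_lt
    (mul_lt_top hK.2 hf.2)⟩

/-- The pointwise bound `|K * f| ≤ ‖K‖_p ‖f‖_q` for conjugate exponents. -/
theorem enorm_cv_le_mul {K : E4 → ℂ} (hK : AEStronglyMeasurable K)
    (hf : AEStronglyMeasurable f) [HolderTriple p q 1] (x : E4) :
    ‖cv K f x‖ₑ ≤ N[p] K * N[q] f := by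
  have hKx : AEStronglyMeasurable (fun y => K (x - y)) volume :=
    hK.comp_measurePreserving (measurePreserving_sub_left x)
  have h := eLpNorm_smul_le_mul_eLpNorm (p := p) (q := q) (r := 1) hf hKx
  rw [eLpNorm_one_eq_lintegral_enorm] at h
  refine (enorm_integral_le_lintegral_enorm _).trans (h.trans (le_of_eq ?_))
  congr 1
  exact eLpNorm_comp_measurePreserving hK (measurePreserving_sub_left x)

theorem integrable_cv_integrand {K : E4 → ℂ} [HolderTriple p q 1]
    (hK : MemLp K p) (hf : MemLp f q) (x : E4) : Integrable (fun y => K (x - y) * f y) := by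
  have h1 : MemLp (fun y => K (x - y)) p volume :=
    hK.comp_measurePreserving (measurePreserving_sub_left x)
  exact memLp_one_iff_integrable.1 (hf.mul' h1)

theorem integrable_cv_integrand_of_locallyIntegrable
    (hk : Continuous k) (hc : HasCompactSupport k) (hf : LocallyIntegrable f) (x : E4) :
    Integrable (fun y => rk k (x - y) * f y) := by
  have := (hc.convolutionExists_left (ContinuousLinearMap.lsmul ℝ ℝ) hk hf x).integrable_swap
  simpa [rk] using this

/-- The `n`-th member of a sequence of bump functions at the origin, supported in the ball of
radius `1 / (n + 1)`. -/
def bumpSeq (n : ℕ) : ContDiffBump (0 : E4) where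
  rIn := 1 / (2 * (n + 1))
  rOut := 1 / (n + 1)
  rIn_pos := by positivity
  rIn_lt_rOut := by
    have : (0 : ℝ) < n + 1 := by positivity
    rw [div_lt_div_iff₀ (by positivity) this]; linarith

/-- The mollifier `ηₙ`: smooth, nonnegative, of integral one and supported in the ball of radius
`1 / (n + 1)`. -/
def mol (n : ℕ) : E4 → ℝ := (bumpSeq n).normed volume

theorem mol_contDiff (n : ℕ) : ContDiff ℝ ∞ (mol n) := (bumpSeq n).contDiff_normed
theorem mol_hasCompactSupport (n : ℕ) : HasCompactSupport (mol n) :=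
  (bumpSeq n).hasCompactSupport_normed
theorem mol_nonneg (n : ℕ) (x : E4) : 0 ≤ mol n x := (bumpSeq n).nonneg_normed x

theorem rk_continuous (hk : Continuous k) : Continuous (rk k) :=
  continuous_ofReal.comp hk

theorem rk_memLp (hk : Continuous k) (hc : HasCompactSupport k) (p : ℝ≥0∞) :
    MemLp (rk k) p :=
  (rk_continuous hk).memLp_of_hasCompactSupport (hc.comp_left (g := fun r : ℝ => (r : ℂ)) (by simp))

theorem eLpNorm_mol (n : ℕ) : N[1] (rk (mol n)) = 1 := by
  have h1 : ∀ x, ‖rk (mol n) x‖ₑ = ofReal (mol n x) := by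
    intro x
    rw [rk, ← ofReal_norm, norm_real, norm_of_nonneg (mol_nonneg n x)]
  rw [eLpNorm_one_eq_lintegral_enorm]
  simp only [h1]
  simp only [mol]
  rw [← ofReal_integral_eq_lintegral_ofReal (bumpSeq n).integrable_normed
    (ae_of_all _ (mol_nonneg n)), (bumpSeq n).integral_normed, ofReal_one]

theorem eLpNorm_cv_mol_le (n : ℕ) (hf : AEStronglyMeasurable f)
    (hp : 1 ≤ p) : N[p] (cv (rk (mol n)) f) ≤ N[p] f := by
  have := eLpNorm_cv_le (rk_continuous (mol_contDiff n).continuous).aestronglyMeasurable hf hp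
  rwa [eLpNorm_mol, one_mul] at this

theorem tendsto_rOut : Tendsto (fun n => (bumpSeq n).rOut) atTop (𝓝 0) :=
  tendsto_one_div_add_atTop_nhds_zero_nat

/-- Mollifications converge almost everywhere. -/
theorem ae_tendsto_cv_mol (hf : LocallyIntegrable f) :
    ∀ᵐ x, Tendsto (fun n => cv (rk (mol n)) f x) atTop (𝓝 (f x)) := by
  have := ContDiffBump.ae_convolution_tendsto_right_of_locallyIntegrable (φ := bumpSeq) (K := 2)
    (l := atTop) (μ := (volume : Measure E4)) tendsto_rOut
    (Eventually.of_forall fun n => by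
      change (1 / (n + 1) : ℝ) ≤ 2 * (1 / (2 * (n + 1)))
      have : (0 : ℝ) < n + 1 := by positivity
      apply le_of_eq; field_simp) hf
  filter_upwards [this] with x hx
  simpa only [cv_rk_eq_convolution, mol] using hx

theorem cv_sub_of_integrable {K : E4 → ℂ} {x : E4} (hf : Integrable fun y => K (x - y) * f y)
    (hg : Integrable fun y => K (x - y) * g y) : cv K (f - g) x = cv K f x - cv K g x := by
  simp only [cv, Pi.sub_apply, mul_sub]
  exact integral_sub hf hg

theorem cv_add_of_integrable {K : E4 → ℂ} {x : E4} (hf : Integrable fun y => K (x - y) * f y)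
    (hg : Integrable fun y => K (x - y) * g y) : cv K (f + g) x = cv K f x + cv K g x := by
  simp only [cv, Pi.add_apply, mul_add]
  exact integral_add hf hg

theorem tendsto_eLpNorm_cv_mol_of_continuous (hg : Continuous g)
    (hc : HasCompactSupport g) (p : ℝ≥0∞) :
    Tendsto (fun n => N[p] (cv (rk (mol n)) g - g)) atTop (𝓝 0) := by
  set S := Metric.cthickening 1 (tsupport g) with hS
  have hSc : IsCompact S := hc.isCompact.cthickening
  have hvol : volume S ≠ ⊤ := hSc.measure_lt_top.ne
  have huc : UniformContinuous g := hc.uniformContinuous_of_continuous hg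
  have hsupp : ∀ n, Function.support (cv (rk (mol n)) g - g) ⊆ S := by
    intro n x hx
    by_contra hxS
    apply hx
    have hgx : ∀ y, dist y x ≤ 1 → g y = 0 := by
      intro y hy
      by_contra hgy
      exact hxS (Metric.mem_cthickening_of_dist_le x y 1 _ (subset_tsupport _ hgy)
        (by rwa [dist_comm]))
    have h0 : cv (rk (mol n)) g x = 0 := by
      refine integral_eq_zero_of_ae (ae_of_all _ fun y => ?_)
      by_cases hy : dist y x ≤ 1
      · simp [hgx y hy]
      · have : mol n (x - y) = 0 := by
          rw [← Function.notMem_support, mol, ContDiffBump.support_normed_eq]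
          simp only [Metric.mem_ball, dist_zero_right, not_lt]
          have h1 : (bumpSeq n).rOut ≤ 1 := by
            change (1 / (n + 1) : ℝ) ≤ 1
            rw [div_le_one (by positivity)]; linarith [n.cast_nonneg (α := ℝ)]
          rw [dist_comm, dist_eq_norm] at hy
          linarith
        simp [rk, this]
    simp [h0, hgx x (by simp)]
  have hb : ∀ δ : ℝ, 0 < δ → ∀ᶠ n in atTop,
      N[p] (cv (rk (mol n)) g - g) ≤ volume S ^ p.toReal⁻¹ * ofReal δ := by
    intro δ hδ
    obtain ⟨r, hr, hrg⟩ := Metric.uniformContinuous_iff.1 huc δ hδ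
    filter_upwards [tendsto_rOut.eventually (gt_mem_nhds hr)] with n hn
    rw [← eLpNorm_restrict_eq_of_support_subset (hsupp n)]
    have := eLpNorm_le_of_ae_bound (p := p) (μ := volume.restrict S)
      (f := cv (rk (mol n)) g - g) (C := δ) (ae_of_all _ fun x => ?_)
    · simpa using this
    · rw [Pi.sub_apply, ← dist_eq_norm, cv_rk_eq_convolution]
      refine (bumpSeq n).dist_normed_convolution_le hg.aestronglyMeasurable fun y hy => ?_
      exact (hrg (lt_trans hy hn)).le
  have hC : volume S ^ p.toReal⁻¹ ≠ ⊤ := by exact ENNReal.rpow_ne_top_of_nonneg (by positivity) hvol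
  rw [tendsto_nhds_zero]
  intro ε hε
  rcases eq_or_ne ε ⊤ with rfl | hεt
  · exact Eventually.of_forall fun _ => le_top
  set C := volume S ^ p.toReal⁻¹
  obtain ⟨δ, hδ, hδε⟩ : ∃ δ : ℝ, 0 < δ ∧ C * ofReal δ ≤ ε := by
    refine ⟨ε.toReal / (C.toReal + 1), div_pos (ENNReal.toReal_pos hε.ne' hεt) (by positivity), ?_⟩
    rw [← ofReal_toReal hC, ← ofReal_mul toReal_nonneg]
    conv_rhs => rw [← ofReal_toReal hεt]
    apply ofReal_le_ofReal
    rw [ENNReal.toReal_ofReal toReal_nonneg, mul_div_assoc', div_le_iff₀ (by positivity)]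
    nlinarith [toReal_nonneg (a := C), toReal_nonneg (a := ε)]
  filter_upwards [hb δ hδ] with n hn using hn.trans hδε

/-- Mollifications converge in `L^p`, `1 ≤ p < ∞`. -/
theorem tendsto_eLpNorm_cv_mol (hp : 1 ≤ p) (hpt : p ≠ ⊤) (hf : MemLp f p) :
    Tendsto (fun n => N[p] (cv (rk (mol n)) f - f)) atTop (𝓝 0) := by
  rw [tendsto_nhds_zero]
  intro ε hε
  have hε3 : ε / 3 ≠ 0 := (ENNReal.div_pos hε.ne' (by simp)).ne'
  obtain ⟨g, hgc, hfg, hg, hgp⟩ := hf.exists_hasCompactSupport_eLpNorm_sub_le hpt hε3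
  filter_upwards [tendsto_nhds_zero.1 (tendsto_eLpNorm_cv_mol_of_continuous hg hgc p)
    (ε / 3) (pos_iff_ne_zero.2 hε3)] with n hn
  have hint : ∀ {h : E4 → ℂ}, MemLp h p → ∀ x, Integrable fun y => rk (mol n) (x - y) * h y :=
    fun hh x => integrable_cv_integrand_of_locallyIntegrable (mol_contDiff n).continuous
      (mol_hasCompactSupport n) (hh.locallyIntegrable hp) x
  have e : cv (rk (mol n)) f - f = cv (rk (mol n)) (f - g) + (cv (rk (mol n)) g - g) + (g - f) := by
    ext x
    simp only [Pi.sub_apply, Pi.add_apply]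
    rw [cv_sub_of_integrable (hint hf x) (hint hgp x)]
    ring
  have hm := (rk_continuous (mol_contDiff n).continuous).aestronglyMeasurable
    (μ := (volume : Measure E4))
  have m1 := aestronglyMeasurable_cv hm (hf.1.sub hgp.1)
  have m2 := (aestronglyMeasurable_cv hm hgp.1).sub hgp.1
  rw [e]
  calc _ ≤ N[p] (cv (rk (mol n)) (f - g)) + N[p] (cv (rk (mol n)) g - g) + N[p] (g - f) :=
        (eLpNorm_add_le (m1.add m2) (hgp.1.sub hf.1) hp).trans
          (by gcongr; exact eLpNorm_add_le m1 m2 hp)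
    _ ≤ ε / 3 + ε / 3 + ε / 3 := by
        gcongr
        · exact (eLpNorm_cv_mol_le n (hf.1.sub hgp.1) hp).trans hfg
        · rw [← eLpNorm_neg, neg_sub]; exact hfg
    _ = ε := ENNReal.add_thirds ε

/-! ### Weak partial derivatives -/

/-- `g` is the weak partial derivative `∂ⱼ f` on `ℝ⁴`. -/
def HasWeakDer (j : Fin 4) (f g : E4 → ℂ) : Prop := LocallyIntegrable f ∧ LocallyIntegrable g ∧
    ∀ φ : E4 → ℝ, ContDiff ℝ ∞ φ → HasCompactSupport φ → ∫ x, pd j φ x • f x = -∫ x, φ x • g x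

theorem HasWeakGradient.hasWeakDer {g : E4 → G4} (h : HasWeakGradient f g)
    (j : Fin 4) : HasWeakDer j f (fun x => g x j) := by
  refine ⟨h.1, ?_, fun φ h1 h2 => h.2.2 φ h1 h2 j⟩
  intro x
  obtain ⟨U, hU, hi⟩ := h.2.1 x
  exact ⟨U, hU, (EuclideanSpace.proj (𝕜 := ℂ) j).integrable_comp hi⟩

theorem locallyIntegrable_toLp {g : Fin 4 → E4 → ℂ} (h : ∀ j, LocallyIntegrable (g j)) :
    LocallyIntegrable (fun x => (WithLp.toLp 2 (fun j => g j x) : G4)) := by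
  intro x
  choose U hU hi using fun j => h j x
  refine ⟨⋂ j, U j, (Filter.iInter_mem).2 hU, ?_⟩
  have : Integrable (fun x => (fun j => g j x : Fin 4 → ℂ)) (volume.restrict (⋂ j, U j)) :=
    Integrable.of_eval fun j => (hi j).mono_set (iInter_subset _ j)
  exact (PiLp.continuousLinearEquiv 2 ℝ (fun _ : Fin
      4 => ℂ)).symm.toContinuousLinearMap.integrable_comp this

theorem hasWeakGradient_of_hasWeakDer {g : Fin 4 → E4 → ℂ}
    (h : ∀ j, HasWeakDer j f (g j)) :
    HasWeakGradient f (fun x => WithLp.toLp 2 (fun j => g j x)) :=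
  ⟨(h 0).1, locallyIntegrable_toLp fun j => (h j).2.1, fun φ h1 h2 j => (h j).2.2 φ h1 h2⟩

theorem HasWeakDer.congr (h : HasWeakDer j f g)
    (hf : f =ᵐ[volume] f') (hg : g =ᵐ[volume] g') : HasWeakDer j f' g' := by
  refine ⟨h.1.congr hf, h.2.1.congr hg, fun φ h1 h2 => ?_⟩
  have e1 : ∫ x, pd j φ x • f' x = ∫ x, pd j φ x • f x :=
    integral_congr_ae (hf.mono fun x hx => by simp only [hx])
  have e2 : ∫ x, φ x • g' x = ∫ x, φ x • g x :=
    integral_congr_ae (hg.mono fun x hx => by simp only [hx])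
  rw [e1, e2]
  exact h.2.2 φ h1 h2

theorem pd_contDiff {V : Type*} [NormedAddCommGroup V] [NormedSpace ℝ V] {f : E4 → V}
    (hf : ContDiff ℝ ∞ f) (j : Fin 4) : ContDiff ℝ ∞ (pd j f) :=
  (hf.fderiv_right (m := ∞) (by simp)).clm_apply contDiff_const

theorem pd_hasCompactSupport {V : Type*} [NormedAddCommGroup V] [NormedSpace ℝ V] {f : E4 → V}
    (hf : HasCompactSupport f) (j : Fin 4) : HasCompactSupport (pd j f) :=
  hf.fderiv_apply (𝕜 := ℝ) _

theorem integrable_smul_of_locallyIntegrable {φ : E4 → ℝ} (h1 : Continuous φ)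
    (h2 : HasCompactSupport φ) (hf : LocallyIntegrable f) : Integrable fun x => φ x • f x :=
  hf.integrable_smul_left_of_hasCompactSupport h1 h2

theorem HasWeakDer.add (h : HasWeakDer j f g)
    (h' : HasWeakDer j f' g') : HasWeakDer j (f + f') (g + g') := by
  refine ⟨h.1.add h'.1, h.2.1.add h'.2.1, fun φ h1 h2 => ?_⟩
  have hp := (pd_contDiff h1 j).continuous
  have hc := pd_hasCompactSupport h2 j
  simp only [Pi.add_apply, smul_add]
  rw [integral_add (integrable_smul_of_locallyIntegrable hp hc h.1)
    (integrable_smul_of_locallyIntegrable hp hc h'.1),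
    integral_add (integrable_smul_of_locallyIntegrable h1.continuous h2 h.2.1)
    (integrable_smul_of_locallyIntegrable h1.continuous h2 h'.2.1), h.2.2 φ h1 h2, h'.2.2 φ h1 h2]
  ring

theorem HasWeakDer.neg (h : HasWeakDer j f g) :
    HasWeakDer j (-f) (-g) := by
  refine ⟨h.1.neg, h.2.1.neg, fun φ h1 h2 => ?_⟩
  simp only [Pi.neg_apply, smul_neg, integral_neg, h.2.2 φ h1 h2]

theorem HasWeakDer.sub (h : HasWeakDer j f g)
    (h' : HasWeakDer j f' g') : HasWeakDer j (f - f') (g - g') := by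
  rw [sub_eq_add_neg, sub_eq_add_neg]; exact h.add h'.neg

theorem HasWeakDer.unique (h : HasWeakDer j f g)
    (h' : HasWeakDer j f g') : g =ᵐ[volume] g' := by
  refine ae_eq_of_integral_contDiff_smul_eq h.2.1 h'.2.1 fun φ h1 h2 => ?_
  have := (h.2.2 φ h1 h2).symm.trans (h'.2.2 φ h1 h2)
  exact neg_injective this

theorem HasWeakGradient.unique {g g' : E4 → G4} (h : HasWeakGradient f g)
    (h' : HasWeakGradient f g') : g =ᵐ[volume] g' := by
  have : ∀ j : Fin 4, ∀ᵐ x, g x j = g' x j := fun j => (h.hasWeakDer j).unique (h'.hasWeakDer j)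
  filter_upwards [ae_all_iff.2 this] with x hx
  exact PiLp.ext hx

theorem hasWeakGradient_weakGrad (h : ∃ g, HasWeakGradient f g) :
    HasWeakGradient f (weakGrad f) := by
  rw [weakGrad, dif_pos h]; exact h.choose_spec

theorem weakGrad_ae_eq {g : E4 → G4} (h : HasWeakGradient f g) :
    weakGrad f =ᵐ[volume] g := (hasWeakGradient_weakGrad ⟨g, h⟩).unique h

theorem HasWeakGradient.congr_left {g : E4 → G4} (h : HasWeakGradient f g)
    (hf : f =ᵐ[volume] f') : HasWeakGradient f' g := by
  refine ⟨h.1.congr hf, h.2.1, fun φ h1 h2 j => ?_⟩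
  rw [← h.2.2 φ h1 h2 j]
  exact integral_congr_ae (hf.mono fun x hx => by simp only [hx])

theorem weakGrad_congr (hf : f =ᵐ[volume] f') : weakGrad f =ᵐ[volume] weakGrad f' := by
  by_cases h : ∃ g, HasWeakGradient f g
  · obtain ⟨g, hg⟩ := h
    exact (weakGrad_ae_eq hg).trans (weakGrad_ae_eq (hg.congr_left hf)).symm
  · have h' : ¬ ∃ g, HasWeakGradient f' g := fun ⟨g, hg⟩ => h ⟨g, hg.congr_left hf.symm⟩
    rw [weakGrad, weakGrad, dif_neg h, dif_neg h']

/-! ### Derivatives of mollified functions -/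

theorem hasFDerivAt_comp_sub_left (hk : Differentiable ℝ k) (x y : E4) (j : Fin 4) :
    pd j (fun y => k (x - y)) y = -pd j k (x - y) := by
  have h : HasFDerivAt (fun y => k (x - y)) ((fderiv ℝ k (x - y)).comp
      (-ContinuousLinearMap.id ℝ E4)) y :=
    (hk (x - y)).hasFDerivAt.comp y ((hasFDerivAt_id y).const_sub x)
  simp [pd, h.fderiv]

theorem contDiff_reflect (hk : ContDiff ℝ ∞ k) (x : E4) :
    ContDiff ℝ ∞ fun y => k (x - y) := hk.comp (contDiff_const.sub contDiff_id)

theorem hasCompactSupport_reflect (hc : HasCompactSupport k) (x : E4) :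
    HasCompactSupport fun y => k (x - y) :=
  hc.comp_homeomorph (Homeomorph.subLeft x)

/-- Convolution with a test function moves weak derivatives onto the test function. -/
theorem HasWeakDer.cv_pd (h : HasWeakDer j f g)
    (hk : ContDiff ℝ ∞ k) (hc : HasCompactSupport k) : cv (rk (pd j k)) f = cv (rk k) g := by
  ext x
  have := h.2.2 (fun y => k (x - y)) (contDiff_reflect hk x) (hasCompactSupport_reflect hc x)
  simp only [hasFDerivAt_comp_sub_left (hk.differentiable (by simp)), neg_smul, integral_neg,
    neg_inj] at this
  simpa [cv, rk] using this

theorem contDiff_cv (hf : LocallyIntegrable f)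
    (hk : ContDiff ℝ ∞ k) (hc : HasCompactSupport k) : ContDiff ℝ ∞ (cv (rk k) f) := by
  rw [cv_rk_eq_convolution]
  exact hc.contDiff_convolution_left _ hk hf

theorem pd_cv (hf : LocallyIntegrable f)
    (hk : ContDiff ℝ ∞ k) (hc : HasCompactSupport k) (j : Fin 4) :
    pd j (cv (rk k) f) = cv (rk (pd j k)) f := by
  ext x
  have h := hc.hasFDerivAt_convolution_left (ContinuousLinearMap.lsmul ℝ ℝ)
      (hk.of_le (by simp)) hf x
  rw [← cv_rk_eq_convolution] at h
  rw [pd, h.fderiv]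
  have hex : ConvolutionExistsAt (fderiv ℝ k) f x
      ((ContinuousLinearMap.lsmul ℝ ℝ : ℝ →L[ℝ] ℂ →L[ℝ] ℂ).precompL E4) volume :=
    (hc.fderiv ℝ).convolutionExists_left _ (hk.continuous_fderiv (by simp)) hf x
  rw [convolution_eq_swap]
  rw [ContinuousLinearMap.integral_apply hex.integrable_swap]
  simp [cv, rk, pd]

/-- Integration by parts on `ℝ⁴`. -/
theorem integral_mul_pd (hf : Differentiable ℝ f) (hg : Differentiable ℝ g)
    (j : Fin 4) (h1 : Integrable fun x => pd j f x * g x) (h2 : Integrable fun x => f x * pd j g x)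
    (h3 : Integrable fun x => f x * g x) :
    ∫ x, f x * pd j g x = -∫ x, pd j f x * g x :=
  integral_mul_fderiv_eq_neg_fderiv_mul_of_integrable h1 h2 h3 (fun x _ => hf x) (fun x _ => hg x)

theorem hasWeakDer_of_contDiff (hf : ContDiff ℝ 1 f) (j : Fin 4) :
    HasWeakDer j f (pd j f) := by
  have hcont : Continuous (pd j f) := (hf.continuous_fderiv (by simp)).clm_apply continuous_const
  refine ⟨hf.continuous.locallyIntegrable, hcont.locallyIntegrable, fun φ h1 h2 => ?_⟩
  have hp : ∀ x, pd j (rk φ) x = ((pd j φ x : ℝ) : ℂ) := by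
    intro x
    have : HasFDerivAt (rk φ) (ofRealCLM.comp (fderiv ℝ φ x)) x :=
      ofRealCLM.hasFDerivAt.comp x (h1.differentiable (by simp) x).hasFDerivAt
    simp [pd, this.fderiv]
  have h := integral_mul_pd (f := f) (g := rk φ) (hf.differentiable (by simp))
    (ofRealCLM.differentiable.comp (h1.differentiable (by simp))) j ?_ ?_ ?_
  · simp only [hp] at h
    calc ∫ x, pd j φ x • f x = ∫ x, f x * ((pd j φ x : ℝ) : ℂ) := by
          congr 1; ext x; rw [Complex.real_smul, mul_comm]
      _ = _ := h
      _ = _ := by congr 2; ext x; rw [Complex.real_smul, mul_comm, rk]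
  · simpa [rk, mul_comm] using
      integrable_smul_of_locallyIntegrable h1.continuous h2 hcont.locallyIntegrable
  · simp only [hp]
    simpa [mul_comm] using
      integrable_smul_of_locallyIntegrable (pd_contDiff h1 j).continuous (pd_hasCompactSupport h2 j)
        hf.continuous.locallyIntegrable
  · simpa [rk, mul_comm] using
      integrable_smul_of_locallyIntegrable h1.continuous h2 hf.continuous.locallyIntegrable

/-! ### Convergence in `L^p` -/

/-- The sequence `fₙ` converges to `f` in `L^p(ℝ⁴)`. -/
structure LpTendsto (p : ℝ≥0∞) (f : ℕ → E4 → ℂ) (g : E4 → ℂ) : Prop where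
  memLp : ∀ n, MemLp (f n) p
  memLp_lim : MemLp g p
  tendsto : Tendsto (fun n => N[p] (f n - g)) atTop (𝓝 0)

theorem LpTendsto.mol (hp : 1 ≤ p) (hpt : p ≠ ⊤) (hf : MemLp f p) :
    LpTendsto p (fun n => cv (rk (mol n)) f) f :=
  ⟨fun n => memLp_cv (rk_memLp (mol_contDiff n).continuous (mol_hasCompactSupport n) 1) hp hf, hf,
    tendsto_eLpNorm_cv_mol hp hpt hf⟩

theorem LpTendsto.const (hf : MemLp f p) :
    LpTendsto p (fun _ => f) f := ⟨fun _ => hf, hf, by simp⟩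

theorem LpTendsto.add (hp : 1 ≤ p) {f f' : ℕ → E4 → ℂ}
    (h : LpTendsto p f g) (h' : LpTendsto p f' g') :
    LpTendsto p (fun n => f n + f' n) (g + g') := by
  refine ⟨fun n => (h.memLp n).add (h'.memLp n), h.memLp_lim.add h'.memLp_lim, ?_⟩
  refine tendsto_of_tendsto_of_tendsto_of_le_of_le tendsto_const_nhds
    (by simpa using h.tendsto.add h'.tendsto) (fun _ => zero_le) fun n => ?_
  have e : f n + f' n - (g + g') = (f n - g) + (f' n - g') := by abel
  simp only [e]
  exact eLpNorm_add_le ((h.memLp n).1.sub h.memLp_lim.1) ((h'.memLp n).1.sub h'.memLp_lim.1) hp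

theorem LpTendsto.const_mul {f : ℕ → E4 → ℂ}
    (h : LpTendsto p f g) (c : ℂ) : LpTendsto p (fun n x => c * f n x) (fun x => c * g x) := by
  refine ⟨fun n => (h.memLp n).const_mul c, h.memLp_lim.const_mul c, ?_⟩
  have : ∀ n, N[p] ((fun x => c * f n x) - fun x => c * g x) = ‖c‖ₑ * N[p] (f n - g) := by
    intro n
    rw [← eLpNorm_const_smul]
    congr 1; ext x; simp [mul_sub]
  simp only [this]
  simpa using ENNReal.Tendsto.const_mul h.tendsto (Or.inr (by simp))

theorem LpTendsto.conj {f : ℕ → E4 → ℂ} (h : LpTendsto p f g) :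
    LpTendsto p (fun n x => conj (f n x)) (fun x => conj (g x)) := by
  refine ⟨fun n => (h.memLp n).star, h.memLp_lim.star, ?_⟩
  refine h.tendsto.congr fun n => ?_
  refine eLpNorm_congr_norm_ae (ae_of_all _ fun x => ?_)
  simp only [Pi.sub_apply, ← map_sub, RCLike.norm_conj]

theorem LpTendsto.mul [HolderTriple p q r] (hr : 1 ≤ r)
    {f f' : ℕ → E4 → ℂ} (h : LpTendsto p f g) (h' : LpTendsto q f' g')
    (hq : 1 ≤ q := by norm_num) :
    LpTendsto r (fun n x => f n x * f' n x) (fun x => g x * g' x) := by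
  refine ⟨fun n => (h'.memLp n).mul' (h.memLp n), h'.memLp_lim.mul' h.memLp_lim, ?_⟩
  have hb : ∀ n, N[r] ((fun x => f n x * f' n x) - fun x => g x * g' x) ≤
      N[p] (f n - g) * (N[q] (f' n - g') + N[q] g') + N[p] g * N[q] (f' n - g') := by
    intro n
    have e : ((fun x => f n x * f' n x) - fun x => g x * g' x) =
        ((f n - g) • f' n) + (g • (f' n - g')) := by
      ext x; simp; ring
    have m1 := (h.memLp n).1.sub h.memLp_lim.1
    have m2 := (h'.memLp n).1.sub h'.memLp_lim.1
    rw [e]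
    refine (eLpNorm_add_le (m1.smul (h'.memLp n).1) (h.memLp_lim.1.smul m2) hr).trans ?_
    gcongr
    · refine (eLpNorm_smul_le_mul_eLpNorm (h'.memLp n).1 m1 (p := p) (q := q)).trans ?_
      gcongr
      have := eLpNorm_add_le m2 h'.memLp_lim.1 hq
      simpa using this
    · exact eLpNorm_smul_le_mul_eLpNorm m2 h.memLp_lim.1
  refine tendsto_of_tendsto_of_tendsto_of_le_of_le tendsto_const_nhds ?_ (fun _ => zero_le) hb
  have t2 : Tendsto (fun n => N[q] (f' n - g') + N[q] g') atTop
      (𝓝 (N[q] g')) := by simpa using h'.tendsto.add_const (N[q] g')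
  have t3 := ENNReal.Tendsto.mul h.tendsto (Or.inr h'.memLp_lim.2.ne) t2 (Or.inr (by simp))
  have t4 := ENNReal.Tendsto.const_mul (a := N[p] g) h'.tendsto (Or.inr h.memLp_lim.2.ne)
  simpa using t3.add t4

theorem LpTendsto.integral {f : ℕ → E4 → ℂ} (h : LpTendsto 1 f g) :
    Tendsto (fun n => ∫ x, f n x) atTop (𝓝 (∫ x, g x)) := by
  refine tendsto_integral_of_L1' g (memLp_one_iff_integrable.1 h.memLp_lim).1 ?_ h.tendsto
  exact Eventually.of_forall fun n => memLp_one_iff_integrable.1 (h.memLp n)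

theorem LpTendsto.eLpNorm (hp : 1 ≤ p) {f : ℕ → E4 → ℂ}
    (h : LpTendsto p f g) :
    Tendsto (fun n => N[p] (f n)) atTop (𝓝 (N[p] g)) := by
  have h1 : ∀ n, N[p] (f n) ≤ N[p] (f n - g) + N[p] g := by
    intro n
    have := eLpNorm_add_le ((h.memLp n).1.sub h.memLp_lim.1) h.memLp_lim.1 hp
    simpa using this
  have h2 : ∀ n, N[p] g - N[p] (f n - g) ≤ N[p] (f n) := by
    intro n
    have := eLpNorm_sub_le (h.memLp n).1 ((h.memLp n).1.sub h.memLp_lim.1) hp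
    rw [tsub_le_iff_right]
    simpa using this
  refine tendsto_of_tendsto_of_tendsto_of_le_of_le ?_ ?_ h2 h1
  · simpa using ENNReal.Tendsto.sub tendsto_const_nhds h.tendsto (Or.inl h.memLp_lim.2.ne)
  · simpa using h.tendsto.add_const (N[p] g)

/-! ### Spatial cutoffs and Sobolev inequalities -/

/-- A fixed bump function, equal to one on the unit ball and supported in the ball of radius 2. -/
def bumpOne : ContDiffBump (0 : E4) where
  rIn := 1
  rOut := 2
  rIn_pos := one_pos
  rIn_lt_rOut := one_lt_two

/-- The spatial cutoff `χₙ(x) = χ(x / (n + 1))`. -/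
def cut (n : ℕ) : E4 → ℝ := fun x => bumpOne (((n : ℝ) + 1)⁻¹ • x)

theorem cut_contDiff (n : ℕ) : ContDiff ℝ ∞ (cut n) := bumpOne.contDiff.comp (contDiff_const_smul _)

theorem cut_hasCompactSupport (n : ℕ) : HasCompactSupport (cut n) :=
  bumpOne.hasCompactSupport.comp_smul (by positivity)

theorem cut_nonneg (n : ℕ) (x : E4) : 0 ≤ cut n x := bumpOne.nonneg
theorem cut_le_one (n : ℕ) (x : E4) : cut n x ≤ 1 := bumpOne.le_one

theorem cut_eq_one {n : ℕ} {x : E4} (h : ‖x‖ ≤ n + 1) : cut n x = 1 := by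
  refine bumpOne.one_of_mem_closedBall ?_
  simp only [Metric.mem_closedBall, dist_zero_right, norm_smul, norm_inv]
  rw [norm_of_nonneg (by positivity : (0 : ℝ) ≤ n + 1), inv_mul_le_iff₀ (by positivity)]
  change ‖x‖ ≤ (n + 1) * 1
  linarith

theorem eventually_cut_eq_one (x : E4) : ∀ᶠ n in atTop, cut n x = 1 := by
  obtain ⟨N, hN⟩ := exists_nat_ge ‖x‖
  filter_upwards [eventually_ge_atTop N] with n hn
  apply cut_eq_one
  have : (N : ℝ) ≤ n := by exact_mod_cast hn
  linarith

theorem pd_cut (n : ℕ) (j : Fin 4) (x : E4) :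
    pd j (cut n) x = ((n : ℝ) + 1)⁻¹ * pd j bumpOne (((n : ℝ) + 1)⁻¹ • x) := by
  have h : HasFDerivAt (cut n) ((fderiv ℝ bumpOne (((n : ℝ) + 1)⁻¹ • x)).comp
      (((n : ℝ) + 1)⁻¹ • ContinuousLinearMap.id ℝ E4)) x :=
    ((bumpOne.contDiff (n := 1)).differentiable (by simp) _).hasFDerivAt.comp x
      ((hasFDerivAt_id x).const_smul (((n : ℝ) + 1)⁻¹))
  simp [pd, h.fderiv]

theorem exists_bound_pd_bumpOne : ∃ B : ℝ, 0 ≤ B ∧ ∀ (j : Fin 4) (x : E4), |pd j bumpOne x| ≤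
    B := by
  have hc : ∀ j : Fin 4, ∃ B : ℝ, ∀ x, ‖pd j (bumpOne : E4 → ℝ) x‖ ≤ B := fun j =>
    (pd_hasCompactSupport bumpOne.hasCompactSupport j).exists_bound_of_continuous
      (pd_contDiff bumpOne.contDiff j).continuous
  choose B hB using hc
  refine ⟨∑ j, |B j|, by positivity, fun j x => ?_⟩
  refine ((hB j x).trans (le_abs_self _)).trans ?_
  exact single_le_sum (f := fun j => |B j|) (fun i _ => abs_nonneg _) (Finset.mem_univ j)

theorem pd_cut_eq_zero_of_lt {n : ℕ} {x : E4} (j : Fin 4) (h : ‖x‖ < n + 1) :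
    pd j (cut n) x = 0 := by
  have : cut n =ᶠ[𝓝 x] fun _ => 1 := by
    have hU : {y : E4 | ‖y‖ < n + 1} ∈ 𝓝 x := (isOpen_lt continuous_norm continuous_const).mem_nhds
        h
    filter_upwards [hU] with y hy using cut_eq_one (le_of_lt hy)
  rw [pd, this.fderiv_eq]
  simp

theorem pd_cut_eq_zero_of_gt {n : ℕ} {x : E4} (j : Fin 4) (h : 2 * (n + 1) < ‖x‖) :
    pd j (cut n) x = 0 := by
  have : cut n =ᶠ[𝓝 x] fun _ => 0 := by
    have hU : {y : E4 | 2 * (n + 1) < ‖y‖} ∈ 𝓝 x :=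
      (isOpen_lt continuous_const continuous_norm).mem_nhds h
    filter_upwards [hU] with y hy
    refine bumpOne.zero_of_le_dist ?_
    simp only [dist_zero_right, norm_smul, norm_inv]
    rw [norm_of_nonneg (by positivity : (0 : ℝ) ≤ n + 1), le_inv_mul_iff₀ (by positivity)]
    change (n + 1) * (2 : ℝ) ≤ ‖y‖
    linarith [hy.le]
  rw [pd, this.fderiv_eq]
  simp

/-- In dimension four `∇χₙ` is bounded in `L^q` uniformly in `n` for all `4 ≤ q < ∞`; the case
`q = 4` is scale invariant. -/
theorem exists_bound_eLpNorm_pd_cut (hq : 4 ≤ q) :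
    ∃ B : ℝ≥0∞, B ≠ ⊤ ∧ ∀ n j, N[q] (pd j (cut n)) ≤ B := by
  obtain ⟨B, hB0, hB⟩ := exists_bound_pd_bumpOne
  set V := volume (Metric.closedBall (0 : E4) 2)
  have hV : V ≠ ⊤ := (isCompact_closedBall _ _).measure_lt_top.ne
  refine ⟨(V ^ q.toReal⁻¹) * ofReal B, mul_ne_top
    (ENNReal.rpow_ne_top_of_nonneg (by positivity) hV) ofReal_ne_top, fun n j => ?_⟩
  set R : ℝ := n + 1 with hR
  have hR1 : 1 ≤ R := by rw [hR]; linarith [n.cast_nonneg (α := ℝ)]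
  have hR0 : 0 < R := by linarith
  have hsub : Function.support (pd j (cut n)) ⊆ Metric.closedBall (0 : E4) (R * 2) := by
    intro x hx
    by_contra h
    refine hx (pd_cut_eq_zero_of_gt j ?_)
    simpa [hR, mul_comm] using h
  rw [← eLpNorm_restrict_eq_of_support_subset hsub]
  refine (eLpNorm_le_of_ae_bound (C := R⁻¹ * B) (ae_of_all _ fun x => ?_)).trans ?_
  · rw [pd_cut, norm_eq_abs, abs_mul, abs_of_pos (inv_pos.2 hR0)]
    gcongr
    exact hB _ _
  · rw [Measure.restrict_apply_univ, Measure.addHaar_closedBall_mul_of_pos _ _ hR0]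
    have hfin : Module.finrank ℝ E4 = 4 := by simp
    rw [hfin, mul_rpow_of_nonneg _ _ (by positivity), ofReal_mul (by positivity)]
    have h1 : ofReal (R ^ 4) ^ q.toReal⁻¹ ≤ ofReal R := by
      rw [ofReal_rpow_of_nonneg (by positivity) (by positivity)]
      apply ofReal_le_ofReal
      rw [← Real.rpow_natCast, ← Real.rpow_mul hR0.le]
      conv_rhs => rw [← Real.rpow_one R]
      apply Real.rpow_le_rpow_of_exponent_le hR1
      rcases eq_or_ne q ⊤ with rfl | hqt
      · simp
      · have : 4 ≤ q.toReal := by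
          have := toReal_mono hqt hq
          simpa using this
        push_cast
        rw [mul_inv_le_iff₀ (by linarith)]; linarith
    calc ofReal (R ^ 4) ^ q.toReal⁻¹ * V ^ q.toReal⁻¹ * (ofReal R⁻¹ * ofReal B)
        ≤ ofReal R * V ^ q.toReal⁻¹ * (ofReal R⁻¹ * ofReal B) := by gcongr
      _ = (ofReal R * ofReal R⁻¹) * (V ^ q.toReal⁻¹ * ofReal B) := by ring
      _ = _ := by
        rw [← ofReal_mul hR0.le, mul_inv_cancel₀ hR0.ne', ofReal_one, one_mul]

theorem tendsto_eLpNorm_indicator_compl_ball (hpt : p ≠ ⊤)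
    (hf : MemLp f p) :
    Tendsto (fun n : ℕ => N[p] ({x : E4 | (n : ℝ) + 1 ≤ ‖x‖}.indicator f)) atTop (𝓝 0) := by
  rw [tendsto_nhds_zero]
  intro ε hε
  obtain ⟨g, hgc, hfg, hg, hgp⟩ := hf.exists_hasCompactSupport_eLpNorm_sub_le hpt hε.ne'
  obtain ⟨R, hR⟩ := hgc.isCompact.isBounded.subset_closedBall 0
  obtain ⟨N, hN⟩ := exists_nat_ge R
  filter_upwards [eventually_ge_atTop N] with n hn
  refine le_trans (eLpNorm_mono_ae (ae_of_all _ fun x => ?_)) hfg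
  by_cases hx : (n : ℝ) + 1 ≤ ‖x‖
  · have : g x = 0 := by
      by_contra h
      have := hR (subset_tsupport g h)
      simp only [Metric.mem_closedBall, dist_zero_right] at this
      have h2 : (N : ℝ) ≤ n := by exact_mod_cast hn
      linarith
    simp [this, hx]
  · simp [hx]

theorem norm_fderiv_le_sum (f : E4 → ℂ) (x : E4) : ‖fderiv ℝ f x‖ ≤ ∑ j, ‖pd j f x‖ := by
  refine ContinuousLinearMap.opNorm_le_bound _ (by positivity) fun y => ?_
  have hy : y = ∑ j, y j • EuclideanSpace.single j (1 : ℝ) := by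
    have := (EuclideanSpace.basisFun (Fin 4) ℝ).sum_repr y
    simpa using this.symm
  conv_lhs => rw [hy]
  rw [map_sum, sum_mul]
  refine (norm_sum_le _ _).trans (sum_le_sum fun j _ => ?_)
  rw [map_smul, norm_smul, mul_comm]
  gcongr
  · rfl
  · exact PiLp.norm_apply_le y j

theorem pd_mul (hf : Differentiable ℝ f) (hg : Differentiable ℝ g) (j : Fin 4)
    (x : E4) : pd j (fun x => f x * g x) x = pd j f x * g x + f x * pd j g x := by
  rw [pd, fderiv_fun_mul (hf x) (hg x)]
  simp [pd]; ring

theorem pd_rk {φ : E4 → ℝ} (h : Differentiable ℝ φ) (j : Fin 4) : pd j (rk φ) = rk (pd j φ) := by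
  ext x
  have : HasFDerivAt (rk φ) (ofRealCLM.comp (fderiv ℝ φ x)) x :=
    ofRealCLM.hasFDerivAt.comp x (h x).hasFDerivAt
  simp [pd, this.fderiv, rk]

theorem rk_contDiff {φ : E4 → ℝ} (h : ContDiff ℝ ∞ φ) : ContDiff ℝ ∞ (rk φ) :=
  ofRealCLM.contDiff.comp h

/-- The Gagliardo–Nirenberg–Sobolev inequality on `ℝ⁴` for `L⁴` functions with weak gradient in
`L^p`: the inequality for test functions is applied to `χₙ (ηₙ * f)`. -/
theorem exists_sobolev {p p' : NNReal} (hp : 1 ≤ p) (hp' : (p' : ℝ)⁻¹ = p⁻¹ - 4⁻¹)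
    (hq : 4 ≤ q) [HolderTriple q 4 p] :
    ∃ C : ℝ≥0∞, C ≠ ⊤ ∧ ∀ (f : E4 → ℂ) (g : Fin 4 → E4 → ℂ), MemLp f 4 →
      (∀ j, HasWeakDer j f (g j)) → (∀ j, MemLp (g j) p) →
      N[p'] f ≤ C * ∑ j, N[p] (g j) := by
  set C : ℝ≥0∞ := ((SNormLESNormFDerivOfEqConst ℂ (volume : Measure E4) p : NNReal) : ℝ≥0∞) with hC
  refine ⟨C, ENNReal.coe_ne_top, fun f g hf hfg hg => ?_⟩
  obtain ⟨B, hBt, hB⟩ := exists_bound_eLpNorm_pd_cut hq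
  have hp1 : (1 : ℝ≥0∞) ≤ p := by exact_mod_cast hp
  have h14 : (1 : ℝ≥0∞) ≤ 4 := by norm_num
  have hfl := hf.locallyIntegrable h14
  set fn : ℕ → E4 → ℂ := fun n => cv (rk (mol n)) f with hfn
  set h : ℕ → E4 → ℂ := fun n x => rk (cut n) x * fn n x with hh
  have hfs : ∀ n, ContDiff ℝ ∞ (fn n) := fun n =>
    contDiff_cv hfl (mol_contDiff n) (mol_hasCompactSupport n)
  have hhs : ∀ n, ContDiff ℝ ∞ (h n) := fun n => (rk_contDiff (cut_contDiff n)).mul (hfs n)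
  have hhc : ∀ n, HasCompactSupport (h n) := fun n =>
    ((cut_hasCompactSupport n).comp_left (g := fun r : ℝ => (r : ℂ)) (by simp)).mul_right
  -- the error caused by `∇χₙ`, which is supported in `|x| ≥ n + 1`
  set e : ℕ → ℝ≥0∞ := fun n => B * (N[4] (fn n - f) +
    N[4] ({x : E4 | (n : ℝ) + 1 ≤ ‖x‖}.indicator f)) with he
  have he0 : Tendsto e atTop (𝓝 0) := by
    have := (tendsto_eLpNorm_cv_mol h14 (by norm_num) hf).add
      (tendsto_eLpNorm_indicator_compl_ball (by norm_num) hf)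
    simpa using ENNReal.Tendsto.const_mul this (Or.inr hBt)
  have hder : ∀ n j, N[p] (pd j (h n)) ≤ N[p] (g j) + e n := by
    intro n j
    have e1 : pd j (h n) = (fun x => rk (cut n) x * cv (rk (mol n)) (g j) x) +
        (pd j (rk (cut n)) • ({x : E4 | (n : ℝ) + 1 ≤ ‖x‖}.indicator (fn n))) := by
      ext x
      simp only [hh]
      rw [pd_mul ((rk_contDiff (cut_contDiff n)).differentiable (by simp))
        ((hfs n).differentiable (by simp)), add_comm]
      simp only [Pi.add_apply, smul_eq_mul, Pi.mul_apply]
      congr 1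
      · rw [hfn]
        simp only
        rw [pd_cv hfl (mol_contDiff n) (mol_hasCompactSupport n),
          (hfg j).cv_pd (mol_contDiff n) (mol_hasCompactSupport n)]
      · by_cases hx : (n : ℝ) + 1 ≤ ‖x‖
        · rw [indicator_of_mem (by exact hx)]
        · rw [pd_rk ((cut_contDiff n).differentiable (by simp)), rk,
            pd_cut_eq_zero_of_lt j (not_le.1 hx)]
          simp
    have hm := (rk_continuous (mol_contDiff n).continuous).aestronglyMeasurable
      (μ := (volume : Measure E4))
    have m0 : AEStronglyMeasurable (cv (rk (mol n)) (g j)) volume :=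
      aestronglyMeasurable_cv hm (hg j).1
    have ms : MeasurableSet {x : E4 | (n : ℝ) + 1 ≤ ‖x‖} :=
      (isClosed_le continuous_const continuous_norm).measurableSet
    have m1 : AEStronglyMeasurable (pd j (rk (cut n))) (volume : Measure E4) :=
      (pd_contDiff (rk_contDiff (cut_contDiff n)) j).continuous.aestronglyMeasurable
    have m2 : AEStronglyMeasurable (fn n) volume := (hfs n).continuous.aestronglyMeasurable
    rw [e1]
    refine (eLpNorm_add_le ((rk_continuous (cut_contDiff n).continuous).aestronglyMeasurable.mul m0)
      (m1.smul (m2.indicator ms)) hp1).trans ?_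
    gcongr
    · refine le_trans (eLpNorm_mono_ae (ae_of_all _ fun x => ?_)) (eLpNorm_cv_mol_le n (hg j).1 hp1)
      rw [Pi.mul_apply, norm_mul, rk, norm_real, norm_of_nonneg (cut_nonneg n x)]
      exact mul_le_of_le_one_left (norm_nonneg _) (cut_le_one n x)
    · refine (eLpNorm_smul_le_mul_eLpNorm (p := q) (q := 4) (m2.indicator ms) m1).trans ?_
      rw [he]
      simp only
      gcongr
      · refine le_trans (le_of_eq (eLpNorm_congr_norm_ae (ae_of_all _ fun x => ?_))) (hB n j)
        rw [pd_rk ((cut_contDiff n).differentiable (by simp)), rk, norm_real]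
      · have e2 : ({x : E4 | (n : ℝ) + 1 ≤ ‖x‖}.indicator (fn n)) =
            {x : E4 | (n : ℝ) + 1 ≤ ‖x‖}.indicator (fn n - f) +
              {x : E4 | (n : ℝ) + 1 ≤ ‖x‖}.indicator f := by
          rw [← indicator_add']; congr 1; ext x; simp
        rw [e2]
        refine (eLpNorm_add_le ((m2.sub hf.1).indicator ms) (hf.1.indicator ms) h14).trans ?_
        gcongr
        exact eLpNorm_indicator_le _
  have hbound : ∀ n, N[p'] (h n) ≤ C * ∑ j, (N[p] (g j) + e n) := by
    intro n
    have hfin : Module.finrank ℝ E4 = 4 := by simp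
    refine (eLpNorm_le_eLpNorm_fderiv_of_eq (volume : Measure E4) ((hhs n).of_le (by simp)) (hhc n)
      (p := p) (p' := p') hp (by rw [hfin]; norm_num) (by rw [hfin, hp']; norm_num)).trans ?_
    rw [hC]
    gcongr
    calc N[p] (fderiv ℝ (h n)) ≤ N[p] (fun x => ∑ j, ‖pd j (h n) x‖) := by
          refine eLpNorm_mono_ae (ae_of_all _ fun x => ?_)
          refine (norm_fderiv_le_sum _ x).trans (le_abs_self _)
      _ ≤ ∑ j, N[p] (fun x => ‖pd j (h n) x‖) := by
          have : (fun x => ∑ j, ‖pd j (h n) x‖) = ∑ j, fun x => ‖pd j (h n) x‖ := by ext x; simp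
          rw [this]
          exact eLpNorm_sum_le (fun j _ =>
            (pd_contDiff (hhs n) j).continuous.norm.aestronglyMeasurable) hp1
      _ ≤ _ := by
          refine sum_le_sum fun j _ => ?_
          rw [eLpNorm_norm]
          exact hder n j
  have hlim : ∀ᵐ x, Tendsto (fun n => h n x) atTop (𝓝 (f x)) := by
    filter_upwards [ae_tendsto_cv_mol hfl] with x hx
    refine hx.congr' ?_
    filter_upwards [eventually_cut_eq_one x] with n hn
    simp [hh, rk, hn, hfn]
  refine (Lp.eLpNorm_lim_le_liminf_eLpNorm (fun n => (hhs n).continuous.aestronglyMeasurable) f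
    hlim).trans ?_
  have hlim2 : Tendsto (fun n => C * ∑ j, (N[p] (g j) + e n)) atTop (𝓝 (C * ∑ j, N[p] (g j))) := by
    refine ENNReal.Tendsto.const_mul ?_ (Or.inr ENNReal.coe_ne_top)
    refine tendsto_finsetSum _ fun j _ => ?_
    simpa using he0.const_add (N[p] (g j))
  exact (liminf_le_liminf (Eventually.of_forall hbound)).trans hlim2.liminf_eq.le

theorem exists_sobolev_two : ∃ C : ℝ≥0∞, C ≠ ⊤ ∧ ∀ (f : E4 → ℂ) (g : Fin 4 → E4 → ℂ),
    MemLp f 4 → (∀ j, HasWeakDer j f (g j)) → (∀ j, MemLp (g j) 2) →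
      N[4] f ≤ C * ∑ j, N[2] (g j) := by
  have : HolderTriple 4 4 ((2 : NNReal) : ℝ≥0∞) := ⟨by
    rw [← toReal_eq_toReal_iff' (by simp) (by simp)]
    rw [toReal_add (by simp) (by simp)]; norm_num⟩
  exact exists_sobolev (p := 2) (p' := 4) (q := 4) (by norm_num) (by norm_num) le_rfl

theorem exists_sobolev_six : ∃ C : ℝ≥0∞, C ≠ ⊤ ∧ ∀ (f : E4 → ℂ) (g : Fin 4 → E4 → ℂ),
    MemLp f 4 → (∀ j, HasWeakDer j f (g j)) → (∀ j, MemLp (g j) ((12 / 5 : NNReal) : ℝ≥0∞)) →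
      N[6] f ≤ C * ∑ j, N[((12 / 5 : NNReal) : ℝ≥0∞)] (g j) := by
  have : HolderTriple 6 4 ((12 / 5 : NNReal) : ℝ≥0∞) := ⟨by
    rw [← toReal_eq_toReal_iff' (by simp) (by simp)]
    rw [toReal_add (by simp) (by simp)]; norm_num⟩
  exact exists_sobolev (p := 12 / 5) (p' := 6) (q := 6)
    (by rw [← NNReal.coe_le_coe]; norm_num) (by norm_num) (by norm_num)

/-! ### Weak derivatives in time -/

/-- On the interval `(a, b)` the integrable function `f` has the integrable weak derivative `g`. -/
structure HasWeakDeriv (a b : ℝ) (f g : ℝ → ℝ) : Prop where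
  integrable : IntegrableOn f (Ioo a b)
  integrable_deriv : IntegrableOn g (Ioo a b)
  integral_eq : ∀ θ : ℝ → ℝ, ContDiff ℝ ∞ θ → HasCompactSupport θ → tsupport θ ⊆ Ioo a b →
    ∫ t, deriv θ t * f t = -∫ t, θ t * g t

theorem eq_zero_of_tsupport {θ : ℝ → ℝ} (h : tsupport θ ⊆ Ioo a b) {t : ℝ}
    (ht : t ∉ Ioo a b) : θ t = 0 := by
  by_contra h0
  exact ht (h (subset_tsupport θ h0))

theorem tsupport_deriv_subset' {θ : ℝ → ℝ} : tsupport (deriv θ) ⊆ tsupport θ :=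
  closure_minimal (support_deriv_subset) isClosed_closure

theorem integral_eq_intervalIntegral (hab : a ≤ b) {θ f : ℝ → ℝ}
    (h : tsupport θ ⊆ Ioo a b) : ∫ t, θ t * f t = ∫ t in a..b, θ t * f t := by
  rw [intervalIntegral.integral_of_le hab, ← integral_indicator measurableSet_Ioc]
  congr 1
  ext t
  by_cases ht : t ∈ Ioc a b
  · simp [ht]
  · have : t ∉ Ioo a b := fun h => ht (Ioo_subset_Ioc_self h)
    simp [ht, eq_zero_of_tsupport h this]

theorem intervalIntegrable_of_Ioo (hab : a ≤ b) {g : ℝ → ℝ}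
    (hg : IntegrableOn g (Ioo a b)) : IntervalIntegrable g volume a b := by
  rwa [intervalIntegrable_iff_integrableOn_Ioo_of_le hab]

theorem absolutelyContinuousOnInterval_primitive (hab : a ≤ b) {g : ℝ → ℝ}
    (hg : IntegrableOn g (Ioo a b)) (c : ℝ) :
    AbsolutelyContinuousOnInterval (fun t => c + ∫ s in a..t, g s) a b := by
  have h1 := (intervalIntegrable_of_Ioo hab hg).absolutelyContinuousOnInterval_intervalIntegral
    (c := a) left_mem_uIcc
  have h2 : AbsolutelyContinuousOnInterval (fun _ : ℝ => c) a b :=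
    contDiff_const.contDiffOn.absolutelyContinuousOnInterval
  exact h2.add h1

theorem ae_deriv_primitive (hab : a ≤ b) {g : ℝ → ℝ}
    (hg : IntegrableOn g (Ioo a b)) (c : ℝ) :
    ∀ᵐ t, t ∈ Ioc a b → deriv (fun t => c + ∫ s in a..t, g s) t = g t := by
  filter_upwards [(intervalIntegrable_of_Ioo hab hg).ae_hasDerivAt_integral] with t ht hmem
  have hm : t ∈ uIcc a b := by rw [uIcc_of_le hab]; exact Ioc_subset_Icc_self hmem
  exact ((ht hm a left_mem_uIcc).const_add c).deriv

theorem integrableOn_primitive (hab : a ≤ b) {g : ℝ → ℝ}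
    (hg : IntegrableOn g (Ioo a b)) (c : ℝ) :
    IntegrableOn (fun t => c + ∫ s in a..t, g s) (Ioo a b) := by
  have h := (absolutelyContinuousOnInterval_primitive hab hg c).continuousOn
  rw [uIcc_of_le hab] at h
  exact (h.integrableOn_compact isCompact_Icc).mono_set Ioo_subset_Icc_self

theorem ae_restrict_of_Ioo {p : ℝ → Prop} (h : ∀ᵐ t ∂vol[a,b], p t) :
    ∀ᵐ t ∂volume.restrict (Ioc a b), p t := by
  rwa [restrict_Ioo_eq_restrict_Ioc] at h

/-- A function that agrees almost everywhere with a primitive of `g` has weak derivative `g`. -/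
theorem hasWeakDeriv_of_ae_eq (hab : a ≤ b) {f g : ℝ → ℝ}
    (hg : IntegrableOn g (Ioo a b)) {c : ℝ}
    (h : ∀ᵐ t ∂vol[a,b], f t = c + ∫ s in a..t, g s) : HasWeakDeriv a b f g := by
  refine ⟨(integrableOn_primitive hab hg c).congr_fun_ae (h.mono fun t ht => ht.symm), hg,
    fun θ h1 h2 h3 => ?_⟩
  rw [integral_eq_intervalIntegral hab (tsupport_deriv_subset'.trans h3),
    integral_eq_intervalIntegral hab h3]
  have hAC := absolutelyContinuousOnInterval_primitive hab hg c
  have hθ : AbsolutelyContinuousOnInterval θ a b :=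
    (h1.of_le (by simp)).contDiffOn.absolutelyContinuousOnInterval
  have key := hAC.integral_mul_deriv_eq_deriv_mul hθ
  rw [eq_zero_of_tsupport h3 (t := a) (by simp), eq_zero_of_tsupport h3 (t := b) (by simp)] at key
  simp only [mul_zero, sub_zero, zero_sub] at key
  have e1 : ∫ t in a..b, deriv θ t * f t = ∫ t in a..b, (c + ∫ s in a..t, g s) * deriv θ t := by
    rw [intervalIntegral.integral_of_le hab, intervalIntegral.integral_of_le hab]
    refine integral_congr_ae ((ae_restrict_of_Ioo h).mono fun t ht => ?_)
    simp only [ht, mul_comm]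
  have e2 : ∫ t in a..b, θ t * g t =
      ∫ t in a..b, deriv (fun t => c + ∫ s in a..t, g s) t * θ t := by
    rw [intervalIntegral.integral_of_le hab, intervalIntegral.integral_of_le hab]
    refine integral_congr_ae ?_
    filter_upwards [(ae_restrict_iff' measurableSet_Ioc).2 (ae_deriv_primitive hab hg c)] with t ht
    simp only [ht, mul_comm]
  rw [e1, e2, key]

theorem exists_bump_Ioo (hab : a < b) : ∃ ρ : ℝ → ℝ, ContDiff ℝ ∞ ρ ∧
    HasCompactSupport ρ ∧ tsupport ρ ⊆ Ioo a b ∧ ∫ t, ρ t = 1 := by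
  let B : ContDiffBump ((a + b) / 2) :=
    { rIn := (b - a) / 8, rOut := (b - a) / 4, rIn_pos := by linarith, rIn_lt_rOut := by linarith }
  refine ⟨B.normed volume, B.contDiff_normed, B.hasCompactSupport_normed, ?_, B.integral_normed⟩
  rw [B.tsupport_normed_eq]
  intro t ht
  rw [Real.closedBall_eq_Icc] at ht
  change t ∈ Icc ((a + b) / 2 - (b - a) / 4) ((a + b) / 2 + (b - a) / 4) at ht
  constructor <;> [linarith [ht.1]; linarith [ht.2]]

theorem exists_contDiff_primitive {ψ : ℝ → ℝ} (h1 : ContDiff ℝ ∞ ψ)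
    (h2 : HasCompactSupport ψ) (h3 : tsupport ψ ⊆ Ioo a b) (h0 : ∫ t, ψ t = 0) :
    ∃ θ : ℝ → ℝ, ContDiff ℝ ∞ θ ∧ HasCompactSupport θ ∧ tsupport θ ⊆ Ioo a b ∧ deriv θ = ψ := by
  rcases (tsupport ψ).eq_empty_or_nonempty with he | hne
  · have : ψ = 0 := by rwa [tsupport_eq_empty_iff] at he
    exact ⟨0, contDiff_const, HasCompactSupport.zero, by simp [tsupport], by rw [this]; ext; simp⟩
  have hK : IsCompact (tsupport ψ) := h2
  set m := sInf (tsupport ψ)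
  set M := sSup (tsupport ψ)
  have hm : m ∈ tsupport ψ := hK.sInf_mem hne
  have hM : M ∈ tsupport ψ := hK.sSup_mem hne
  have hmM : m ≤ M := hK.isBounded.bddBelow |> fun h => csInf_le h hM
  have hsub : tsupport ψ ⊆ Icc m M := fun t ht =>
    ⟨csInf_le hK.isBounded.bddBelow ht, le_csSup hK.isBounded.bddAbove ht⟩
  have hz : ∀ t, t ∉ Icc m M → ψ t = 0 := fun t ht => by
    by_contra h; exact ht (hsub (subset_tsupport ψ h))
  set θ : ℝ → ℝ := fun t => ∫ s in m..t, ψ s with hθ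
  have hder : ∀ t, HasDerivAt θ (ψ t) t := fun t =>
    h1.continuous.integral_hasStrictDerivAt m t |>.hasDerivAt
  have hd : deriv θ = ψ := funext fun t => (hder t).deriv
  have hsupp : Function.support θ ⊆ Icc m M := by
    intro t ht
    by_contra hn
    apply ht
    rcases lt_or_ge t m with h | h
    · simp only [hθ]
      rw [intervalIntegral.integral_symm, intervalIntegral.integral_of_le h.le,
        setIntegral_eq_zero_of_ae_eq_zero, neg_zero]
      have : ∀ᵐ s : ℝ, s ≠ m := by simp [ae_iff]
      filter_upwards [this] with s hs hmem
      exact hz s fun h' => hs (le_antisymm hmem.2 h'.1)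
    · have hMt : M < t := by by_contra h'; exact hn ⟨h, not_lt.1 h'⟩
      simp only [hθ]
      rw [intervalIntegral.integral_of_le h, ← h0]
      rw [← integral_Icc_eq_integral_Ioc]
      refine setIntegral_eq_integral_of_forall_compl_eq_zero fun s hs => hz s fun h' => hs ?_
      exact ⟨h'.1, h'.2.trans hMt.le⟩
  have hts : tsupport θ ⊆ Icc m M := closure_minimal hsupp isClosed_Icc
  refine ⟨θ, ?_, HasCompactSupport.of_support_subset_isCompact isCompact_Icc hsupp, ?_, hd⟩
  · exact contDiff_infty_iff_deriv.2 ⟨fun t => (hder t).differentiableAt, by rwa [hd]⟩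
  · exact hts.trans fun t ht => ⟨(h3 hm).1.trans_le ht.1, ht.2.trans_lt (h3 hM).2⟩

theorem integrable_mul_of_tsupport {θ f : ℝ → ℝ} (h1 : Continuous θ)
    (h2 : HasCompactSupport θ) (h3 : tsupport θ ⊆ Ioo a b) (hf : IntegrableOn f (Ioo a b)) :
    Integrable fun t => θ t * f t := by
  obtain ⟨C, hC⟩ := h2.exists_bound_of_continuous h1
  have : IntegrableOn (fun t => θ t * f t) (Ioo a b) :=
    Integrable.bdd_mul hf h1.aestronglyMeasurable (ae_of_all _ hC)
  rwa [integrableOn_iff_integrable_of_support_subset] at this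
  intro t ht
  by_contra h
  exact ht (by simp [eq_zero_of_tsupport h3 h])

/-- The du Bois-Reymond lemma: a function with weak derivative `g` agrees almost everywhere with a
primitive of `g`. -/
theorem HasWeakDeriv.exists_ae_eq (hab : a < b) {f g : ℝ → ℝ} (h : HasWeakDeriv a b f g) :
    ∃ c, ∀ᵐ t ∂vol[a,b], f t = c + ∫ s in a..t, g s := by
  obtain ⟨ρ, r1, r2, r3, r4⟩ := exists_bump_Ioo hab
  set G : ℝ → ℝ := fun t => 0 + ∫ s in a..t, g s with hG
  have hGw : HasWeakDeriv a b G g :=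
    hasWeakDeriv_of_ae_eq hab.le h.integrable_deriv (c := 0) (ae_of_all _ fun t => rfl)
  set w : ℝ → ℝ := fun t => f t - G t with hw
  have hwi : IntegrableOn w (Ioo a b) := h.integrable.sub hGw.integrable
  have hw0 : ∀ θ : ℝ → ℝ, ContDiff ℝ ∞ θ → HasCompactSupport θ → tsupport θ ⊆ Ioo a b →
      ∫ t, deriv θ t * w t = 0 := by
    intro θ t1 t2 t3
    have d1 : Continuous (deriv θ) := t1.continuous_deriv (by simp)
    have d3 := tsupport_deriv_subset'.trans t3
    simp only [hw, mul_sub]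
    rw [integral_sub (integrable_mul_of_tsupport d1 t2.deriv d3 h.integrable)
      (integrable_mul_of_tsupport d1 t2.deriv d3 hGw.integrable), h.integral_eq θ t1 t2 t3,
      hGw.integral_eq θ t1 t2 t3, sub_self]
  set c := ∫ t, ρ t * w t with hc
  refine ⟨c, ?_⟩
  have hzero : ∀ᵐ t : ℝ, t ∈ Ioo a b → w t - c = 0 := by
    refine isOpen_Ioo.ae_eq_zero_of_integral_contDiff_smul_eq_zero
      (hwi.sub (integrableOn_const (by simp))).locallyIntegrableOn fun ψ p1 p2 p3 => ?_
    have hρi : Integrable ρ := r1.continuous.integrable_of_hasCompactSupport r2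
    have hψi : Integrable ψ := p1.continuous.integrable_of_hasCompactSupport p2
    set I := ∫ t, ψ t
    have q1 : ContDiff ℝ ∞ (fun t => ψ t - I * ρ t) := p1.sub (contDiff_const.mul r1)
    have q2 : HasCompactSupport (fun t => ψ t - I * ρ t) := by
      have : HasCompactSupport (fun t => I * ρ t) := r2.mul_left
      exact p2.sub this
    have q3 : tsupport (fun t => ψ t - I * ρ t) ⊆ Ioo a b := by
      refine (tsupport_sub ψ (fun t => I * ρ t)).trans (union_subset p3 ?_)
      exact (tsupport_mul_subset_right (f := fun _ => I) (g := ρ)).trans r3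
    have q4 : ∫ t, (ψ t - I * ρ t) = 0 := by
      rw [integral_sub hψi (hρi.const_mul I), integral_const_mul, r4]; ring
    obtain ⟨θ, t1, t2, t3, t4⟩ := exists_contDiff_primitive q1 q2 q3 q4
    have h0 := hw0 θ t1 t2 t3
    rw [t4] at h0
    have i1 := integrable_mul_of_tsupport p1.continuous p2 p3 hwi
    have i2 := integrable_mul_of_tsupport r1.continuous r2 r3 hwi
    have e1 : ∫ t, (ψ t - I * ρ t) * w t = (∫ t, ψ t * w t) - I * c := by
      rw [hc, ← integral_const_mul, ← integral_sub i1 (i2.const_mul I)]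
      congr 1; ext t; ring
    rw [e1] at h0
    simp only [smul_eq_mul, mul_sub]
    rw [integral_sub i1 (hψi.mul_const c), integral_mul_const]
    exact h0
  rw [ae_restrict_iff' measurableSet_Ioo]
  filter_upwards [hzero] with t ht hmem
  have := ht hmem
  simp only [hw, hG] at this
  linarith

theorem HasWeakDeriv.congr {f g f' g' : ℝ → ℝ} (h : HasWeakDeriv a b f g)
    (hf : ∀ᵐ t ∂vol[a,b], f t = f' t)
    (hg : ∀ᵐ t ∂vol[a,b], g t = g' t) : HasWeakDeriv a b f' g' := by
  refine ⟨h.integrable.congr hf, h.integrable_deriv.congr hg, fun θ h1 h2 h3 => ?_⟩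
  have e : ∀ {θ u u' : ℝ → ℝ}, tsupport θ ⊆ Ioo a b →
      (∀ᵐ t ∂vol[a,b], u t = u' t) → ∫ t, θ t * u t = ∫ t, θ t * u' t := by
    intro θ u u' hθ hu
    rw [ae_restrict_iff' measurableSet_Ioo] at hu
    refine integral_congr_ae ?_
    filter_upwards [hu] with t ht
    by_cases hm : t ∈ Ioo a b
    · simp only [ht hm]
    · simp [eq_zero_of_tsupport hθ hm]
  rw [← e (tsupport_deriv_subset'.trans h3) hf, ← e h3 hg, h.integral_eq θ h1 h2 h3]

/-- The product rule for weak derivatives in one variable. -/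
theorem HasWeakDeriv.mul (hab : a < b) {f g f' g' : ℝ → ℝ} (h : HasWeakDeriv a b f g)
    (h' : HasWeakDeriv a b f' g') :
    HasWeakDeriv a b (fun t => f t * f' t) (fun t => g t * f' t + f t * g' t) := by
  obtain ⟨c, hc⟩ := h.exists_ae_eq hab
  obtain ⟨c', hc'⟩ := h'.exists_ae_eq hab
  have i := h.integrable_deriv
  have i' := h'.integrable_deriv
  set P : ℝ → ℝ := fun t => c + ∫ s in a..t, g s with hP
  set P' : ℝ → ℝ := fun t => c' + ∫ s in a..t, g' s with hP'
  have ac : AbsolutelyContinuousOnInterval P a b := absolutelyContinuousOnInterval_primitive hab.le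
      i c
  have ac' : AbsolutelyContinuousOnInterval P' a b :=
    absolutelyContinuousOnInterval_primitive hab.le i' c'
  have d := ae_deriv_primitive hab.le i c
  have d' := ae_deriv_primitive hab.le i' c'
  set s : ℝ → ℝ := fun t => g t * P' t + P t * g' t with hs
  have hsi : IntegrableOn s (Ioo a b) := by
    have := ((intervalIntegrable_of_Ioo hab.le i).mul_continuousOn ac'.continuousOn).add
      ((intervalIntegrable_of_Ioo hab.le i').continuousOn_mul ac.continuousOn)
    rwa [intervalIntegrable_iff_integrableOn_Ioo_of_le hab.le] at this
  have hprod : HasWeakDeriv a b (fun t => P t * P' t) s := by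
    refine hasWeakDeriv_of_ae_eq hab.le hsi (c := P a * P' a) ?_
    rw [ae_restrict_iff' measurableSet_Ioo]
    refine ae_of_all _ fun t ht => ?_
    have hsub : uIcc a t ⊆ uIcc a b := by
      rw [uIcc_of_le ht.1.le, uIcc_of_le hab.le]; exact Icc_subset_Icc_right ht.2.le
    have key := (ac.mono hsub).integral_deriv_mul_eq_sub (ac'.mono hsub)
    have e : ∫ x in a..t, s x = ∫ x in a..t, deriv P x * P' x + P x * deriv P' x := by
      rw [intervalIntegral.integral_of_le ht.1.le, intervalIntegral.integral_of_le ht.1.le]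
      refine integral_congr_ae ?_
      rw [EventuallyEq, ae_restrict_iff' measurableSet_Ioc]
      filter_upwards [d, d'] with x hx hx' hmem
      have hm : x ∈ Ioc a b := ⟨hmem.1, hmem.2.trans ht.2.le⟩
      rw [hx hm, hx' hm]
    rw [e, key]; ring
  refine hprod.congr ?_ ?_
  · filter_upwards [hc, hc'] with t h1 h2
    rw [h1, h2]
  · filter_upwards [hc, hc'] with t h1 h2
    simp only [hs]
    rw [h1, h2]

theorem HasWeakDeriv.add {f g f' g' : ℝ → ℝ} (h : HasWeakDeriv a b f g)
    (h' : HasWeakDeriv a b f' g') :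
    HasWeakDeriv a b (fun t => f t + f' t) (fun t => g t + g' t) := by
  refine ⟨h.integrable.add h'.integrable, h.integrable_deriv.add h'.integrable_deriv,
    fun θ h1 h2 h3 => ?_⟩
  have d1 : Continuous (deriv θ) := h1.continuous_deriv (by simp)
  have d3 := tsupport_deriv_subset'.trans h3
  simp only [mul_add]
  rw [integral_add (integrable_mul_of_tsupport d1 h2.deriv d3 h.integrable)
      (integrable_mul_of_tsupport d1 h2.deriv d3 h'.integrable),
      integral_add (integrable_mul_of_tsupport h1.continuous h2 h3 h.integrable_deriv)
      (integrable_mul_of_tsupport h1.continuous h2 h3 h'.integrable_deriv),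
      h.integral_eq θ h1 h2 h3, h'.integral_eq θ h1 h2 h3]
  ring

theorem HasWeakDeriv.const_mul {f g : ℝ → ℝ} (h : HasWeakDeriv a b f g) (c : ℝ) :
    HasWeakDeriv a b (fun t => c * f t) (fun t => c * g t) := by
  refine ⟨h.integrable.const_mul c, h.integrable_deriv.const_mul c, fun θ h1 h2 h3 => ?_⟩
  have e : ∀ u v : ℝ → ℝ, ∫ t, u t * (c * v t) = c * ∫ t, u t * v t := by
    intro u v
    rw [← integral_const_mul]; congr 1; ext t; ring
  rw [e, e, h.integral_eq θ h1 h2 h3]; ring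

theorem hasWeakDeriv_zero (a b : ℝ) : HasWeakDeriv a b (fun _ => 0) (fun _ => 0) :=
  ⟨integrableOn_zero, integrableOn_zero, by simp⟩

theorem HasWeakDeriv.sum {ι : Type*} (s : Finset ι) {f g : ι → ℝ → ℝ}
    (h : ∀ i, HasWeakDeriv a b (f i) (g i)) :
    HasWeakDeriv a b (fun t => ∑ i ∈ s, f i t) (fun t => ∑ i ∈ s, g i t) := by
  classical
  induction s using Finset.induction_on with
  | empty => simpa using hasWeakDeriv_zero a b
  | insert i s hi ih => simpa only [Finset.sum_insert hi] using (h i).add ih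

/-- Increments of a function with weak derivative `g` are integrals of `g`. -/
theorem HasWeakDeriv.ae_sub_eq (hab : a < b) {f g : ℝ → ℝ} (h : HasWeakDeriv a b f g) :
    ∀ᵐ t₁ ∂vol[a,b], ∀ᵐ t₂ ∂vol[a,b], f t₂ - f t₁ = ∫ s in t₁..t₂, g s := by
  obtain ⟨c, hc⟩ := h.exists_ae_eq hab
  have hm := ae_restrict_mem (μ := volume) (measurableSet_Ioo (a := a) (b := b))
  filter_upwards [hc, hm] with t₁ h1 m1
  filter_upwards [hc, hm] with t₂ h2 m2
  have hi := intervalIntegrable_of_Ioo hab.le h.integrable_deriv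
  have ha : a ∈ uIcc a b := left_mem_uIcc
  have hi' : ∀ {t}, t ∈ Ioo a b → IntervalIntegrable g volume a t := fun ht =>
    hi.mono_set (by rw [uIcc_of_le ht.1.le, uIcc_of_le hab.le]; exact Icc_subset_Icc_right ht.2.le)
  rw [h1, h2, add_sub_add_left_eq_sub, intervalIntegral.integral_interval_sub_left (hi' m2)
      (hi' m1)]

/-- Integrating in `x` a family of weak time derivatives. -/
theorem hasWeakDeriv_integral {e s : ℝ → E4 → ℝ}
    (h : ∀ x, HasWeakDeriv a b (fun t => e t x) (fun t => s t x))
    (he : Integrable (uncurry e) ((vol[a,b]).prod volume))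
    (hs : Integrable (uncurry s) ((vol[a,b]).prod volume)) :
    HasWeakDeriv a b (fun t => ∫ x, e t x) (fun t => ∫ x, s t x) := by
  refine ⟨Integrable.integral_prod_left he, Integrable.integral_prod_left hs, fun θ h1 h2 h3 => ?_⟩
  have key : ∀ {θ : ℝ → ℝ} {u : ℝ → E4 → ℝ}, Continuous θ → HasCompactSupport θ →
      tsupport θ ⊆ Ioo a b →
      Integrable (uncurry u) ((vol[a,b]).prod volume) →
      ∫ t, θ t * ∫ x, u t x = ∫ x, ∫ t, θ t * u t x := by
    intro θ u t1 t2 t3 hu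
    obtain ⟨C, hC⟩ := t2.exists_bound_of_continuous t1
    have e0 : ∀ v : ℝ → ℝ, ∫ t, θ t * v t = ∫ t in Ioo a b, θ t * v t := fun v => by
      refine (setIntegral_eq_integral_of_forall_compl_eq_zero fun t ht => ?_).symm
      rw [eq_zero_of_tsupport t3 ht, zero_mul]
    rw [e0]
    simp only [fun x => e0 (fun t => u t x)]
    have e1 : ∀ t, θ t * ∫ x, u t x = ∫ x, θ t * u t x := fun t => (integral_const_mul _ _).symm
    simp only [e1]
    refine integral_integral_swap (μ := vol[a,b]) (ν := (volume : Measure E4))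
      (f := fun t x => θ t * u t x) ?_
    have : Integrable (fun z : ℝ × E4 => θ z.1 * uncurry u z) ((vol[a,b]).prod volume) :=
      Integrable.bdd_mul hu (t1.comp continuous_fst).aestronglyMeasurable
        (ae_of_all _ fun z => hC z.1)
    exact this
  rw [key (h1.continuous_deriv (by simp)) h2.deriv (tsupport_deriv_subset'.trans h3) he,
    key h1.continuous h2 h3 hs, ← integral_neg]
  congr 1
  ext x
  exact (h x).integral_eq θ h1 h2 h3

/-- Weak time derivatives pass to dominated limits. -/
theorem hasWeakDeriv_of_tendsto {f s : ℕ → ℝ → ℝ} {f₀ s₀ A B : ℝ → ℝ}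
    (h : ∀ n, HasWeakDeriv a b (f n) (s n))
    (hA : IntegrableOn A (Ioo a b)) (hB : IntegrableOn B (Ioo a b))
    (hfA : ∀ n, ∀ᵐ t ∂vol[a,b], |f n t| ≤ A t)
    (hsB : ∀ n, ∀ᵐ t ∂vol[a,b], |s n t| ≤ B t)
    (hf : ∀ᵐ t ∂vol[a,b], Tendsto (fun n => f n t) atTop (𝓝 (f₀ t)))
    (hs : ∀ᵐ t ∂vol[a,b], Tendsto (fun n => s n t) atTop (𝓝 (s₀ t))) :
    HasWeakDeriv a b f₀ s₀ := by
  have hlim : ∀ {u : ℕ → ℝ → ℝ} {u₀ U : ℝ → ℝ}, (∀ n, IntegrableOn (u n) (Ioo a b)) →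
      IntegrableOn U (Ioo a b) → (∀ n, ∀ᵐ t ∂vol[a,b], |u n t| ≤ U t) →
      (∀ᵐ t ∂vol[a,b], Tendsto (fun n => u n t) atTop (𝓝 (u₀ t))) →
      IntegrableOn u₀ (Ioo a b) ∧ ∀ θ : ℝ → ℝ, Continuous θ → HasCompactSupport θ →
        tsupport θ ⊆ Ioo a b →
        Tendsto (fun n => ∫ t, θ t * u n t) atTop (𝓝 (∫ t, θ t * u₀ t)) := by
    intro u u₀ U hu hU huU hlim
    have hm : AEStronglyMeasurable u₀ (vol[a,b]) :=
      aestronglyMeasurable_of_tendsto_ae atTop (fun n => (hu n).1) hlim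
    refine ⟨Integrable.mono' hU hm ?_, fun θ t1 t2 t3 => ?_⟩
    · filter_upwards [hlim, ae_all_iff.2 huU] with t h1 h2
      exact le_of_tendsto' h1.norm h2
    · obtain ⟨C, hC⟩ := t2.exists_bound_of_continuous t1
      have e0 : ∀ v : ℝ → ℝ, ∫ t, θ t * v t = ∫ t in Ioo a b, θ t * v t := fun v => by
        refine (setIntegral_eq_integral_of_forall_compl_eq_zero fun t ht => ?_).symm
        rw [eq_zero_of_tsupport t3 ht, zero_mul]
      simp only [e0]
      refine tendsto_integral_of_dominated_convergence (fun t => C * U t)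
        (fun n => t1.aestronglyMeasurable.mul (hu n).1) (hU.const_mul C) (fun n => ?_) ?_
      · filter_upwards [huU n] with t ht
        rw [norm_mul]
        exact mul_le_mul (hC t) ht (norm_nonneg _) ((norm_nonneg _).trans (hC t))
      · filter_upwards [hlim] with t ht using ht.const_mul _
  obtain ⟨i1, l1⟩ := hlim (fun n => (h n).integrable) hA hfA hf
  obtain ⟨i2, l2⟩ := hlim (fun n => (h n).integrable_deriv) hB hsB hs
  refine ⟨i1, i2, fun θ h1 h2 h3 => ?_⟩
  refine tendsto_nhds_unique (l1 _ (h1.continuous_deriv (by simp)) h2.deriv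
    (tsupport_deriv_subset'.trans h3)) ?_
  simp only [fun n => (h n).integral_eq θ h1 h2 h3]
  exact (l2 θ h1.continuous h2 h3).neg

/-! ### Weak time derivatives of complex functions -/

/-- The complex function `f` has the weak derivative `g` on `(a, b)`. -/
def HasWeakDerivC (a b : ℝ) (f g : ℝ → ℂ) : Prop :=
  HasWeakDeriv a b (fun t => (f t).re) (fun t => (g t).re) ∧
    HasWeakDeriv a b (fun t => (f t).im) (fun t => (g t).im)

theorem HasWeakDerivC.normSq (hab : a < b) {f g : ℝ → ℂ} (h : HasWeakDerivC a b f g) :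
    HasWeakDeriv a b (fun t => ‖f t‖ ^ 2) (fun t => 2 * (conj (f t) * g t).re) := by
  have := (h.1.mul hab h.1).add (h.2.mul hab h.2)
  refine this.congr (ae_of_all _ fun t => ?_) (ae_of_all _ fun t => ?_)
  · rw [← normSq_eq_norm_sq, Complex.normSq_apply]
  · simp; ring

theorem HasWeakDerivC.im_conj_mul (hab : a < b) {f g f' g' : ℝ → ℂ}
    (h : HasWeakDerivC a b f g) (h' : HasWeakDerivC a b f' g') :
    HasWeakDeriv a b (fun t => (conj (f t) * f' t).im)
      (fun t => (conj (g t) * f' t + conj (f t) * g' t).im) := by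
  have := (h.1.mul hab h'.2).add ((h.2.mul hab h'.1).const_mul (-1))
  refine this.congr (ae_of_all _ fun t => ?_) (ae_of_all _ fun t => ?_)
  · simp
  · simp; ring

/-! ### The mollified equation -/

/-- The Laplacian `∑ⱼ ∂ⱼ ∂ⱼ f`. -/
def lap {V : Type*} [NormedAddCommGroup V] [NormedSpace ℝ V] (f : E4 → V) : E4 → V :=
  fun x => ∑ j, pd j (pd j f) x

theorem lap_contDiff (hk : ContDiff ℝ ∞ k) : ContDiff ℝ ∞ (lap k) :=
  ContDiff.sum fun j _ => pd_contDiff (pd_contDiff hk j) j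

theorem lap_hasCompactSupport (hk : HasCompactSupport k) :
    HasCompactSupport (lap k) := by
  have : lap k = pd 0 (pd 0 k) + pd 1 (pd 1 k) + pd 2 (pd 2 k) + pd 3 (pd 3 k) := by
    ext x; simp [lap, Fin.sum_univ_four]
  rw [this]
  have h := fun j => pd_hasCompactSupport (pd_hasCompactSupport hk j) j
  exact (((h 0).add (h 1)).add (h 2)).add (h 3)

theorem laplacian_eq_lap (hk : ContDiff ℝ ∞ k) : Laplacian.laplacian k = lap k := by
  rw [InnerProductSpace.laplacian_eq_iteratedFDeriv_orthonormalBasis k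
    (EuclideanSpace.basisFun (Fin 4) ℝ)]
  ext x
  refine sum_congr rfl fun j _ => ?_
  rw [iteratedFDeriv_two_apply]
  have h : DifferentiableAt ℝ (fderiv ℝ k) x :=
    (hk.fderiv_right (m := ∞) (by simp)).differentiable (by simp) x
  have : HasFDerivAt (pd j k) ((ContinuousLinearMap.apply ℝ ℝ
      (EuclideanSpace.single j (1 : ℝ))).comp
      (fderiv ℝ (fderiv ℝ k) x)) x :=
    (ContinuousLinearMap.apply ℝ ℝ (EuclideanSpace.single j (1 : ℝ))).hasFDerivAt.comp x
        h.hasFDerivAt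
  simp only [EuclideanSpace.basisFun_apply, Matrix.cons_val_zero, Matrix.cons_val_one]
  rw [show pd j (pd j k) x = fderiv ℝ (pd j k) x (EuclideanSpace.single j 1) from rfl, this.fderiv]
  simp

theorem pd_const_mul {f : E4 → ℝ} (hf : Differentiable ℝ f) (c : ℝ) (j : Fin 4) :
    pd j (fun y => c * f y) = fun y => c * pd j f y := by
  ext y
  simp [pd, fderiv_const_mul (hf y)]

theorem laplacian_const_mul_reflect (hk : ContDiff ℝ ∞ k) (c : ℝ) (x y : E4) :
    Laplacian.laplacian (fun y => c * k (x - y)) y = c * lap k (x - y) := by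
  rw [laplacian_eq_lap (contDiff_const.mul (contDiff_reflect hk x))]
  simp only [lap, mul_sum]
  refine sum_congr rfl fun j _ => ?_
  have d1 := (contDiff_reflect hk x).differentiable (by simp)
  have hp := pd_contDiff hk j
  have d2 := (contDiff_reflect hp x).differentiable (by simp)
  rw [pd_const_mul d1]
  have e1 : pd j (fun y => k (x - y)) = fun y => (-1) * pd j k (x - y) := by
    ext y; rw [hasFDerivAt_comp_sub_left (hk.differentiable (by simp))]; ring
  rw [e1]
  have e2 : (fun y => c * (-1 * pd j k (x - y))) = fun y => (-c) * pd j k (x - y) := by ext y; ring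
  rw [e2, pd_const_mul d2]
  beta_reduce
  rw [hasFDerivAt_comp_sub_left (hp.differentiable (by simp))]
  ring

theorem integrable_kernel_mul {I : Set ℝ} (hI : Icc a b ⊆ I) {w : ℝ → E4 → ℂ}
    (hw : LocallyIntegrableOn (uncurry w) (I ×ˢ univ)) (hk : Continuous k)
    (hc : HasCompactSupport k) (x : E4) :
    Integrable (fun z : ℝ × E4 => rk k (x - z.2) * w z.1 z.2) ((vol[a,b]).prod volume) := by
  have hc' := hasCompactSupport_reflect hc x
  set S := tsupport (fun y => k (x - y))
  have hK : IsCompact (Icc a b ×ˢ S) := isCompact_Icc.prod hc'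
  have h1 : IntegrableOn (uncurry w) (Icc a b ×ˢ S) :=
    hw.integrableOn_compact_subset (prod_mono hI (subset_univ _)) hK
  have h2 : IntegrableOn (uncurry w) (Ioo a b ×ˢ S) :=
    h1.mono_set (prod_mono Ioo_subset_Icc_self subset_rfl)
  obtain ⟨C, hC⟩ := hc'.exists_bound_of_continuous (hk.comp (continuous_const.sub continuous_id))
  have h3 : IntegrableOn (fun z : ℝ × E4 => rk k (x - z.2) * w z.1 z.2) (Ioo a b ×ˢ S) := by
    refine Integrable.bdd_mul (c := C) h2 ?_ (ae_of_all _ fun z => ?_)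
    · exact ((rk_continuous hk).comp (continuous_const.sub continuous_snd)).aestronglyMeasurable
    · rw [rk, norm_real]; exact hC z.2
  have h4 : IntegrableOn (fun z : ℝ × E4 => rk k (x - z.2) * w z.1 z.2) (Ioo a b ×ˢ univ) := by
    refine h3.of_forall_sdiff_eq_zero (measurableSet_Ioo.prod .univ) fun z hz => ?_
    have : z.2 ∉ S := fun h => hz.2 ⟨hz.1.1, h⟩
    have h0 : k (x - z.2) = 0 := by by_contra h; exact this (subset_tsupport _ h)
    simp [rk, h0]
  rwa [IntegrableOn, Measure.volume_eq_prod, ← Measure.prod_restrict, Measure.restrict_univ] at h4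

/-- Mollifying a distributional solution of `(i∂ₜ + Δ) w = h` in space gives, at every point `x`, a
function of time with an integrable weak derivative. -/
theorem SolvesSchrodinger.hasWeakDerivC {J : Set ℝ} (hI : Icc a b ⊆ J)
    {w h : ℝ → E4 → ℂ} (hw : SolvesSchrodinger J w h) (hk : ContDiff ℝ ∞ k)
    (hc : HasCompactSupport k) (x : E4) :
    HasWeakDerivC a b (fun t => cv (rk k) (w t) x)
      (fun t => I * cv (rk (lap k)) (w t) x - I * cv (rk k) (h t) x) := by
  have i1 := integrable_kernel_mul hI hw.1 hk.continuous hc x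
  have i2 := integrable_kernel_mul hI hw.1 (lap_contDiff hk).continuous (lap_hasCompactSupport hc) x
  have i3 := integrable_kernel_mul hI hw.2.1 hk.continuous hc x
  have j1 : IntegrableOn (fun t => cv (rk k) (w t) x) (Ioo a b) := i1.integral_prod_left
  have j2 : IntegrableOn (fun t => cv (rk (lap k)) (w t) x) (Ioo a b) := i2.integral_prod_left
  have j3 : IntegrableOn (fun t => cv (rk k) (h t) x) (Ioo a b) := i3.integral_prod_left
  set G : ℝ → ℂ := fun t => I * cv (rk (lap k)) (w t) x - I * cv (rk k) (h t) x
  have j4 : IntegrableOn G (Ioo a b) := (j2.const_mul _).sub (j3.const_mul _)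
  have hcm : ∀ {θ : ℝ → ℝ} {W : ℝ → ℂ}, Continuous θ → HasCompactSupport θ →
      IntegrableOn W (Ioo a b) → tsupport θ ⊆ Ioo a b → Integrable fun t => (θ t : ℂ) * W t := by
    intro θ W t1 t2 hW t3
    obtain ⟨C, hC⟩ := t2.exists_bound_of_continuous t1
    have : IntegrableOn (fun t => (θ t : ℂ) * W t) (Ioo a b) :=
      Integrable.bdd_mul (c := C) hW (continuous_ofReal.comp t1).aestronglyMeasurable
        (ae_of_all _ fun t => by rw [norm_real]; exact hC t)
    rwa [integrableOn_iff_integrable_of_support_subset] at this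
    intro t ht
    by_contra h
    exact ht (by simp [eq_zero_of_tsupport t3 h])
  have key : ∀ θ : ℝ → ℝ, ContDiff ℝ ∞ θ → HasCompactSupport θ → tsupport θ ⊆ Ioo a b →
      ∫ t, ((deriv θ t : ℝ) : ℂ) * cv (rk k) (w t) x = -∫ t, (θ t : ℂ) * G t := by
    intro θ t1 t2 t3
    have d1 : Continuous (deriv θ) := t1.continuous_deriv (by simp)
    have d3 := tsupport_deriv_subset'.trans t3
    have hx2 := hasCompactSupport_reflect hc x
    have hφ := hw.2.2 (fun z => θ z.1 * k (x - z.2))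
      ((t1.comp contDiff_fst).mul (hk.comp (contDiff_const.sub contDiff_snd)))
      (HasCompactSupport.of_support_subset_isCompact (t2.isCompact.prod hx2.isCompact) (by
        intro z hz
        have := mul_ne_zero_iff.1 hz
        exact ⟨subset_tsupport _ this.1, subset_tsupport (fun y => k (x - y)) this.2⟩))
      (by
        have : tsupport (fun z : ℝ × E4 => θ z.1 * k (x - z.2)) ⊆ tsupport θ ×ˢ univ := by
          refine closure_minimal (fun z hz => ⟨subset_tsupport _ (mul_ne_zero_iff.1 hz).1, trivial⟩)
            ((isClosed_tsupport θ).prod isClosed_univ)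
        exact this.trans (prod_mono (t3.trans (Ioo_subset_Icc_self.trans hI)) subset_rfl))
    have hfub : ∀ {θ : ℝ → ℝ} {k : E4 → ℝ} {w : ℝ → E4 → ℂ}, Continuous θ → HasCompactSupport θ →
        tsupport θ ⊆ Ioo a b → Integrable (fun z : ℝ × E4 => rk k (x - z.2) * w z.1 z.2)
          ((vol[a,b]).prod volume) →
        Integrable (fun z : ℝ × E4 => (θ z.1 : ℂ) * (rk k (x - z.2) * w z.1 z.2)) ∧
        ∫ z : ℝ × E4, (θ z.1 : ℂ) * (rk k (x - z.2) * w z.1 z.2) =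
          ∫ t, (θ t : ℂ) * cv (rk k) (w t) x := by
      intro θ k w t1 t2 t3 hi
      obtain ⟨C, hC⟩ := t2.exists_bound_of_continuous t1
      have h1 : Integrable (fun z : ℝ × E4 => (θ z.1 : ℂ) * (rk k (x - z.2) * w z.1 z.2))
          ((vol[a,b]).prod volume) := by
        refine Integrable.bdd_mul (c := C) hi ?_ (ae_of_all _ fun z => ?_)
        · exact (continuous_ofReal.comp (t1.comp continuous_fst)).aestronglyMeasurable
        · rw [norm_real]; exact hC z.1
      have h2 : IntegrableOn (fun z : ℝ × E4 => (θ z.1 : ℂ) * (rk k (x - z.2) * w z.1 z.2))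
          (Ioo a b ×ˢ univ) := by
        rwa [IntegrableOn, Measure.volume_eq_prod, ← Measure.prod_restrict, Measure.restrict_univ]
      rw [integrableOn_iff_integrable_of_support_subset] at h2
      · refine ⟨h2, ?_⟩
        rw [Measure.volume_eq_prod] at h2 ⊢
        rw [integral_prod _ h2]
        simp only [integral_const_mul]
        rfl
      · intro z hz
        refine ⟨?_, trivial⟩
        by_contra h
        exact hz (by simp [eq_zero_of_tsupport t3 h])
    obtain ⟨a1, b1⟩ := hfub d1 t2.deriv d3 i1
    obtain ⟨a2, b2⟩ := hfub t1.continuous t2 t3 i2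
    obtain ⟨a3, b3⟩ := hfub t1.continuous t2 t3 i3
    have hder : ∀ z : ℝ × E4, deriv (fun s => θ s * k (x - z.2)) z.1 = deriv θ z.1 * k (x - z.2) :=
      fun z => deriv_mul_const (t1.differentiable (by simp) z.1) _
    have eL : ∫ z : ℝ × E4, w z.1 z.2 *
        (-I * ((deriv (fun s => θ s * k (x - z.2)) z.1 : ℝ) : ℂ) +
          ((Laplacian.laplacian (fun y => θ z.1 * k (x - y)) z.2 : ℝ) : ℂ)) =
        -I * (∫ t, ((deriv θ t : ℝ) : ℂ) * cv (rk k) (w t) x) +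
          ∫ t, (θ t : ℂ) * cv (rk (lap k)) (w t) x := by
      rw [← b1, ← b2, ← integral_const_mul, ← integral_add (a1.const_mul _) a2]
      congr 1
      ext z
      rw [hder, laplacian_const_mul_reflect hk]
      simp only [rk]
      push_cast
      ring
    have eR : ∫ z : ℝ × E4, h z.1 z.2 * ((θ z.1 * k (x - z.2) : ℝ) : ℂ) =
        ∫ t, (θ t : ℂ) * cv (rk k) (h t) x := by
      rw [← b3]
      congr 1
      ext z
      simp only [rk]
      push_cast
      ring
    have hφ' := eL.symm.trans (hφ.trans eR)
    have e4 : ∫ t, (θ t : ℂ) * G t = I * (∫ t, (θ t : ℂ) * cv (rk (lap k)) (w t) x) -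
          I * ∫ t, (θ t : ℂ) * cv (rk k) (h t) x := by
      have c2 := hcm t1.continuous t2 j2 t3
      have c3 := hcm t1.continuous t2 j3 t3
      rw [← integral_const_mul, ← integral_const_mul,
        ← integral_sub (c2.const_mul _) (c3.const_mul _)]
      congr 1; ext t; ring
    rw [e4, ← hφ']
    linear_combination (∫ t, ((deriv θ t : ℝ) : ℂ) * cv (rk k) (w t) x) * Complex.I_sq
  have hre : ∀ {θ : ℝ → ℝ} {W : ℝ → ℂ}, (Integrable fun t => (θ t : ℂ) * W t) →
      (∫ t, (θ t : ℂ) * W t).re = ∫ t, θ t * (W t).re ∧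
      (∫ t, (θ t : ℂ) * W t).im = ∫ t, θ t * (W t).im := by
    intro θ W hi
    constructor
    · have := integral_re (𝕜 := ℂ) hi
      simpa using this.symm
    · have := integral_im (𝕜 := ℂ) hi
      simpa using this.symm
  have fin : ∀ θ : ℝ → ℝ, ContDiff ℝ ∞ θ → HasCompactSupport θ → tsupport θ ⊆ Ioo a b →
      (∫ t, deriv θ t * (cv (rk k) (w t) x).re = -∫ t, θ t * (G t).re) ∧
      ∫ t, deriv θ t * (cv (rk k) (w t) x).im = -∫ t, θ t * (G t).im := by
    intro θ t1 t2 t3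
    have A := hre (hcm (t1.continuous_deriv (by simp)) t2.deriv j1 (tsupport_deriv_subset'.trans t3))
    have B := hre (hcm t1.continuous t2 j4 t3)
    rw [← A.1, ← A.2, ← B.1, ← B.2, key θ t1 t2 t3]
    exact ⟨neg_re _, neg_im _⟩
  exact ⟨⟨j1.re, j4.re, fun θ t1 t2 t3 => (fin θ t1 t2 t3).1⟩,
    j1.im, j4.im, fun θ t1 t2 t3 => (fin θ t1 t2 t3).2⟩

/-! ### Measurability in time -/

theorem measurable_eLpNorm_slice {V : Type*} [NormedAddCommGroup V] {w : ℝ → E4 → V}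
    (hw : StronglyMeasurable (uncurry w)) (p : ℝ≥0∞) :
    Measurable fun t => N[p] (w t) := by
  rcases eq_or_ne p 0 with rfl | hp0
  · simp
  have hm : Measurable fun z : ℝ × E4 => ‖w z.1 z.2‖ₑ := hw.enorm
  rcases eq_or_ne p ⊤ with rfl | hpt
  · simp only [eLpNorm_exponent_top]
    refine measurable_of_Iic fun c => ?_
    have : {t : ℝ | eLpNormEssSup (w t) volume ≤ c} =
        {t | volume (Prod.mk t ⁻¹' {z : ℝ × E4 | c < ‖w z.1 z.2‖ₑ}) = 0} := by
      ext t
      simp only [mem_ofPred_eq, preimage_ofPred_eq]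
      constructor
      · intro h
        have := enorm_ae_le_eLpNormEssSup (w t) volume
        rw [ae_iff] at this
        refine measure_mono_null (fun x hx => ?_) this
        simp only [mem_ofPred_eq, not_le] at hx ⊢
        exact h.trans_lt hx
      · intro h
        refine eLpNormEssSup_le_of_ae_enorm_bound ?_
        rw [ae_iff]
        simpa using h
    change MeasurableSet {t : ℝ | eLpNormEssSup (w t) volume ≤ c}
    rw [this]
    exact measurable_measure_prodMk_left (measurableSet_lt measurable_const hm)
      (measurableSet_singleton 0)
  · simp only [eLpNorm_eq_lintegral_rpow_enorm_toReal hp0 hpt]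
    exact (Measurable.lintegral_prod_right' (f := fun z : ℝ × E4 => ‖w z.1 z.2‖ₑ ^ p.toReal)
      (hm.pow_const _)).pow_const _

theorem stronglyMeasurable_cv {K : E4 → ℂ} (hK : Continuous K) {w : ℝ → E4 → ℂ}
    (hw : StronglyMeasurable (uncurry w)) :
    StronglyMeasurable (uncurry fun t x => cv K (w t) x) := by
  have h1 : StronglyMeasurable fun z : (ℝ × E4) × E4 => K (z.1.2 - z.2) :=
    (hK.comp (by fun_prop)).stronglyMeasurable
  have h2 : StronglyMeasurable fun z : (ℝ × E4) × E4 => w z.1.1 z.2 :=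
    hw.comp_measurable (by fun_prop : Measurable fun z : (ℝ × E4) × E4 => (z.1.1, z.2))
  exact (h1.mul h2).integral_prod_right'

/-- A jointly measurable version of the weak derivative `∂ⱼ w(t)`, obtained as a limit of
derivatives of mollifications. -/
def derLim (j : Fin 4) (w : ℝ → E4 → ℂ) : ℝ → E4 → ℂ :=
  fun t x => limUnder atTop fun n => cv (rk (pd j (mol n))) (w t) x

theorem stronglyMeasurable_derLim (j : Fin 4) {w : ℝ → E4 → ℂ}
    (hw : StronglyMeasurable (uncurry w)) :
    StronglyMeasurable (uncurry (derLim j w)) :=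
  StronglyMeasurable.limUnder (l := atTop) fun n =>
    stronglyMeasurable_cv (rk_continuous (pd_contDiff (mol_contDiff n) j).continuous) hw

theorem derLim_ae_eq {w : ℝ → E4 → ℂ} {t : ℝ}
    (h : HasWeakDer j (w t) g) : derLim j w t =ᵐ[volume] g := by
  filter_upwards [ae_tendsto_cv_mol h.2.1] with x hx
  refine Tendsto.limUnder_eq ?_
  simpa only [h.cv_pd (mol_contDiff _) (mol_hasCompactSupport _)] using hx

/-! ### Littlewood–Paley kernels -/

open scoped SchwartzMap LineDeriv

theorem holderTriple_four_thirds : HolderTriple p₄₃ 4 1 := ⟨by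
    rw [← toReal_eq_toReal_iff' (by simp) (by simp)]
    rw [toReal_add (by simp) (by simp)]; norm_num⟩

/-- Schwartz functions turn products into convolutions under the inverse Fourier transform. -/
theorem cv_fourierInv (σ τ : 𝓢(E4, ℂ)) : cv (𝓕⁻ σ : 𝓢(E4, ℂ)) (𝓕⁻ τ : 𝓢(E4, ℂ)) =
      (𝓕⁻ (SchwartzMap.pairing (ContinuousLinearMap.mul ℂ ℂ) σ τ) : 𝓢(E4, ℂ)) := by
  ext x
  have h := SchwartzMap.convolution_apply (ContinuousLinearMap.mul ℂ ℂ) (𝓕⁻ σ : 𝓢(E4, ℂ))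
    (𝓕⁻ τ : 𝓢(E4, ℂ)) x
  rw [convolution_eq_swap] at h
  have e : SchwartzMap.convolution (ContinuousLinearMap.mul ℂ ℂ) (𝓕⁻ σ : 𝓢(E4, ℂ))
    (𝓕⁻ τ : 𝓢(E4, ℂ)) = 𝓕⁻ (SchwartzMap.pairing (ContinuousLinearMap.mul ℂ ℂ) σ τ) := by
    simp [SchwartzMap.convolution]
  rw [e] at h
  rw [h]
  rfl

theorem lintegral_cv_integrand_le {K : E4 → ℂ} (hK : AEStronglyMeasurable K)
    (hf : AEStronglyMeasurable f) [HolderTriple p q 1] (x : E4) :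
    ∫⁻ y, ‖K (x - y) * f y‖ₑ ≤ N[p] K * N[q] f := by
  have hKx : AEStronglyMeasurable (fun y => K (x - y)) volume :=
    hK.comp_measurePreserving (measurePreserving_sub_left x)
  have h := eLpNorm_smul_le_mul_eLpNorm (p := p) (q := q) (r := 1) hf hKx
  rw [eLpNorm_one_eq_lintegral_enorm] at h
  refine h.trans (le_of_eq ?_)
  congr 1
  exact eLpNorm_comp_measurePreserving hK (measurePreserving_sub_left x)

theorem cv_assoc (L K : 𝓢(E4, ℂ)) (hf : MemLp f 4) :
    cv (cv L K) f = cv L (cv K f) := by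
  ext x
  have := holderTriple_four_thirds
  have hKm := K.continuous.aestronglyMeasurable (μ := (volume : Measure E4))
  have hLx : Integrable (fun w => L (x - w)) :=
    (measurePreserving_sub_left x).integrable_comp_of_integrable L.integrable
  have hK43 : MemLp K p₄₃ (volume : Measure E4) := K.memLp _
  have hint : Integrable (fun p : E4 × E4 => L (x - p.1) * (K (p.1 - p.2) * f p.2))
      (volume.prod volume) := by
    have hm : AEStronglyMeasurable (fun p : E4 × E4 => L (x - p.1) * (K (p.1 - p.2) * f p.2))
      (volume.prod volume) :=
      (L.continuous.comp (continuous_const.sub continuous_fst)).aestronglyMeasurable.mul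
        (aestronglyMeasurable_cv_integrand hKm hf.1)
    refine ⟨hm, ?_⟩
    rw [hasFiniteIntegral_iff_enorm, lintegral_prod _ hm.enorm]
    calc ∫⁻ w, ∫⁻ y, ‖L (x - w) * (K (w - y) * f y)‖ₑ ≤ ∫⁻ w, ‖L (x - w)‖ₑ *
            (N[p₄₃] K * N[4] f) := by
          refine lintegral_mono fun w => ?_
          simp only [enorm_mul (L (x - w))]
          rw [lintegral_const_mul' _ _ enorm_ne_top]
          gcongr
          exact lintegral_cv_integrand_le hKm hf.1 w
      _ < ⊤ := by
          have hB : N[p₄₃] K * N[4] f < ⊤ := mul_lt_top hK43.2 hf.2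
          rw [lintegral_mul_const' _ _ hB.ne]
          exact mul_lt_top hLx.2 hB
  have h := integral_integral_swap (f := fun w y => L (x - w) * (K (w - y) * f y)) hint
  have e1 : cv L (cv K f) x = ∫ w, ∫ y, L (x - w) * (K (w - y) * f y) := by
    simp only [cv, integral_const_mul]
  rw [e1, h]
  simp only [cv]
  refine integral_congr_ae (ae_of_all _ fun y => ?_)
  simp only [← mul_assoc]
  rw [integral_mul_const, ← integral_sub_right_eq_self _ y]
  congr 2
  ext w
  rw [sub_sub, add_sub_cancel]

/-- Integration by parts against a Schwartz kernel. -/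
theorem HasWeakDer.cv_pd_schwartz (h : HasWeakDer j f g)
    (hf : MemLp f 4) (hg : MemLp g 2) (K : 𝓢(E4, ℂ)) : cv (pd j K) f = cv K g := by
  ext x
  have := holderTriple_four_thirds
  set K' : 𝓢(E4, ℂ) := ∂_{EuclideanSpace.single j (1 : ℝ)} K with hK'
  have hpd : pd j K = K' := by ext y; simp [hK', pd, SchwartzMap.lineDerivOp_apply_eq_fderiv]
  rw [hpd]
  have h4 : LpTendsto 4 (fun n => cv (rk (mol n)) f) f := .mol (by norm_num) (by norm_num) hf
  have h2 : LpTendsto 2 (fun n => cv (rk (mol n)) g) g := .mol (by norm_num) (by norm_num) hg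
  have k1 : MemLp (fun y => K' (x - y)) p₄₃ volume :=
    (K'.memLp _).comp_measurePreserving (measurePreserving_sub_left x)
  have k2 : MemLp (fun y => K (x - y)) 2 volume :=
    (K.memLp _).comp_measurePreserving (measurePreserving_sub_left x)
  have k3 : MemLp (fun y => K (x - y)) p₄₃ volume :=
    (K.memLp _).comp_measurePreserving (measurePreserving_sub_left x)
  have l1 := (LpTendsto.mul le_rfl (LpTendsto.const k1) h4).integral
  have l2 := (LpTendsto.mul le_rfl (LpTendsto.const k2) h2).integral
  refine tendsto_nhds_unique l1 (l2.congr fun n => ?_)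
  have hfs : ContDiff ℝ ∞ (cv (rk (mol n)) f) :=
    contDiff_cv h.1 (mol_contDiff n) (mol_hasCompactSupport n)
  have hdf : pd j (cv (rk (mol n)) f) = cv (rk (mol n)) g := by
    rw [pd_cv h.1 (mol_contDiff n) (mol_hasCompactSupport n),
      h.cv_pd (mol_contDiff n) (mol_hasCompactSupport n)]
  have hKd : Differentiable ℝ (fun y => K (x - y)) :=
    K.differentiable.comp (differentiable_id.const_sub x)
  have hKp : ∀ y, pd j (fun y => K (x - y)) y = -K' (x - y) := by
    intro y
    have h : HasFDerivAt (fun y => K (x - y))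
        ((fderiv ℝ K (x - y)).comp (-ContinuousLinearMap.id ℝ E4)) y :=
      (K.differentiable (x - y)).hasFDerivAt.comp y ((hasFDerivAt_id y).const_sub x)
    rw [← hpd]
    simp [pd, h.fderiv]
  have i1 := memLp_one_iff_integrable.1 ((h4.memLp n).mul' k1 (r := 1))
  have i2 := memLp_one_iff_integrable.1 ((h2.memLp n).mul' k2 (r := 1))
  have i3 := memLp_one_iff_integrable.1 ((h4.memLp n).mul' k3 (r := 1))
  have := integral_mul_pd hKd (hfs.differentiable (by simp)) j
    (i1.neg.congr (ae_of_all _ fun y => by simp [hKp])) (by rw [hdf]; exact i2) i3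
  rw [hdf] at this
  rw [this]
  simp only [hKp, neg_mul, integral_neg, neg_neg]

/-- The factor `2π / 2ᵏ`: the Fourier transform is normalized by `exp (-2πi ⟨x, η⟩)`, so that
`freq k • η` is `ξ / 2ᵏ` for the frequency `ξ = 2πη`. -/
def freq (k : ℤ) : ℝ := 2 * Real.pi * (2 : ℝ) ^ (-k)

theorem freq_pos (k : ℤ) : 0 < freq k := by unfold freq; positivity

theorem freq_sub_one (k : ℤ) : freq (k - 1) = 2 * freq k := by
  unfold freq
  rw [neg_sub, sub_eq_add_neg, add_comm, zpow_add₀ (by norm_num)]; simp; ring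

theorem Framework.hasCompactSupport_φ (S : Framework) : HasCompactSupport S.φ := by
  refine HasCompactSupport.of_support_subset_isCompact (isCompact_closedBall (0 : E4) 2) ?_
  intro x hx
  rw [Metric.mem_closedBall, dist_zero_right]
  by_contra hlt
  exact hx (S.φ_zero x (not_le.1 hlt))

/-- The symbol of the low-frequency projection to `|ξ| ≲ 2ᵏ`. -/
def Framework.lowSym (S : Framework) (k : ℤ) : 𝓢(E4, ℂ) :=
  HasCompactSupport.toSchwartzMap (f := fun η : E4 => ((S.φ (freq k • η) : ℝ) : ℂ))
    ((S.hasCompactSupport_φ.comp_homeomorph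
      (Homeomorph.smulOfNeZero (freq k) (freq_pos k).ne')).comp_left (g := fun r : ℝ => (r : ℂ))
          (by simp))
    (ofRealCLM.contDiff.comp (S.φ_smooth.comp (contDiff_const_smul (freq k))))

theorem Framework.lowSym_apply (S : Framework) (k : ℤ) (η : E4) :
    S.lowSym k η = ((S.φ (freq k • η) : ℝ) : ℂ) := rfl

/-- The kernel of the low-frequency projection to `|ξ| ≲ 2ᵏ`. -/
def Framework.lowKer (S : Framework) (k : ℤ) : 𝓢(E4, ℂ) := 𝓕⁻ (S.lowSym k)

/-- The symbol of `P_N`, `N = 2ᵏ`. -/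
def Framework.bandSym (S : Framework) (k : ℤ) : 𝓢(E4, ℂ) := S.lowSym k - S.lowSym (k - 1)

/-- The kernel of `P_N`, `N = 2ᵏ`. -/
def Framework.bandKer (S : Framework) (k : ℤ) : 𝓢(E4, ℂ) := 𝓕⁻ (S.bandSym k)

theorem Framework.bandKer_eq (S : Framework) (k : ℤ) : S.bandKer k = S.lowKer k -
    S.lowKer (k - 1) := by
  simp only [bandKer, bandSym, lowKer]
  exact (FourierTransform.fourierInvCLM ℂ 𝓢(E4, ℂ)).map_sub _ _

theorem Framework.multiplier_eq (S : Framework) (k : ℤ) (f : E4 → ℂ) :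
    multiplier (dyadicSymbol S.φ ((2 : ℝ) ^ k)) f = cv (S.bandKer k) f := by
  ext x
  have e : (fun η : E4 => ((dyadicSymbol S.φ ((2 : ℝ) ^ k) ((2 * Real.pi) • η) : ℝ) : ℂ)) =
      S.bandSym k := by
    ext η
    change _ = S.lowSym k η - S.lowSym (k - 1) η
    simp only [dyadicSymbol, lowSym_apply, smul_smul, freq_sub_one]
    rw [Complex.ofReal_sub, freq, zpow_neg]
    ring_nf
  simp only [multiplier, cv, bandKer]
  rw [e, SchwartzMap.fourierInv_coe]

/-- Scaling of the low-frequency kernels. -/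
theorem Framework.lowKer_scale (S : Framework) (k : ℤ) (x : E4) :
    S.lowKer k x = (((2 : ℝ) ^ k) ^ 4 : ℝ) • S.lowKer 0 ((2 : ℝ) ^ k • x) := by
  have h2 : (0 : ℝ) < 2 ^ k := by positivity
  simp only [lowKer, SchwartzMap.fourierInv_coe, fourierInv_eq']
  have := Measure.integral_comp_smul (volume : Measure E4)
    (fun v => Complex.exp ((2 * Real.pi * inner ℝ v ((2 : ℝ) ^ k • x) : ℝ) * I) • S.lowSym 0 v)
    ((2 : ℝ) ^ k)⁻¹
  have e : ∀ v : E4, Complex.exp ((2 * Real.pi *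
      inner ℝ (((2 : ℝ) ^ k)⁻¹ • v) ((2 : ℝ) ^ k • x) : ℝ) * I)
      • S.lowSym 0 (((2 : ℝ) ^ k)⁻¹ • v) =
      Complex.exp ((2 * Real.pi * inner ℝ v x : ℝ) * I) • S.lowSym k v := by
    intro v
    rw [inner_smul_left, inner_smul_right]
    simp only [lowSym_apply, smul_smul, freq, neg_zero, zpow_zero, mul_one, zpow_neg]
    simp only [conj_trivial, ← mul_assoc]
    congr 5
    field_simp
  simp only [e] at this
  rw [this]
  congr 1
  simp [abs_of_pos h2]

theorem eLpNorm_one_scale (K : E4 → ℂ) {r : ℝ} (hr : 0 < r) :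
    N[1] (fun x => (r ^ 4 : ℝ) • K (r • x)) = N[1] K := by
  have h := lintegral_map_equiv (μ := (volume : Measure E4)) (fun x => ‖K x‖ₑ)
    (Homeomorph.smulOfNeZero r hr.ne').toMeasurableEquiv
  have h2 := Measure.map_addHaar_smul (volume : Measure E4) hr.ne'
  have e : ⇑(Homeomorph.smulOfNeZero r hr.ne' : E4 ≃ₜ E4).toMeasurableEquiv = (r • ·) := rfl
  rw [e, h2, lintegral_smul_measure] at h
  rw [eLpNorm_one_eq_lintegral_enorm, eLpNorm_one_eq_lintegral_enorm]
  simp only [enorm_smul]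
  rw [lintegral_const_mul' _ _ enorm_ne_top, ← h, smul_eq_mul, ← mul_assoc,
    Real.enorm_of_nonneg (by positivity), ← ofReal_mul (by positivity)]
  simp [abs_of_pos hr, hr.ne']

theorem Framework.eLpNorm_lowKer (S : Framework) (k : ℤ) :
    N[1] (S.lowKer k) = N[1] (S.lowKer 0) := by
  rw [← eLpNorm_one_scale (S.lowKer 0) (r := (2 : ℝ) ^ k) (by positivity)]
  congr 1
  ext x
  exact S.lowKer_scale k x

theorem Framework.eLpNorm_pd_lowKer (S : Framework) (k : ℤ) (j : Fin 4) : N[1] (pd j (S.lowKer k)) =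
      ofReal ((2 : ℝ) ^ k) * N[1] (pd j (S.lowKer 0)) := by
  set r : ℝ := (2 : ℝ) ^ k with hr
  have hr0 : 0 < r := by positivity
  rw [← eLpNorm_one_scale (pd j (S.lowKer 0)) hr0]
  have e : pd j (S.lowKer k) = r • fun x => (r ^ 4 : ℝ) • pd j (S.lowKer 0) (r • x) := by
    have e0 : (S.lowKer k : E4 → ℂ) = fun x => (r ^ 4 : ℝ) • S.lowKer 0 (r • x) :=
      funext fun x => S.lowKer_scale k x
    ext x
    have h1 : HasFDerivAt (fun x => S.lowKer 0 (r • x))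
        ((fderiv ℝ (S.lowKer 0) (r • x)).comp (r • ContinuousLinearMap.id ℝ E4)) x :=
      ((S.lowKer 0).differentiable (r • x)).hasFDerivAt.comp x ((hasFDerivAt_id x).const_smul r)
    have h2 : fderiv ℝ (fun x => (r ^ 4 : ℝ) • S.lowKer 0 (r • x)) x = _ :=
      (h1.const_smul (r ^ 4)).fderiv
    rw [e0, pd, h2]
    simp [pd]
    ring
  rw [e, eLpNorm_const_smul, Real.enorm_of_nonneg hr0.le]

theorem Framework.lowSym_mul_bandSym (S : Framework) (k : ℤ) (η : E4) :
    S.lowSym (k + 1) η * S.bandSym k η = S.bandSym k η := by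
  have h1 : freq k = 2 * freq (k + 1) := by rw [← freq_sub_one, add_sub_cancel_right]
  have hp := freq_pos k
  have hp1 := freq_pos (k + 1)
  change S.lowSym (k + 1) η * (S.lowSym k η - S.lowSym (k - 1) η) =
    S.lowSym k η - S.lowSym (k - 1) η
  simp only [lowSym_apply]
  by_cases h : ‖freq (k + 1) • η‖ ≤ 1
  · rw [S.φ_one _ h]; simp
  · rw [norm_smul, norm_of_nonneg hp1.le] at h
    rw [S.φ_zero (freq k • η), S.φ_zero (freq (k - 1) • η)]
    · simp
    · rw [norm_smul, norm_of_nonneg (freq_pos _).le, freq_sub_one]; nlinarith [norm_nonneg η]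
    · rw [norm_smul, norm_of_nonneg hp.le]; nlinarith [norm_nonneg η]

theorem Framework.pd_bandKer (S : Framework) (k : ℤ) (j : Fin 4) :
    pd j (S.bandKer k) = cv (pd j (S.lowKer (k + 1))) (S.bandKer k) := by
  set m : E4 := EuclideanSpace.single j (1 : ℝ) with hm
  have hpd : ∀ σ : 𝓢(E4, ℂ), pd j (𝓕⁻ σ : 𝓢(E4, ℂ)) =
      (𝓕⁻ ((2 * Real.pi * I) • SchwartzMap.smulLeftCLM ℂ (inner ℝ · m) σ) : 𝓢(E4, ℂ)) := by
    intro σ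
    rw [← SchwartzMap.lineDerivOp_fourierInv_eq]
    ext y; simp [pd, SchwartzMap.lineDerivOp_apply_eq_fderiv, hm]
  rw [lowKer, bandKer, hpd, hpd, cv_fourierInv]
  congr 2
  ext η
  have hg : (inner ℝ · m : E4 → ℝ).HasTemperateGrowth := by fun_prop
  simp only [_root_.smul_apply, SchwartzMap.pairing_apply_apply,
    SchwartzMap.smulLeftCLM_apply_apply hg, ContinuousLinearMap.mul_apply']
  conv_lhs => rw [← S.lowSym_mul_bandSym k η]
  simp only [Complex.real_smul, smul_eq_mul]
  ring

/-- Bernstein's inequality for the gradient of a dyadic piece. -/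
theorem Framework.eLpNorm_band_der_le (S : Framework) (h : HasWeakDer j f g)
    (hf : MemLp f 4) (hg : MemLp g 2) (k : ℤ) :
    N[4] (cv (S.bandKer k) g) ≤ 2 * N[1] (pd j (S.lowKer 0)) *
      (ofReal ((2 : ℝ) ^ k) * N[4] (cv (S.bandKer k) f)) := by
  set L : 𝓢(E4, ℂ) := ∂_{EuclideanSpace.single j (1 : ℝ)} (S.lowKer (k + 1)) with hL
  have hpd : pd j (S.lowKer (k + 1)) = L := by
    ext y; simp [hL, pd, SchwartzMap.lineDerivOp_apply_eq_fderiv]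
  have e : cv (S.bandKer k) g = cv L (cv (S.bandKer k) f) := by
    rw [← h.cv_pd_schwartz hf hg, S.pd_bandKer, hpd, cv_assoc _ _ hf]
  rw [e]
  refine (eLpNorm_cv_le L.continuous.aestronglyMeasurable (aestronglyMeasurable_cv
    (S.bandKer k).continuous.aestronglyMeasurable hf.1) (by norm_num)).trans (le_of_eq ?_)
  rw [← hpd, S.eLpNorm_pd_lowKer, zpow_add_one₀ (by norm_num), ofReal_mul (by positivity)]
  simp only [ofReal_ofNat]
  ring

/-! ### A square function bound in `L⁴` -/

open scoped SchwartzMap LineDeriv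

theorem norm_fourierInv_le {b : E4 → ℂ} (x : E4) : ‖𝓕⁻ b x‖ ≤ ∫ y, ‖b y‖ := by
  rw [fourierInv_eq']
  refine (norm_integral_le_integral_norm _).trans (le_of_eq ?_)
  congr 1
  ext y
  rw [norm_smul, Complex.norm_exp_ofReal_mul_I, one_mul]

theorem continuous_fourierInv {b : E4 → ℂ} (hb : Integrable b) : Continuous (𝓕⁻ b) := by
  have := VectorFourier.fourierIntegral_continuous (μ := volume) (L := (innerₗ E4))
      Real.continuous_fourierChar
    (by exact continuous_inner) hb
  rw [Real.fourierInv_eq_fourier_comp_neg]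
  have := VectorFourier.fourierIntegral_continuous (μ := volume) (L := (innerₗ E4))
      Real.continuous_fourierChar
    (by exact continuous_inner) hb.comp_neg
  exact this

theorem integrable_mul_fourierInv {h b : E4 → ℂ} (hh : Integrable h) (hb : Integrable b) :
    Integrable fun x => h x * 𝓕⁻ b x :=
  hh.mul_bdd (c := ∫ y, ‖b y‖) (continuous_fourierInv hb).aestronglyMeasurable
    (ae_of_all _ fun x => norm_fourierInv_le x)

/-- If the transform of `h` vanishes on a ball of radius `r` and `a` has frequencies in a ball of
radius `s`, then the transform of `h a` vanishes on the ball of radius `r - s`. -/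
theorem fourierInv_mul_eq_zero {h b : E4 → ℂ} (hh : Integrable h) (hb : Integrable b) {r s : ℝ}
    (h0 : ∀ η, ‖η‖ < r → 𝓕⁻ h η = 0) (hs : ∀ η, s < ‖η‖ → b η = 0) {η : E4}
    (hη : ‖η‖ < r - s) : 𝓕⁻ (fun x => h x * 𝓕⁻ b x) η = 0 := by
  set e : E4 → E4 → ℂ := fun x y => Complex.exp ((2 * Real.pi * inner ℝ x y : ℝ) * I) with he
  have hen : ∀ x y, ‖e x y‖ = 1 := fun x y => Complex.norm_exp_ofReal_mul_I _
  have hint : Integrable (fun p : E4 × E4 => e p.1 η * e p.2 p.1 * (h p.1 * b p.2))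
      (volume.prod volume) := by
    refine (hh.mul_prod hb).bdd_mul (c := 1) ?_ (ae_of_all _ fun p => by
      rw [norm_mul, hen, hen, one_mul])
    simp only [he]
    fun_prop
  have hsw := integral_integral_swap (f := fun x y => e x η * e y x * (h x * b y)) hint
  have e1 : 𝓕⁻ (fun x => h x * 𝓕⁻ b x) η = ∫ x, ∫ y, e x η * e y x * (h x * b y) := by
    rw [fourierInv_eq']
    congr 1
    ext x
    rw [fourierInv_eq', smul_eq_mul, ← mul_assoc, ← integral_const_mul]
    congr 1
    ext y
    simp only [he, smul_eq_mul]
    ring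
  rw [e1, hsw]
  refine integral_eq_zero_of_ae (ae_of_all _ fun y => ?_)
  by_cases hy : s < ‖y‖
  · simp [hs y hy]
  · have := h0 (η + y) ((norm_add_le _ _).trans_lt (by linarith [not_lt.1 hy]))
    rw [fourierInv_eq'] at this
    have e2 : ∀ x, e x η * e y x * (h x * b y) =
        (Complex.exp ((2 * Real.pi * inner ℝ x (η + y) : ℝ) * I) • h x) * b y := by
      intro x
      rw [inner_add_right, real_inner_comm y x, mul_add, Complex.ofReal_add, add_mul,
          Complex.exp_add]
      simp only [he, smul_eq_mul]
      ring
    simp only [e2]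
    rw [integral_mul_const, this]
    simp

theorem conj_fourierInv (b : E4 → ℂ) (x : E4) : conj (𝓕⁻ b x) = 𝓕⁻ (fun y => conj (b (-y))) x := by
  rw [fourierInv_eq', fourierInv_eq', ← integral_conj, ← integral_neg_eq_self]
  congr 1
  ext y
  simp only [smul_eq_mul, map_mul, ← Complex.exp_conj, inner_neg_left, conj_ofReal,
    Complex.conj_I]
  push_cast
  ring_nf

theorem integral_eq_fourierInv_zero (h : E4 → ℂ) : ∫ x, h x = 𝓕⁻ h 0 := by
  rw [fourierInv_eq']; simp

theorem Framework.cv_lowKer (S : Framework) (k : ℤ) (g : 𝓢(E4, ℂ)) :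
    cv (S.lowKer k) g = 𝓕⁻ (fun η => S.lowSym k η * 𝓕 g η) := by
  have : (g : E4 → ℂ) = (𝓕⁻ (𝓕 g) : 𝓢(E4, ℂ)) := by simp
  rw [lowKer]
  conv_lhs => rw [this]
  rw [cv_fourierInv, SchwartzMap.fourierInv_coe]
  rfl

theorem Framework.cv_bandKer (S : Framework) (k : ℤ) (g : 𝓢(E4, ℂ)) : cv (S.bandKer k) g =
      (𝓕⁻ (SchwartzMap.pairing (ContinuousLinearMap.mul ℂ ℂ) (S.bandSym k) (𝓕 g)) : 𝓢(E4, ℂ)) := by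
  have : (g : E4 → ℂ) = (𝓕⁻ (𝓕 g) : 𝓢(E4, ℂ)) := by simp
  rw [bandKer]
  conv_lhs => rw [this]
  rw [cv_fourierInv]

/-- A dyadic piece at frequency `2ᵏ` is orthogonal to cubic expressions in frequencies below
`2ᵏ⁻⁴`. -/
theorem Framework.integral_band_mul_cube (S : Framework) (k : ℤ) (g : 𝓢(E4, ℂ)) :
    ∫ x, cv (S.bandKer k) g x * conj (cv (S.lowKer (k - 4)) g x) *
      cv (S.lowKer (k - 4)) g x * conj (cv (S.lowKer (k - 4)) g x) = 0 := by
  set b : E4 → ℂ := fun η => S.lowSym (k - 4) η * 𝓕 g η with hb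
  have hbi : Integrable b :=
    (SchwartzMap.pairing (ContinuousLinearMap.mul ℂ ℂ) (S.lowSym (k - 4)) (𝓕 g)).integrable
  set b' : E4 → ℂ := fun y => conj (b (-y)) with hb'
  have hbi' : Integrable b' := by
    have := hbi.comp_neg
    exact (LinearIsometryEquiv.integrable_comp_iff (Complex.conjLIE)).2 this
  have hf4 : freq (k - 4) = 16 * freq k := by
    have h1 := freq_sub_one k
    have h2 := freq_sub_one (k - 1)
    have h3 := freq_sub_one (k - 1 - 1)
    have h4 := freq_sub_one (k - 1 - 1 - 1)
    rw [show k - 4 = k - 1 - 1 - 1 - 1 by ring, h4, h3, h2, h1]; ring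
  have hp := freq_pos k
  have hs : ∀ η, 1 / (8 * freq k) < ‖η‖ → b η = 0 := by
    intro η hη
    rw [div_lt_iff₀ (by positivity)] at hη
    simp only [hb, lowSym_apply]
    rw [S.φ_zero]
    · simp
    · rw [norm_smul, hf4, norm_of_nonneg (by positivity)]; linarith
  have hs' : ∀ η, 1 / (8 * freq k) < ‖η‖ → b' η = 0 := by
    intro η hη
    simp only [hb']
    rw [hs _ (by rwa [norm_neg]), map_zero]
  simp only [S.cv_lowKer]
  rw [S.cv_bandKer]
  set q := SchwartzMap.pairing (ContinuousLinearMap.mul ℂ ℂ) (S.bandSym k) (𝓕 g) with hq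
  have h0 : ∀ η, ‖η‖ < 1 / (2 * freq k) → 𝓕⁻ ((𝓕⁻ q : 𝓢(E4, ℂ)) : E4 → ℂ) η = 0 := by
    intro η hη
    rw [lt_div_iff₀ (by positivity)] at hη
    rw [Real.fourierInv_eq_fourier_neg, ← SchwartzMap.fourier_coe]
    simp only [FourierTransform.fourier_fourierInv_eq, hq, SchwartzMap.pairing_apply_apply,
      ContinuousLinearMap.mul_apply']
    have : S.bandSym k (-η) = 0 := by
      change S.lowSym k (-η) - S.lowSym (k - 1) (-η) = 0
      simp only [lowSym_apply]
      rw [S.φ_one, S.φ_one, sub_self]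
      · rw [norm_smul, norm_neg, freq_sub_one, norm_of_nonneg (by positivity)]; linarith
      · rw [norm_smul, norm_neg, norm_of_nonneg (by positivity)]; nlinarith [norm_nonneg η]
    rw [this, zero_mul]
  have hqi := (𝓕⁻ q : 𝓢(E4, ℂ)).integrable (μ := volume)
  have i1 := integrable_mul_fourierInv hqi hbi'
  have i2 := integrable_mul_fourierInv i1 hbi
  have z1 := fun η hη => fourierInv_mul_eq_zero hqi hbi' h0 hs' (η := η) hη
  have z2 := fun η hη => fourierInv_mul_eq_zero i1 hbi z1 hs (η := η) hη
  have z3 := fourierInv_mul_eq_zero i2 hbi' z2 hs' (η := 0) (by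
    rw [norm_zero]
    have : 1 / (2 * freq k) = 4 * (1 / (8 * freq k)) := by field_simp; norm_num
    have h8 : 0 < 1 / (8 * freq k) := by positivity
    linarith)
  rw [← integral_eq_fourierInv_zero] at z3
  simpa only [conj_fourierInv] using z3

/-- Expansion of `|a + f|⁴` in which the term linear in `f` is taken at `b` instead of `a`. -/
theorem quartic_increment (a b f : ℂ) : ‖a + f‖ ^ 4 ≤ ‖a‖ ^ 4 + 4 * (f * conj b * b * conj b).re +
      12 * (‖f‖ * (‖a - b‖ + ‖f‖) * (‖a‖ + ‖b‖ + ‖f‖) ^ 2) := by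
  have h1 : ‖a + f‖ ^ 2 = ‖a‖ ^ 2 + 2 * (f * conj a).re + ‖f‖ ^ 2 := by
    rw [← normSq_eq_norm_sq, ← normSq_eq_norm_sq, ← normSq_eq_norm_sq,
      Complex.normSq_add]
    simp; ring
  have h2 : |(f * conj a).re| ≤ ‖f‖ * ‖a‖ := by simpa using abs_re_le_norm (f * conj a)
  have h3 : (f * conj b * b * conj b).re = ‖b‖ ^ 2 * (f * conj b).re := by
    have : f * conj b * b * conj b = ((‖b‖ ^ 2 : ℝ) : ℂ) * (f * conj b) := by
      rw [Complex.ofReal_pow, ← Complex.mul_conj']; ring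
    rw [this, re_ofReal_mul]
  have h4 : |‖a‖ ^ 2 * (f * conj a).re - ‖b‖ ^ 2 * (f * conj b).re| ≤
      ‖f‖ * (‖a - b‖ * (3 * (‖a‖ + ‖b‖ + ‖f‖) ^ 2)) := by
    have e : ‖a‖ ^ 2 * (f * conj a).re - ‖b‖ ^ 2 * (f * conj b).re =
        (f * (((‖a‖ ^ 2 : ℝ) : ℂ) * conj (a - b) + ((‖a‖ ^ 2 - ‖b‖ ^ 2 : ℝ) : ℂ) * conj b)).re := by
      rw [← re_ofReal_mul, ← re_ofReal_mul, ← sub_re]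
      congr 1
      rw [map_sub]; push_cast; ring
    rw [e]
    refine (abs_re_le_norm _).trans ?_
    rw [norm_mul]
    gcongr
    refine (norm_add_le _ _).trans ?_
    rw [norm_mul, norm_mul, norm_real, norm_real, RCLike.norm_conj, RCLike.norm_conj,
      norm_of_nonneg (sq_nonneg _), norm_eq_abs]
    have h5 : |‖a‖ ^ 2 - ‖b‖ ^ 2| ≤ (‖a‖ + ‖b‖) * ‖a - b‖ := by
      rw [sq_sub_sq, abs_mul, abs_of_nonneg (by positivity : 0 ≤ ‖a‖ + ‖b‖)]
      gcongr
      exact abs_norm_sub_norm_le a b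
    have h6 := mul_le_mul_of_nonneg_right h5 (norm_nonneg b)
    have h7 : ‖a - b‖ * (‖a‖ ^ 2 + (‖a‖ + ‖b‖) * ‖b‖) ≤ ‖a - b‖ * (3 * (‖a‖ + ‖b‖ + ‖f‖) ^ 2) := by
      gcongr
      nlinarith [norm_nonneg a, norm_nonneg b, norm_nonneg f,
          mul_nonneg (norm_nonneg a) (norm_nonneg b),
        mul_nonneg (norm_nonneg a) (norm_nonneg f), mul_nonneg (norm_nonneg f) (norm_nonneg b)]
    linarith
  set t := (f * conj a).re
  set A := ‖a‖
  set B := ‖b‖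
  set F := ‖f‖
  have hA : 0 ≤ A := norm_nonneg a
  have hB : 0 ≤ B := norm_nonneg b
  have hF : 0 ≤ F := norm_nonneg f
  have e4 : ‖a + f‖ ^ 4 = (A ^ 2 + 2 * t + F ^ 2) ^ 2 := by rw [← h1]; ring
  rw [e4, h3]
  have ht := abs_le.1 h2
  have ht2 : t ^ 2 ≤ (F * A) ^ 2 := sq_le_sq.2 (by rwa [abs_of_nonneg (mul_nonneg hF hA)])
  have ht3 : t * F ^ 2 ≤ (F * A) * F ^ 2 := by gcongr; exact ht.2
  have h4' := (abs_le.1 h4).2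
  have h8 : 6 * (F * A) ^ 2 + 4 * ((F * A) * F ^ 2) + F ^ 4 ≤ 12 * (F * F * (A + B + F) ^ 2) := by
    have : 0 ≤ F * F := mul_nonneg hF hF
    have h9 : 6 * A ^ 2 + 4 * A * F + F ^ 2 ≤ 12 * (A + B + F) ^ 2 := by
      nlinarith [mul_nonneg hA hB, mul_nonneg hA hF, mul_nonneg hF hB]
    calc _ = F * F * (6 * A ^ 2 + 4 * A * F + F ^ 2) := by ring
      _ ≤ F * F * (12 * (A + B + F) ^ 2) := mul_le_mul_of_nonneg_left h9 this
      _ = _ := by ring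
  have e5 : (A ^ 2 + 2 * t + F ^ 2) ^ 2 =
    A ^ 4 + 4 * (A ^ 2 * t) + 4 * t ^ 2 + 2 * (F * A) ^ 2 + 4 * (t * F ^ 2) + F ^ 4 := by ring
  have e6 : 12 * (F * (‖a - b‖ + F) * (A + B + F) ^ 2) =
    4 * (F * (‖a - b‖ * (3 * (A + B + F) ^ 2))) + 12 * (F * F * (A + B + F) ^ 2) := by ring
  rw [e5, e6]
  linarith

theorem holderTriple_four_four_two : HolderTriple 4 4 2 := ⟨by
    rw [← toReal_eq_toReal_iff' (by simp) (by simp)]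
    rw [toReal_add (by simp) (by simp)]; norm_num⟩

theorem eLpNorm_fun_mul_le {α 𝕜 : Type*} [MeasurableSpace α] {μ : Measure α} [RCLike 𝕜]
    [HolderTriple p q r] {f g : α → 𝕜} (hf : AEStronglyMeasurable f μ)
    (hg : AEStronglyMeasurable g μ) :
    eLpNorm (fun x => f x * g x) r μ ≤ eLpNorm f p μ * eLpNorm g q μ :=
  eLpNorm_smul_le_mul_eLpNorm (p := p) (q := q) (r := r) (f := g) (φ := f) hg hf

/-- Hölder's inequality for four functions in `L⁴`. -/
theorem lintegral_mul_four_le {f g h : E4 → ℝ} (hf : AEStronglyMeasurable f)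
    (hg : AEStronglyMeasurable g) (hh : AEStronglyMeasurable h) (hk : AEStronglyMeasurable k) :
    N[1] (fun x => f x * g x * (h x * k x)) ≤ N[4] f * N[4] g * (N[4] h * N[4] k) := by
  have := holderTriple_four_four_two
  have h1 := eLpNorm_fun_mul_le (p := 4) (q := 4) (r := 2) hf hg
  have h2 := eLpNorm_fun_mul_le (p := 4) (q := 4) (r := 2) hh hk
  exact (eLpNorm_fun_mul_le (p := 2) (q := 2) (r := 1) (hf.mul hg) (hh.mul hk)).trans
    (mul_le_mul' h1 h2)

/-- The real-valued `L⁴` norm. -/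
def norm4 (f : E4 → ℂ) : ℝ := (N[4] f).toReal

theorem norm4_nonneg (f : E4 → ℂ) : 0 ≤ norm4 f := toReal_nonneg

theorem integrable_norm_pow_four (hf : MemLp f 4) : Integrable fun x => ‖f x‖ ^ 4 := by
  have := hf.integrable_norm_rpow (by norm_num) (by norm_num)
  simpa using this

theorem norm4_pow_four (hf : MemLp f 4) : norm4 f ^ 4 = ∫ x, ‖f x‖ ^ 4 := by
  have h := hf.eLpNorm_eq_integral_rpow_norm (by norm_num) (by norm_num)
  have h0 : 0 ≤ ∫ x, ‖f x‖ ^ 4 := integral_nonneg fun x => by positivity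
  rw [norm4, h, ENNReal.toReal_ofReal (by positivity)]
  simp only [ENNReal.toReal_ofNat, Real.rpow_ofNat]
  rw [← Real.rpow_natCast, ← Real.rpow_mul h0]
  norm_num

theorem ofReal_norm4_sq (hf : MemLp f 4) : ofReal (norm4 f ^ 2) = N[4] f ^ 2 := by
  rw [ofReal_pow (norm4_nonneg f), norm4, ofReal_toReal hf.2.ne]

theorem norm4_add_le (hf : MemLp f 4) (hg : MemLp g 4) :
    norm4 (f + g) ≤ norm4 f + norm4 g := by
  rw [norm4, norm4, norm4, ← toReal_add hf.2.ne hg.2.ne]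
  exact toReal_mono (add_lt_top.2 ⟨hf.2, hg.2⟩).ne
    (eLpNorm_add_le hf.1 hg.1 (by norm_num))

/-- If `f` is orthogonal to `|b|² b`, the increment of `‖a‖₄⁴` is at least quadratic in `f` and `a -
b`. -/
theorem norm4_pow_four_add_le {a b : E4 → ℂ} (ha : MemLp a 4) (hb : MemLp b 4) (hf : MemLp f 4)
    (h0 : ∫ x, f x * conj (b x) * b x * conj (b x) = 0) :
    norm4 (a + f) ^ 4 ≤ norm4 a ^ 4 +
      12 * (norm4 f * (norm4 (a - b) + norm4 f) * (norm4 a + norm4 b + norm4 f) ^ 2) := by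
  have := holderTriple_four_four_two
  have hbc : MemLp (fun x => conj (b x)) 4 := hb.star
  have i1 : Integrable fun x => f x * conj (b x) * b x * conj (b x) := by
    have h1 : MemLp (fun x => f x * conj (b x)) 2 := hbc.mul' hf
    have h2 : MemLp (fun x => b x * conj (b x)) 2 := hbc.mul' hb
    have := memLp_one_iff_integrable.1 (h2.mul' h1 (r := 1))
    simpa only [mul_assoc] using this
  have hd := ha.sub hb
  set u : E4 → ℝ := fun x => ‖f x‖
  set w : E4 → ℝ := fun x => ‖a x - b x‖ + ‖f x‖
  set m : E4 → ℝ := fun x => ‖a x‖ + ‖b x‖ + ‖f x‖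
  have hu : MemLp u 4 := hf.norm
  have hw : MemLp w 4 := hd.norm.add hf.norm
  have hm : MemLp m 4 := (ha.norm.add hb.norm).add hf.norm
  have hH := lintegral_mul_four_le hu.1 hw.1 hm.1 hm.1
  have hfin : N[4] u * N[4] w * (N[4] m * N[4] m) < ⊤ :=
    mul_lt_top (mul_lt_top hu.2 hw.2) (mul_lt_top hm.2 hm.2)
  have i2 : Integrable fun x => u x * w x * (m x * m x) := ⟨(hu.1.mul hw.1).mul (hm.1.mul hm.1), by
      rw [hasFiniteIntegral_iff_enorm, ← eLpNorm_one_eq_lintegral_enorm]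
      exact hH.trans_lt hfin⟩
  have nu : (N[4] u).toReal = norm4 f := by rw [norm4, eLpNorm_norm]
  have nw : (N[4] w).toReal ≤ norm4 (a - b) + norm4 f := by
    rw [norm4, norm4, ← toReal_add hd.2.ne hf.2.ne]
    refine toReal_mono (add_lt_top.2 ⟨hd.2, hf.2⟩).ne ?_
    refine (eLpNorm_add_le hd.norm.1 hf.norm.1 (by norm_num)).trans ?_
    rw [eLpNorm_norm, eLpNorm_norm]
  have nm : (N[4] m).toReal ≤ norm4 a + norm4 b + norm4 f := by
    rw [norm4, norm4, norm4, ← toReal_add ha.2.ne hb.2.ne,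
      ← toReal_add (add_lt_top.2 ⟨ha.2, hb.2⟩).ne hf.2.ne]
    refine toReal_mono (add_lt_top.2
      ⟨add_lt_top.2 ⟨ha.2, hb.2⟩, hf.2⟩).ne ?_
    refine (eLpNorm_add_le (ha.norm.add hb.norm).1 hf.norm.1 (by norm_num)).trans ?_
    refine (add_le_add_left (eLpNorm_add_le ha.norm.1 hb.norm.1 (by norm_num)) _).trans ?_
    rw [eLpNorm_norm, eLpNorm_norm, eLpNorm_norm]
  have hI : ∫ x, u x * w x * (m x * m x) ≤
      norm4 f * (norm4 (a - b) + norm4 f) * (norm4 a + norm4 b + norm4 f) ^ 2 := by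
    calc ∫ x, u x * w x * (m x * m x) ≤ (N[1] (fun x => u x * w x * (m x * m x))).toReal := by
          rw [integral_eq_lintegral_of_nonneg_ae (ae_of_all _ fun x => by positivity) i2.1,
            eLpNorm_one_eq_lintegral_enorm]
          refine toReal_mono i2.2.ne (lintegral_mono fun x => ?_)
          rw [Real.enorm_of_nonneg (by positivity)]
      _ ≤ _ := toReal_mono hfin.ne hH
      _ ≤ _ := by
        simp only [ENNReal.toReal_mul, nu]
        rw [sq]
        have h1 := norm4_nonneg f
        have h2 := norm4_nonneg (a - b)
        have h3 := norm4_nonneg a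
        have h4 := norm4_nonneg b
        gcongr
  have hP : ∫ x, ‖(a + f) x‖ ^ 4 ≤ ∫ x, (‖a x‖ ^ 4 + 4 * (f x * conj (b x) * b x * conj (b x)).re +
      12 * (u x * w x * (m x * m x))) := by
    refine integral_mono (integrable_norm_pow_four (ha.add hf))
      (((integrable_norm_pow_four ha).add (i1.re.const_mul 4)).add (i2.const_mul 12)) fun x => ?_
    have := quartic_increment (a x) (b x) (f x)
    rw [sq] at this
    exact this
  have i1r : Integrable fun x => 4 * (f x * conj (b x) * b x * conj (b x)).re := i1.re.const_mul 4
  have i14 : Integrable fun x => ‖a x‖ ^ 4 + 4 * (f x * conj (b x) * b x * conj (b x)).re :=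
    (integrable_norm_pow_four ha).add i1r
  rw [integral_add i14 (i2.const_mul 12), integral_add (integrable_norm_pow_four ha) i1r,
    integral_const_mul, integral_const_mul] at hP
  have hre : ∫ x, (f x * conj (b x) * b x * conj (b x)).re = 0 := by
    have := integral_re i1
    simp only [RCLike.re_eq_complex_re] at this
    rw [this, h0]; rfl
  rw [norm4_pow_four (ha.add hf), norm4_pow_four ha]
  rw [hre] at hP
  linarith

/-- A discrete Grönwall-type bound. The increments of `aₙ⁴` are at most `M²` times products of the
`p`, with `M` the running maximum; at an index where `M` is attained, `M⁴ ≤ a₃⁴ + 768 M² ∑ pₖ²`. -/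
theorem sq_le_of_quartic_increments {a p : ℕ → ℝ} (ha : ∀ n, 0 ≤ a n)
    (h : ∀ k M, (∀ i ≤ k + 4, a i ≤ M) → a (k + 4) ^ 4 ≤ a (k + 3) ^ 4 +
      192 * M ^ 2 * (p (k + 4) * (p (k + 4) + p (k + 3) + p (k + 2) + p (k + 1)))) (n : ℕ) :
    a n ^ 2 ≤ a 0 ^ 2 + a 1 ^ 2 + a 2 ^ 2 + a 3 ^ 2 +
      768 * ∑ k ∈ Finset.range (n + 1), p k ^ 2 := by
  have step : ∀ N M, (∀ i ≤ N + 3, a i ≤ M) → a (N + 3) ^ 4 ≤ a 3 ^ 4 + 192 * M ^ 2 *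
      (4 * ∑ k ∈ Finset.range (N + 4), p k ^ 2 - 3 / 2 * p (N + 3) ^ 2 - p (N + 2) ^ 2 -
        1 / 2 * p (N + 1) ^ 2) := by
    intro N M
    induction N with
    | zero =>
      intro _
      have : 0 ≤ 4 * ∑ k ∈ Finset.range (0 + 4), p k ^ 2 - 3 / 2 * p (0 + 3) ^ 2 - p (0 + 2) ^ 2 -
        1 / 2 * p (0 + 1) ^ 2 := by
        simp [Finset.sum_range_succ]
        nlinarith [sq_nonneg (p 0), sq_nonneg (p 1), sq_nonneg (p 2), sq_nonneg (p 3)]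
      have := mul_nonneg (by positivity : 0 ≤ 192 * M ^ 2) this
      simpa using this
    | succ N ih =>
      intro hM
      have h1 := ih fun i hi => hM i (by omega)
      have h2 := h N M fun i hi => hM i (by omega)
      rw [show N + 1 + 3 = N + 4 by ring, show N + 1 + 2 = N + 3 by ring,
        show N + 1 + 1 = N + 2 by ring, show N + 1 + 4 = N + 4 + 1 by ring,
        Finset.sum_range_succ]
      have h3 : p (N + 4) * (p (N + 4) + p (N + 3) + p (N + 2) + p (N + 1)) ≤
        5 / 2 * p (N + 4) ^ 2 + 1 / 2 * p (N + 3) ^ 2 + 1 / 2 * p (N + 2) ^ 2 +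
          1 / 2 * p (N + 1) ^ 2 := by
        nlinarith [sq_nonneg (p (N + 4) - p (N + 3)), sq_nonneg (p (N + 4) - p (N + 2)),
          sq_nonneg (p (N + 4) - p (N + 1))]
      have h4 := mul_le_mul_of_nonneg_left h3 (by positivity : 0 ≤ 192 * M ^ 2)
      linarith
  -- the index at which the maximum is attained
  obtain ⟨i, hi, him⟩ := Finset.exists_max_image (Finset.range (n + 1)) a ⟨0, by simp⟩
  have hin : i ≤ n := by simpa [Nat.lt_succ_iff] using hi
  have hmax : ∀ j ≤ n, a j ≤ a i := fun j hj => him j (by simpa [Nat.lt_succ_iff] using hj)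
  have hS : ∀ m, 0 ≤ ∑ k ∈ Finset.range m, p k ^ 2 := fun m => sum_nonneg fun k _ => sq_nonneg _
  have hni : a n ^ 2 ≤ a i ^ 2 := by
    have := hmax n le_rfl
    have := ha n
    gcongr
  refine hni.trans ?_
  by_cases h3 : i < 3
  · have := hS (n + 1)
    interval_cases i <;> nlinarith [sq_nonneg (a 0), sq_nonneg (a 1), sq_nonneg (a 2),
        sq_nonneg (a 3)]
  · obtain ⟨N, rfl⟩ : ∃ N, i = N + 3 := ⟨i - 3, by omega⟩
    have h5 := step N (a (N + 3)) fun j hj => hmax j (by omega)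
    have h6 : ∑ k ∈ Finset.range (N + 4), p k ^ 2 ≤ ∑ k ∈ Finset.range (n + 1), p k ^ 2 :=
      Finset.sum_le_sum_of_subset_of_nonneg (Finset.range_subset_range.2 (by omega))
        fun _ _ _ => sq_nonneg _
    set T := ∑ k ∈ Finset.range (n + 1), p k ^ 2
    set x := a (N + 3)
    have h7 : x ^ 4 ≤ a 3 ^ 4 + 768 * T * x ^ 2 := by
      have h8 : 4 * ∑ k ∈ Finset.range (N + 4), p k ^ 2 - 3 / 2 * p (N + 3) ^ 2 - p (N + 2) ^ 2 -
        1 / 2 * p (N + 1) ^ 2 ≤ 4 * T := by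
        nlinarith [sq_nonneg (p (N + 3)), sq_nonneg (p (N + 2)), sq_nonneg (p (N + 1))]
      have := mul_le_mul_of_nonneg_left h8 (by positivity : 0 ≤ 192 * x ^ 2)
      linarith
    have hax : a 3 ^ 2 ≤ x ^ 2 := by
      have := hmax 3 (by omega)
      have := ha 3
      gcongr
    have hkey : x ^ 2 ≤ a 3 ^ 2 + 768 * T := by
      by_contra hlt
      push Not at hlt
      have hT := hS (n + 1)
      have hx : 0 < x ^ 2 := by nlinarith [sq_nonneg (a 3)]
      nlinarith [mul_lt_mul_of_pos_left hlt hx, mul_le_mul_of_nonneg_left hax (sq_nonneg (a 3))]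
    nlinarith [sq_nonneg (a 0), sq_nonneg (a 1), sq_nonneg (a 2)]


/-- Fatou's lemma for bounds in `L^q` along a sequence that converges in `L^p`. -/
theorem eLpNorm_le_of_tendsto (hp : p ≠ 0) (hq : q ≠ 0) (hqt : q ≠ ⊤) {f : ℕ → E4 → ℂ}
    (h : LpTendsto p f g) {B : ℝ≥0∞} (hB : ∀ n, N[q] (f n) ≤ B) :
    N[q] g ≤ B := by
  obtain ⟨ns, -, hns⟩ := (tendstoInMeasure_of_tendsto_eLpNorm hp (fun n => (h.memLp n).1)
    h.memLp_lim.1 h.tendsto).exists_seq_tendsto_ae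
  have := Lp.eLpNorm'_lim_le_liminf_eLpNorm' (p := q.toReal) (ENNReal.toReal_pos hq hqt)
    (fun n => (h.memLp (ns n)).1) hns
  rw [← eLpNorm_eq_eLpNorm' hq hqt] at this
  refine this.trans (liminf_le_of_le (by isBoundedDefault) fun b hb => ?_)
  obtain ⟨n, hn⟩ := hb.exists
  rw [← eLpNorm_eq_eLpNorm' hq hqt] at hn
  exact hn.trans (hB _)

/-- Convolution with a Schwartz kernel maps `L²` to `L⁴`. -/
theorem eLpNorm_cv_four_le (K : 𝓢(E4, ℂ)) (hg : AEStronglyMeasurable g) :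
    N[4] (cv K g) ≤ (N[2] K * N[1] K) ^ (1 / 2 : ℝ) * N[2] g := by
  have hKm := K.continuous.aestronglyMeasurable (μ := (volume : Measure E4))
  set B := N[2] K * N[2] g with hB
  have h1 : ∀ x, ‖cv K g x‖ₑ ≤ B := fun x => enorm_cv_le_mul (p := 2) (q := 2) hKm hg x
  have h2 := eLpNorm_cv_le (p := 2) hKm hg (by norm_num)
  have h4 : N[4] (cv K g) ^ 4 ≤ B ^ 2 * (N[1] K * N[2] g) ^ 2 := by
    calc N[4] (cv K g) ^ 4 = ∫⁻ x, ‖cv K g x‖ₑ ^ 4 := eLpNorm_four_pow _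
      _ ≤ ∫⁻ x, B ^ 2 * ‖cv K g x‖ₑ ^ 2 := by
        refine lintegral_mono fun x => ?_
        calc ‖cv K g x‖ₑ ^ 4 = ‖cv K g x‖ₑ ^ 2 * ‖cv K g x‖ₑ ^ 2 := by ring
          _ ≤ _ := by gcongr; exact h1 x
      _ = B ^ 2 * N[2] (cv K g) ^ 2 := by
        rw [lintegral_const_mul'' _ ((aestronglyMeasurable_cv hKm hg).enorm.pow_const _),
            eLpNorm_two_sq]
      _ ≤ _ := by gcongr
  refine (ENNReal.pow_le_pow_left_iff (n := 4) (by norm_num)).1 (h4.trans (le_of_eq ?_))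
  have hr : ((N[2] K * N[1] K) ^ (1 / 2 : ℝ)) ^ 4 = (N[2] K * N[1] K) ^ 2 := by
    rw [← rpow_natCast, ← rpow_mul, ← rpow_natCast]; norm_num
  rw [mul_pow (_ ^ (1 / 2 : ℝ)) _ 4, hr, hB]; ring

theorem exists_cv_four_bound (K : 𝓢(E4, ℂ)) : ∃ C : ℝ≥0∞, C ≠ ⊤ ∧ ∀ g : E4 → ℂ,
    AEStronglyMeasurable g → N[4] (cv K g) ≤ C * N[2] g := by
  have h2 : MemLp K 2 (volume : Measure E4) := K.memLp _
  have h1 : MemLp K 1 (volume : Measure E4) := K.memLp _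
  exact ⟨_, ENNReal.rpow_ne_top_of_nonneg (by norm_num) (mul_lt_top h2.2 h1.2).ne,
    fun g hg => eLpNorm_cv_four_le K hg⟩

theorem memLp_cv_four (K : 𝓢(E4, ℂ)) (hg : MemLp g 2) : MemLp (cv K g) 4 := by
  obtain ⟨C, hC, h⟩ := exists_cv_four_bound K
  exact ⟨aestronglyMeasurable_cv K.continuous.aestronglyMeasurable hg.1,
    (h g hg.1).trans_lt (mul_lt_top hC.lt_top hg.2)⟩

theorem cv_sub (K : 𝓢(E4, ℂ)) (hf : MemLp f 2) (hg : MemLp g 2) :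
    cv K (f - g) = cv K f - cv K g := by
  have hK : MemLp K 2 (volume : Measure E4) := K.memLp _
  ext x
  exact cv_sub_of_integrable (integrable_cv_integrand hK hf x) (integrable_cv_integrand hK hg x)

theorem cv_kernel_sub (K L : 𝓢(E4, ℂ)) (hf : MemLp f 2) :
    cv (K - L : 𝓢(E4, ℂ)) f = cv K f - cv L f := by
  have hK : MemLp K 2 (volume : Measure E4) := K.memLp _
  have hL : MemLp L 2 (volume : Measure E4) := L.memLp _
  ext x
  have h := integral_sub (integrable_cv_integrand hK hf x) (integrable_cv_integrand hL hf x)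
  simp only [← sub_mul] at h
  exact h

/-- Approximation of `L²` functions by Schwartz functions. -/
theorem exists_schwartz_approx (hg : MemLp g 2) :
    ∃ s : ℕ → 𝓢(E4, ℂ), LpTendsto 2 (fun n => (s n : E4 → ℂ)) g := by
  have h : ∀ n : ℕ, ∃ s : 𝓢(E4, ℂ), N[2] ((s : E4 → ℂ) - g) ≤ ofReal (1 / ((n : ℝ) + 1)) := by
    intro n
    obtain ⟨u, h1, h2, h3⟩ := hg.exist_eLpNorm_sub_le (by norm_num) (by norm_num)
      (by positivity : 0 < 1 / ((n : ℝ) + 1))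
    refine ⟨h1.toSchwartzMap h2, ?_⟩
    rw [eLpNorm_sub_comm]
    exact h3
  choose s hs using h
  refine ⟨s, fun n => (s n).memLp _, hg, ?_⟩
  refine tendsto_of_tendsto_of_tendsto_of_le_of_le tendsto_const_nhds ?_ (fun _ => zero_le) hs
  have := (ENNReal.continuous_ofReal.tendsto 0).comp tendsto_one_div_add_atTop_nhds_zero_nat
  rwa [ENNReal.ofReal_zero] at this

theorem LpTendsto.cv_four (K : 𝓢(E4, ℂ)) {f : ℕ → E4 → ℂ} (h : LpTendsto 2 f g) :
    LpTendsto 4 (fun n => cv K (f n)) (cv K g) := by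
  obtain ⟨C, hC, hb⟩ := exists_cv_four_bound K
  refine ⟨fun n => memLp_cv_four K (h.memLp n), memLp_cv_four K h.memLp_lim, ?_⟩
  have hz : Tendsto (fun n => C * N[2] (f n - g)) atTop (𝓝 0) := by
    simpa using ENNReal.Tendsto.const_mul h.tendsto (Or.inr hC)
  refine tendsto_of_tendsto_of_tendsto_of_le_of_le tendsto_const_nhds hz (fun _ => zero_le) fun
      n => ?_
  simp only
  rw [← cv_sub K (h.memLp n) h.memLp_lim]
  exact hb _ ((h.memLp n).1.sub h.memLp_lim.1)

theorem LpTendsto.norm4 {f : ℕ → E4 → ℂ} (h : LpTendsto 4 f g) :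
    Tendsto (fun n => norm4 (f n)) atTop (𝓝 (norm4 g)) :=
  (ENNReal.tendsto_toReal h.memLp_lim.2.ne).comp (h.eLpNorm (by norm_num))

/-- The increments of `‖P_{≤k} g‖₄⁴`, in which the term that is linear in the new dyadic piece
vanishes by `integral_band_mul_cube`. -/
theorem Framework.norm4_low_sq_le_schwartz (S : Framework) (g : 𝓢(E4, ℂ)) (n : ℕ) :
    norm4 (cv (S.lowKer n) g) ^ 2 ≤ norm4 (cv (S.lowKer 0) g) ^ 2 + norm4 (cv (S.lowKer 1) g) ^ 2 +
      norm4 (cv (S.lowKer 2) g) ^ 2 + norm4 (cv (S.lowKer 3) g) ^ 2 +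
      768 * ∑ k ∈ Finset.range (n + 1), norm4 (cv (S.bandKer k) g) ^ 2 := by
  have hg : MemLp g 2 (volume : Measure E4) := g.memLp _
  set A : ℕ → E4 → ℂ := fun i => cv (S.lowKer i) g with hA
  set f : ℕ → E4 → ℂ := fun i => cv (S.bandKer i) g with hf
  have mA : ∀ i, MemLp (A i) 4 := fun i => memLp_cv_four _ hg
  have mf : ∀ i, MemLp (f i) 4 := fun i => memLp_cv_four _ hg
  have hsub : ∀ i : ℕ, f (i + 1) = A (i + 1) - A i := by
    intro i
    simp only [hf, hA, S.bandKer_eq]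
    rw [cv_kernel_sub _ _ hg]
    push_cast
    rw [add_sub_cancel_right]
  have hadd : ∀ i : ℕ, A (i + 1) = A i + f (i + 1) := fun i => by rw [hsub]; abel
  refine sq_le_of_quartic_increments (a := fun i => norm4 (A i)) (p := fun i => norm4 (f i))
    (fun i => norm4_nonneg _) (fun k M hM => ?_) n
  have h0 := S.integral_band_mul_cube ((k + 4 : ℕ) : ℤ) g
  have e : (((k + 4 : ℕ) : ℤ) - 4) = (k : ℤ) := by push_cast; ring
  rw [e] at h0
  have h := norm4_pow_four_add_le (mA (k + 3)) (mA k) (mf (k + 4)) h0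
  rw [← hadd (k + 3)] at h
  refine h.trans ?_
  have hd : norm4 (A (k + 3) - A k) ≤ norm4 (f (k + 3)) + norm4 (f (k + 2)) +
      norm4 (f (k + 1)) := by
    have : A (k + 3) - A k = f (k + 3) + f (k + 2) + f (k + 1) := by rw [hsub, hsub, hsub]; abel
    rw [this]
    refine (norm4_add_le ((mf _).add (mf _)) (mf _)).trans ?_
    gcongr
    exact norm4_add_le (mf _) (mf _)
  have hM3 := hM (k + 3) (by omega)
  have hM4 := hM (k + 4) (by omega)
  have hM0 := hM k (by omega)
  have hfb : norm4 (f (k + 4)) ≤ 2 * M := by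
    rw [hsub (k + 3), sub_eq_add_neg]
    refine (norm4_add_le (mA _) (mA _).neg).trans ?_
    have : norm4 (-A (k + 3)) = norm4 (A (k + 3)) := by rw [norm4, eLpNorm_neg, norm4]
    rw [this]
    linarith
  have n0 := norm4_nonneg (A k)
  have n3 := norm4_nonneg (A (k + 3))
  have nd := norm4_nonneg (A (k + 3) - A k)
  have p4 := norm4_nonneg (f (k + 4))
  have hsq : (norm4 (A (k + 3)) + norm4 (A k) + norm4 (f (k + 4))) ^ 2 ≤ 16 * M ^ 2 := by
    have : norm4 (A (k + 3)) + norm4 (A k) + norm4 (f (k + 4)) ≤ 4 * M := by linarith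
    calc _ ≤ (4 * M) ^ 2 := by gcongr
      _ = _ := by ring
  have hp : norm4 (f (k + 4)) * (norm4 (A (k + 3) - A k) + norm4 (f (k + 4))) ≤
      norm4 (f (k + 4)) * (norm4 (f (k + 4)) + norm4 (f (k + 3)) + norm4 (f (k + 2)) +
        norm4 (f (k + 1))) := mul_le_mul_of_nonneg_left (by linarith) p4
  have := mul_le_mul hp hsq (sq_nonneg _) ((mul_nonneg p4 (add_nonneg nd p4)).trans hp)
  linarith

theorem Framework.norm4_low_sq_le (S : Framework) (hg : MemLp g 2) (n : ℕ) :
    norm4 (cv (S.lowKer n) g) ^ 2 ≤ norm4 (cv (S.lowKer 0) g) ^ 2 + norm4 (cv (S.lowKer 1) g) ^ 2 +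
      norm4 (cv (S.lowKer 2) g) ^ 2 + norm4 (cv (S.lowKer 3) g) ^ 2 +
      768 * ∑ k ∈ Finset.range (n + 1), norm4 (cv (S.bandKer k) g) ^ 2 := by
  obtain ⟨s, hs⟩ := exists_schwartz_approx hg
  have hl : ∀ K : 𝓢(E4, ℂ), Tendsto (fun m => norm4 (cv K (s m)) ^ 2) atTop
      (𝓝 (norm4 (cv K g) ^ 2)) :=
    fun K => (hs.cv_four K).norm4.pow 2
  refine le_of_tendsto_of_tendsto' (hl _) (((((hl _).add (hl _)).add (hl _)).add (hl _)).add
    ((tendsto_finsetSum _ fun k _ => hl _).const_mul 768)) fun m => ?_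
  exact S.norm4_low_sq_le_schwartz (s m) n

/-- The low-frequency projections converge strongly in `L²`. -/
theorem Framework.lpTendsto_low (S : Framework) (hg : MemLp g 2) :
    LpTendsto 2 (fun n : ℕ => cv (S.lowKer n) g) g := by
  have hK : ∀ k, MemLp (S.lowKer k) 1 (volume : Measure E4) := fun k => (S.lowKer k).memLp _
  have mem : ∀ {h : E4 → ℂ}, MemLp h 2 → ∀ n : ℕ, MemLp (cv (S.lowKer n) h) 2 := fun hh n =>
    memLp_cv (hK n) (by norm_num) hh
  set C := N[1] (S.lowKer 0) with hC
  have hCt : C ≠ ⊤ := (hK 0).2.ne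
  have bound : ∀ {h : E4 → ℂ}, MemLp h 2 → ∀ n : ℕ, N[2] (cv (S.lowKer n) h) ≤ C * N[2] h := by
    intro h hh n
    rw [hC, ← S.eLpNorm_lowKer n]
    exact eLpNorm_cv_le (hK n).1 hh.1 (by norm_num)
  -- for Schwartz functions: Plancherel and dominated convergence on the Fourier side
  have schw : ∀ s : 𝓢(E4, ℂ), Tendsto (fun n : ℕ => N[2] (cv (S.lowKer n) s - (s : E4 → ℂ)))
      atTop (𝓝 0) := by
    intro s
    have e : ∀ n : ℕ, N[2] (cv (S.lowKer n) s - (s : E4 → ℂ)) ^ 2 =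
        ∫⁻ η, ‖(S.lowSym n η - 1) * 𝓕 s η‖ₑ ^ 2 := by
      intro n
      set q : 𝓢(E4, ℂ) := SchwartzMap.pairing (ContinuousLinearMap.mul ℂ ℂ) (S.lowSym n) (𝓕 s) - 𝓕 s
        with hq
      have hqe : ∀ η, q η = (S.lowSym n η - 1) * 𝓕 s η := fun η => by rw [sub_mul, one_mul]; rfl
      have hinv : cv (S.lowKer n) s - (s : E4 → ℂ) = (𝓕⁻ q : 𝓢(E4, ℂ)) := by
        have e1 : (𝓕⁻ q : 𝓢(E4, ℂ)) = 𝓕⁻ (SchwartzMap.pairing (ContinuousLinearMap.mul ℂ ℂ)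
            (S.lowSym n) (𝓕 s)) - s := by
          have := (FourierTransform.fourierInvCLM ℂ 𝓢(E4, ℂ)).map_sub
            (SchwartzMap.pairing (ContinuousLinearMap.mul ℂ ℂ) (S.lowSym n) (𝓕 s)) (𝓕 s)
          refine this.trans ?_
          have h9 : 𝓕⁻ (𝓕 s : 𝓢(E4, ℂ)) = s := by simp
          exact congrArg _ h9
        rw [e1, S.cv_lowKer]
        ext x
        change _ = (𝓕⁻ (SchwartzMap.pairing (ContinuousLinearMap.mul ℂ ℂ)
            (S.lowSym n) (𝓕 s)) : 𝓢(E4, ℂ)) x - s x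
        rw [SchwartzMap.fourierInv_coe]
        rfl
      rw [hinv, eLpNorm_two_sq_eq ((𝓕⁻ q : 𝓢(E4, ℂ)).memLp _), ←
          SchwartzMap.integral_norm_sq_fourier,
        FourierTransform.fourier_fourierInv_eq, ← eLpNorm_two_sq_eq (q.memLp _), eLpNorm_two_sq]
      simp only [hqe]
    obtain ⟨D, hD⟩ := S.hasCompactSupport_φ.exists_bound_of_continuous S.φ_smooth.continuous
    have hlim : Tendsto (fun n : ℕ => ∫⁻ η, ‖(S.lowSym n η - 1) * 𝓕 s η‖ₑ ^ 2) atTop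
        (𝓝 (∫⁻ _ : E4, (0 : ℝ≥0∞))) := by
      have hF : MemLp (𝓕 s : 𝓢(E4, ℂ)) 2 (volume : Measure E4) := (𝓕 s).memLp _
      refine tendsto_lintegral_of_dominated_convergence'
        (fun η => (ofReal (D + 1) * ‖𝓕 s η‖ₑ) ^ 2) (fun n => ?_) (fun n => ?_) ?_ ?_
      · exact ((((S.lowSym n).continuous.sub continuous_const).mul
          (𝓕 s).continuous).enorm.measurable.pow_const 2).aemeasurable
      · refine ae_of_all _ fun η => ?_
        simp only [enorm_mul]
        gcongr
        rw [← ofReal_norm]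
        refine ofReal_le_ofReal ((norm_sub_le _ _).trans ?_)
        rw [lowSym_apply, norm_real, norm_one]
        gcongr
        exact hD _
      · simp only [mul_pow]
        rw [lintegral_const_mul _ ((𝓕 s).continuous.enorm.measurable.pow_const 2)]
        rw [← eLpNorm_two_sq]
        exact (mul_lt_top (by simp) (pow_lt_top hF.2)).ne
      · refine ae_of_all _ fun η => ?_
        have hf : Tendsto (fun n : ℕ => freq n * ‖η‖) atTop (𝓝 0) := by
          have h1 : Tendsto (fun n : ℕ => (1 / 2 : ℝ) ^ n) atTop (𝓝 0) :=
            tendsto_pow_atTop_nhds_zero_of_lt_one (by norm_num) (by norm_num)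
          have := (h1.const_mul (2 * Real.pi)).mul_const ‖η‖
          simpa [freq] using this
        have hev : ∀ᶠ n : ℕ in atTop, freq n * ‖η‖ < 1 := hf.eventually (gt_mem_nhds one_pos)
        refine tendsto_const_nhds.congr' ?_
        filter_upwards [hev] with n hn
        rw [lowSym_apply, S.φ_one]
        · simp
        · rw [norm_smul, norm_of_nonneg (freq_pos _).le]; exact hn.le
    simp only [← e, lintegral_zero] at hlim
    have := hlim.ennrpow_const (1 / 2)
    refine (this.congr fun n => ?_).trans (by simp)
    rw [← rpow_natCast, ← rpow_mul]; norm_num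
  refine ⟨mem hg, hg, ?_⟩
  obtain ⟨s, hs⟩ := exists_schwartz_approx hg
  refine tendsto_nhds_zero.2 fun ε hε => ?_
  obtain ⟨δ, hδ, hδε⟩ : ∃ δ : ℝ≥0∞, 0 < δ ∧ C * δ + δ + δ ≤ ε := by
    have : Tendsto (fun δ : ℝ≥0∞ => C * δ + δ + δ) (𝓝 0) (𝓝 0) := by
      have h1 : Tendsto (fun δ : ℝ≥0∞ => C * δ) (𝓝 0) (𝓝 (C * 0)) :=
        ENNReal.Tendsto.const_mul tendsto_id (Or.inr hCt)
      simpa using (h1.add tendsto_id).add tendsto_id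
    have h2 := ((tendsto_nhds_zero.1 this ε hε).filter_mono nhdsWithin_le_nhds :
      ∀ᶠ δ in 𝓝[>] (0 : ℝ≥0∞), C * δ + δ + δ ≤ ε)
    obtain ⟨δ, h3, h4⟩ := (h2.and self_mem_nhdsWithin).exists
    exact ⟨δ, h4, h3⟩
  obtain ⟨m, hm⟩ := (tendsto_nhds_zero.1 hs.tendsto δ hδ).exists
  filter_upwards [tendsto_nhds_zero.1 (schw (s m)) δ hδ] with n hn
  have hsm : MemLp (s m) 2 (volume : Measure E4) := hs.memLp m
  have e : cv (S.lowKer n) g - g = cv (S.lowKer n) (g - (s m : E4 → ℂ)) +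
      (cv (S.lowKer n) (s m) - (s m : E4 → ℂ)) +
      ((s m : E4 → ℂ) - g) := by
    rw [cv_sub _ hg hsm]; abel
  have hm' : N[2] (g - (s m : E4 → ℂ)) ≤ δ := by rw [eLpNorm_sub_comm]; exact hm
  rw [e]
  refine (eLpNorm_add_le (((mem (hg.sub hsm) n).add ((mem hsm n).sub hsm)).1) (hsm.sub hg).1
    (by norm_num)).trans ?_
  refine (add_le_add (eLpNorm_add_le (mem (hg.sub hsm) n).1 ((mem hsm n).sub hsm).1
    (by norm_num)) hm).trans ?_
  refine le_trans ?_ hδε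
  gcongr
  exact (bound (hg.sub hsm) n).trans (by gcongr)

/-- The square function bound: `‖g‖₄² ≲ ‖g‖₂² + ∑ₖ ‖P_{2ᵏ} g‖₄²`, with the sum over `k ≥ 0`; the
low frequencies are controlled in `L²` by Bernstein's inequality. -/
theorem Framework.exists_square_function_bound (S : Framework) : ∃ C : ℝ≥0∞, C ≠ ⊤ ∧
    ∀ g : E4 → ℂ, MemLp g 2 → N[4] g ^ 2 ≤
      C * N[2] g ^ 2 + 768 * ∑' k : ℕ, N[4] (cv (S.bandKer k) g) ^ 2 := by
  choose C hC hb using fun K : 𝓢(E4, ℂ) => exists_cv_four_bound K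
  set D : ℝ≥0∞ := C (S.lowKer 0) ^ 2 + C (S.lowKer 1) ^ 2 + C (S.lowKer 2) ^ 2 + C (S.lowKer 3) ^ 2
  refine ⟨D, by simp [D, hC], fun g hg => ?_⟩
  have key : ∀ n : ℕ, N[4] (cv (S.lowKer n) g) ≤ (D * N[2] g ^ 2 +
      768 * ∑' k : ℕ, N[4] (cv (S.bandKer k) g) ^ 2) ^ (1 / 2 : ℝ) := by
    intro n
    have hm : ∀ K : 𝓢(E4, ℂ), MemLp (cv K g) 4 := fun K => memLp_cv_four K hg
    have h := ofReal_le_ofReal (S.norm4_low_sq_le hg n)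
    rw [ofReal_add (by positivity)
        (mul_nonneg (by norm_num) (sum_nonneg fun k _ => sq_nonneg _)),
      ofReal_add (by positivity) (sq_nonneg _),
      ofReal_add (by positivity) (sq_nonneg _),
      ofReal_add (by positivity) (sq_nonneg _), ofReal_mul (by norm_num),
      ofReal_sum_of_nonneg fun k _ => sq_nonneg _] at h
    simp only [ofReal_norm4_sq (hm _), ofReal_ofNat] at h
    have h2 : N[4] (cv (S.lowKer n) g) ^ 2 ≤ D * N[2] g ^ 2 +
        768 * ∑' k : ℕ, N[4] (cv (S.bandKer k) g) ^ 2 := by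
      refine h.trans (add_le_add ?_ (mul_le_mul_right (ENNReal.sum_le_tsum _) _))
      simp only [D, add_mul, ← mul_pow]
      gcongr <;> exact hb _ g hg.1
    calc N[4] (cv (S.lowKer n) g) = (N[4] (cv (S.lowKer n) g) ^ 2) ^ (1 / 2 : ℝ) := by
          rw [← rpow_natCast, ← rpow_mul]; norm_num
      _ ≤ _ := by gcongr
  have := eLpNorm_le_of_tendsto (p := 2) (q := 4) (by norm_num) (by norm_num)
    (by norm_num) (S.lpTendsto_low hg) key
  calc _ ≤ ((D * N[2] g ^ 2 +
      768 * ∑' k : ℕ, N[4] (cv (S.bandKer k) g) ^ 2) ^ (1 / 2 : ℝ)) ^ 2 := by gcongr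
    _ = _ := by rw [← rpow_natCast, ← rpow_mul]; norm_num

open scoped SchwartzMap

theorem lintegral_eLpNorm_sq_eq {V : Type*} [NormedAddCommGroup V] (I : Set ℝ) (r : ℝ≥0∞)
    (u : ℝ → E4 → V) :
    ∫⁻ t in I, N[r] (u t) ^ 2 = mixedNorm 2 r I u ^ 2 := by
  have := eLpNorm_nnreal_pow_eq_lintegral (p := 2) (by norm_num) (f := fun t => N[r] (u t))
    (μ := volume.restrict I)
  simp only [enorm_eq_self] at this
  rw [mixedNorm]
  simpa using this.symm

/-- Finiteness of `‖v‖_X` puts the gradient in `L²ₜ L⁴ₓ`: `‖P_N ∂ⱼv‖₄` is at most a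
constant times `N ‖P_N v‖₄`, and the squares are summable over `N`. -/
theorem Framework.lintegral_der_four_lt_top (S : Framework) {J : Set ℝ}
    {v g : ℝ → E4 → ℂ}
    (hv : AEStronglyMeasurable (uncurry v) ((volume.restrict J).prod volume))
    (h4 : ∀ᵐ t ∂volume.restrict J, MemLp (v t) 4)
    (hd : ∀ᵐ t ∂volume.restrict J, HasWeakDer j (v t) (g t))
    (h2 : ∀ᵐ t ∂volume.restrict J, MemLp (g t) 2)
    (hg : ∫⁻ t in J, N[2] (g t) ^ 2 < ⊤) (hX : S.XNorm J v < ⊤) :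
    ∫⁻ t in J, N[4] (g t) ^ 2 < ⊤ := by
  obtain ⟨C, hC, hb⟩ := S.exists_square_function_bound
  have hD : MemLp (pd j (S.lowKer 0)) 1 (volume : Measure E4) := by
    have : pd j (S.lowKer 0) =
      (LineDeriv.lineDerivOp (EuclideanSpace.single j (1 : ℝ)) (S.lowKer 0) : 𝓢(E4, ℂ)) := by
      ext y; simp [pd, SchwartzMap.lineDerivOp_apply_eq_fderiv]
    rw [this]
    exact SchwartzMap.memLp (LineDeriv.lineDerivOp (EuclideanSpace.single j (1 : ℝ))
        (S.lowKer 0) : 𝓢(E4, ℂ)) 1 volume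
  set D : ℝ≥0∞ := 2 * N[1] (pd j (S.lowKer 0)) with hDdef
  have hDt : D ≠ ⊤ := mul_ne_top (by norm_num) hD.2.ne
  have hmeas : ∀ k : ℤ, AEMeasurable (fun t => N[4] (cv (S.bandKer k) (v t)))
      (volume.restrict J) := by
    intro k
    set w : ℝ → E4 → ℂ := fun t x => hv.mk _ (t, x) with hw
    have hws : StronglyMeasurable (uncurry w) := hv.stronglyMeasurable_mk
    refine ⟨_, measurable_eLpNorm_slice (stronglyMeasurable_cv (S.bandKer k).continuous hws) 4, ?_⟩
    filter_upwards [Measure.ae_ae_of_ae_prod hv.ae_eq_mk] with t ht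
    congr 1
    ext x
    refine integral_congr_ae (ht.mono fun y hy => ?_)
    simp only [uncurry] at hy
    simp only [hw, hy]
  set c : ℕ → ℝ≥0∞ := fun k => ofReal ((2 : ℝ) ^ (k : ℤ)) with hc
  have hpt : ∀ᵐ t ∂volume.restrict J, N[4] (g t) ^ 2 ≤ C * N[2] (g t) ^ 2 + 768 * ∑' k : ℕ, D ^ 2 *
        (c k ^ 2 * N[4] (cv (S.bandKer k) (v t)) ^ 2) := by
    filter_upwards [h4, hd, h2] with t t4 td t2
    refine (hb (g t) t2).trans ?_
    gcongr with k
    rw [← mul_pow, ← mul_pow]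
    gcongr
    exact S.eLpNorm_band_der_le td t4 t2 k
  refine (lintegral_mono_ae hpt).trans_lt ?_
  have hmk : ∀ k : ℕ, AEMeasurable (fun t => D ^ 2 *
      (c k ^ 2 * N[4] (cv (S.bandKer k) (v t)) ^ 2)) (volume.restrict J) := fun k =>
    (((hmeas k).pow_const 2).const_mul _).const_mul _
  rw [lintegral_add_right' _ ((AEMeasurable.tsum hmk).const_mul _),
    lintegral_const_mul' _ _ hC, lintegral_const_mul' _ _ (by norm_num), lintegral_tsum hmk]
  refine add_lt_top.2 ⟨mul_lt_top hC.lt_top hg, mul_lt_top (by norm_num) ?_⟩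
  have hX2 : ∑' k : ℤ, S.XNNorm ((2 : ℝ) ^ k) J v ^ 2 < ⊤ := by
    by_contra h
    rw [not_lt, top_le_iff] at h
    rw [XNorm, h, ENNReal.top_rpow_of_pos (by norm_num)] at hX
    exact lt_irrefl _ hX
  calc ∑' k : ℕ, ∫⁻ t in J, D ^ 2 * (c k ^ 2 * N[4] (cv (S.bandKer k) (v t)) ^ 2)
      ≤ ∑' k : ℕ, D ^ 2 * S.XNNorm ((2 : ℝ) ^ (k : ℤ)) J v ^ 2 := by
        refine ENNReal.tsum_le_tsum fun k => ?_
        rw [lintegral_const_mul' _ _ (pow_ne_top hDt),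
          lintegral_const_mul' _ _ (pow_ne_top ofReal_ne_top),
          lintegral_eLpNorm_sq_eq J 4 (fun t => cv (S.bandKer k) (v t)), ← mul_pow]
        gcongr
        have e : (fun t => cv (S.bandKer k) (v t)) = S.P ((2 : ℝ) ^ (k : ℤ)) v := by
          ext t : 1
          exact (S.multiplier_eq k (v t)).symm
        rw [e, XNNorm, add_assoc, add_assoc]
        exact le_self_add
    _ = D ^ 2 * ∑' k : ℕ, S.XNNorm ((2 : ℝ) ^ (k : ℤ)) J v ^ 2 := ENNReal.tsum_mul_left
    _ ≤ D ^ 2 * ∑' k : ℤ, S.XNNorm ((2 : ℝ) ^ k) J v ^ 2 := by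
        gcongr
        exact ENNReal.tsum_comp_le_tsum_of_injective Nat.cast_injective
          (fun k : ℤ => S.XNNorm ((2 : ℝ) ^ k) J v ^ 2)
    _ < ⊤ := mul_lt_top (pow_lt_top hDt.lt_top) hX2

/-! ### Smooth functions with derivatives in `Lᵖ` -/

/-- Smooth functions all of whose partial derivatives lie in `Lᵖ`. A derivative of any order is
given by the list of its directions. -/
def SmoothLp (p : ℝ≥0∞) (f : E4 → ℂ) : Prop :=
  ContDiff ℝ ∞ f ∧ ∀ l : List (Fin 4), MemLp (l.foldr pd f) p

theorem SmoothLp.memLp (h : SmoothLp p f) : MemLp f p := h.2 []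

theorem SmoothLp.differentiable (h : SmoothLp p f) : Differentiable ℝ f :=
  h.1.differentiable (by simp)

theorem SmoothLp.pd (h : SmoothLp p f) (j : Fin 4) : SmoothLp p (pd j f) :=
  ⟨pd_contDiff h.1 j, fun l => by simpa using h.2 (l ++ [j])⟩

theorem SmoothLp.lap (h : SmoothLp p f) : MemLp (lap f) p :=
  memLp_finsetSum _ fun j _ => ((h.pd j).pd j).memLp

theorem smoothLp_cv (hp : 1 ≤ p) (hf : MemLp f p)
    (hk : ContDiff ℝ ∞ k) (hc : HasCompactSupport k) : SmoothLp p (cv (rk k) f) := by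
  have hl := hf.locallyIntegrable hp
  refine ⟨contDiff_cv hl hk hc, fun l => ?_⟩
  have : ∃ k' : E4 → ℝ, ContDiff ℝ ∞ k' ∧ HasCompactSupport k' ∧
      l.foldr ForcedNLS.pd (cv (rk k) f) = cv (rk k') f := by
    induction l with
    | nil => exact ⟨k, hk, hc, rfl⟩
    | cons j l ih =>
      obtain ⟨k', h1, h2, h3⟩ := ih
      exact ⟨ForcedNLS.pd j k', pd_contDiff h1 j, pd_hasCompactSupport h2 j, by
        rw [List.foldr_cons, h3, pd_cv hl h1 h2]⟩
  obtain ⟨k', h1, h2, h3⟩ := this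
  rw [h3]
  exact memLp_cv (rk_memLp h1.continuous h2 1) hp hf

theorem pd_conj (hf : Differentiable ℝ f) (j : Fin 4) :
    pd j (fun x => conj (f x)) = fun x => conj (pd j f x) := by
  ext x
  have : HasFDerivAt (fun x => conj (f x)) ((conjCLE : ℂ →L[ℝ] ℂ).comp (fderiv ℝ f x)) x :=
    (conjCLE : ℂ →L[ℝ] ℂ).hasFDerivAt.comp x (hf x).hasFDerivAt
  simp [pd, this.fderiv]

theorem SmoothLp.conj (h : SmoothLp p f) :
    SmoothLp p (fun x => conj (f x)) := by
  refine ⟨(conjCLE : ℂ →L[ℝ] ℂ).contDiff.comp h.1, fun l => ?_⟩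
  have : l.foldr ForcedNLS.pd (fun x => conj (f x)) = (fun x => conj (l.foldr ForcedNLS.pd f x)) ∧
      ContDiff ℝ ∞ (l.foldr ForcedNLS.pd f) := by
    induction l with
    | nil => exact ⟨rfl, h.1⟩
    | cons j l ih =>
      exact ⟨by rw [List.foldr_cons, ih.1, pd_conj (ih.2.differentiable (by simp))]; rfl,
        pd_contDiff ih.2 j⟩
  rw [this.1]
  exact (h.2 l).star

theorem integrable_fun_mul [HolderTriple p q 1]
    (hf : MemLp f p) (hg : MemLp g q) : Integrable fun x => f x * g x :=
  memLp_one_iff_integrable.1 (hg.mul' hf)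

theorem pd_pd_comm {V : Type*} [NormedAddCommGroup V] [NormedSpace ℝ V] {f : E4 → V}
    (hf : ContDiff ℝ ∞ f) (i j : Fin 4) : pd i (pd j f) = pd j (pd i f) := by
  ext x
  have h : DifferentiableAt ℝ (fderiv ℝ f) x :=
    (hf.fderiv_right (m := ∞) (by simp)).differentiable (by simp) x
  have e : ∀ i j : Fin 4, pd i (pd j f) x = fderiv ℝ (fderiv ℝ f) x (EuclideanSpace.single i 1)
      (EuclideanSpace.single j 1) := by
    intro i j
    have : HasFDerivAt (pd j f) ((ContinuousLinearMap.apply ℝ V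
        (EuclideanSpace.single j (1 : ℝ))).comp
        (fderiv ℝ (fderiv ℝ f) x)) x :=
      (ContinuousLinearMap.apply ℝ V (EuclideanSpace.single j (1 : ℝ))).hasFDerivAt.comp x
          h.hasFDerivAt
    rw [show pd i (pd j f) x = fderiv ℝ (pd j f) x (EuclideanSpace.single i 1) from rfl,
        this.fderiv]
    simp
  rw [e, e]
  have hs : IsSymmSndFDerivAt ℝ f x := hf.contDiffAt.isSymmSndFDerivAt
      (by simp only [minSmoothness_of_isRCLikeNormedField]; exact WithTop.coe_le_coe.2 le_top)
  exact hs _ _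

theorem pd_add {V : Type*} [NormedAddCommGroup V] [NormedSpace ℝ V] {f g : E4 → V}
    (hf : Differentiable ℝ f) (hg : Differentiable ℝ g) (j : Fin 4) :
    pd j (f ⊞ g) = fun x => pd j f x + pd j g x := by
  ext x
  simp [pd, fderiv_fun_add (hf x) (hg x)]

theorem pd_sum {V ι : Type*} [NormedAddCommGroup V] [NormedSpace ℝ V] {s : Finset ι}
    {f : ι → E4 → V}
    (hf : ∀ i, Differentiable ℝ (f i)) (j : Fin 4) :
    pd j (fun x => ∑ i ∈ s, f i x) = fun x => ∑ i ∈ s, pd j (f i) x := by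
  ext x
  simp [pd, fderiv_fun_sum (fun i _ => hf i x)]

theorem lap_pd {V : Type*} [NormedAddCommGroup V] [NormedSpace ℝ V] {f : E4 → V}
    (hf : ContDiff ℝ ∞ f) (j : Fin 4) : lap (pd j f) = pd j (lap f) := by
  have h : pd j (lap f) = fun x => ∑ i, pd j (pd i (pd i f)) x :=
    pd_sum (fun i => (pd_contDiff (pd_contDiff hf i) i).differentiable (by simp)) j
  rw [h]
  ext x
  refine sum_congr rfl fun i _ => ?_
  rw [pd_pd_comm hf i j, pd_pd_comm (pd_contDiff hf i) i j]

theorem cv_lap (hf : LocallyIntegrable f) (hk : ContDiff ℝ ∞ k)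
    (hc : HasCompactSupport k) : cv (rk (lap k)) f = lap (cv (rk k) f) := by
  ext x
  have h1 : ∀ j : Fin 4, pd j (pd j (cv (rk k) f)) = cv (rk (pd j (pd j k))) f := fun j => by
    rw [pd_cv hf hk hc, pd_cv hf (pd_contDiff hk j) (pd_hasCompactSupport hc j)]
  simp only [lap, h1]
  have hi : ∀ j ∈ (Finset.univ : Finset (Fin 4)),
      Integrable (fun y => rk (pd j (pd j k)) (x - y) * f y) := fun j _ =>
    integrable_cv_integrand_of_locallyIntegrable (pd_contDiff (pd_contDiff hk j) j).continuous
      (pd_hasCompactSupport (pd_hasCompactSupport hc j) j) hf x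
  simp only [cv]
  rw [← integral_finsetSum _ hi]
  congr 1
  ext y
  simp [rk, lap, sum_mul]

/-- The mollification of `f` at scale `1 / (n + 1)`. -/
def mo (n : ℕ) (f : E4 → ℂ) : E4 → ℂ := cv (rk (mol n)) f

theorem smoothLp_mo (hp : 1 ≤ p) (hf : MemLp f p) (n : ℕ) :
    SmoothLp p (mo n f) := smoothLp_cv hp hf (mol_contDiff n) (mol_hasCompactSupport n)

theorem eLpNorm_mo_le (hp : 1 ≤ p) (hf : AEStronglyMeasurable f) (n : ℕ) :
    N[p] (mo n f) ≤ N[p] f := eLpNorm_cv_mol_le n hf hp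

theorem HasWeakDer.pd_mo (h : HasWeakDer j f g) (n : ℕ) :
    pd j (mo n f) = mo n g := by
  rw [mo, pd_cv h.1 (mol_contDiff n) (mol_hasCompactSupport n),
    h.cv_pd (mol_contDiff n) (mol_hasCompactSupport n)]
  rfl

/-! ### The cubic nonlinearity -/

/-- The nonlinearity `|u|² u`. -/
def cub (u : E4 → ℂ) : E4 → ℂ := fun x => ((‖u x‖ ^ 2 : ℝ) : ℂ) * u x

/-- The derivative `2 |u|² ∂u + u² conj(∂u)` of `|u|² u`. -/
def dcub (u d : E4 → ℂ) : E4 → ℂ := fun x => 2 * (u x * conj (u x)) * d x + u x * u x * conj (d x)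

theorem cub_eq (u : E4 → ℂ) : cub u = fun x => u x * conj (u x) * u x := by
  ext x
  rw [cub, Complex.ofReal_pow, ← Complex.mul_conj']

theorem norm_dcub_le (u d : E4 → ℂ) (x : E4) : ‖dcub u d x‖ ≤ 3 * (‖u x‖ * ‖u x‖ * ‖d x‖) := by
  refine (norm_add_le _ _).trans (le_of_eq ?_)
  simp only [norm_mul, RCLike.norm_conj, Complex.norm_ofNat]
  ring

theorem holderTriple_two_four : HolderTriple 2 4 p₄₃ := ⟨by
    rw [← toReal_eq_toReal_iff' (by simp) (by simp)]
    rw [toReal_add (by simp) (by simp)]; norm_num⟩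

theorem holderTriple_six_six : HolderTriple 6 6 3 := ⟨by
    rw [← toReal_eq_toReal_iff' (by simp) (by simp)]
    rw [toReal_add (by simp) (by simp)]; norm_num⟩

theorem holderTriple_three_six : HolderTriple 3 6 2 := ⟨by
    rw [← toReal_eq_toReal_iff' (by simp) (by simp)]
    rw [toReal_add (by simp) (by simp)]; norm_num⟩

theorem one_le_four_thirds : (1 : ℝ≥0∞) ≤ p₄₃ := by
  rw [← ENNReal.coe_one, ENNReal.coe_le_coe, ← NNReal.coe_le_coe]; norm_num

theorem LpTendsto.cub_four {f : ℕ → E4 → ℂ} (h : LpTendsto 4 f g) :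
    LpTendsto p₄₃ (fun n => cub (f n)) (cub g) := by
  have := holderTriple_four_four_two
  have := holderTriple_two_four
  simp only [cub_eq]
  exact LpTendsto.mul one_le_four_thirds (LpTendsto.mul (r := 2) (by norm_num) h h.conj) h

theorem LpTendsto.cub_six {f : ℕ → E4 → ℂ} (h : LpTendsto 6 f g) :
    LpTendsto 2 (fun n => cub (f n)) (cub g) := by
  have := holderTriple_six_six
  have := holderTriple_three_six
  simp only [cub_eq]
  exact LpTendsto.mul (by norm_num) (LpTendsto.mul (r := 3) (by norm_num) h h.conj) h

theorem LpTendsto.dcub {f d : ℕ → E4 → ℂ} {e : E4 → ℂ} (h : LpTendsto 4 f g)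
    (h' : LpTendsto 4 d e) :
    LpTendsto p₄₃ (fun n => dcub (f n) (d n)) (dcub g e) := by
  have := holderTriple_four_four_two
  have := holderTriple_two_four
  exact LpTendsto.add one_le_four_thirds (LpTendsto.mul one_le_four_thirds
      ((LpTendsto.mul (r := 2) (by norm_num) h h.conj).const_mul 2) h')
    (LpTendsto.mul one_le_four_thirds (LpTendsto.mul (r := 2) (by norm_num) h h) h'.conj)

theorem MemLp.cub_four (h : MemLp f 4) : MemLp (cub f) p₄₃ :=
  (LpTendsto.const h).cub_four.memLp_lim

theorem MemLp.cub_six (h : MemLp f 6) : MemLp (cub f) 2 :=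
  (LpTendsto.const h).cub_six.memLp_lim

theorem MemLp.dcub (h : MemLp f 4) (h' : MemLp d 4) : MemLp (dcub f d) p₄₃ :=
  ((LpTendsto.const h).dcub (LpTendsto.const h')).memLp_lim

theorem eLpNorm_cub_four_le (h : AEStronglyMeasurable f) :
    N[p₄₃] (cub f) ≤ N[4] f ^ 3 := by
  have := holderTriple_four_four_two
  have := holderTriple_two_four
  have hc : N[4] (fun x => conj (f x)) = N[4] f :=
    eLpNorm_congr_norm_ae (ae_of_all _ fun x => by simp)
  have h1 := eLpNorm_fun_mul_le (p := 4) (q := 4) (r := 2) h h.star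
  have h2 := eLpNorm_fun_mul_le (p := 2) (q := 4) (r := p₄₃) (h.mul h.star) h
  rw [cub_eq]
  refine h2.trans ((mul_le_mul_left h1 _).trans (le_of_eq ?_))
  change N[4] f * N[4] (fun x => conj (f x)) * _ = _
  rw [hc]; ring

theorem eLpNorm_cub_six_le (h : AEStronglyMeasurable f) :
    N[2] (cub f) ≤ N[6] f ^ 3 := by
  have := holderTriple_six_six
  have := holderTriple_three_six
  have hc : N[6] (fun x => conj (f x)) = N[6] f :=
    eLpNorm_congr_norm_ae (ae_of_all _ fun x => by simp)
  have h1 := eLpNorm_fun_mul_le (p := 6) (q := 6) (r := 3) h h.star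
  have h2 := eLpNorm_fun_mul_le (p := 3) (q := 6) (r := 2) (h.mul h.star) h
  rw [cub_eq]
  refine h2.trans ((mul_le_mul_left h1 _).trans (le_of_eq ?_))
  change N[6] f * N[6] (fun x => conj (f x)) * _ = _
  rw [hc]; ring

theorem eLpNorm_dcub_le (h : AEStronglyMeasurable f) (hd : AEStronglyMeasurable d) :
    N[p₄₃] (dcub f d) ≤ 3 * (N[4] f ^ 2 * N[4] d) := by
  have := holderTriple_four_four_two
  have := holderTriple_two_four
  have h1 := eLpNorm_fun_mul_le (p := 4) (q := 4) (r := 2) h.norm h.norm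
  have h2 := eLpNorm_fun_mul_le (p := 2) (q := 4) (r := p₄₃) (h.norm.mul h.norm) hd.norm
  have h3 : N[p₄₃] (dcub f d) ≤ 3 * N[p₄₃] (fun x => ‖f x‖ * ‖f x‖ * ‖d x‖) := by
    have := eLpNorm_le_nnreal_smul_eLpNorm_of_ae_le_mul (c := 3) (f := dcub f d)
      (g := fun x => ‖f x‖ * ‖f x‖ * ‖d x‖) (μ := (volume : Measure E4))
      (ae_of_all _ fun x => by
        rw [← NNReal.coe_le_coe]
        simpa using norm_dcub_le f d x) p₄₃
    simpa [ENNReal.smul_def] using this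
  refine h3.trans ?_
  gcongr
  refine h2.trans ((mul_le_mul_left h1 _).trans (le_of_eq ?_))
  rw [eLpNorm_norm, eLpNorm_norm, sq]

theorem cub_contDiff (hw : ContDiff ℝ ∞ w) : ContDiff ℝ ∞ (cub w) := by
  rw [cub_eq]
  exact (hw.mul ((conjCLE : ℂ →L[ℝ] ℂ).contDiff.comp hw)).mul hw

theorem pd_cub (hw : ContDiff ℝ ∞ w) (j : Fin 4) : pd j (cub w) = dcub w (pd j w) := by
  have hd := hw.differentiable (by simp)
  have hcd : Differentiable ℝ fun x => conj (w x) :=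
    (conjCLE : ℂ →L[ℝ] ℂ).differentiable.comp hd
  ext x
  have e1 : pd j (fun x => w x * conj (w x) * w x) x = _ :=
    pd_mul (f := fun x => w x * conj (w x)) (hd.mul hcd) hd j x
  rw [cub_eq, e1, pd_mul hd hcd, pd_conj hd, dcub]
  ring

theorem hasWeakDer_of_lpTendsto (hp : 1 ≤ p) (hq : 1 ≤ q)
    {f g : ℕ → E4 → ℂ} {f₀ g₀ : E4 → ℂ} (hf : LpTendsto p f f₀) (hg : LpTendsto q g g₀)
    (h : ∀ n, HasWeakDer j (f n) (g n)) : HasWeakDer j f₀ g₀ := by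
  refine ⟨hf.memLp_lim.locallyIntegrable hp, hg.memLp_lim.locallyIntegrable hq, fun φ h1 h2 => ?_⟩
  have key : ∀ {r : ℝ≥0∞} {w : ℕ → E4 → ℂ} {w₀ : E4 → ℂ} {k : E4 → ℝ}, 1 ≤ r → LpTendsto r w w₀ →
      ContDiff ℝ ∞ k → HasCompactSupport k →
      Tendsto (fun n => ∫ x, k x • w n x) atTop (𝓝 (∫ x, k x • w₀ x)) := by
    intro r w w₀ k hr hw k1 k2
    have : HolderTriple (r.conjExponent) r 1 := by
      have := ENNReal.HolderConjugate.conjExponent hr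
      have := HolderTriple.symm (p := r) (q := r.conjExponent) (r := 1)
      exact this
    have := (LpTendsto.mul (p := r.conjExponent) le_rfl
      (LpTendsto.const (rk_memLp k1.continuous k2 _)) hw hr).integral
    simpa [rk] using this
  refine tendsto_nhds_unique (key hp hf (pd_contDiff h1 j) (pd_hasCompactSupport h2 j)) ?_
  refine ((key hq hg h1 h2).neg).congr fun n => ?_
  rw [(h n).2.2 φ h1 h2]

/-- The weak chain rule for `|u|² u`. -/
theorem HasWeakDer.cub (h : HasWeakDer j u d) (hu : MemLp u 4)
    (hd : MemLp d 4) : HasWeakDer j (cub u) (dcub u d) := by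
  have h4 : LpTendsto 4 (fun n => mo n u) u := .mol (by norm_num) (by norm_num) hu
  have d4 : LpTendsto 4 (fun n => mo n d) d := .mol (by norm_num) (by norm_num) hd
  refine hasWeakDer_of_lpTendsto one_le_four_thirds one_le_four_thirds h4.cub_four (h4.dcub d4)
    fun n => ?_
  have hs := (smoothLp_mo (by norm_num) hu n).1
  rw [← h.pd_mo, ← pd_cub hs]
  exact hasWeakDer_of_contDiff ((cub_contDiff hs).of_le (by simp)) j

/-! ### Integral identities at a fixed time -/

theorem foldr_pd_contDiff (hf : ContDiff ℝ ∞ f) (l : List (Fin 4)) :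
    ContDiff ℝ ∞ (l.foldr pd f) := by
  induction l with
  | nil => exact hf
  | cons j l ih => exact pd_contDiff ih j

theorem SmoothLp.add (hf : SmoothLp p f) (hg : SmoothLp p g) :
    SmoothLp p (f ⊞ g) := by
  refine ⟨hf.1.add hg.1, fun l => ?_⟩
  have : l.foldr ForcedNLS.pd (f ⊞ g) =
      fun x => l.foldr ForcedNLS.pd f x + l.foldr ForcedNLS.pd g x := by
    induction l with
    | nil => rfl
    | cons j l ih =>
      rw [List.foldr_cons, ih, pd_add ((foldr_pd_contDiff hf.1 l).differentiable (by simp))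
        ((foldr_pd_contDiff hg.1 l).differentiable (by simp))]
      rfl
  rw [this]
  exact (hf.2 l).add (hg.2 l)

theorem SmoothLp.const_mul (hf : SmoothLp p f) (c : ℂ) :
    SmoothLp p (fun x => c * f x) := by
  refine ⟨contDiff_const.mul hf.1, fun l => ?_⟩
  have : l.foldr ForcedNLS.pd (fun x => c * f x) = fun x => c * l.foldr ForcedNLS.pd f x := by
    induction l with
    | nil => rfl
    | cons j l ih =>
      rw [List.foldr_cons, ih]
      ext x
      rw [ForcedNLS.pd, fderiv_const_mul ((foldr_pd_contDiff hf.1 l).differentiable (by simp) x)]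
      rfl
  rw [this]
  exact (hf.2 l).const_mul c

theorem SmoothLp.lap_smooth (hf : SmoothLp p f) :
    SmoothLp p (ForcedNLS.lap f) := by
  have h := fun j => (hf.pd j).pd j
  have e : ForcedNLS.lap f = fun x => ForcedNLS.pd 0 (ForcedNLS.pd 0 f) x +
      (ForcedNLS.pd 1 (ForcedNLS.pd 1 f) x + (ForcedNLS.pd 2 (ForcedNLS.pd 2 f) x +
        ForcedNLS.pd 3 (ForcedNLS.pd 3 f) x)) := by
    ext x; simp [ForcedNLS.lap, Fin.sum_univ_four]; ring
  rw [e]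
  exact (h 0).add ((h 1).add ((h 2).add (h 3)))

/-- A real weight, bounded with bounded first derivatives. -/
def BddWeight (a : E4 → ℝ) : Prop :=
  ContDiff ℝ ∞ a ∧ (∃ C, ∀ x, |a x| ≤ C) ∧ ∀ j, ∃ C, ∀ x, |pd j a x| ≤ C

/-- The weighted bilinear integral `∫ a f g`. -/
def wint (a : E4 → ℝ) (f g : E4 → ℂ) : ℂ := ∫ x, (a x : ℂ) * (f x * g x)

theorem integrable_wint {a : E4 → ℝ} (ha : Continuous a) (hb : ∃ C, ∀ x, |a x| ≤ C)
    (hf : MemLp f 2) (hg : MemLp g 2) : Integrable fun x => (a x : ℂ) * (f x * g x) := by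
  obtain ⟨C, hC⟩ := hb
  exact (integrable_fun_mul hf hg).bdd_mul (c := C)
    (continuous_ofReal.comp ha).aestronglyMeasurable
    (ae_of_all _ fun x => by rw [norm_real]; exact hC x)

theorem conj_wint (a : E4 → ℝ) (f g : E4 → ℂ) : conj (wint a f g) =
    wint a (fun x => conj (f x)) (fun x => conj (g x)) := by
  rw [wint, ← integral_conj]
  simp [wint]

theorem wint_comm (a : E4 → ℝ) (f g : E4 → ℂ) : wint a f g = wint a g f := by
  simp only [wint, mul_comm (f _)]

/-- Weighted integration by parts. -/
theorem wint_pd {a : E4 → ℝ} (ha : BddWeight a) (hf : SmoothLp 2 f)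
    (hg : SmoothLp 2 g) (j : Fin 4) :
    wint a f (pd j g) = -wint (pd j a) f g - wint a (pd j f) g := by
  have hac := ha.1.continuous
  have hpc := (pd_contDiff ha.1 j).continuous
  have i1 := integrable_wint hac ha.2.1 hf.memLp (hg.pd j).memLp
  have i2 := integrable_wint hpc (ha.2.2 j) hf.memLp hg.memLp
  have i3 := integrable_wint hac ha.2.1 (hf.pd j).memLp hg.memLp
  have i4 := integrable_wint hac ha.2.1 hf.memLp hg.memLp
  have hd : Differentiable ℝ (rk a) := (rk_contDiff ha.1).differentiable (by simp)
  have hp : pd j (fun x => rk a x * f x) = fun x => ((pd j a x : ℝ) : ℂ) * f x + ((a x : ℝ) : ℂ) *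
      pd j f x := by
    ext x
    rw [pd_mul hd hf.differentiable, pd_rk (ha.1.differentiable (by simp))]
    rfl
  have := integral_mul_pd (f := fun x => rk a x * f x) (hd.mul hf.differentiable) hg.differentiable
      j
    (by rw [hp]; refine (i2.add i3).congr (ae_of_all _ fun x => ?_)
        simp only [Pi.add_apply]; ring)
    (by refine i1.congr (ae_of_all _ fun x => ?_); simp only [rk]; ring)
    (by refine i4.congr (ae_of_all _ fun x => ?_); simp only [rk]; ring)
  rw [hp] at this
  have e1 : wint a f (pd j g) = ∫ x, rk a x * f x * pd j g x := by
    rw [wint]; congr 1; ext x; simp only [rk]; ring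
  rw [e1, this, wint, wint, neg_sub_left, ← integral_add i3 i2]
  congr 2
  ext x; ring

/-- `2 Re ∫ a ∂ₖf conj(f) = -∫ ∂ₖa |f|²`. -/
theorem two_re_wint {a : E4 → ℝ} (ha : BddWeight a) (hf : SmoothLp 2 f) (k : Fin 4) :
    2 * (wint a (pd k f) (fun x => conj (f x))).re =
      -(wint (pd k a) f (fun x => conj (f x))).re := by
  have h := wint_pd ha hf.conj hf k
  rw [pd_conj hf.differentiable, wint_comm, wint_comm (pd k a),
    wint_comm a (fun x => conj (pd k f x))] at h
  have h2 := conj_wint a (pd k f) (fun x => conj (f x))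
  simp only [RingHomCompTriple.comp_apply, RingHom.id_apply] at h2
  rw [wint_comm a _ f] at h2
  rw [← h2] at h
  have := congrArg Complex.re h
  simp only [sub_re, neg_re, Complex.conj_re] at this
  linarith

/-- Pairing the Laplacian with a weighted function. -/
theorem wint_lap {a : E4 → ℝ} (ha : BddWeight a) (hf : SmoothLp 2 f)
    (hw : SmoothLp 2 w) :
    wint a f (fun x => conj (lap w x)) = -∑ j, (wint (pd j a) f (fun x => conj (pd j w x)) +
        wint a (pd j f) (fun x => conj (pd j w x))) := by
  have e : ∀ j, wint a f (fun x => conj (pd j (pd j w) x)) =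
      -(wint (pd j a) f (fun x => conj (pd j w x)) +
        wint a (pd j f) (fun x => conj (pd j w x))) := by
    intro j
    have := wint_pd ha hf (hw.pd j).conj j
    rw [pd_conj (hw.pd j).differentiable] at this
    rw [this]; ring
  rw [← sum_neg_distrib]
  simp only [← e]
  simp only [wint]
  rw [← integral_finsetSum _ fun j _ => integrable_wint ha.1.continuous ha.2.1 hf.memLp
    ((hw.pd j).pd j).conj.memLp]
  congr 1
  ext x
  simp only [lap, map_sum, mul_sum]

theorem wint_one (f g : E4 → ℂ) : wint (fun _ => 1) f g = ∫ x, f x * g x := by simp [wint]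

theorem bddWeight_one : BddWeight fun _ => 1 :=
  ⟨contDiff_const, ⟨1, by simp⟩, fun j => ⟨0, by simp [pd]⟩⟩

/-- The free Schrödinger flow does not change the mass. -/
theorem re_integral_conj_lap (hw : SmoothLp 2 w) :
    (∫ x, conj (w x) * (I * lap w x)).re = 0 := by
  have h := wint_lap bddWeight_one hw hw
  have h0 : ∀ j, pd j (fun _ : E4 => (1 : ℝ)) = fun _ => 0 := fun j => by ext x; simp [pd]
  have e : ∀ j, (wint (fun _ => 1) (pd j w) (fun x => conj (pd j w x))).im = 0 := by
    intro j
    rw [wint_one]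
    simp only [mul_conj]
    rw [integral_complex_ofReal, ofReal_im]
  have h1 : (wint (fun _ => 1) w (fun x => conj (lap w x))).im = 0 := by
    rw [h]
    simp only [h0, neg_im, Complex.im_sum, add_im, e]
    simp [wint]
  rw [wint_one] at h1
  have h2 : ∫ x, conj (w x) * (I * lap w x) =
      I * conj (∫ x, w x * conj (lap w x)) := by
    rw [← integral_conj, ← integral_const_mul]
    congr 1
    ext x
    simp only [map_mul, RingHomCompTriple.comp_apply, RingHom.id_apply]
    ring
  rw [h2, I_mul_re, conj_im, h1]
  simp

/-! ### The Morawetz weight -/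

theorem one_le_jap (x : E4) : 1 ≤ jap x := by rw [jap, Real.one_le_sqrt]; nlinarith [sq_nonneg ‖x‖]

theorem jap_pos (x : E4) : 0 < jap x := one_pos.trans_le (one_le_jap x)

theorem jap_sq (x : E4) : jap x ^ 2 = 1 + ‖x‖ ^ 2 := Real.sq_sqrt (by positivity)

theorem jap_contDiff : ContDiff ℝ ∞ jap :=
  (contDiff_const.add (contDiff_norm_sq ℝ)).sqrt fun x => by positivity

/-- The function `⟨x⟩⁻¹`. -/
def ijap (x : E4) : ℝ := (jap x)⁻¹

theorem ijap_pos (x : E4) : 0 < ijap x := inv_pos.2 (jap_pos x)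

theorem ijap_le_one (x : E4) : ijap x ≤ 1 := inv_le_one_of_one_le₀ (one_le_jap x)

theorem norm_sq_mul_ijap (x : E4) : ‖x‖ ^ 2 * ijap x ^ 2 = 1 - ijap x ^ 2 := by
  have h := jap_sq x
  have hp := jap_pos x
  rw [ijap, inv_pow]
  field_simp
  linarith

theorem norm_sq_eq_sum (x : E4) : ‖x‖ ^ 2 = ∑ j, x j ^ 2 := by rw [EuclideanSpace.real_norm_sq_eq]

theorem abs_mul_ijap_le (x : E4) (j : Fin 4) : |x j * ijap x| ≤ 1 := by
  have h := norm_sq_mul_ijap x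
  rw [norm_sq_eq_sum] at h
  have h2 : x j ^ 2 ≤ ∑ j, x j ^ 2 :=
    single_le_sum (f := fun j => x j ^ 2) (fun _ _ => sq_nonneg _) (Finset.mem_univ j)
  rw [abs_le_one_iff_mul_self_le_one]
  nlinarith [sq_nonneg (ijap x), mul_le_mul_of_nonneg_right h2 (sq_nonneg (ijap x))]

theorem ijap_contDiff : ContDiff ℝ ∞ ijap := jap_contDiff.inv fun x => (jap_pos x).ne'

theorem coord_contDiff (k : Fin 4) : ContDiff ℝ ∞ fun x : E4 => x k :=
  (EuclideanSpace.proj (𝕜 := ℝ) k).contDiff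

theorem pd_coord (j k : Fin 4) (x : E4) : pd j (fun x : E4 => x k) x = if j = k then 1 else 0 := by
  have h : HasFDerivAt (fun x : E4 => x k) (EuclideanSpace.proj (𝕜 := ℝ) k : E4 →L[ℝ] ℝ) x :=
    (EuclideanSpace.proj (𝕜 := ℝ) k : E4 →L[ℝ] ℝ).hasFDerivAt
  rw [pd, h.fderiv]
  simp [eq_comm]

theorem pd_mul_real {f g : E4 → ℝ} (hf : Differentiable ℝ f) (hg : Differentiable ℝ g) (j : Fin 4)
    (x : E4) : pd j (fun x => f x * g x) x = pd j f x * g x + f x * pd j g x := by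
  rw [pd, fderiv_fun_mul (hf x) (hg x)]
  simp [pd]; ring

theorem pd_ijap (j : Fin 4) (x : E4) : pd j ijap x = -(x j * ijap x ^ 3) := by
  have h1 : HasFDerivAt (fun x : E4 => 1 + ‖x‖ ^ 2) (2 • innerSL ℝ x) x :=
    (hasStrictFDerivAt_norm_sq x).hasFDerivAt.const_add 1
  have h2 := (hasDerivAt_inv (jap_pos x).ne').comp_hasFDerivAt x (h1.sqrt (by positivity))
  have h3 : pd j ijap x = _ := congrArg (· (EuclideanSpace.single j (1 : ℝ))) h2.fderiv
  rw [h3]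
  have h4 := jap_pos x
  rw [jap] at h4
  simp [ijap, jap, EuclideanSpace.inner_single_right]
  field_simp

theorem pd_ijap_pow (n : ℕ) (j : Fin 4) (x : E4) :
    pd j (fun x => ijap x ^ (n + 1)) x = -((n + 1) * x j * ijap x ^ (n + 3)) := by
  have hd := ijap_contDiff.differentiable (by simp)
  have h := ((hd x).hasFDerivAt.pow (n + 1)).fderiv
  have h3 : pd j (fun x => ijap x ^ (n + 1)) x =
      _ := congrArg (· (EuclideanSpace.single j (1 : ℝ))) h
  have h4 := pd_ijap j x
  rw [pd] at h4
  rw [h3]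
  simp [h4]
  ring

theorem ijap_pow_contDiff (n : ℕ) : ContDiff ℝ ∞ fun x => ijap x ^ n := ijap_contDiff.pow n

theorem pd_coord_mul_ijap_pow (n : ℕ) (j k : Fin 4) (x : E4) :
    pd j (fun x => x k * ijap x ^ (n + 1)) x =
      (if j = k then 1 else 0) * ijap x ^ (n + 1) - (n + 1) * x j * x k * ijap x ^ (n + 3) := by
  rw [pd_mul_real ((coord_contDiff k).differentiable (by simp))
    ((ijap_pow_contDiff (n + 1)).differentiable (by simp)), pd_coord, pd_ijap_pow]
  ring

theorem abs_ijap_pow_le (n : ℕ) (x : E4) : |ijap x ^ n| ≤ 1 := by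
  rw [abs_of_nonneg (pow_nonneg (ijap_pos x).le n)]
  exact pow_le_one₀ (ijap_pos x).le (ijap_le_one x)

theorem abs_coord_mul_le (n : ℕ) (j : Fin 4) (x : E4) : |x j * ijap x ^ (n + 1)| ≤ 1 := by
  rw [pow_succ', ← mul_assoc, abs_mul]
  exact mul_le_one₀ (abs_mul_ijap_le x j) (abs_nonneg _) (abs_ijap_pow_le n x)

theorem abs_coord_mul_coord_le (n : ℕ) (j k : Fin 4) (x : E4) :
    |x j * x k * ijap x ^ (n + 2)| ≤ 1 := by
  have : x j * x k * ijap x ^ (n + 2) = (x j * ijap x) * (x k * ijap x ^ (n + 1)) := by ring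
  rw [this, abs_mul]
  exact mul_le_one₀ (abs_mul_ijap_le x j) (abs_nonneg _) (abs_coord_mul_le n k x)

/-- The components `xₖ / ⟨x⟩` of the gradient of `⟨x⟩`. -/
def morA (k : Fin 4) (x : E4) : ℝ := x k * ijap x ^ (0 + 1)

/-- The Laplacian `3 ⟨x⟩⁻¹ + ⟨x⟩⁻³` of `⟨x⟩`. -/
def morB (x : E4) : ℝ := 3 * ijap x ^ (0 + 1) + ijap x ^ (2 + 1)

/-- The derivative `∂ⱼ Δ⟨x⟩`. -/
def morC (j : Fin 4) (x : E4) : ℝ := -3 * (x j * ijap x ^ (2 + 1)) - 3 * (x j * ijap x ^ (4 + 1))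

theorem pd_morA (j k : Fin 4) (x : E4) : pd j (morA k) x =
    (if j = k then 1 else 0) * ijap x - x j * x k * ijap x ^ 3 := by
  have := pd_coord_mul_ijap_pow 0 j k x
  have e : morA k = fun x => x k * ijap x ^ (0 + 1) := rfl
  rw [e, this]
  norm_num

theorem pd_lincomb {f g : E4 → ℝ} (hf : Differentiable ℝ f) (hg : Differentiable ℝ g) (c d : ℝ)
    (j : Fin 4) (x : E4) : pd j (fun x => c * f x + d * g x) x = c * pd j f x + d * pd j g x := by
  rw [pd_add (hf.const_mul c) (hg.const_mul d), pd_const_mul hf, pd_const_mul hg]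

theorem sum_pd_morA (x : E4) : ∑ k, pd k (morA k) x = morB x := by
  simp only [pd_morA, if_true, Finset.sum_sub_distrib]
  have h := norm_sq_mul_ijap x
  rw [norm_sq_eq_sum] at h
  have e : ∑ k, x k * x k * ijap x ^ 3 = ((∑ k, x k ^ 2) * ijap x ^ 2) * ijap x := by
    rw [sum_mul, sum_mul]
    exact sum_congr rfl fun k _ => by ring
  rw [e, h, morB]
  simp; ring

theorem coord_ijap_contDiff (n : ℕ) (k : Fin 4) : ContDiff ℝ ∞ fun x => x k * ijap x ^ n :=
  (coord_contDiff k).mul (ijap_pow_contDiff n)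

theorem pd_morB (j : Fin 4) : pd j morB = morC j := by
  ext x
  have := pd_lincomb ((ijap_pow_contDiff (0 + 1)).differentiable (by simp))
    ((ijap_pow_contDiff (2 + 1)).differentiable (by simp)) 3 1 j x
  rw [pd_ijap_pow, pd_ijap_pow] at this
  have e : morB = fun x => 3 * ijap x ^ (0 + 1) + 1 * ijap x ^ (2 + 1) := by ext x; simp [morB]
  rw [e, this, morC]
  norm_num; ring

theorem pd_morC (i j : Fin 4) (x : E4) : pd i (morC j) x =
    -3 * ((if i = j then 1 else 0) * ijap x ^ 3 - 3 * (x i * x j * ijap x ^ 5)) -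
      3 * ((if i = j then 1 else 0) * ijap x ^ 5 - 5 * (x i * x j * ijap x ^ 7)) := by
  have := pd_lincomb ((coord_ijap_contDiff (2 + 1) j).differentiable (by simp))
    ((coord_ijap_contDiff (4 + 1) j).differentiable (by simp)) (-3) (-3) i x
  rw [pd_coord_mul_ijap_pow, pd_coord_mul_ijap_pow] at this
  have e : morC j = fun x => -3 * (x j * ijap x ^ (2 + 1)) + -3 * (x j * ijap x ^ (4 + 1)) := by
    ext x; simp only [morC]; ring
  rw [e, this]
  norm_num; ring

theorem sum_pd_morC_nonpos (x : E4) : ∑ j, pd j (morC j) x ≤ 0 := by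
  simp only [pd_morC, if_true]
  have h := norm_sq_mul_ijap x
  rw [norm_sq_eq_sum] at h
  have e : ∀ n : ℕ, ∑ k, x k * x k * ijap x ^ (n + 2) = (1 - ijap x ^ 2) * ijap x ^ n := by
    intro n
    rw [← h, sum_mul, sum_mul]
    exact sum_congr rfl fun k _ => by ring
  have e5 := e 3
  have e7 := e 5
  simp only [Finset.sum_sub_distrib, ← mul_sum]
  norm_num at e5 e7 ⊢
  rw [e5, e7]
  have := ijap_pos x
  nlinarith [pow_pos this 3, pow_pos this 5, pow_pos this 7]

theorem bddWeight_morA (k : Fin 4) : BddWeight (morA k) := by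
  refine ⟨coord_ijap_contDiff _ k, ⟨1, abs_coord_mul_le 0 k⟩, fun j => ⟨2, fun x => ?_⟩⟩
  rw [pd_morA]
  refine (abs_sub _ _).trans ?_
  have h1 : |x j * x k * ijap x ^ 3| ≤ 1 := abs_coord_mul_coord_le 1 j k x
  have h2 : |(if j = k then (1 : ℝ) else 0) * ijap x| ≤ 1 := by
    have := abs_ijap_pow_le 1 x
    rw [pow_one] at this
    split_ifs
    · rw [one_mul]; exact this
    · simp
  linarith

theorem bddWeight_morB : BddWeight morB := by
  refine ⟨(contDiff_const.mul (ijap_pow_contDiff _)).add (ijap_pow_contDiff _), ⟨4, fun x => ?_⟩,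
    fun j => ⟨6, fun x => ?_⟩⟩
  · refine (abs_add_le _ _).trans ?_
    rw [abs_mul]
    have h1 := abs_ijap_pow_le (0 + 1) x
    have h2 := abs_ijap_pow_le (2 + 1) x
    norm_num at h1 h2 ⊢
    linarith
  · rw [pd_morB, morC]
    refine (abs_sub _ _).trans ?_
    rw [abs_mul, abs_mul]
    have h1 := abs_coord_mul_le 2 j x
    have h2 := abs_coord_mul_le 4 j x
    norm_num at h1 h2 ⊢
    linarith

theorem bddWeight_morC (j : Fin 4) : BddWeight (morC j) := by
  refine ⟨(contDiff_const.mul (coord_ijap_contDiff _ j)).sub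
    (contDiff_const.mul (coord_ijap_contDiff _ j)), ⟨6, fun x => ?_⟩, fun i => ⟨30, fun x => ?_⟩⟩
  · rw [← pd_morB]
    rw [pd_morB, morC]
    refine (abs_sub _ _).trans ?_
    rw [abs_mul, abs_mul]
    have h1 := abs_coord_mul_le 2 j x
    have h2 := abs_coord_mul_le 4 j x
    norm_num at h1 h2 ⊢
    linarith
  · rw [pd_morC]
    have h5 := abs_le.1 (abs_coord_mul_coord_le 3 i j x)
    have h7 := abs_le.1 (abs_coord_mul_coord_le 5 i j x)
    have h2 : ∀ n : ℕ, |(if i = j then (1 : ℝ) else 0) * ijap x ^ n| ≤ 1 := by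
      intro n
      have := abs_ijap_pow_le n x
      split_ifs
      · rw [one_mul]; exact this
      · simp
    have a3 := abs_le.1 (h2 3)
    have a5 := abs_le.1 (h2 5)
    norm_num at h5 h7
    rw [abs_le]
    constructor <;> linarith [h5.1, h5.2, h7.1, h7.2, a3.1, a3.2, a5.1, a5.2]

/-- The Hessian of `⟨x⟩` is nonnegative. -/
theorem sum_hessian_nonneg (x : E4) (z : Fin 4 → ℂ) :
    0 ≤ ∑ j, ∑ k, pd j (morA k) x * (z k * conj (z j)).re := by
  have hz := ijap_pos x
  have key : ∀ r : Fin 4 → ℝ, 0 ≤ ∑ j, ∑ k, pd j (morA k) x * (r k * r j) := by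
    intro r
    have e : ∑ j, ∑ k, pd j (morA k) x * (r k * r j) =
        ijap x * (∑ j, r j ^ 2 - (∑ j, x j * r j) ^ 2 * ijap x ^ 2) := by
      simp only [pd_morA, Fin.sum_univ_four]
      simp
      ring
    rw [e]
    have h := norm_sq_mul_ijap x
    rw [norm_sq_eq_sum] at h
    have hc := Finset.sum_mul_sq_le_sq_mul_sq Finset.univ (fun j => x j) r
    have h1 : (∑ j, x j * r j) ^ 2 * ijap x ^ 2 ≤ (1 - ijap x ^ 2) * ∑ j, r j ^ 2 := by
      rw [← h]
      calc _ ≤ ((∑ j, x j ^ 2) * ∑ j, r j ^ 2) * ijap x ^ 2 := by gcongr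
        _ = _ := by ring
    have h2 : 0 ≤ ∑ j, r j ^ 2 := sum_nonneg fun _ _ => sq_nonneg _
    refine mul_nonneg hz.le ?_
    nlinarith [sq_nonneg (ijap x)]
  have h1 := key fun k => (z k).re
  have h2 := key fun k => (z k).im
  refine (add_nonneg h1 h2).trans (le_of_eq ?_)
  rw [← sum_add_distrib]
  refine sum_congr rfl fun j _ => ?_
  rw [← sum_add_distrib]
  refine sum_congr rfl fun k _ => ?_
  simp
  ring

/-! ### The Morawetz inequality at a fixed time -/

theorem wint_re {a : E4 → ℝ} (ha : Continuous a) (hb : ∃ C, ∀ x, |a x| ≤ C)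
    (hf : MemLp f 2) (hg : MemLp g 2) : (wint a f g).re = ∫ x, a x * (f x * g x).re := by
  have h := integrable_wint ha hb hf hg
  rw [wint, ← reCLM_apply, ← reCLM.integral_comp_comm h]
  simp

theorem wint_im {a : E4 → ℝ} (ha : Continuous a) (hb : ∃ C, ∀ x, |a x| ≤ C)
    (hf : MemLp f 2) (hg : MemLp g 2) : (wint a f g).im = ∫ x, a x * (f x * g x).im := by
  have h := integrable_wint ha hb hf hg
  rw [wint, ← Complex.imCLM_apply, ← Complex.imCLM.integral_comp_comm h]
  simp

theorem memLp_conj (hf : MemLp f p) :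
    MemLp (fun x => conj (f x)) p := hf.star

/-- Pairing the right hand side of the Schrödinger equation with a weighted function. -/
theorem im_wint_flow {a : E4 → ℝ} (ha : BddWeight a) (hf : SmoothLp 2 f)
    (hw : SmoothLp 2 w) (hg : MemLp g 2) :
    (wint a f (fun x => conj (I * lap w x - I * g x))).im =
      ∑ j, ((wint (pd j a) f (fun x => conj (pd j w x))).re +
        (wint a (pd j f) (fun x => conj (pd j w x))).re) +
      (wint a f (fun x => conj (g x))).re := by
  have i1 := integrable_wint ha.1.continuous ha.2.1 hf.memLp (memLp_conj hw.lap)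
  have i2 := integrable_wint ha.1.continuous ha.2.1 hf.memLp (memLp_conj hg)
  have e : wint a f (fun x => conj (I * lap w x - I * g x)) =
      -I * wint a f (fun x => conj (lap w x)) +
        I * wint a f (fun x => conj (g x)) := by
    simp only [wint]
    rw [← integral_const_mul, ← integral_const_mul,
      ← integral_add (i1.const_mul _) (i2.const_mul _)]
    congr 1
    ext x
    simp only [map_sub, map_mul, Complex.conj_I]
    ring
  rw [e, wint_lap ha hf hw]
  simp only [add_im, neg_mul, neg_im, Complex.I_mul_im, neg_re,
    re_sum, add_re, neg_neg]

theorem sum_wint_pd_morA (hf : MemLp f 2) (hg : MemLp g 2) :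
    ∑ k, wint (pd k (morA k)) f g = wint morB f g := by
  simp only [wint]
  rw [← integral_finsetSum _ fun k _ => integrable_wint
    (pd_contDiff (bddWeight_morA k).1 k).continuous ((bddWeight_morA k).2.2 k) hf hg]
  congr 1
  ext x
  rw [← sum_mul, ← sum_pd_morA]
  push_cast
  rfl

theorem sum_re_wint_hessian_nonneg {d : Fin 4 → E4 → ℂ} (hd : ∀ j, MemLp (d j) 2) :
    0 ≤ ∑ j, ∑ k, (wint (pd j (morA k)) (d k) (fun x => conj (d j x))).re := by
  have hc := fun j k => (pd_contDiff (bddWeight_morA k).1 j).continuous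
  have e := fun j k => wint_re (hc j k) ((bddWeight_morA k).2.2 j) (hd k) (memLp_conj (hd j))
  have hi : ∀ j k, Integrable fun x => pd j (morA k) x * (d k x * conj (d j x)).re := by
    intro j k
    have := (integrable_wint (hc j k) ((bddWeight_morA k).2.2 j) (hd k) (memLp_conj (hd j))).re
    refine this.congr (ae_of_all _ fun x => ?_)
    simp
  simp only [e]
  simp only [← integral_finsetSum Finset.univ fun k _ => hi _ k]
  rw [← integral_finsetSum Finset.univ fun j _ => integrable_finsetSum _ fun k _ => hi j k]
  exact integral_nonneg fun x => sum_hessian_nonneg x fun j => d j x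

/-- The sign of `Δ²⟨x⟩`. -/
theorem sum_re_wint_pd_morC_nonpos (hw : MemLp w 2) :
    ∑ j, (wint (pd j (morC j)) w (fun x => conj (w x))).re ≤ 0 := by
  have hc := fun j => (pd_contDiff (bddWeight_morC j).1 j).continuous
  have e := fun j => wint_re (hc j) ((bddWeight_morC j).2.2 j) hw (memLp_conj hw)
  have hi : ∀ j, Integrable fun x => pd j (morC j) x * (w x * conj (w x)).re := by
    intro j
    have := (integrable_wint (hc j) ((bddWeight_morC j).2.2 j) hw (memLp_conj hw)).re
    refine this.congr (ae_of_all _ fun x => ?_)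
    simp
  simp only [e]
  rw [← integral_finsetSum _ fun j _ => hi j]
  refine integral_nonpos fun x => ?_
  simp only [mul_conj, ofReal_re]
  rw [← sum_mul]
  exact mul_nonpos_of_nonpos_of_nonneg (sum_pd_morC_nonpos x) (Complex.normSq_nonneg _)

theorem SmoothLp.flow (hw : SmoothLp 2 w) (hg : SmoothLp 2 g) :
    SmoothLp 2 (fun x => I * ForcedNLS.lap w x - I * g x) := by
  have := (hw.lap_smooth.const_mul I).add (hg.const_mul (-I))
  convert this using 2
  ring

/-- The Morawetz inequality for the weight `⟨x⟩`: the time derivative of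
`∑ₖ Im ∫ (xₖ/⟨x⟩) conj(w) ∂ₖw` along `∂ₜw = i Δw - i g` is bounded from below by the contribution
of `g`, because `⟨x⟩` is convex and `Δ²⟨x⟩ ≤ 0`. -/
theorem morawetz_inequality (hw : SmoothLp 2 w) (hg : SmoothLp 2 g) :
    2 * ∑ k, (wint (morA k) (pd k w) (fun x => conj (g x))).re +
        (wint morB w (fun x => conj (g x))).re ≤
      ∑ k, ((wint (morA k) (pd k w) (fun x => conj (I * lap w x - I * g x))).im +
        (wint (morA k) (fun x => conj (w x))
          (pd k fun x => I * lap w x - I * g x)).im) := by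
  set W := fun x => I * lap w x - I * g x with hWdef
  change _ ≤ ∑ k, ((wint (morA k) (pd k w) (fun x => conj (W x))).im +
    (wint (morA k) (fun x => conj (w x)) (pd k W)).im)
  have hW : SmoothLp 2 W := hw.flow hg
  -- integrate by parts to move the derivative away from `W`
  have hB : ∀ k, (wint (morA k) (fun x => conj (w x)) (pd k W)).im =
      (wint (pd k (morA k)) w (fun x => conj (W x))).im +
        (wint (morA k) (pd k w) (fun x => conj (W x))).im := by
    intro k
    rw [wint_pd (bddWeight_morA k) hw.conj hW k, pd_conj hw.differentiable]
    have h1 := congrArg Complex.im (conj_wint (pd k (morA k)) w (fun x => conj (W x)))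
    have h2 := congrArg Complex.im (conj_wint (morA k) (pd k w) (fun x => conj (W x)))
    simp only [RingHomCompTriple.comp_apply, RingHom.id_apply, conj_im] at h1 h2
    simp only [Complex.sub_im, neg_im, ← h1, ← h2]
    ring
  have hsum : ∑ k, (wint (pd k (morA k)) w (fun x => conj (W x))).im =
      (wint morB w (fun x => conj (W x))).im := by
    rw [← Complex.im_sum, sum_wint_pd_morA hw.memLp hW.conj.memLp]
  have hA : ∀ k, (wint (morA k) (pd k w) (fun x => conj (W x))).im = _ :=
    fun k => im_wint_flow (bddWeight_morA k) (hw.pd k) hw hg.memLp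
  have hM : (wint morB w (fun x => conj (W x))).im = _ := im_wint_flow bddWeight_morB hw hw hg.memLp
  -- the second order terms without a sign cancel
  have c1 : ∑ k, ∑ j, 2 * (wint (morA k) (pd j (pd k w)) (fun x => conj (pd j w x))).re =
      -∑ j, (wint morB (pd j w) (fun x => conj (pd j w x))).re := by
    rw [Finset.sum_comm, ← sum_neg_distrib]
    refine sum_congr rfl fun j _ => ?_
    rw [← sum_wint_pd_morA (hw.pd j).memLp (hw.pd j).conj.memLp, re_sum,
      ← sum_neg_distrib]
    refine sum_congr rfl fun k _ => ?_
    rw [pd_pd_comm hw.1 j k]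
    exact two_re_wint (bddWeight_morA k) (hw.pd j) k
  have c2 : ∀ j, (wint (morC j) w (fun x => conj (pd j w x))).re =
      -(1 / 2) * (wint (pd j (morC j)) w (fun x => conj (w x))).re := by
    intro j
    have h1 := two_re_wint (bddWeight_morC j) hw j
    have h2 := congrArg Complex.re (conj_wint (morC j) (pd j w) (fun x => conj (w x)))
    simp only [RingHomCompTriple.comp_apply, RingHom.id_apply, Complex.conj_re] at h2
    rw [wint_comm _ _ w] at h2
    rw [← h2]
    linarith
  have p1 := sum_re_wint_hessian_nonneg fun j => (hw.pd j).memLp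
  have p2 := sum_re_wint_pd_morC_nonpos hw.memLp
  rw [Finset.sum_comm] at p1
  simp only [hB, sum_add_distrib, hsum, hM, pd_morB, c2, ← mul_sum]
  simp only [hA, sum_add_distrib]
  simp only [← mul_sum] at c1
  linarith

/-! ### Further identities at a fixed time -/

instance : HolderTriple p₄₃ 4 1 := holderTriple_four_thirds

instance : HolderTriple 4 p₄₃ 1 := holderTriple_four_thirds.symm

/-- Pairing the Laplacian with the nonlinearity. -/
theorem integral_conj_cub_lap (hw : SmoothLp 4 w) :
    ∫ x, conj (cub w x) * (I * lap w x) =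
      -∑ j, ∫ x, conj (dcub w (pd j w) x) * (I * pd j w x) := by
  have hG := MemLp.cub_four hw.memLp
  have hGd : Differentiable ℝ (fun x => conj (cub w x)) :=
    (conjCLE.contDiff.comp (cub_contDiff hw.1)).differentiable (by simp)
  have h1 : ∀ j, pd j (fun x => conj (cub w x)) = fun x => conj (dcub w (pd j w) x) := fun j => by
    rw [pd_conj ((cub_contDiff hw.1).differentiable (by simp)), pd_cub hw.1]
  have e : ∀ j, ∫ x, conj (cub w x) * pd j (pd j w) x =
      -∫ x, conj (dcub w (pd j w) x) * pd j w x := by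
    intro j
    have := integral_mul_pd hGd (hw.pd j).differentiable j
      (by rw [h1]; exact integrable_fun_mul (p := p₄₃) (q := 4)
            (memLp_conj (MemLp.dcub hw.memLp (hw.pd j).memLp)) (hw.pd j).memLp)
      (integrable_fun_mul (p := p₄₃) (q := 4) (memLp_conj hG) ((hw.pd j).pd j).memLp)
      (integrable_fun_mul (p := p₄₃) (q := 4) (memLp_conj hG) (hw.pd j).memLp)
    rw [h1] at this
    exact this
  have e1 : ∀ j, ∫ x, conj (dcub w (pd j w) x) * (I * pd j w x) =
      I * ∫ x, conj (dcub w (pd j w) x) * pd j w x := by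
    intro j
    rw [← integral_const_mul]
    congr 1; ext x; ring
  have e2 : ∫ x, conj (cub w x) * (I * lap w x) =
      I * ∑ j, ∫ x, conj (cub w x) * pd j (pd j w) x := by
    rw [← integral_finsetSum _ fun j _ => integrable_fun_mul (p := p₄₃)
      (q := 4) (memLp_conj hG) ((hw.pd j).pd j).memLp, ← integral_const_mul]
    congr 1; ext x
    simp only [lap, mul_sum]
    exact sum_congr rfl fun j _ => by ring
  rw [e2]
  simp only [e, e1, sum_neg_distrib, ← mul_sum]
  ring

/-- A localized form of mass conservation for the free flow. -/
theorem abs_re_integral_cut_conj_lap_le {χ : E4 → ℝ} (hχ : ContDiff ℝ ∞ χ)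
    (hc : HasCompactSupport χ) (hw : ContDiff ℝ ∞ w) :
    ofReal |∫ x, χ x * (conj (w x) * (I * lap w x)).re| ≤
      ∑ j, N[4] (pd j χ) * (N[4] w * N[2] (pd j w)) := by
  have hcc : Continuous fun x => conj (w x) := continuous_conj.comp hw.continuous
  have hl : ∀ j, Continuous (pd j (pd j w)) := fun
      j => (pd_contDiff (pd_contDiff hw j) j).continuous
  have hp : ∀ j, Continuous (pd j w) := fun j => (pd_contDiff hw j).continuous
  have hpχ : ∀ j, Continuous (pd j χ) := fun j => (pd_contDiff hχ j).continuous
  have hχc := hχ.continuous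
  have rc : HasCompactSupport (rk χ) := hc.comp_left (g := fun x : ℝ => (x : ℂ)) (by simp)
  have rpc : ∀ j, HasCompactSupport (rk (pd j χ)) := fun j =>
    (pd_hasCompactSupport hc j).comp_left (g := fun x : ℝ => (x : ℂ)) (by simp)
  have rkc := rk_continuous hχc
  have rpkc := fun j => rk_continuous (hpχ j)
  have I0 : ∀ g : E4 → ℂ, Continuous g → Integrable fun x => rk χ x * g x := fun g hg =>
    (rkc.mul hg).integrable_of_hasCompactSupport rc.mul_right
  have I1 : ∀ j, ∀ g : E4 → ℂ, Continuous g → Integrable fun x => rk (pd j χ) x * g x :=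
    fun j g hg => ((rpkc j).mul hg).integrable_of_hasCompactSupport (rpc j).mul_right
  have hwd := hw.differentiable (by simp)
  have hχd := (rk_contDiff hχ).differentiable (by simp)
  have hcd : Differentiable ℝ fun x => conj (w x) :=
    (conjCLE.contDiff.comp hw).differentiable (by simp)
  have hpp : ∀ j, pd j (fun x => rk χ x * conj (w x)) =
      fun x => rk (pd j χ) x * conj (w x) + rk χ x * conj (pd j w x) := by
    intro j; ext x
    rw [pd_mul hχd hcd, pd_rk (hχ.differentiable (by simp)), pd_conj hwd]
  have J3 : ∀ j, Integrable fun x =>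
      rk χ x * (conj (w x) * (I * pd j (pd j w) x)) := fun j =>
    I0 (fun x => conj (w x) * (I * pd j (pd j w) x)) (hcc.mul (continuous_const.mul (hl j)))
  have e : ∀ j, (∫ x, rk χ x * (conj (w x) * (I * pd j (pd j w) x))).re =
      -(∫ x, rk (pd j χ) x * (conj (w x) * (I * pd j w x))).re := by
    intro j
    have J1 := I1 j (fun x => conj (w x) * (I * pd j w x))
      (hcc.mul (continuous_const.mul (hp j)))
    have J2 := I0 (fun x => conj (pd j w x) * (I * pd j w x))
      ((continuous_conj.comp (hp j)).mul (continuous_const.mul (hp j)))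
    have := integral_mul_pd (f := fun x => rk χ x * conj (w x))
      (g := fun x => I * pd j w x) (hχd.mul hcd)
      ((contDiff_const.mul (pd_contDiff hw j)).differentiable (by simp)) j
      (by rw [hpp]; refine (J1.add J2).congr (ae_of_all _ fun x => ?_)
          simp only [Pi.add_apply]; ring)
      (by
        have h2 : pd j (fun x => I * pd j w x) = fun x => I * pd j (pd j w) x := by
          ext x
          rw [pd, fderiv_const_mul ((pd_contDiff hw j).differentiable (by simp) x)]; rfl
        rw [h2]
        refine (J3 j).congr (ae_of_all _ fun x => ?_)
        ring)
      (by refine (I0 (fun x => conj (w x) * (I * pd j w x))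
            (hcc.mul (continuous_const.mul (hp j)))).congr (ae_of_all _ fun x => ?_)
          ring)
    have h2 : pd j (fun x => I * pd j w x) = fun x => I * pd j (pd j w) x := by
      ext x
      rw [pd, fderiv_const_mul ((pd_contDiff hw j).differentiable (by simp) x)]; rfl
    rw [h2, hpp] at this
    have e1 : ∫ x, rk χ x * (conj (w x) * (I * pd j (pd j w) x)) =
        ∫ x, rk χ x * conj (w x) * (I * pd j (pd j w) x) := by
      congr 1; ext x; ring
    have e2 : ∫ x, (rk (pd j χ) x * conj (w x) + rk χ x * conj (pd j w x)) *
        (I * pd j w x) =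
        (∫ x, rk (pd j χ) x * (conj (w x) * (I * pd j w x))) +
        ∫ x, rk χ x * (conj (pd j w x) * (I * pd j w x)) := by
      rw [← integral_add J1 J2]
      congr 1; ext x; ring
    have e3 : (∫ x, rk χ x * (conj (pd j w x) * (I * pd j w x))).re = 0 := by
      rw [← reCLM_apply, ← reCLM.integral_comp_comm J2]
      refine integral_eq_zero_of_ae (ae_of_all _ fun x => ?_)
      have : conj (pd j w x) * (I * pd j w x) =
          I * ((Complex.normSq (pd j w x) : ℝ) : ℂ) := by
        rw [← mul_conj]; ring
      simp only [this, reCLM_apply, rk, re_ofReal_mul, I_mul_re,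
        ofReal_im]
      simp
    rw [e1, this, e2, neg_re, add_re, e3, add_zero]
  have e0 : ∫ x, χ x * (conj (w x) * (I * lap w x)).re =
      -∑ j, (∫ x, rk (pd j χ) x * (conj (w x) * (I * pd j w x))).re := by
    rw [← sum_neg_distrib]
    simp only [← e]
    rw [← re_sum, ← integral_finsetSum _ fun j _ => J3 j, ← reCLM_apply,
      ← reCLM.integral_comp_comm (integrable_finsetSum _ fun j _ => J3 j)]
    congr 1; ext x
    simp only [← mul_sum, lap, reCLM_apply, rk]
    rw [re_ofReal_mul]
  rw [e0, abs_neg]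
  calc ofReal |∑ j, (∫ x, rk (pd j χ) x * (conj (w x) * (I * pd j w x))).re|
      ≤ ∑ j, ‖∫ x, rk (pd j χ) x * (conj (w x) * (I * pd j w x))‖ₑ := by
        rw [← enorm_eq_ofReal_abs]
        refine (enorm_sum_le _ _).trans (sum_le_sum fun j _ => ?_)
        rw [enorm_eq_ofReal_abs, ← ofReal_norm]
        exact ofReal_le_ofReal (abs_re_le_norm _)
    _ ≤ _ := by
        refine sum_le_sum fun j _ => ?_
        refine (enorm_integral_le_lintegral_enorm _).trans ?_
        rw [← eLpNorm_one_eq_lintegral_enorm]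
        have s1 : N[p₄₃] (fun x => conj (w x) * (I * pd j w x)) ≤ N[4] w * N[2] (pd j w) := by
          have : HolderTriple 4 2 p₄₃ := holderTriple_two_four.symm
          refine (eLpNorm_fun_mul_le (p := 4) (q := 2) hcc.aestronglyMeasurable
            (continuous_const.mul (hp j)).aestronglyMeasurable).trans (le_of_eq ?_)
          congr 1
          · exact eLpNorm_congr_norm_ae (ae_of_all _ fun x => by simp)
          · exact eLpNorm_congr_norm_ae (ae_of_all _ fun x => by simp)
        refine (eLpNorm_fun_mul_le (p := 4) (q := p₄₃)
          (g := fun x => conj (w x) * (I * pd j w x)) (rpkc j).aestronglyMeasurable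
          (hcc.mul (continuous_const.mul (hp j))).aestronglyMeasurable).trans ?_
        refine mul_le_mul' ?_ s1
        exact le_of_eq (eLpNorm_congr_norm_ae (ae_of_all _ fun x => by simp [rk]))

theorem memLp_weight {a : E4 → ℝ} (ha : Continuous a) (hb : ∃ C, ∀ x, |a x| ≤ C) :
    MemLp (rk a) ⊤ := by
  obtain ⟨C, hC⟩ := hb
  exact memLp_top_of_bound (rk_continuous ha).aestronglyMeasurable C
    (ae_of_all _ fun x => by rw [rk, norm_real]; exact hC x)

/-- The weak form of `∂ₖ |u|⁴ = 4 Re (conj(|u|²u) ∂ₖu)`, tested against a weight. -/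
theorem integral_weight_conj_cub {a : E4 → ℝ} (ha : BddWeight a) {k : Fin 4}
    (h : HasWeakDer k u d) (hu : MemLp u 4) (hd : MemLp d 4) :
    ∫ x, a x * (conj (cub u x) * d x).re = -(1 / 4) * ∫ x, pd k a x * ‖u x‖ ^ 4 := by
  have hac := ha.1.continuous
  have hpc := (pd_contDiff ha.1 k).continuous
  have had : Differentiable ℝ (rk a) := (rk_contDiff ha.1).differentiable (by simp)
  have l1 := LpTendsto.const (memLp_weight hac ha.2.1)
  have l2 := LpTendsto.const (memLp_weight hpc (ha.2.2 k))
  have lu : LpTendsto 4 (fun n => mo n u) u := LpTendsto.mol (by norm_num) (by simp) hu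
  have ld : LpTendsto 4 (fun n => mo n d) d := LpTendsto.mol (by norm_num) (by simp) hd
  have t1 : LpTendsto 1 (fun n x => cub (mo n u) x * conj (mo n u x))
      (fun x => cub u x * conj (u x)) := lu.cub_four.mul le_rfl lu.conj
  have t2 : LpTendsto 1 (fun n x => dcub (mo n u) (mo n d) x * conj (mo n u x))
      (fun x => dcub u d x * conj (u x)) := (lu.dcub ld).mul le_rfl lu.conj
  have t3 : LpTendsto 1 (fun n x => cub (mo n u) x * conj (mo n d x))
      (fun x => cub u x * conj (d x)) := lu.cub_four.mul le_rfl ld.conj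
  have r1 := (l2.mul le_rfl t1).integral
  have r2 := (l1.mul le_rfl (t2.add le_rfl t3)).integral
  -- the identity for the mollified functions
  have key : ∀ n, ∫ x, rk a x * ((fun x => dcub (mo n u) (mo n d) x * conj (mo n u x)) +
      fun x => cub (mo n u) x * conj (mo n d x)) x =
      -∫ x, rk (pd k a) x * (cub (mo n u) x * conj (mo n u x)) := by
    intro n
    have hs := smoothLp_mo (by norm_num) hu n
    have hcd : Differentiable ℝ (cub (mo n u)) := (cub_contDiff hs.1).differentiable (by simp)
    have hp : pd k (fun x => cub (mo n u) x * conj (mo n u x)) =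
        (fun x => dcub (mo n u) (mo n d) x * conj (mo n u x)) +
          fun x => cub (mo n u) x * conj (mo n d x) := by
      ext x
      rw [pd_mul hcd hs.conj.differentiable, pd_cub hs.1, pd_conj hs.differentiable, h.pd_mo]
      rfl
    have := integral_mul_pd (f := rk a) (g := fun x => cub (mo n u) x * conj (mo n u x)) had
      (hcd.mul hs.conj.differentiable) k
      (by rw [pd_rk (ha.1.differentiable (by simp))]
          exact memLp_one_iff_integrable.1 ((l2.mul le_rfl t1).memLp n))
      (by rw [hp]; exact memLp_one_iff_integrable.1 ((l1.mul le_rfl (t2.add le_rfl t3)).memLp n))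
      (memLp_one_iff_integrable.1 ((l1.mul le_rfl t1).memLp n))
    rw [hp, pd_rk (ha.1.differentiable (by simp))] at this
    exact this
  simp only [key] at r2
  have e := tendsto_nhds_unique r2 r1.neg
  have i2 := memLp_one_iff_integrable.1 (l1.mul le_rfl (t2.add le_rfl t3)).memLp_lim
  have i1 := memLp_one_iff_integrable.1 (l2.mul le_rfl t1).memLp_lim
  have e' := congrArg Complex.re e
  rw [neg_re, ← reCLM_apply, ← reCLM_apply,
    ← reCLM.integral_comp_comm i1, ← reCLM.integral_comp_comm i2] at e'
  have s1 : ∀ x, reCLM (rk a x * ((fun x => dcub u d x * conj (u x)) +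
      fun x => cub u x * conj (d x)) x) =
      4 * (a x * (conj (cub u x) * d x).re) := by
    intro x
    simp only [reCLM_apply, rk, Pi.add_apply, re_ofReal_mul, dcub, cub_eq]
    simp
    ring
  have s2 : ∀ x, reCLM (rk (pd k a) x * (cub u x * conj (u x))) = pd k a x * ‖u x‖ ^ 4 := by
    intro x
    have : cub u x * conj (u x) = ((‖u x‖ ^ 4 : ℝ) : ℂ) := by
      rw [cub, mul_assoc, mul_conj, normSq_eq_norm_sq]
      push_cast; ring
    simp only [this, rk]
    rw [← Complex.ofReal_mul]
    exact ofReal_re _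
  simp only [s1, s2] at e'
  rw [integral_const_mul] at e'
  linarith

/-! ### Regular solutions on a bounded time interval -/

/-- The function of time that dominates the time derivatives of the mass, energy and momentum. -/
def control (u : E4 → ℂ) (dv dF : Fin 4 → E4 → ℂ) : ℝ≥0∞ :=
  (∑ j, (N[4] (dv j) + N[4] (dF j))) ^ 2 + N[6] u ^ 6 + 1

/-- The regularity of `v(t)` and `F(t)` at almost every time `t`; `dv` and `dF` are the weak
gradients, and `M` bounds the norms that stay bounded in time. -/
structure Slice (v F : E4 → ℂ) (dv dF : Fin 4 → E4 → ℂ) (M : ℝ≥0∞) : Prop where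
  v4 : MemLp v 4
  F2 : MemLp F 2
  F4 : MemLp F 4
  u6 : MemLp (F ⊞ v) 6
  dv2 : ∀ j, MemLp (dv j) 2
  dv4 : ∀ j, MemLp (dv j) 4
  dF4 : ∀ j, MemLp (dF j) 4
  hv : ∀ j, HasWeakDer j v (dv j)
  hF : ∀ j, HasWeakDer j F (dF j)
  v4_le : N[4] v ≤ M
  F2_le : N[2] F ≤ M
  F4_le : N[4] F ≤ M
  dv2_le : ∀ j, N[2] (dv j) ≤ M

/-- A solution `v` with forcing `F` on the bounded interval `(a, b)`, in terms of jointly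
measurable representatives. The equations are stated for all regularizations in space. -/
structure Regular (a b : ℝ) (v F : ℝ → E4 → ℂ) (dv dF : Fin 4 → ℝ → E4 → ℂ) (M : ℝ≥0∞) : Prop where
  hab : a < b
  one_le : 1 ≤ M
  ne_top : M ≠ ⊤
  meas_v : StronglyMeasurable (uncurry v)
  meas_F : StronglyMeasurable (uncurry F)
  meas_dv : ∀ j, StronglyMeasurable (uncurry (dv j))
  meas_dF : ∀ j, StronglyMeasurable (uncurry (dF j))
  slice : ∀ᵐ t ∂vol[a,b], Slice (v t) (F t) (fun j => dv j t) (fun j => dF j t) M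
  control_lt : ∫⁻ t in Ioo a b,
    control (F t ⊞ v t) (fun j => dv j t) (fun j => dF j t) < ⊤
  eq_v : ∀ k : E4 → ℝ, ContDiff ℝ ∞ k → HasCompactSupport k → ∀ x,
    HasWeakDerivC a b (fun t => cv (rk k) (v t) x) (fun t => I * cv (rk (lap k)) (v t) x -
      I * cv (rk k) (cub fun x => F t x + v t x) x)
  eq_F : ∀ k : E4 → ℝ, ContDiff ℝ ∞ k → HasCompactSupport k → ∀ x,
    HasWeakDerivC a b (fun t => cv (rk k) (F t) x) (fun t => I * cv (rk (lap k)) (F t) x)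

theorem Slice.u4 (h : Slice v F dv dF M) :
    MemLp (F ⊞ v) 4 := h.F4.add h.v4

theorem Slice.u4_le (h : Slice v F dv dF M) :
    N[4] (F ⊞ v) ≤ 2 * M := by
  refine (eLpNorm_add_le h.F4.1 h.v4.1 (by norm_num)).trans ?_
  rw [two_mul]
  exact add_le_add h.F4_le h.v4_le

theorem pow_three_le (x : ℝ≥0∞) : x ^ 3 ≤ x ^ 6 + 1 := by
  rcases le_total x 1 with h | h
  · exact (pow_le_one' h 3).trans le_add_self
  · exact (pow_le_pow_right' h (by norm_num)).trans le_self_add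

theorem eLpNorm_six_pow_three_le (u : E4 → ℂ) (dv dF : Fin 4 → E4 → ℂ) :
    N[6] u ^ 3 ≤ control u dv dF := by
  refine (pow_three_le _).trans ?_
  rw [control, add_assoc]
  exact le_add_self

theorem one_le_control (u : E4 → ℂ) (dv dF : Fin 4 → E4 → ℂ) : 1 ≤ control u dv dF := le_add_self

theorem measurable_control {v F : ℝ → E4 → ℂ} {dv dF : Fin 4 → ℝ → E4 → ℂ}
    (h : Regular a b v F dv dF M) :
    Measurable fun t => control (F t ⊞ v t) (fun j => dv j t) (fun j => dF j t) := by
  unfold control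
  refine ((Measurable.pow_const (Finset.measurable_sum _ fun j _ => ?_) 2).add
    (Measurable.pow_const ?_ 6)).add measurable_const
  · exact (measurable_eLpNorm_slice (h.meas_dv j) 4).add (measurable_eLpNorm_slice (h.meas_dF j) 4)
  · exact measurable_eLpNorm_slice (w := fun t x => F t x + v t x) (h.meas_F.add h.meas_v) 6

/-! ### Weak time derivatives of spatial integrals -/

theorem hasWeakDeriv_slice {Φ : ℝ → ℝ≥0∞} (hΦ : ∫⁻ t in Ioo a b, Φ t < ⊤) {C : ℝ≥0∞}
    (hC : C ≠ ⊤) {e s : ℝ → E4 → ℝ} (h : ∀ x, HasWeakDeriv a b (fun t => e t x) (fun t => s t x))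
    (he : StronglyMeasurable (uncurry e)) (hs : StronglyMeasurable (uncurry s))
    (heb : ∀ᵐ t ∂vol[a,b], N[1] (e t) ≤ C * Φ t)
    (hsb : ∀ᵐ t ∂vol[a,b], N[1] (s t) ≤ C * Φ t) :
    HasWeakDeriv a b (fun t => ∫ x, e t x) (fun t => ∫ x, s t x) := by
  have key : ∀ g : ℝ → E4 → ℝ, StronglyMeasurable (uncurry g) →
      (∀ᵐ t ∂vol[a,b], N[1] (g t) ≤ C * Φ t) →
      Integrable (uncurry g) ((vol[a,b]).prod volume) := by
    intro g hg hb
    refine ⟨hg.aestronglyMeasurable, ?_⟩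
    rw [HasFiniteIntegral, lintegral_prod _ hg.enorm.aemeasurable]
    calc ∫⁻ t in Ioo a b, ∫⁻ x, ‖g t x‖ₑ ≤ ∫⁻ t in Ioo a b, C * Φ t := by
          refine lintegral_mono_ae ?_
          filter_upwards [hb] with t ht
          rwa [← eLpNorm_one_eq_lintegral_enorm]
      _ = C * ∫⁻ t in Ioo a b, Φ t := lintegral_const_mul' _ _ hC
      _ < ⊤ := mul_lt_top hC.lt_top hΦ
  exact hasWeakDeriv_integral h (key e he heb) (key s hs hsb)

/-- Weak time derivatives pass to limits that are dominated by a multiple of an integrable function.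
-/
theorem hasWeakDeriv_of_tendsto_of_le {Φ : ℝ → ℝ≥0∞} (hm : Measurable Φ)
    (hΦ : ∫⁻ t in Ioo a b, Φ t < ⊤) {C : ℝ≥0∞} (hC : C ≠ ⊤) {f s : ℕ → ℝ → ℝ} {f₀ s₀ : ℝ → ℝ}
    (h : ∀ n, HasWeakDeriv a b (f n) (s n))
    (hf : ∀ᵐ t ∂vol[a,b], (∀ n, ‖f n t‖ₑ ≤ C * Φ t) ∧ Tendsto (fun n => f n t) atTop (𝓝 (f₀ t)))
    (hs : ∀ᵐ t ∂vol[a,b], (∀ n, ‖s n t‖ₑ ≤ C * Φ t) ∧ Tendsto (fun n => s n t) atTop (𝓝 (s₀ t))) :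
    HasWeakDeriv a b f₀ s₀ := by
  have hfin : ∫⁻ t in Ioo a b, C * Φ t < ⊤ := by
    rw [lintegral_const_mul' _ _ hC]; exact mul_lt_top hC.lt_top hΦ
  have hm' : Measurable fun t => C * Φ t := hm.const_mul C
  have hA : IntegrableOn (fun t => (C * Φ t).toReal) (Ioo a b) :=
    integrable_toReal_of_lintegral_ne_top hm'.aemeasurable hfin.ne
  have hlt := ae_lt_top hm' hfin.ne
  refine hasWeakDeriv_of_tendsto h hA hA ?_ ?_ (hf.mono fun t ht => ht.2) (hs.mono fun t ht => ht.2)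
  · intro n
    filter_upwards [hf, hlt] with t ht h2
    rw [← norm_eq_abs, ← toReal_enorm]
    exact toReal_mono h2.ne (ht.1 n)
  · intro n
    filter_upwards [hs, hlt] with t ht h2
    rw [← norm_eq_abs, ← toReal_enorm]
    exact toReal_mono h2.ne (ht.1 n)

theorem uIoc_subset_Ioo {s t : ℝ} (hs : s ∈ Ioo a b) (ht : t ∈ Ioo a b) : uIoc s t ⊆ Ioo a b :=
  uIoc_subset_uIcc.trans (OrdConnected.uIcc_subset ordConnected_Ioo hs ht)

theorem HasWeakDeriv.ae_abs_sub_le (hab : a < b) {f s : ℝ → ℝ}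
    (h : HasWeakDeriv a b f s) {C : ℝ} (hs : ∀ᵐ t ∂vol[a,b], |s t| ≤ C) :
    ∀ᵐ t₁ ∂vol[a,b], ∀ᵐ t₂ ∂vol[a,b],
      |f t₂ - f t₁| ≤ C * |t₂ - t₁| := by
  filter_upwards [h.ae_sub_eq hab, ae_restrict_mem measurableSet_Ioo] with t₁ h1 m1
  filter_upwards [h1, ae_restrict_mem measurableSet_Ioo] with t₂ h2 m2
  rw [h2, ← norm_eq_abs]
  refine intervalIntegral.norm_integral_le_of_norm_le_const_ae ?_
  have := (ae_restrict_iff' measurableSet_Ioo).1 hs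
  filter_upwards [this] with t ht htm
  exact ht (uIoc_subset_Ioo m1 m2 htm)

/-- The filter of almost all times tending to `0`. Initial values are attained along it by functions
of time that are known almost everywhere only. -/
def nearZero : Filter ℝ := 𝓝 0 ⊓ ae volume

instance : nearZero.NeBot := by
  rw [nearZero, Filter.inf_neBot_iff]
  intro s hs t ht
  by_contra hne
  rw [not_nonempty_iff_eq_empty] at hne
  have h1 : s ⊆ tᶜ := fun x hx hxt => (Set.eq_empty_iff_forall_notMem.1 hne x) ⟨hx, hxt⟩
  have h2 : volume s = 0 := measure_mono_null h1 (mem_ae_iff.1 ht)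
  exact (Measure.measure_pos_of_mem_nhds volume hs).ne' h2

theorem eventually_nearZero (h0 : (0 : ℝ) ∈ Ioo a b) {p : ℝ → Prop}
    (hp : ∀ᵐ t ∂vol[a,b], p t) : ∀ᶠ t in nearZero, p t := by
  have h1 : ∀ᶠ t in nearZero, t ∈ Ioo a b → p t :=
    ((ae_restrict_iff' measurableSet_Ioo).1 hp).filter_mono inf_le_right
  have h2 : ∀ᶠ t in nearZero, t ∈ Ioo a b :=
    Filter.Eventually.filter_mono inf_le_left (isOpen_Ioo.mem_nhds h0)
  filter_upwards [h1, h2] with t ht h using ht h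

theorem exists_seq_nearZero {p : ℝ → Prop} (hp : ∀ᶠ t in nearZero, p t) {g : ℝ → ℝ≥0∞}
    (hg : Tendsto g nearZero (𝓝 0)) :
    ∃ t : ℕ → ℝ, (∀ n, p (t n)) ∧ Tendsto t atTop (𝓝 0) ∧
      Tendsto (fun n => g (t n)) atTop (𝓝 0) := by
  have h1 : ∀ n : ℕ, ∃ t, p t ∧ |t| < 1 / ((n : ℝ) + 1) ∧ g t < ((n : ℝ≥0∞) + 1)⁻¹ := by
    intro n
    have a1 : ∀ᶠ t in nearZero, |t| < 1 / ((n : ℝ) + 1) := by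
      refine Filter.Eventually.filter_mono inf_le_left ?_
      have := Metric.ball_mem_nhds (0 : ℝ) (ε := 1 / ((n : ℝ) + 1)) (by positivity)
      filter_upwards [this] with t ht
      simpa [Real.dist_eq] using ht
    have a2 : ∀ᶠ t in nearZero, g t < ((n : ℝ≥0∞) + 1)⁻¹ := hg.eventually (Iio_mem_nhds (by simp))
    exact (hp.and (a1.and a2)).exists
  choose t ht using h1
  refine ⟨t, fun n => (ht n).1, ?_, ?_⟩
  · refine squeeze_zero_norm (fun n => ?_) tendsto_one_div_add_atTop_nhds_zero_nat
    exact (ht n).2.1.le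
  · refine tendsto_of_tendsto_of_tendsto_of_le_of_le tendsto_const_nhds ?_ (fun _ => zero_le)
      (fun n => (ht n).2.2.le)
    have := ENNReal.tendsto_inv_nat_nhds_zero.comp (tendsto_add_atTop_nat 1)
    refine this.congr fun n => ?_
    simp

/-! ### The mass of `v` -/

section Mass

variable {v F : ℝ → E4 → ℂ} {dv dF : Fin 4 → ℝ → E4 → ℂ}

theorem stronglyMeasurable_cub {u : ℝ → E4 → ℂ} (hu : StronglyMeasurable (uncurry u)) :
    StronglyMeasurable (uncurry fun t => cub (u t)) := by
  have : (uncurry fun t => cub (u t)) = fun z => ((‖uncurry u z‖ ^ 2 : ℝ) : ℂ) * uncurry u z := rfl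
  rw [this]
  exact (continuous_ofReal.comp_stronglyMeasurable (hu.norm.pow 2)).mul hu

theorem Regular.meas_u (h : Regular a b v F dv dF M) :
    StronglyMeasurable (uncurry fun t x => F t x + v t x) := h.meas_F.add h.meas_v

theorem Regular.meas_cub (h : Regular a b v F dv dF M) :
    StronglyMeasurable (uncurry fun t => cub fun x => F t x + v t x) :=
  stronglyMeasurable_cub h.meas_u

theorem stronglyMeasurable_cv_test (hk : ContDiff ℝ ∞ k) {w : ℝ → E4 → ℂ}
    (hw : StronglyMeasurable (uncurry w)) :
    StronglyMeasurable (uncurry fun t x => cv (rk k) (w t) x) :=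
  stronglyMeasurable_cv (rk_continuous hk.continuous) hw

/-- The Laplacian of a regularization only involves the gradient of the function. -/
theorem cv_lap_eq {w : E4 → ℂ} {d : Fin 4 → E4 → ℂ} (h : ∀ j, HasWeakDer j w (d j))
    (hk : ContDiff ℝ ∞ k) (hc : HasCompactSupport k) :
    cv (rk (lap k)) w = fun x => ∑ j, cv (rk (pd j k)) (d j) x := by
  rw [cv_lap (h 0).1 hk hc]
  ext x
  simp only [lap]
  refine sum_congr rfl fun j _ => ?_
  rw [pd_cv (h j).1 hk hc, (h j).cv_pd hk hc, pd_cv (h j).2.1 hk hc]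

theorem eLpNorm_cv_lap_le {w : E4 → ℂ} {d : Fin 4 → E4 → ℂ} (h : ∀ j, HasWeakDer j w (d j))
    (hp : 1 ≤ p) (hd : ∀ j, MemLp (d j) p)
    (hk : ContDiff ℝ ∞ k) (hc : HasCompactSupport k)
    (hM : ∀ j, N[p] (d j) ≤ M) :
    N[p] (cv (rk (lap k)) w) ≤ (∑ j, N[1] (rk (pd j k))) * M := by
  rw [cv_lap_eq h hk hc, sum_mul]
  have hr : ∀ j, MemLp (rk (pd j k)) 1 := fun j =>
    rk_memLp (pd_contDiff hk j).continuous (pd_hasCompactSupport hc j) 1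
  have e : (fun x => ∑ j, cv (rk (pd j k)) (d j) x) = ∑ j, cv (rk (pd j k)) (d j) := by ext x; simp
  rw [e]
  refine (eLpNorm_sum_le (fun j _ => (memLp_cv (hr j) hp (hd j)).1) hp).trans
    (sum_le_sum fun j _ => ?_)
  exact (eLpNorm_cv_le (hr j).1 (hd j).1 hp).trans (mul_le_mul' le_rfl (hM j))

theorem sum_eLpNorm_pd_ne_top (hk : ContDiff ℝ ∞ k) (hc : HasCompactSupport k) :
    ∑ j, N[1] (rk (pd j k)) ≠ ⊤ :=
  (sum_lt_top.2 fun j _ =>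
    (rk_memLp (pd_contDiff hk j).continuous (pd_hasCompactSupport hc j) 1).2).ne

theorem Slice.cub_le {v F : E4 → ℂ} {dv dF : Fin 4 → E4 → ℂ} (h : Slice v F dv dF M) :
    N[2] (cub fun x => F x + v x) ≤ control (F ⊞ v) dv dF :=
  (eLpNorm_cub_six_le h.u6.1).trans (eLpNorm_six_pow_three_le _ _ _)

/-- The right hand side of the regularized equation for `v` is square integrable. -/
theorem Slice.flow_le {v F : E4 → ℂ} {dv dF : Fin 4 → E4 → ℂ} (h : Slice v F dv dF M)
    (hk : ContDiff ℝ ∞ k) (hc : HasCompactSupport k) :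
    N[2] (fun x => I * cv (rk (lap k)) v x -
        I * cv (rk k) (cub fun x => F x + v x) x) ≤
      ((∑ j, N[1] (rk (pd j k))) * M + N[1] (rk k)) * control (F ⊞ v) dv dF := by
  have hN := MemLp.cub_six h.u6
  have hr := rk_memLp hk.continuous hc 1
  have hl : MemLp (cv (rk (lap k)) v) 2 := by
    rw [cv_lap_eq h.hv hk hc]
    exact memLp_finsetSum _ fun j _ => memLp_cv (rk_memLp (pd_contDiff hk j).continuous
      (pd_hasCompactSupport hc j) 1) (by norm_num) (h.dv2 j)
  have hn : MemLp (cv (rk k) (cub fun x => F x + v x)) 2 := memLp_cv hr (by norm_num) hN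
  have n1 : N[2] (fun x => I * cv (rk (lap k)) v x) = N[2] (cv (rk (lap k)) v) :=
    eLpNorm_congr_norm_ae (ae_of_all _ fun x => by simp)
  have n2 : N[2] (fun x => I * cv (rk k) (cub fun x => F x + v x) x) =
      N[2] (cv (rk k) (cub fun x => F x + v x)) :=
    eLpNorm_congr_norm_ae (ae_of_all _ fun x => by simp)
  refine (eLpNorm_sub_le (hl.1.const_mul _) (hn.1.const_mul _) (by norm_num)).trans ?_
  rw [n1, n2, add_mul]
  refine add_le_add ?_ ?_
  · refine (eLpNorm_cv_lap_le h.hv (by norm_num) h.dv2 hk hc h.dv2_le).trans ?_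
    exact le_mul_of_one_le_right' (one_le_control _ _ _)
  · exact (eLpNorm_cv_le hr.1 hN.1 (by norm_num)).trans (mul_le_mul' le_rfl h.cub_le)

end Mass

instance : HolderTriple 4 4 2 := holderTriple_four_four_two

section Mass

variable {v F : ℝ → E4 → ℂ} {dv dF : Fin 4 → ℝ → E4 → ℂ}

theorem eLpNorm_conj (f : E4 → ℂ) (p : ℝ≥0∞) : N[p] (fun x => conj (f x)) = N[p] f :=
  eLpNorm_congr_norm_ae (ae_of_all _ fun x => by simp)

theorem eLpNorm_const_I_mul (f : E4 → ℂ) (p : ℝ≥0∞) : N[p] (fun x => I * f x) = N[p] f :=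
  eLpNorm_congr_norm_ae (ae_of_all _ fun x => by simp)

theorem eLpNorm_re_le (f : E4 → ℂ) (p : ℝ≥0∞) : N[p] (fun x => (f x).re) ≤ N[p] f :=
  eLpNorm_mono fun _ => abs_re_le_norm _

theorem eLpNorm_cut_mul_le (m : ℕ) (f : E4 → ℝ) (p : ℝ≥0∞) :
    N[p] (fun x => cut m x * f x) ≤ N[p] f :=
  eLpNorm_mono fun x => by
    rw [norm_mul, norm_of_nonneg (cut_nonneg m x)]
    exact mul_le_of_le_one_left (norm_nonneg _) (cut_le_one m x)

theorem Regular.hasWeakDeriv_cut_mass (h : Regular a b v F dv dF M) (m n : ℕ) :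
    HasWeakDeriv a b (fun t => ∫ x, cut m x * ‖cv (rk (mol n)) (v t) x‖ ^ 2)
      (fun t => ∫ x, cut m x * (2 * (conj (cv (rk (mol n)) (v t) x) *
        (I * cv (rk (lap (mol n))) (v t) x -
          I * cv (rk (mol n)) (cub fun x => F t x + v t x) x)).re)) := by
  have hk := mol_contDiff n
  have hc := mol_hasCompactSupport n
  have hV := stronglyMeasurable_cv_test hk h.meas_v
  have hL := stronglyMeasurable_cv_test (lap_contDiff hk) h.meas_v
  have hN := stronglyMeasurable_cv_test hk h.meas_cub
  have hcut : StronglyMeasurable (fun z : ℝ × E4 => cut m z.2) :=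
    ((cut_contDiff m).continuous.comp continuous_snd).stronglyMeasurable
  have hcr : ∀ p, MemLp (rk (cut m)) p := fun p =>
    rk_memLp (cut_contDiff m).continuous (cut_hasCompactSupport m) p
  set D := (∑ j, N[1] (rk (pd j (mol n)))) * M + N[1] (rk (mol n)) with hD
  have hDt : D ≠ ⊤ := add_ne_top.2
    ⟨mul_ne_top (sum_eLpNorm_pd_ne_top hk hc) h.ne_top, (rk_memLp hk.continuous hc 1).2.ne⟩
  refine hasWeakDeriv_slice h.control_lt (C := N[2] (rk (cut m)) * (M * M) +
      2 * (N[4] (rk (cut m)) * (M * D))) ?_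
    (fun x => ((h.eq_v _ hk hc x).normSq h.hab).const_mul (cut m x)) ?_ ?_ ?_ ?_
  · exact add_ne_top.2 ⟨mul_ne_top (hcr 2).2.ne
      (mul_ne_top h.ne_top h.ne_top), mul_ne_top (by simp)
      (mul_ne_top (hcr 4).2.ne (mul_ne_top h.ne_top hDt))⟩
  · exact hcut.mul (hV.norm.pow 2)
  · exact hcut.mul ((continuous_re.comp_stronglyMeasurable
      ((continuous_conj.comp_stronglyMeasurable hV).mul
        ((hL.const_mul _).sub (hN.const_mul _)))).const_mul 2)
  · filter_upwards [h.slice] with t ht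
    have hVt : AEStronglyMeasurable (cv (rk (mol n)) (v t)) := (smoothLp_mo
        (by norm_num) ht.v4 n).memLp.1
    have hV4 : N[4] (cv (rk (mol n)) (v t)) ≤ M :=
      (eLpNorm_mo_le (by norm_num) ht.v4.1 n).trans ht.v4_le
    calc N[1] (fun x => cut m x * ‖cv (rk (mol n)) (v t) x‖ ^ 2)
        = N[1] (fun x => rk (cut m) x * (cv (rk (mol n)) (v t) x * cv (rk (mol n)) (v t)
            x)) := eLpNorm_congr_norm_ae (ae_of_all _ fun x => by simp [rk, sq])
      _ ≤ N[2] (rk (cut m)) * (N[4] (cv (rk (mol n)) (v t)) * N[4] (cv (rk (mol n)) (v t))) :=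
          (eLpNorm_fun_mul_le (p := 2) (q := 2) (hcr 2).1 (hVt.mul hVt)).trans
            (mul_le_mul' le_rfl (eLpNorm_fun_mul_le (p := 4) (q := 4) hVt hVt))
      _ ≤ N[2] (rk (cut m)) * (M * M) := by gcongr
      _ ≤ _ := le_self_add.trans (le_mul_of_one_le_right' (one_le_control _ _ _))
  · filter_upwards [h.slice] with t ht
    have hVt : AEStronglyMeasurable (cv (rk (mol n)) (v t)) := (smoothLp_mo
        (by norm_num) ht.v4 n).memLp.1
    have hV4 : N[4] (cv (rk (mol n)) (v t)) ≤ M :=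
      (eLpNorm_mo_le (by norm_num) ht.v4.1 n).trans ht.v4_le
    set Y := fun x => I * cv (rk (lap (mol n))) (v t) x -
          I * cv (rk (mol n)) (cub fun x => F t x + v t x) x with hY
    have hYm : AEStronglyMeasurable Y :=
      (((hL.comp_measurable measurable_prodMk_left).const_mul _).sub
        ((hN.comp_measurable measurable_prodMk_left).const_mul _)).aestronglyMeasurable
    calc N[1] (fun x => cut m x * (2 * (conj (cv (rk (mol n)) (v t) x) * Y x).re))
        ≤ N[1] (fun x => 2 * (rk (cut m) x * (cv (rk (mol n)) (v t) x * Y x))) := by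
          refine eLpNorm_mono fun x => ?_
          have := abs_re_le_norm (conj (cv (rk (mol n)) (v t) x) * Y x)
          simp only [norm_mul, rk, norm_real, norm_eq_abs, abs_two,
            RCLike.norm_conj] at this ⊢
          have h2 : ‖(2 : ℂ)‖ = 2 := by simp
          rw [h2]
          have := mul_le_mul_of_nonneg_left this (abs_nonneg (cut m x))
          linarith
      _ = 2 * N[1] (fun x => rk (cut m) x * (cv (rk (mol n)) (v t) x * Y x)) := by
          rw [show (fun x => 2 * (rk (cut m) x * (cv (rk (mol n)) (v t) x * Y x))) =
            (2 : ℂ) • fun x => rk (cut m) x * (cv (rk (mol n)) (v t) x * Y x) from rfl,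
            eLpNorm_const_smul]
          congr 1
          rw [← ofReal_norm]; simp
      _ ≤ 2 * (N[4] (rk (cut m)) * (M * (D *
            control (F t ⊞ v t) (fun j => dv j t) fun j => dF j t))) := by
          have : HolderTriple 4 2 p₄₃ := holderTriple_two_four.symm
          gcongr
          refine (eLpNorm_fun_mul_le (p := 4) (q := p₄₃) (hcr 4).1
            (hVt.mul hYm)).trans (mul_le_mul' le_rfl ?_)
          exact (eLpNorm_fun_mul_le (p := 4) (q := 2) hVt hYm).trans
            (mul_le_mul' hV4 (ht.flow_le hk hc))
      _ = 2 * (N[4] (rk (cut m)) * (M * D)) *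
            control (F t ⊞ v t) (fun j => dv j t) fun j => dF j t := by ring
      _ ≤ _ := mul_le_mul' le_add_self le_rfl

/-- The time derivative of a localized mass is bounded independently of the localization, because
`∇χₘ` is bounded in `L⁴`, `v` in `L⁴` and `∇v` in `L²`. -/
theorem Slice.cut_mass_le {v F : E4 → ℂ} {dv dF : Fin 4 → E4 → ℂ} {B : ℝ≥0∞}
    (h : Slice v F dv dF M) (hB : ∀ n j, N[4] (pd j (cut n)) ≤ B) (m n : ℕ) :
    ofReal |∫ x, cut m x * (2 * (conj (cv (rk (mol n)) v x) *
        (I * cv (rk (lap (mol n))) v x -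
          I * cv (rk (mol n)) (cub fun x => F x + v x) x)).re)| ≤
      2 * (4 * (B * (M * M)) + M * (2 * M) ^ 3) := by
  have hk := mol_contDiff n
  have hc := mol_hasCompactSupport n
  have hV := smoothLp_mo (by norm_num) h.v4 n
  have hV4 : N[4] (mo n v) ≤ M := (eLpNorm_mo_le (by norm_num) h.v4.1 n).trans h.v4_le
  have hN := MemLp.cub_four h.u4
  have hNn : MemLp (mo n (cub fun x => F x + v x)) p₄₃ :=
    (smoothLp_mo one_le_four_thirds hN n).memLp
  have hNb : N[p₄₃] (mo n (cub fun x => F x + v x)) ≤ (2 * M) ^ 3 := by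
    refine (eLpNorm_mo_le one_le_four_thirds hN.1 n).trans ((eLpNorm_cub_four_le h.u4.1).trans ?_)
    gcongr
    exact h.u4_le
  have i1 : Integrable fun x => cut m x * (conj (mo n v x) * (I * lap (mo n v) x)).re := by
    refine Continuous.integrable_of_hasCompactSupport ?_ (cut_hasCompactSupport m).mul_right
    have h1 := hV.1.continuous
    have h2 : Continuous (lap (mo n v)) := hV.lap_smooth.1.continuous
    have h3 := (cut_contDiff m).continuous
    fun_prop
  have i2' : Integrable fun x => (conj (mo n v x) *
      (I * mo n (cub fun x => F x + v x) x)).re :=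
    (integrable_fun_mul (p := 4) (q := p₄₃) (memLp_conj hV.memLp) (hNn.const_mul I)).re
  have i2 : Integrable fun x => cut m x * (conj (mo n v x) *
      (I * mo n (cub fun x => F x + v x) x)).re := by
    refine i2'.bdd_mul (c := 1) (cut_contDiff m).continuous.aestronglyMeasurable
      (ae_of_all _ fun x => ?_)
    rw [norm_of_nonneg (cut_nonneg m x)]
    exact cut_le_one m x
  have e : ∫ x, cut m x * (2 * (conj (cv (rk (mol n)) v x) *
        (I * cv (rk (lap (mol n))) v x -
          I * cv (rk (mol n)) (cub fun x => F x + v x) x)).re) =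
      2 * ((∫ x, cut m x * (conj (mo n v x) * (I * lap (mo n v) x)).re) -
        ∫ x, cut m x * (conj (mo n v x) * (I * mo n (cub fun x => F x + v x) x)).re) := by
    rw [← integral_sub i1 i2, ← integral_const_mul, cv_lap (h.hv 0).1 hk hc]
    congr 1
    ext x
    rw [mul_sub, sub_re]
    simp only [mo]
    ring
  rw [e, abs_mul, abs_two, ofReal_mul (by norm_num), ofReal_ofNat]
  gcongr
  refine (ofReal_le_ofReal (abs_sub _ _)).trans (ENNReal.ofReal_add_le.trans
    (add_le_add ?_ ?_))
  · refine (abs_re_integral_cut_conj_lap_le (cut_contDiff m) (cut_hasCompactSupport m)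
      hV.1).trans ?_
    have : ∀ j ∈ (Finset.univ : Finset (Fin 4)), N[4] (pd j (cut m)) *
        (N[4] (mo n v) * N[2] (pd j (mo n v))) ≤ B * (M * M) := by
      intro j _
      rw [(h.hv j).pd_mo]
      exact mul_le_mul' (hB m j) (mul_le_mul' hV4
        ((eLpNorm_mo_le (by norm_num) (h.dv2 j).1 n).trans (h.dv2_le j)))
    refine (sum_le_sum this).trans ?_
    simp
  · rw [← enorm_eq_ofReal_abs]
    refine (enorm_integral_le_lintegral_enorm _).trans ?_
    rw [← eLpNorm_one_eq_lintegral_enorm]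
    refine (eLpNorm_cut_mul_le m _ 1).trans ((eLpNorm_re_le _ 1).trans ?_)
    refine (eLpNorm_fun_mul_le (p := 4) (q := p₄₃) (memLp_conj hV.memLp).1
      (hNn.const_mul I).1).trans ?_
    rw [eLpNorm_conj, eLpNorm_const_I_mul]
    exact mul_le_mul' hV4 hNb

theorem LpTendsto.integral_cut_sq {f : ℕ → E4 → ℂ} (h : LpTendsto 4 f g) (m : ℕ) :
    Tendsto (fun n => ∫ x, cut m x * ‖f n x‖ ^ 2) atTop (𝓝 (∫ x, cut m x * ‖g x‖ ^ 2)) := by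
  have hc : LpTendsto 2 (fun _ => rk (cut m)) (rk (cut m)) := LpTendsto.const
    (rk_memLp (cut_contDiff m).continuous (cut_hasCompactSupport m) 2)
  have h2 : LpTendsto 2 (fun n x => f n x * conj (f n x))
      (fun x => g x * conj (g x)) := h.mul (by norm_num) h.conj
  have h1 := ((hc.mul le_rfl h2).integral)
  have e : ∀ w : E4 → ℂ, ∫ x, rk (cut m) x * (w x * conj (w x)) =
      ((∫ x, cut m x * ‖w x‖ ^ 2 : ℝ) : ℂ) := by
    intro w
    rw [← integral_complex_ofReal]
    congr 1
    ext x
    rw [mul_conj, normSq_eq_norm_sq, rk]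
    push_cast; rfl
  simp only [e] at h1
  exact (continuous_re.tendsto _).comp h1

theorem Regular.cut_mass (h : Regular a b v F dv dF M) :
    ∃ C : ℝ, 0 ≤ C ∧ ∀ m, ∀ᵐ t₁ ∂vol[a,b], ∀ᵐ t₂ ∂vol[a,b],
      |(∫ x, cut m x * ‖v t₂ x‖ ^ 2) - ∫ x, cut m x * ‖v t₁ x‖ ^ 2| ≤ C * |t₂ - t₁| := by
  obtain ⟨B, hBt, hB⟩ := exists_bound_eLpNorm_pd_cut (q := 4) le_rfl
  have hCt : 2 * (4 * (B * (M * M)) + M * (2 * M) ^ 3) ≠ ⊤ := by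
    have := h.ne_top
    finiteness
  refine ⟨(2 * (4 * (B * (M * M)) + M * (2 * M) ^ 3)).toReal, toReal_nonneg, fun m => ?_⟩
  have h1 : ∀ n, ∀ᵐ t₁ ∂vol[a,b], ∀ᵐ t₂ ∂vol[a,b],
      |(∫ x, cut m x * ‖mo n (v t₂) x‖ ^ 2) - ∫ x, cut m x * ‖mo n (v t₁) x‖ ^ 2| ≤
        (2 * (4 * (B * (M * M)) + M * (2 * M) ^ 3)).toReal * |t₂ - t₁| := by
    intro n
    refine (h.hasWeakDeriv_cut_mass m n).ae_abs_sub_le h.hab ?_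
    filter_upwards [h.slice] with t ht
    rw [← ENNReal.ofReal_le_iff_le_toReal hCt]
    exact ht.cut_mass_le hB m n
  have hl : ∀ {t}, Slice (v t) (F t) (fun j => dv j t) (fun j => dF j t) M →
      Tendsto (fun n => ∫ x, cut m x * ‖mo n (v t) x‖ ^ 2) atTop
        (𝓝 (∫ x, cut m x * ‖v t x‖ ^ 2)) := fun ht =>
    (LpTendsto.mol (by norm_num) (by simp) ht.v4).integral_cut_sq m
  filter_upwards [ae_all_iff.2 h1, h.slice] with t₁ h2 s1
  filter_upwards [ae_all_iff.2 h2, h.slice] with t₂ h3 s2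
  exact le_of_tendsto ((hl s2).sub (hl s1)).abs (Eventually.of_forall h3)

/-- The solution `v` is square integrable in space, with a mass that depends continuously on
time at the initial time. -/
theorem Regular.mass_le (h : Regular a b v F dv dF M) (h0 : (0 : ℝ) ∈ Ioo a b) {v₀ : E4 → ℂ}
    (hv₀ : MemLp v₀ 2) (hv₀' : MemLp v₀ 4)
    (hlim : Tendsto (fun t => N[4] (v t - v₀)) nearZero (𝓝 0)) :
    ∃ C : ℝ, 0 ≤ C ∧ ∀ᵐ t ∂vol[a,b], N[2] (v t) ^ 2 ≤ N[2] v₀ ^ 2 + ofReal (C * |t|) := by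
  obtain ⟨C, hC, hcut⟩ := h.cut_mass
  refine ⟨C, hC, ?_⟩
  filter_upwards [ae_all_iff.2 hcut, h.slice] with t ht s1
  -- compare the localized masses at time `t` and at times tending to zero
  have hm : ∀ m, ofReal (∫ x, cut m x * ‖v t x‖ ^ 2) ≤ N[2] v₀ ^ 2 + ofReal (C * |t|) := by
    intro m
    obtain ⟨s, hs, hs0, hsl⟩ := exists_seq_nearZero
      ((eventually_nearZero h0 (ht m)).and (eventually_nearZero h0 h.slice)) hlim
    have l1 : LpTendsto 4 (fun n => v (s n)) v₀ := ⟨fun n => (hs n).2.v4, hv₀', hsl⟩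
    have l2 := l1.integral_cut_sq m
    have l3 : |(∫ x, cut m x * ‖v₀ x‖ ^ 2) - ∫ x, cut m x * ‖v t x‖ ^ 2| ≤ C * |0 - t| :=
      le_of_tendsto_of_tendsto (l2.sub tendsto_const_nhds).abs
        ((hs0.sub_const t).abs.const_mul C) (Eventually.of_forall fun n => (hs n).1)
    rw [zero_sub, abs_neg] at l3
    have l4 : ∫ x, cut m x * ‖v t x‖ ^ 2 ≤ (∫ x, cut m x * ‖v₀ x‖ ^ 2) + C * |t| := by
      linarith [(abs_le.1 l3).1]
    refine (ofReal_le_ofReal l4).trans (ENNReal.ofReal_add_le.trans ?_)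
    gcongr
    rw [eLpNorm_two_sq_eq hv₀]
    refine ofReal_le_ofReal ?_
    refine integral_mono_of_nonneg (ae_of_all _ fun x => ?_) ?_ (ae_of_all _ fun x => ?_)
    · exact mul_nonneg (cut_nonneg m x) (sq_nonneg _)
    · simpa using hv₀.integrable_norm_pow (p := 2) (by norm_num)
    · simpa using mul_le_of_le_one_left (sq_nonneg ‖v₀ x‖) (cut_le_one m x)
  rw [eLpNorm_two_sq]
  have hvm : AEStronglyMeasurable (v t) := s1.v4.1
  have hint : ∀ m, Integrable fun x => cut m x * ‖v t x‖ ^ 2 := by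
    intro m
    have h4 : MemLp (fun x => v t x * v t x) 2 := s1.v4.mul' s1.v4
    have hc := rk_memLp (cut_contDiff m).continuous (cut_hasCompactSupport m) 2
    have := (integrable_fun_mul hc h4).norm
    refine this.congr (ae_of_all _ fun x => ?_)
    simp [rk, abs_of_nonneg (cut_nonneg m x), sq]
  -- remove the cutoff by Fatou's lemma
  calc ∫⁻ x, ‖v t x‖ₑ ^ 2 = ∫⁻ x, liminf (fun m => ofReal (cut m x * ‖v t x‖ ^ 2)) atTop := by
        refine lintegral_congr fun x => ?_
        have : Tendsto (fun m => ofReal (cut m x * ‖v t x‖ ^ 2)) atTop (𝓝 (‖v t x‖ₑ ^ 2)) := by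
          refine tendsto_const_nhds.congr' ?_
          filter_upwards [eventually_cut_eq_one x] with m hm
          rw [hm, one_mul, ofReal_pow (norm_nonneg _), ofReal_norm]
        exact this.liminf_eq.symm
    _ ≤ liminf (fun m => ∫⁻ x, ofReal (cut m x * ‖v t x‖ ^ 2)) atTop :=
        lintegral_liminf_le' fun m => (hint m).1.aemeasurable.ennreal_ofReal
    _ ≤ _ := by
        refine liminf_le_of_le (by isBoundedDefault) fun y hy => ?_
        obtain ⟨m, hm'⟩ := hy.exists
        refine hm'.trans ?_
        rw [← ofReal_integral_eq_lintegral_ofReal (hint m) (ae_of_all _ fun x =>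
          mul_nonneg (cut_nonneg m x) (sq_nonneg _))]
        exact hm m

end Mass

/-! ### Quadratic and quartic integrals of regularized solutions -/

section Fields

variable {Φ : ℝ → ℝ≥0∞} {A D : ℝ≥0∞} {U Y : ℝ → E4 → ℂ}

theorem eLpNorm_one_mul_le (hf : AEStronglyMeasurable f)
    (hg : AEStronglyMeasurable g) :
    N[1] (fun x => f x * g x) ≤ N[2] f * N[2] g :=
  eLpNorm_fun_mul_le hf hg

theorem StronglyMeasurable.slice {U : ℝ → E4 → ℂ} (h : StronglyMeasurable (uncurry U))
    (t : ℝ) : AEStronglyMeasurable (U t) :=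
  (h.comp_measurable measurable_prodMk_left).aestronglyMeasurable

theorem hasWeakDeriv_integral_norm_sq (hab : a < b) (hΦ1 : ∀ t, 1 ≤ Φ t)
    (hΦ : ∫⁻ t in Ioo a b, Φ t < ⊤) (hA : A ≠ ⊤) (hD : D ≠ ⊤)
    (hU : StronglyMeasurable (uncurry U)) (hY : StronglyMeasurable (uncurry Y))
    (h : ∀ x, HasWeakDerivC a b (fun t => U t x) (fun t => Y t x))
    (hUA : ∀ᵐ t ∂vol[a,b], N[2] (U t) ≤ A)
    (hYD : ∀ᵐ t ∂vol[a,b], N[2] (Y t) ≤ D * Φ t) :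
    HasWeakDeriv a b (fun t => ∫ x, ‖U t x‖ ^ 2) (fun t => ∫ x, 2 * (conj (U t x) * Y t x).re) := by
  refine hasWeakDeriv_slice hΦ (C := A * A + 2 * (A * D)) (by finiteness)
    (fun x => (h x).normSq hab) (hU.norm.pow 2)
    ((continuous_re.comp_stronglyMeasurable
      ((continuous_conj.comp_stronglyMeasurable hU).mul hY)).const_mul 2) ?_ ?_
  · filter_upwards [hUA] with t h1
    have hm := StronglyMeasurable.slice hU t
    calc N[1] (fun x => ‖U t x‖ ^ 2) = N[1] (fun x => U t x * U t x) :=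
          eLpNorm_congr_norm_ae (ae_of_all _ fun x => by simp [sq])
      _ ≤ A * A := (eLpNorm_one_mul_le hm hm).trans (mul_le_mul' h1 h1)
      _ ≤ _ := le_self_add.trans (le_mul_of_one_le_right' (hΦ1 t))
  · filter_upwards [hUA, hYD] with t h1 h2
    have hm := StronglyMeasurable.slice hU t
    have hm' := StronglyMeasurable.slice hY t
    calc N[1] (fun x => 2 * (conj (U t x) * Y t x).re)
        ≤ N[1] (fun x => (2 : ℝ) • (U t x * Y t x)) := by
          refine eLpNorm_mono fun x => ?_
          have := abs_re_le_norm (conj (U t x) * Y t x)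
          rw [norm_mul, norm_smul]
          refine mul_le_mul_of_nonneg_left (this.trans ?_) (norm_nonneg _)
          simp
      _ = 2 * N[1] (fun x => U t x * Y t x) := by
          rw [show (fun x => (2 : ℝ) • (U t x * Y t x)) =
            (2 : ℝ) • fun x => U t x * Y t x from rfl, eLpNorm_const_smul]
          congr 1
          rw [← ofReal_norm]; simp
      _ ≤ 2 * (A * (D * Φ t)) := by
          gcongr
          exact (eLpNorm_one_mul_le hm hm').trans (mul_le_mul' h1 h2)
      _ = 2 * (A * D) * Φ t := by ring
      _ ≤ _ := mul_le_mul' le_add_self le_rfl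

theorem hasWeakDeriv_integral_norm_four (hab : a < b) (hΦ1 : ∀ t, 1 ≤ Φ t)
    (hΦ : ∫⁻ t in Ioo a b, Φ t < ⊤) (hA : A ≠ ⊤) (hD : D ≠ ⊤)
    (hU : StronglyMeasurable (uncurry U)) (hY : StronglyMeasurable (uncurry Y))
    (h : ∀ x, HasWeakDerivC a b (fun t => U t x) (fun t => Y t x))
    (hUA : ∀ᵐ t ∂vol[a,b], N[2] (U t) ≤ A)
    (hUi : ∀ᵐ t ∂vol[a,b], ∀ x, ‖U t x‖ₑ ≤ A)
    (hYD : ∀ᵐ t ∂vol[a,b], N[2] (Y t) ≤ D * Φ t) :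
    HasWeakDeriv a b (fun t => ∫ x, ‖U t x‖ ^ 4)
      (fun t => ∫ x, 4 * (conj (cub (U t) x) * Y t x).re) := by
  have e : ∀ t x, 2 * (conj (U t x) * Y t x).re * ‖U t x‖ ^ 2 +
      ‖U t x‖ ^ 2 * (2 * (conj (U t x) * Y t x).re) =
      4 * (conj (cub (U t) x) * Y t x).re := by
    intro t x
    rw [cub, map_mul, conj_ofReal, mul_assoc ((‖U t x‖ ^ 2 : ℝ) : ℂ), re_ofReal_mul]
    ring
  have e' : ∀ t x, ‖U t x‖ ^ 2 * ‖U t x‖ ^ 2 = ‖U t x‖ ^ 4 := fun t x => by ring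
  have hle : ∀ t, (∀ x, ‖U t x‖ₑ ≤ A) → ∀ f : E4 → ℂ,
      N[1] (fun x => (‖U t x‖ ^ 2) • f x) ≤ A ^ 2 * N[1] f := by
    intro t ht f
    rw [eLpNorm_one_eq_lintegral_enorm, eLpNorm_one_eq_lintegral_enorm,
      ← lintegral_const_mul' _ _ (by finiteness)]
    refine lintegral_mono fun x => ?_
    rw [enorm_smul, enorm_pow, enorm_norm]
    gcongr
    exact ht x
  refine hasWeakDeriv_slice hΦ (C := A ^ 2 * (A * A) + 4 * (A ^ 2 * (A * D))) (by finiteness)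
    (fun x => ?_) (hU.norm.pow 4) ?_ ?_ ?_
  · have := ((h x).normSq hab).mul hab ((h x).normSq hab)
    simpa only [e, e'] using this
  · exact (continuous_re.comp_stronglyMeasurable
      ((continuous_conj.comp_stronglyMeasurable (stronglyMeasurable_cub hU)).mul
        hY)).const_mul 4
  · filter_upwards [hUA, hUi] with t h1 hi
    have hm := StronglyMeasurable.slice hU t
    calc N[1] (fun x => ‖U t x‖ ^ 4) = N[1] (fun x => (‖U t x‖ ^ 2) • (U t x * U t x)) :=
          eLpNorm_congr_norm_ae (ae_of_all _ fun x => by simp; ring)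
      _ ≤ A ^ 2 * (A * A) := (hle t hi _).trans
          (mul_le_mul' le_rfl ((eLpNorm_one_mul_le hm hm).trans (mul_le_mul' h1 h1)))
      _ ≤ _ := le_self_add.trans (le_mul_of_one_le_right' (hΦ1 t))
  · filter_upwards [hUA, hUi, hYD] with t h1 hi h2
    have hm := StronglyMeasurable.slice hU t
    have hm' := StronglyMeasurable.slice hY t
    calc N[1] (fun x => 4 * (conj (cub (U t) x) * Y t x).re)
        ≤ N[1] ((4 : ℝ) • fun x => (‖U t x‖ ^ 2) • (U t x * Y t x)) := by
          refine eLpNorm_mono fun x => ?_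
          have := abs_re_le_norm (conj (cub (U t) x) * Y t x)
          rw [norm_mul, Pi.smul_apply, norm_smul]
          refine mul_le_mul_of_nonneg_left (this.trans ?_) (norm_nonneg _)
          simp [cub]
          exact le_of_eq (by ring)
      _ = 4 * N[1] (fun x => (‖U t x‖ ^ 2) • (U t x * Y t x)) := by
          rw [eLpNorm_const_smul]
          congr 1
          rw [← ofReal_norm]; simp
      _ ≤ 4 * (A ^ 2 * (A * (D * Φ t))) := by
          gcongr
          exact (hle t hi _).trans (mul_le_mul' le_rfl
            ((eLpNorm_one_mul_le hm hm').trans (mul_le_mul' h1 h2)))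
      _ = 4 * (A ^ 2 * (A * D)) * Φ t := by ring
      _ ≤ _ := mul_le_mul' le_add_self le_rfl

theorem hasWeakDeriv_integral_im (hab : a < b) (hΦ1 : ∀ t, 1 ≤ Φ t)
    (hΦ : ∫⁻ t in Ioo a b, Φ t < ⊤) (hA : A ≠ ⊤) (hD : D ≠ ⊤) {w : E4 → ℝ} (hw : Continuous w)
    (hw1 : ∀ x, |w x| ≤ 1) {U' Y' : ℝ → E4 → ℂ}
    (hU : StronglyMeasurable (uncurry U)) (hY : StronglyMeasurable (uncurry Y))
    (hU' : StronglyMeasurable (uncurry U'))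
    (hY' : StronglyMeasurable (uncurry Y'))
    (h : ∀ x, HasWeakDerivC a b (fun t => U t x) (fun t => Y t x))
    (h' : ∀ x, HasWeakDerivC a b (fun t => U' t x) (fun t => Y' t x))
    (hUA : ∀ᵐ t ∂vol[a,b], N[2] (U t) ≤ A)
    (hUA' : ∀ᵐ t ∂vol[a,b], N[2] (U' t) ≤ A)
    (hYD : ∀ᵐ t ∂vol[a,b], N[2] (Y t) ≤ D * Φ t)
    (hYD' : ∀ᵐ t ∂vol[a,b], N[2] (Y' t) ≤ D * Φ t) :
    HasWeakDeriv a b (fun t => ∫ x, w x * (conj (U t x) * U' t x).im)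
      (fun t => ∫ x, w x * (conj (Y t x) * U' t x + conj (U t x) * Y' t x).im) := by
  have hwm : StronglyMeasurable (fun z : ℝ × E4 => w z.2) :=
    (hw.comp continuous_snd).stronglyMeasurable
  have hle : ∀ f : E4 → ℂ, N[1] (fun x => w x * (f x).im) ≤ N[1] f := by
    intro f
    refine eLpNorm_mono fun x => ?_
    rw [norm_mul]
    exact (mul_le_of_le_one_left (norm_nonneg _) (hw1 x)).trans (abs_im_le_norm _)
  have hc := fun {V : ℝ → E4 → ℂ} (hV : StronglyMeasurable (uncurry V)) =>
    continuous_conj.comp_stronglyMeasurable hV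
  refine hasWeakDeriv_slice hΦ (C := A * A + (D * A + A * D)) (by finiteness)
    (fun x => ((h x).im_conj_mul hab (h' x)).const_mul (w x))
    (hwm.mul (continuous_im.comp_stronglyMeasurable ((hc hU).mul hU')))
    (hwm.mul (continuous_im.comp_stronglyMeasurable
      (((hc hY).mul hU').add ((hc hU).mul hY')))) ?_ ?_
  · filter_upwards [hUA, hUA'] with t h1 h2
    have m1 := (StronglyMeasurable.slice hU t).star
    have m2 := StronglyMeasurable.slice hU' t
    refine (hle _).trans ((eLpNorm_one_mul_le m1 m2).trans ?_)
    refine (mul_le_mul' ((eLpNorm_conj _ _).le.trans h1) h2).trans ?_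
    exact le_self_add.trans (le_mul_of_one_le_right' (hΦ1 t))
  · filter_upwards [hUA, hUA', hYD, hYD'] with t h1 h2 h3 h4
    have m1 := (StronglyMeasurable.slice hU t).star
    have m2 := StronglyMeasurable.slice hU' t
    have m3 := (StronglyMeasurable.slice hY t).star
    have m4 := StronglyMeasurable.slice hY' t
    refine (hle _).trans ((eLpNorm_add_le (m3.mul m2) (m1.mul m4) le_rfl).trans ?_)
    calc _ ≤ D * Φ t * A + A * (D * Φ t) := add_le_add
          ((eLpNorm_one_mul_le m3 m2).trans (mul_le_mul' ((eLpNorm_conj _ _).le.trans h3) h2))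
          ((eLpNorm_one_mul_le m1 m4).trans (mul_le_mul' ((eLpNorm_conj _ _).le.trans h1) h4))
      _ = (D * A + A * D) * Φ t := by ring
      _ ≤ _ := mul_le_mul' le_add_self le_rfl

end Fields

/-! ### Square integrable regular solutions -/

/-- A regular solution whose mass is bounded. -/
structure RegularL2 (a b : ℝ) (v F : ℝ → E4 → ℂ) (dv dF : Fin 4 → ℝ → E4 → ℂ) (M : ℝ≥0∞) :
    Prop extends Regular a b v F dv dF M where
  v2_le : ∀ᵐ t ∂vol[a,b], N[2] (v t) ≤ M

/-- The right hand side of the equation `∂ₜw = i Δw - i g`, regularized by the kernel `k`. -/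
def flow (k : E4 → ℝ) (w g : E4 → ℂ) : E4 → ℂ := fun x =>
  I * cv (rk (lap k)) w x - I * cv (rk k) g x

theorem stronglyMeasurable_flow (hk : ContDiff ℝ ∞ k) {w g : ℝ → E4 → ℂ}
    (hw : StronglyMeasurable (uncurry w)) (hg : StronglyMeasurable (uncurry g)) :
    StronglyMeasurable (uncurry fun t => flow k (w t) (g t)) :=
  ((stronglyMeasurable_cv_test (lap_contDiff hk) hw).const_mul _).sub
    ((stronglyMeasurable_cv_test hk hg).const_mul _)

theorem eLpNorm_flow_le (hk : ContDiff ℝ ∞ k) (hc : HasCompactSupport k)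
    (hw : MemLp w 2) (hg : MemLp g 2) {A Φ : ℝ≥0∞} (hΦ : 1 ≤ Φ)
    (hwA : N[2] w ≤ A) (hgA : N[2] g ≤ Φ) :
    N[2] (flow k w g) ≤ (N[1] (rk (lap k)) * A + N[1] (rk k)) * Φ := by
  have h1 := rk_memLp hk.continuous hc 1
  have h2 := rk_memLp (lap_contDiff hk).continuous (lap_hasCompactSupport hc) 1
  refine (eLpNorm_sub_le ((memLp_cv h2 (by norm_num) hw).1.const_mul _)
    ((memLp_cv h1 (by norm_num) hg).1.const_mul _) (by norm_num)).trans ?_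
  rw [eLpNorm_const_I_mul, eLpNorm_const_I_mul, add_mul]
  refine add_le_add ?_ ((eLpNorm_cv_le h1.1 hg.1 (by norm_num)).trans (mul_le_mul' le_rfl hgA))
  exact ((eLpNorm_cv_le h2.1 hw.1 (by norm_num)).trans (mul_le_mul' le_rfl hwA)).trans
    (le_mul_of_one_le_right' hΦ)

theorem flow_const_ne_top (hk : ContDiff ℝ ∞ k) (hc : HasCompactSupport k)
    {A : ℝ≥0∞} (hA : A ≠ ⊤) :
    N[1] (rk (lap k)) * A + N[1] (rk k) ≠ ⊤ := by
  have h1 := (rk_memLp hk.continuous hc 1).2.ne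
  have h2 := (rk_memLp (lap_contDiff hk).continuous (lap_hasCompactSupport hc) 1).2.ne
  finiteness

theorem flow_mol (hw : LocallyIntegrable w) (n : ℕ) :
    flow (mol n) w g = fun x => I * lap (mo n w) x - I * mo n g x := by
  ext x
  rw [flow, cv_lap hw (mol_contDiff n) (mol_hasCompactSupport n)]
  rfl

theorem flow_pd_mol (hw : MemLp w 2) (hg : MemLp g 2) (n : ℕ) (j : Fin 4) :
    flow (pd j (mol n)) w g = pd j fun x => I * lap (mo n w) x - I * mo n g x := by
  have hk := mol_contDiff n
  have hc := mol_hasCompactSupport n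
  have hwl := hw.locallyIntegrable (by norm_num)
  have hgl := hg.locallyIntegrable (by norm_num)
  have s1 := (smoothLp_mo (by norm_num) hw n).lap_smooth.differentiable
  have s2 := (smoothLp_mo (by norm_num) hg n).differentiable
  ext x
  rw [flow, cv_lap hwl (pd_contDiff hk j) (pd_hasCompactSupport hc j), ← pd_cv hwl hk hc,
    ← pd_cv hgl hk hc, lap_pd (contDiff_cv hwl hk hc)]
  conv_rhs => rw [pd, fderiv_fun_sub ((s1 x).const_mul _) ((s2 x).const_mul _),
    fderiv_const_mul (s1 x), fderiv_const_mul (s2 x)]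
  rfl

section L2

variable {v F : ℝ → E4 → ℂ} {dv dF : Fin 4 → ℝ → E4 → ℂ}

theorem Slice.v2 {v F : E4 → ℂ} {dv dF : Fin 4 → E4 → ℂ} (h : Slice v F dv dF M)
    (hM : M ≠ ⊤) (h2 : N[2] v ≤ M) : MemLp v 2 := ⟨h.v4.1, h2.trans_lt hM.lt_top⟩

theorem Slice.u2_le {v F : E4 → ℂ} {dv dF : Fin 4 → E4 → ℂ} (h : Slice v F dv dF M)
    (h2 : N[2] v ≤ M) : N[2] (F ⊞ v) ≤ 2 * M := by
  refine (eLpNorm_add_le h.F2.1 h.v4.1 (by norm_num)).trans ?_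
  rw [two_mul]
  exact add_le_add h.F2_le h2

theorem HasWeakDerivC.add {f g f' g' : ℝ → ℂ} (h : HasWeakDerivC a b f g)
    (h' : HasWeakDerivC a b f' g') :
    HasWeakDerivC a b (fun t => f t + f' t) (fun t => g t + g' t) := by
  refine ⟨?_, ?_⟩
  · simpa only [add_re] using h.1.add h'.1
  · simpa only [add_im] using h.2.add h'.2

theorem HasWeakDerivC.congr {f g f' g' : ℝ → ℂ} (h : HasWeakDerivC a b f g)
    (hf : ∀ᵐ t ∂vol[a,b], f t = f' t)
    (hg : ∀ᵐ t ∂vol[a,b], g t = g' t) : HasWeakDerivC a b f' g' :=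
  ⟨h.1.congr (hf.mono fun t ht => by rw [ht]) (hg.mono fun t ht => by rw [ht]),
    h.2.congr (hf.mono fun t ht => by rw [ht]) (hg.mono fun t ht => by rw [ht])⟩

theorem cv_test_add (hk : ContDiff ℝ ∞ k) (hc : HasCompactSupport k)
    (hf : LocallyIntegrable f) (hg : LocallyIntegrable g) (x : E4) :
    cv (rk k) (f ⊞ g) x = cv (rk k) f x + cv (rk k) g x :=
  cv_add_of_integrable (integrable_cv_integrand_of_locallyIntegrable hk.continuous hc hf x)
    (integrable_cv_integrand_of_locallyIntegrable hk.continuous hc hg x)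

theorem Regular.eq_u (h : Regular a b v F dv dF M) (hk : ContDiff ℝ ∞ k)
    (hc : HasCompactSupport k) (x : E4) :
    HasWeakDerivC a b (fun t => cv (rk k) (F t ⊞ v t) x)
      (fun t => flow k (F t ⊞ v t) (cub fun x => F t x + v t x) x) := by
  refine ((h.eq_F k hk hc x).add (h.eq_v k hk hc x)).congr ?_ ?_
  · filter_upwards [h.slice] with t ht
    exact (cv_test_add hk hc (ht.hF 0).1 (ht.hv 0).1 x).symm
  · filter_upwards [h.slice] with t ht
    rw [flow, cv_test_add (lap_contDiff hk) (lap_hasCompactSupport hc) (ht.hF 0).1 (ht.hv 0).1 x]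
    ring

theorem RegularL2.hasWeakDeriv_mass_mo (h : RegularL2 a b v F dv dF M) (n : ℕ) :
    HasWeakDeriv a b (fun t => ∫ x, ‖mo n (F t ⊞ v t) x‖ ^ 2)
      (fun t => ∫ x, 2 * (conj (mo n (F t ⊞ v t) x) *
        flow (mol n) (F t ⊞ v t) (cub fun x => F t x + v t x) x).re) := by
  have hk := mol_contDiff n
  have hc := mol_hasCompactSupport n
  have hM := h.ne_top
  refine hasWeakDeriv_integral_norm_sq h.hab (fun t => one_le_control _ _ _) h.control_lt
    (A := 2 * M) (by finiteness) (flow_const_ne_top hk hc (A := 2 * M) (by finiteness))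
    (stronglyMeasurable_cv_test hk h.meas_u) (stronglyMeasurable_flow hk h.meas_u h.meas_cub)
    (fun x => h.eq_u hk hc x) ?_ ?_
  · filter_upwards [h.slice, h.v2_le] with t ht h2
    exact (eLpNorm_mo_le (by norm_num) ht.u4.1 n).trans (ht.u2_le h2)
  · filter_upwards [h.slice, h.v2_le] with t ht h2
    exact eLpNorm_flow_le hk hc (ht.F2.add (ht.v2 hM h2)) (MemLp.cub_six ht.u6)
      (one_le_control _ _ _) (ht.u2_le h2) ht.cub_le

theorem integral_two_re_conj_flow {u N : E4 → ℂ} (hu : MemLp u 2) (hN : MemLp N 2) (n : ℕ) :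
    ∫ x, 2 * (conj (mo n u x) * flow (mol n) u N x).re =
      2 * (∫ x, conj (mo n u x) * mo n N x).im := by
  have hU := smoothLp_mo (by norm_num) hu n
  have hN' := (smoothLp_mo (by norm_num) hN n).memLp
  have i1 : Integrable fun x => conj (mo n u x) * (I * lap (mo n u) x) :=
    integrable_fun_mul (memLp_conj hU.memLp) (hU.lap.const_mul _)
  have i2 : Integrable fun x => conj (mo n u x) * mo n N x :=
    integrable_fun_mul (memLp_conj hU.memLp) hN'
  have i3 : Integrable fun x => conj (mo n u x) * (I * lap (mo n u) x) -
      I * (conj (mo n u x) * mo n N x) := i1.sub (i2.const_mul _)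
  have e : ∀ x, (conj (mo n u x) * flow (mol n) u N x).re =
      reCLM (conj (mo n u x) * (I * lap (mo n u) x) -
        I * (conj (mo n u x) * mo n N x)) := by
    intro x
    rw [flow_mol (hu.locallyIntegrable (by norm_num)), reCLM_apply]
    congr 1
    ring
  simp only [e]
  rw [integral_const_mul, reCLM.integral_comp_comm i3,
    integral_sub i1 (i2.const_mul _), reCLM_apply, sub_re,
    re_integral_conj_lap hU, integral_const_mul, I_mul_re]
  ring

theorem im_integral_conj_cub (u : E4 → ℂ) : (∫ x, conj (u x) * cub u x).im = 0 := by
  have : ∀ x, conj (u x) * cub u x = ((‖u x‖ ^ 4 : ℝ) : ℂ) := by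
    intro x
    rw [cub, mul_left_comm, mul_comm _ (u x), mul_conj, normSq_eq_norm_sq]
    push_cast; ring
  simp only [this]
  rw [integral_complex_ofReal, ofReal_im]

/-- Conservation of the mass of `u = F + v`, which solves `i ∂ₜu + Δu = |u|² u`. -/
theorem RegularL2.hasWeakDeriv_mass (h : RegularL2 a b v F dv dF M) :
    HasWeakDeriv a b (fun t => ∫ x, ‖F t x + v t x‖ ^ 2) (fun _ => 0) := by
  have hM := h.ne_top
  have hlim : ∀ {f : ℕ → E4 → ℂ} {g : E4 → ℂ}, LpTendsto 2 f g →
      Tendsto (fun n => ∫ x, ‖f n x‖ ^ 2) atTop (𝓝 (∫ x, ‖g x‖ ^ 2)) := by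
    intro f g hfg
    have h1 := (hfg.mul le_rfl hfg.conj).integral
    have e : ∀ w : E4 → ℂ, ∫ x, w x * conj (w x) = ((∫ x, ‖w x‖ ^ 2 : ℝ) : ℂ) := by
      intro w
      rw [← integral_complex_ofReal]
      congr 1
      ext x
      rw [mul_conj, normSq_eq_norm_sq]
    simp only [e] at h1
    exact (continuous_re.tendsto _).comp h1
  refine hasWeakDeriv_of_tendsto_of_le (measurable_control h.toRegular) h.control_lt
    (C := 2 * M * (2 * M) + 2 * (2 * M)) (by finiteness) h.hasWeakDeriv_mass_mo ?_ ?_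
  · filter_upwards [h.slice, h.v2_le] with t ht h2
    have hu : MemLp (F t ⊞ v t) 2 := ht.F2.add (ht.v2 hM h2)
    refine ⟨fun n => ?_, hlim (LpTendsto.mol (by norm_num) (by simp) hu)⟩
    refine (enorm_integral_le_lintegral_enorm _).trans ?_
    have hm := (smoothLp_mo (by norm_num) hu n).memLp
    have hb := (eLpNorm_mo_le (by norm_num) hu.1 n).trans (ht.u2_le h2)
    calc ∫⁻ x, ‖‖mo n (F t ⊞ v t) x‖ ^ 2‖ₑ
        = N[1] (fun x => mo n (F t ⊞ v t) x * mo n (F t ⊞ v t) x) := by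
          rw [eLpNorm_one_eq_lintegral_enorm]
          refine lintegral_congr fun x => ?_
          rw [enorm_pow, enorm_norm, enorm_mul, sq]
      _ ≤ 2 * M * (2 * M) := (eLpNorm_one_mul_le hm.1 hm.1).trans (mul_le_mul' hb hb)
      _ ≤ _ := le_self_add.trans (le_mul_of_one_le_right' (one_le_control _ _ _))
  · filter_upwards [h.slice, h.v2_le] with t ht h2
    have hu : MemLp (F t ⊞ v t) 2 := ht.F2.add (ht.v2 hM h2)
    have hN := MemLp.cub_six ht.u6
    have e := fun n => integral_two_re_conj_flow hu hN n
    refine ⟨fun n => ?_, ?_⟩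
    · rw [e]
      have hm := (smoothLp_mo (by norm_num) hu n).memLp
      have hm' := (smoothLp_mo (by norm_num) hN n).memLp
      have hb := (eLpNorm_mo_le (by norm_num) hu.1 n).trans (ht.u2_le h2)
      have hb' := (eLpNorm_mo_le (by norm_num) hN.1 n).trans ht.cub_le
      rw [enorm_mul]
      calc _ ≤ ‖(2 : ℝ)‖ₑ * ‖∫ x, conj (mo n (F t ⊞ v t) x) *
              mo n (cub fun x => F t x + v t x) x‖ₑ := by
            gcongr
            rw [← ofReal_norm, ← ofReal_norm]
            exact ofReal_le_ofReal (abs_im_le_norm _)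
        _ ≤ 2 * (2 * M * control (F t ⊞ v t) (fun j => dv j t) fun j => dF j t) := by
            refine mul_le_mul' (by rw [← ofReal_norm]; simp) ?_
            refine (enorm_integral_le_lintegral_enorm _).trans ?_
            rw [← eLpNorm_one_eq_lintegral_enorm]
            refine (eLpNorm_one_mul_le hm.1.star hm'.1).trans (mul_le_mul' ?_ hb')
            exact (eLpNorm_conj _ _).le.trans hb
        _ = 2 * (2 * M) * control (F t ⊞ v t) (fun j => dv j t) fun j => dF j t := by
            ring
        _ ≤ _ := mul_le_mul' le_add_self le_rfl
    · simp only [e]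
      have l1 : LpTendsto 2 (fun n => mo n fun x => F t x + v t x) (F t ⊞ v t) :=
        LpTendsto.mol (by norm_num) (by simp) hu
      have l2 : LpTendsto 2 (fun n => mo n (cub fun x => F t x + v t x))
        (cub fun x => F t x + v t x) := LpTendsto.mol (by norm_num) (by simp) hN
      have l3 := (((continuous_im.tendsto _).comp
        (l1.conj.mul le_rfl l2).integral).const_mul 2)
      have l4 := im_integral_conj_cub fun x => F t x + v t x
      simp only [l4, mul_zero] at l3
      exact l3

end L2

section Energy

variable {v F : ℝ → E4 → ℂ} {dv dF : Fin 4 → ℝ → E4 → ℂ}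

/-- The mass of `u = F + v` is controlled by its initial value. -/
theorem RegularL2.mass_le (h : RegularL2 a b v F dv dF M) (h0 : (0 : ℝ) ∈ Ioo a b)
    {v₀ : E4 → ℂ} (hv₀ : MemLp v₀ 2) (hv₀' : MemLp v₀ 4)
    (hlim : Tendsto (fun t => N[4] (v t - v₀)) nearZero (𝓝 0)) {f₂ : ℝ≥0∞}
    (hf₂ : ∀ᵐ t ∂vol[a,b], N[2] (F t) ≤ f₂) :
    ∀ᵐ t ∂vol[a,b], N[2] (F t ⊞ v t) ≤ f₂ + N[2] v₀ := by
  obtain ⟨C, hC, hmass⟩ := h.toRegular.mass_le h0 hv₀ hv₀' hlim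
  have hc := h.hasWeakDeriv_mass.ae_abs_sub_le h.hab (C := 0) (ae_of_all _ fun _ => by simp)
  have hu : ∀ᵐ t ∂vol[a,b], MemLp (F t ⊞ v t) 2 := by
    filter_upwards [h.slice, h.v2_le] with t ht h2
    exact ht.F2.add (ht.v2 h.ne_top h2)
  filter_upwards [hc, hu] with t ht hut
  have hev : ∀ᶠ s in nearZero, N[2] (F t ⊞ v t) ≤
      f₂ + (N[2] v₀ ^ 2 + ofReal (C * |s|)) ^ (1 / 2 : ℝ) := by
    filter_upwards [eventually_nearZero h0 ht, eventually_nearZero h0 hu,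
      eventually_nearZero h0 hmass, eventually_nearZero h0 hf₂, eventually_nearZero h0 h.slice]
      with s h1 h2 h3 h4 h5
    have e1 : ∫ x, ‖F s x + v s x‖ ^ 2 = ∫ x, ‖F t x + v t x‖ ^ 2 := by
      rw [zero_mul] at h1
      linarith [abs_nonpos_iff.1 h1]
    have e2 : N[2] (F t ⊞ v t) = N[2] (F s ⊞ v s) := by
      have := (eLpNorm_two_sq_eq hut).trans ((congrArg ofReal e1.symm).trans
        (eLpNorm_two_sq_eq h2).symm)
      exact (ENNReal.pow_right_strictMono (n := 2) (by norm_num)).injective this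
    rw [e2]
    refine (eLpNorm_add_le h5.F2.1 h5.v4.1 (by norm_num)).trans (add_le_add h4 ?_)
    rw [one_div, ENNReal.le_rpow_inv_iff (by norm_num)]
    simpa using h3
  refine le_of_tendsto_of_tendsto tendsto_const_nhds ?_ hev
  have h1 : Tendsto (fun s : ℝ => s) nearZero (𝓝 0) := tendsto_id.mono_left inf_le_left
  have h2 : Tendsto (fun s : ℝ => ofReal (C * |s|)) nearZero (𝓝 0) := by
    have : Tendsto (fun s : ℝ => C * |s|) nearZero (𝓝 0) := by simpa using (h1.abs.const_mul C)
    simpa using ENNReal.tendsto_ofReal this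
  have h3 : Tendsto (fun s : ℝ => (N[2] v₀ ^ 2 + ofReal (C * |s|)) ^
      (1 / 2 : ℝ)) nearZero (𝓝 ((N[2] v₀ ^ 2 + 0) ^ (1 / 2 : ℝ))) :=
    (ENNReal.continuous_rpow_const.tendsto _).comp (tendsto_const_nhds.add h2)
  have h4 : (N[2] v₀ ^ 2 + 0) ^ (1 / 2 : ℝ) = N[2] v₀ := by
    rw [add_zero, ← rpow_natCast, ← rpow_mul]
    norm_num
  rw [h4] at h3
  exact tendsto_const_nhds.add h3

/-! ### The energy identity -/

theorem enorm_im_integral_mul_le [HolderTriple p q 1]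
    (hf : AEStronglyMeasurable f) (hg : AEStronglyMeasurable g) :
    ‖(∫ x, conj (f x) * g x).im‖ₑ ≤ N[p] f * N[q] g := by
  calc ‖(∫ x, conj (f x) * g x).im‖ₑ ≤ ‖∫ x, conj (f x) * g x‖ₑ := by
        rw [← ofReal_norm, ← ofReal_norm]
        exact ofReal_le_ofReal (abs_im_le_norm _)
    _ ≤ N[1] (fun x => conj (f x) * g x) := by
        rw [eLpNorm_one_eq_lintegral_enorm]
        exact enorm_integral_le_lintegral_enorm _
    _ ≤ _ := (eLpNorm_fun_mul_le (p := p) (q := q) hf.star hg).trans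
        (mul_le_mul' (eLpNorm_conj _ _).le le_rfl)

theorem flow_pd_mol_eq {w d e : E4 → ℂ} (h : HasWeakDer j w d)
    (h' : HasWeakDer j g e) (n : ℕ) :
    flow (pd j (mol n)) w g = fun x => I * lap (mo n d) x - I * mo n e x := by
  have hk := mol_contDiff n
  have hc := mol_hasCompactSupport n
  ext x
  rw [flow, lap_pd hk, h.cv_pd (lap_contDiff hk) (lap_hasCompactSupport hc), cv_lap h.2.1 hk hc,
    h'.cv_pd hk hc]
  rfl

theorem re_integral_conj_flow {w : E4 → ℂ} (hw : MemLp w 2)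
    [HolderTriple 4 q 1] (hw4 : MemLp w 4) (hg : MemLp g q) (hq : 1 ≤ q)
    (n : ℕ) :
    ∫ x, (conj (mo n w x) * (I * lap (mo n w) x - I * mo n g x)).re =
      (∫ x, conj (mo n w x) * mo n g x).im := by
  have hW := smoothLp_mo (by norm_num) hw n
  have hW4 := smoothLp_mo (by norm_num) hw4 n
  have hg' := (smoothLp_mo hq hg n).memLp
  have i1 : Integrable fun x => conj (mo n w x) * (I * lap (mo n w) x) :=
    integrable_fun_mul (memLp_conj hW.memLp) (hW.lap.const_mul _)
  have i2 : Integrable fun x => conj (mo n w x) * mo n g x :=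
    integrable_fun_mul (memLp_conj hW4.memLp) hg'
  have i3 : Integrable fun x => conj (mo n w x) * (I * lap (mo n w) x) -
      I * (conj (mo n w x) * mo n g x) := i1.sub (i2.const_mul _)
  have e : ∀ x, (conj (mo n w x) * (I * lap (mo n w) x - I * mo n g x)).re =
      reCLM (conj (mo n w x) * (I * lap (mo n w) x) -
        I * (conj (mo n w x) * mo n g x)) := by
    intro x
    rw [reCLM_apply]
    congr 1
    ring
  simp only [e]
  rw [reCLM.integral_comp_comm i3, integral_sub i1 (i2.const_mul _), reCLM_apply,
    sub_re, re_integral_conj_lap hW, integral_const_mul, I_mul_re]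
  ring

theorem re_integral_conj_cub_flow {u N : E4 → ℂ} {d : Fin 4 → E4 → ℂ} (hu : MemLp u 4)
    (hu6 : MemLp u 6) (hd : ∀ j, HasWeakDer j u (d j)) (hN : MemLp N 2) (n : ℕ) :
    ∫ x, (conj (cub (mo n u) x) * flow (mol n) u N x).re =
      ∑ j, (∫ x, conj (dcub (mo n u) (mo n (d j)) x) * mo n (d j) x).im +
        (∫ x, conj (cub (mo n u) x) * mo n N x).im := by
  have hU := smoothLp_mo (by norm_num) hu n
  have hG := MemLp.cub_four hU.memLp
  have hG2 := MemLp.cub_six (smoothLp_mo (by norm_num) hu6 n).memLp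
  have hN' := (smoothLp_mo (by norm_num) hN n).memLp
  have i1 : Integrable fun x => conj (cub (mo n u) x) * (I * lap (mo n u) x) :=
    integrable_fun_mul (p := p₄₃) (q := 4) (memLp_conj hG) (hU.lap.const_mul _)
  have i2 : Integrable fun x => conj (cub (mo n u) x) * mo n N x :=
    integrable_fun_mul (memLp_conj hG2) hN'
  have i3 : Integrable fun x => conj (cub (mo n u) x) * (I * lap (mo n u) x) -
      I * (conj (cub (mo n u) x) * mo n N x) := i1.sub (i2.const_mul _)
  have e : ∀ x, (conj (cub (mo n u) x) * flow (mol n) u N x).re =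
      reCLM (conj (cub (mo n u) x) * (I * lap (mo n u) x) -
        I * (conj (cub (mo n u) x) * mo n N x)) := by
    intro x
    rw [flow_mol (hd 0).1, reCLM_apply]
    congr 1
    ring
  have e2 : ∀ j, ∫ x, conj (dcub (mo n u) (pd j (mo n u)) x) * (I * pd j (mo n u) x) =
      I * ∫ x, conj (dcub (mo n u) (mo n (d j)) x) * mo n (d j) x := by
    intro j
    rw [(hd j).pd_mo, ← integral_const_mul]
    congr 1
    ext x; ring
  simp only [e]
  rw [reCLM.integral_comp_comm i3, integral_sub i1 (i2.const_mul _), reCLM_apply,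
    sub_re, integral_conj_cub_lap hU, integral_const_mul, I_mul_re]
  simp only [e2, neg_re, re_sum, I_mul_re, sum_neg_distrib]
  ring

theorem RegularL2.hasWeakDeriv_energy_mo (h : RegularL2 a b v F dv dF M) (n : ℕ) : HasWeakDeriv a b
      (fun t => (1 / 2) * ∑ j, (∫ x, ‖cv (rk (pd j (mol n))) (v t) x‖ ^ 2) +
        (1 / 4) * ∫ x, ‖mo n (F t ⊞ v t) x‖ ^ 4)
      (fun t => (1 / 2) * ∑ j, (∫ x, 2 * (conj (cv (rk (pd j (mol n))) (v t) x) *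
          flow (pd j (mol n)) (v t) (cub fun x => F t x + v t x) x).re) +
        (1 / 4) * ∫ x, 4 * (conj (cub (mo n fun x => F t x + v t x) x) *
          flow (mol n) (F t ⊞ v t) (cub fun x => F t x + v t x) x).re) := by
  have hk := mol_contDiff n
  have hc := mol_hasCompactSupport n
  have hM := h.ne_top
  refine ((HasWeakDeriv.sum Finset.univ fun j => ?_).const_mul _).add (HasWeakDeriv.const_mul ?_ _)
  · have hkj := pd_contDiff hk j
    have hcj := pd_hasCompactSupport hc j
    refine hasWeakDeriv_integral_norm_sq h.hab (fun t => one_le_control _ _ _) h.control_lt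
      hM (flow_const_ne_top hkj hcj hM) (stronglyMeasurable_cv_test hkj h.meas_v)
      (stronglyMeasurable_flow hkj h.meas_v h.meas_cub) (fun x => h.eq_v _ hkj hcj x) ?_ ?_
    · filter_upwards [h.slice] with t ht
      rw [(ht.hv j).cv_pd hk hc]
      exact (eLpNorm_mo_le (by norm_num) (ht.dv2 j).1 n).trans (ht.dv2_le j)
    · filter_upwards [h.slice, h.v2_le] with t ht h2
      exact eLpNorm_flow_le hkj hcj (ht.v2 hM h2) (MemLp.cub_six ht.u6) (one_le_control _ _ _)
        h2 ht.cub_le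
  · have hr := rk_memLp hk.continuous hc p₄₃
    have hr' := hr.2.ne
    have hA : 2 * M + N[p₄₃] (rk (mol n)) * (2 * M) ≠ ⊤ := by finiteness
    refine hasWeakDeriv_integral_norm_four h.hab (fun t => one_le_control _ _ _) h.control_lt
      hA (flow_const_ne_top hk hc (A := 2 * M) (by finiteness))
      (stronglyMeasurable_cv_test hk h.meas_u) (stronglyMeasurable_flow hk h.meas_u h.meas_cub)
      (fun x => h.eq_u hk hc x) ?_ ?_ ?_
    · filter_upwards [h.slice, h.v2_le] with t ht h2
      exact ((eLpNorm_mo_le (by norm_num) ht.u4.1 n).trans (ht.u2_le h2)).trans le_self_add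
    · filter_upwards [h.slice] with t ht
      intro x
      refine (enorm_cv_le_mul (p := p₄₃) (q := 4) hr.1 ht.u4.1 x).trans ?_
      exact (mul_le_mul' le_rfl ht.u4_le).trans le_add_self
    · filter_upwards [h.slice, h.v2_le] with t ht h2
      exact eLpNorm_flow_le hk hc (ht.F2.add (ht.v2 hM h2)) (MemLp.cub_six ht.u6)
        (one_le_control _ _ _) (ht.u2_le h2) ht.cub_le

theorem Slice.hasWeakDer_u {v F : E4 → ℂ} {dv dF : Fin 4 → E4 → ℂ}
    (h : Slice v F dv dF M) (j : Fin 4) :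
    HasWeakDer j (F ⊞ v) (dF j ⊞ dv j) := (h.hF j).add (h.hv j)

theorem Slice.du4 {v F : E4 → ℂ} {dv dF : Fin 4 → E4 → ℂ} (h : Slice v F dv dF M)
    (j : Fin 4) : MemLp (dF j ⊞ dv j) 4 := (h.dF4 j).add (h.dv4 j)

theorem Slice.grad_le {v F : E4 → ℂ} {dv dF : Fin 4 → E4 → ℂ} (h : Slice v F dv dF M)
    (j : Fin 4) : N[4] (dv j) ≤ ∑ j, (N[4] (dv j) + N[4] (dF j)) ∧ N[4] (dF j ⊞ dv j) ≤
        ∑ j, (N[4] (dv j) + N[4] (dF j)) := by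
  have h1 := single_le_sum (f := fun j => N[4] (dv j) + N[4] (dF j))
    (fun _ _ => zero_le) (Finset.mem_univ j)
  refine ⟨le_self_add.trans h1, (eLpNorm_add_le (h.dF4 j).1 (h.dv4 j).1 (by norm_num)).trans ?_⟩
  rw [add_comm]
  exact h1

/-- The time derivative of the energy of the regularized solution. -/
theorem Slice.energy_deriv_eq {v F : E4 → ℂ} {dv dF : Fin 4 → E4 → ℂ}
    (h : Slice v F dv dF M) (n : ℕ) :
    (1 / 2) * ∑ j, (∫ x, 2 * (conj (cv (rk (pd j (mol n))) v x) *
        flow (pd j (mol n)) v (cub fun x => F x + v x) x).re) +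
      (1 / 4) * ∫ x, 4 * (conj (cub (mo n fun x => F x + v x) x) *
        flow (mol n) (F ⊞ v) (cub fun x => F x + v x) x).re =
    ∑ j, ((∫ x, conj (mo n (dv j) x) *
        mo n (dcub (F ⊞ v) (dF j ⊞ dv j)) x).im +
      (∫ x, conj (dcub (mo n fun x => F x + v x) (mo n fun x => dF j x + dv j x) x) *
        mo n (dF j ⊞ dv j) x).im) +
    (∫ x, conj (cub (mo n fun x => F x + v x) x) * mo n (cub fun x => F x + v x) x).im := by
  have hk := mol_contDiff n
  have hc := mol_hasCompactSupport n
  have e1 : ∀ j, ∫ x, 2 * (conj (cv (rk (pd j (mol n))) v x) *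
      flow (pd j (mol n)) v (cub fun x => F x + v x) x).re =
      2 * (∫ x, conj (mo n (dv j) x) *
        mo n (dcub (F ⊞ v) (dF j ⊞ dv j)) x).im := by
    intro j
    rw [integral_const_mul, flow_pd_mol_eq (h.hv j) ((h.hasWeakDer_u j).cub h.u4 (h.du4 j)),
      (h.hv j).cv_pd hk hc]
    congr 1
    exact re_integral_conj_flow (q := p₄₃) (h.dv2 j) (h.dv4 j)
      (MemLp.dcub h.u4 (h.du4 j)) one_le_four_thirds n
  simp only [e1]
  rw [integral_const_mul, re_integral_conj_cub_flow h.u4 h.u6 h.hasWeakDer_u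
    (MemLp.cub_six h.u6), ← mul_sum, sum_add_distrib]
  ring

theorem Slice.tendsto_energy_deriv {v F : E4 → ℂ} {dv dF : Fin 4 → E4 → ℂ}
    (h : Slice v F dv dF M) :
    Tendsto (fun n => ∑ j, ((∫ x, conj (mo n (dv j) x) *
        mo n (dcub (F ⊞ v) (dF j ⊞ dv j)) x).im +
      (∫ x, conj (dcub (mo n fun x => F x + v x) (mo n fun x => dF j x + dv j x) x) *
        mo n (dF j ⊞ dv j) x).im) +
      (∫ x, conj (cub (mo n fun x => F x + v x) x) * mo n (cub fun x => F x + v x) x).im) atTop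
      (𝓝 (∑ j, (∫ x, conj (dcub (F ⊞ v) (dF j ⊞ dv j) x) *
        dF j x).im)) := by
  have him := fun {f : ℕ → ℂ} {z : ℂ} (hf : Tendsto f atTop (𝓝 z)) =>
    (continuous_im.tendsto _).comp hf
  have lu : LpTendsto 4 (fun n => mo n fun x => F x + v x) (F ⊞ v) :=
    LpTendsto.mol (by norm_num) (by simp) h.u4
  have lu6 : LpTendsto 6 (fun n => mo n fun x => F x + v x) (F ⊞ v) :=
    LpTendsto.mol (by norm_num) (by simp) h.u6
  have ld : ∀ j, LpTendsto 4 (fun n => mo n fun x => dF j x + dv j x) (dF j ⊞ dv j) :=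
    fun j => LpTendsto.mol (by norm_num) (by simp) (h.du4 j)
  have lv : ∀ j, LpTendsto 4 (fun n => mo n (dv j)) (dv j) :=
    fun j => LpTendsto.mol (by norm_num) (by simp) (h.dv4 j)
  have hdN := fun j => MemLp.dcub h.u4 (h.du4 j)
  have lN : LpTendsto 2 (fun n => mo n (cub fun x => F x + v x)) (cub fun x => F x + v x) :=
    LpTendsto.mol (by norm_num) (by simp) (MemLp.cub_six h.u6)
  have ldN : ∀ j, LpTendsto p₄₃
      (fun n => mo n (dcub (F ⊞ v) (dF j ⊞ dv j)))
      (dcub (F ⊞ v) (dF j ⊞ dv j)) :=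
    fun j => LpTendsto.mol one_le_four_thirds ENNReal.coe_ne_top (hdN j)
  have t1 := fun j => him ((lv j).conj.mul le_rfl (ldN j) one_le_four_thirds).integral
  have t2 := fun j => him ((lu.dcub (ld j)).conj.mul le_rfl (ld j)).integral
  have t3 := him (lu6.cub_six.conj.mul le_rfl lN).integral
  have t := (tendsto_finsetSum Finset.univ fun j _ => (t1 j).add (t2 j)).add t3
  refine (t.congr fun n => rfl).trans (le_of_eq ?_)
  congr 1
  have z : (∫ x, conj (cub (F ⊞ v) x) * cub (F ⊞ v) x).im = 0 := by
    have : ∀ x, conj (cub (F ⊞ v) x) * cub (F ⊞ v) x =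
        ((Complex.normSq (cub (F ⊞ v) x) : ℝ) : ℂ) := fun x => by
      rw [mul_comm, mul_conj]
    simp only [this]
    rw [integral_complex_ofReal, ofReal_im]
  rw [z, add_zero]
  refine sum_congr rfl fun j _ => ?_
  have c : (∫ x, conj (dv j x) * dcub (F ⊞ v) (dF j ⊞ dv j) x).im =
      -(∫ x, conj (dcub (F ⊞ v) (dF j ⊞ dv j) x) * dv j x).im := by
    rw [← conj_im, ← integral_conj]
    congr 2
    ext x
    simp only [map_mul, RingHomCompTriple.comp_apply, RingHom.id_apply]
    ring
  have i1 : Integrable fun x => conj (dcub (F ⊞ v)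
      (dF j ⊞ dv j) x) * dv j x :=
    integrable_fun_mul (p := p₄₃) (q := 4) (memLp_conj (hdN j)) (h.dv4 j)
  have i2 : Integrable fun x => conj (dcub (F ⊞ v)
      (dF j ⊞ dv j) x) * dF j x :=
    integrable_fun_mul (p := p₄₃) (q := 4) (memLp_conj (hdN j)) (h.dF4 j)
  have s : ∫ x, conj (dcub (F ⊞ v) (dF j ⊞ dv j) x) *
      (dF j x + dv j x) = (∫ x, conj (dcub (F ⊞ v)
        (dF j ⊞ dv j) x) * dF j x) + ∫ x, conj (dcub (F ⊞ v)
        (dF j ⊞ dv j) x) * dv j x := by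
    rw [← integral_add i2 i1]
    congr 1; ext x; ring
  rw [c, s, add_im]
  ring

theorem Slice.energy_deriv_le {v F : E4 → ℂ} {dv dF : Fin 4 → E4 → ℂ}
    (h : Slice v F dv dF M) (n : ℕ) :
    ‖∑ j, ((∫ x, conj (mo n (dv j) x) *
        mo n (dcub (F ⊞ v) (dF j ⊞ dv j)) x).im +
      (∫ x, conj (dcub (mo n fun x => F x + v x) (mo n fun x => dF j x + dv j x) x) *
        mo n (dF j ⊞ dv j) x).im) +
      (∫ x, conj (cub (mo n fun x => F x + v x) x) * mo n (cub fun x => F x + v x) x).im‖ₑ ≤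
      (4 * (2 * (3 * (2 * M) ^ 2)) + 1) * control (F ⊞ v) dv dF := by
  set σ := ∑ j, (N[4] (dv j) + N[4] (dF j)) with hσ
  have hUm := (smoothLp_mo (by norm_num) h.u4 n).memLp
  have hU4 : N[4] (mo n fun x => F x + v x) ≤ 2 * M :=
    (eLpNorm_mo_le (by norm_num) h.u4.1 n).trans h.u4_le
  have hdN := fun j => MemLp.dcub h.u4 (h.du4 j)
  have hd := fun j => (smoothLp_mo (by norm_num) (h.du4 j) n).memLp
  have hdb : ∀ j, N[4] (mo n fun x => dF j x + dv j x) ≤ σ := fun j =>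
    (eLpNorm_mo_le (by norm_num) (h.du4 j).1 n).trans (h.grad_le j).2
  have b1 : ∀ j, ‖(∫ x, conj (mo n (dv j) x) *
        mo n (dcub (F ⊞ v) (dF j ⊞ dv j)) x).im‖ₑ ≤
        (3 * (2 * M) ^ 2) * σ ^ 2 := by
    intro j
    refine (enorm_im_integral_mul_le (p := 4) (q := p₄₃)
      (smoothLp_mo (by norm_num) (h.dv4 j) n).memLp.1
      (smoothLp_mo one_le_four_thirds (hdN j) n).memLp.1).trans ?_
    calc _ ≤ σ * (3 * ((2 * M) ^ 2 * σ)) := by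
          refine mul_le_mul' ((eLpNorm_mo_le (by norm_num) (h.dv4 j).1 n).trans (h.grad_le j).1)
            ((eLpNorm_mo_le one_le_four_thirds (hdN j).1 n).trans
              ((eLpNorm_dcub_le h.u4.1 (h.du4 j).1).trans ?_))
          gcongr
          · exact h.u4_le
          · exact (h.grad_le j).2
      _ = _ := by ring
  have b2 : ∀ j, ‖(∫ x, conj (dcub (mo n fun x => F x + v x)
        (mo n fun x => dF j x + dv j x) x) * mo n (dF j ⊞ dv j) x).im‖ₑ ≤
        (3 * (2 * M) ^ 2) * σ ^ 2 := by
    intro j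
    refine (enorm_im_integral_mul_le (p := p₄₃) (q := 4)
      (MemLp.dcub hUm (hd j)).1 (hd j).1).trans ?_
    calc _ ≤ (3 * ((2 * M) ^ 2 * σ)) * σ := by
          refine mul_le_mul' ((eLpNorm_dcub_le hUm.1 (hd j).1).trans ?_) (hdb j)
          gcongr
          exact hdb j
      _ = _ := by ring
  have b3 : ‖(∫ x, conj (cub (mo n fun x => F x + v x) x) *
        mo n (cub fun x => F x + v x) x).im‖ₑ ≤ N[6] (F ⊞ v) ^ 6 := by
    have hU6 := (smoothLp_mo (by norm_num) h.u6 n).memLp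
    have hN := MemLp.cub_six h.u6
    refine (enorm_im_integral_mul_le (p := 2) (q := 2) (MemLp.cub_six hU6).1
      (smoothLp_mo (by norm_num) hN n).memLp.1).trans ?_
    calc _ ≤ N[6] (F ⊞ v) ^ 3 * N[6] (F ⊞ v) ^ 3 := by
          refine mul_le_mul' ((eLpNorm_cub_six_le hU6.1).trans ?_)
            ((eLpNorm_mo_le (by norm_num) hN.1 n).trans (eLpNorm_cub_six_le h.u6.1))
          gcongr
          exact eLpNorm_mo_le (by norm_num) h.u6.1 n
      _ = _ := by ring
  calc _ ≤ ∑ j : Fin 4, ((3 * (2 * M) ^ 2) * σ ^ 2 + (3 * (2 * M) ^ 2) * σ ^ 2) +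
        N[6] (F ⊞ v) ^ 6 := by
        refine (enorm_add_le _ _).trans (add_le_add ((enorm_sum_le _ _).trans
          (sum_le_sum fun j _ => (enorm_add_le _ _).trans (add_le_add (b1 j) (b2 j)))) b3)
    _ = (4 * (2 * (3 * (2 * M) ^ 2))) * σ ^ 2 + 1 * N[6] (F ⊞ v) ^ 6 := by simp; ring
    _ ≤ (4 * (2 * (3 * (2 * M) ^ 2))) * control (F ⊞ v) dv dF +
        1 * control (F ⊞ v) dv dF := by
        refine add_le_add (mul_le_mul' le_rfl ?_) (mul_le_mul' le_rfl ?_)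
        · rw [control, add_assoc]; exact le_self_add
        · rw [control, add_assoc, add_left_comm]; exact le_self_add
    _ = _ := by ring

/-- The energy identity: the rate of change of the modified energy is
`∑ⱼ Im ∫ conj (∂ⱼ(|u|² u)) ∂ⱼF`. -/
theorem RegularL2.hasWeakDeriv_energy (h : RegularL2 a b v F dv dF M) : HasWeakDeriv a b
      (fun t => (1 / 2) * ∑ j, (∫ x, ‖dv j t x‖ ^ 2) + (1 / 4) * ∫ x, ‖F t x + v t x‖ ^ 4)
      (fun t => ∑ j, (∫ x, conj
        (dcub (F t ⊞ v t) (fun x => dF j t x + dv j t x) x) * dF j t x).im) := by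
  have hM := h.ne_top
  refine hasWeakDeriv_of_tendsto_of_le (measurable_control h.toRegular) h.control_lt
    (C := (4 * M ^ 2 + (2 * M) ^ 4) + (4 * (2 * (3 * (2 * M) ^ 2)) + 1)) (by finiteness)
    h.hasWeakDeriv_energy_mo ?_ ?_
  · filter_upwards [h.slice] with t ht
    have hk := mol_contDiff
    have hc := mol_hasCompactSupport
    have e : ∀ n j, cv (rk (pd j (mol n))) (v t) = mo n (dv j t) := fun n j =>
      (ht.hv j).cv_pd (hk n) (hc n)
    simp only [e]
    refine ⟨fun n => ?_, ?_⟩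
    · have b1 : ∀ j, ‖∫ x, ‖mo n (dv j t) x‖ ^ 2‖ₑ ≤ M ^ 2 := by
        intro j
        have hm := (smoothLp_mo (by norm_num) (ht.dv2 j) n).memLp
        rw [enorm_eq_ofReal (integral_nonneg fun x => by positivity), ← eLpNorm_two_sq_eq hm]
        gcongr
        exact (eLpNorm_mo_le (by norm_num) (ht.dv2 j).1 n).trans (ht.dv2_le j)
      have b2 : ‖∫ x, ‖mo n (F t ⊞ v t) x‖ ^ 4‖ₑ ≤ (2 * M) ^ 4 := by
        have hm := (smoothLp_mo (by norm_num) ht.u4 n).memLp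
        rw [enorm_eq_ofReal (integral_nonneg fun x => by positivity), ← eLpNorm_four_pow_eq hm]
        gcongr
        exact (eLpNorm_mo_le (by norm_num) ht.u4.1 n).trans ht.u4_le
      have c1 : ‖(1 / 2 : ℝ)‖ₑ ≤ 1 := by
        rw [enorm_eq_ofReal (by norm_num)]
        exact ofReal_le_one.2 (by norm_num)
      have c2 : ‖(1 / 4 : ℝ)‖ₑ ≤ 1 := by
        rw [enorm_eq_ofReal (by norm_num)]
        exact ofReal_le_one.2 (by norm_num)
      calc _ ≤ 1 * ∑ j : Fin 4, M ^ 2 + 1 * (2 * M) ^ 4 := by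
            refine (enorm_add_le _ _).trans (add_le_add ?_ ?_)
            · rw [enorm_mul]
              exact mul_le_mul' c1 ((enorm_sum_le _ _).trans (sum_le_sum fun j _ => b1 j))
            · rw [enorm_mul]
              exact mul_le_mul' c2 b2
        _ = 4 * M ^ 2 + (2 * M) ^ 4 := by simp
        _ ≤ _ := le_self_add.trans (le_mul_of_one_le_right' (one_le_control _ _ _))
    · refine ((tendsto_finsetSum Finset.univ fun j _ => ?_).const_mul _).add
        (Tendsto.const_mul _ ?_)
      · have l : LpTendsto 2 (fun n => mo n (dv j t)) (dv j t) :=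
          LpTendsto.mol (by norm_num) (by simp) (ht.dv2 j)
        have h1 := (l.mul le_rfl l.conj).integral
        have e : ∀ w : E4 → ℂ, ∫ x, w x * conj (w x) = ((∫ x, ‖w x‖ ^ 2 : ℝ) : ℂ) := by
          intro w
          rw [← integral_complex_ofReal]
          congr 1
          ext x
          rw [mul_conj, normSq_eq_norm_sq]
        simp only [e] at h1
        exact (continuous_re.tendsto _).comp h1
      · have l : LpTendsto 4 (fun n => mo n fun x => F t x + v t x) (F t ⊞ v t) :=
          LpTendsto.mol (by norm_num) (by simp) ht.u4
        have h1 := (l.conj.mul le_rfl l.cub_four one_le_four_thirds).integral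
        have e : ∀ w : E4 → ℂ, ∫ x, conj (w x) * cub w x = ((∫ x, ‖w x‖ ^ 4 : ℝ) : ℂ) := by
          intro w
          rw [← integral_complex_ofReal]
          congr 1
          ext x
          rw [cub, mul_left_comm, mul_comm _ (w x), mul_conj, normSq_eq_norm_sq]
          push_cast; ring
        simp only [e] at h1
        exact (continuous_re.tendsto _).comp h1
  · filter_upwards [h.slice] with t ht
    simp only [ht.energy_deriv_eq]
    exact ⟨fun n => (ht.energy_deriv_le n).trans (mul_le_mul' le_add_self le_rfl),
      ht.tendsto_energy_deriv⟩

end Energy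

/-! ### The Morawetz inequality in time -/

section Morawetz

variable {v F : ℝ → E4 → ℂ} {dv dF : Fin 4 → ℝ → E4 → ℂ}

theorem im_integral_add (hf : Integrable f) (hg : Integrable g) :
    (∫ x, f x).im + (∫ x, g x).im = ∫ x, (f x + g x).im := by
  rw [← add_im, ← integral_add hf hg, ← Complex.imCLM_apply,
    ← Complex.imCLM.integral_comp_comm (φ := fun x => f x + g x) (hf.add hg)]
  rfl

theorem re_integral_add (hf : Integrable f) (hg : Integrable g) :
    (∫ x, f x).re + (∫ x, g x).re = ∫ x, (f x + g x).re := by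
  rw [← add_re, ← integral_add hf hg, ← reCLM_apply,
    ← reCLM.integral_comp_comm (φ := fun x => f x + g x) (hf.add hg)]
  rfl

theorem abs_morA_le (k : Fin 4) (x : E4) : |morA k x| ≤ 1 := abs_coord_mul_le 0 k x

theorem morB_nonneg (x : E4) : 0 ≤ morB x :=
  add_nonneg (mul_nonneg (by norm_num) (pow_nonneg (ijap_pos x).le _))
    (pow_nonneg (ijap_pos x).le _)

theorem morB_le (x : E4) : morB x ≤ 4 * ijap x := by
  have h1 := ijap_pos x
  have h2 : ijap x ^ 2 ≤ 1 := pow_le_one₀ h1.le (ijap_le_one x)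
  have h3 : ijap x ^ (2 + 1) ≤ ijap x := by
    rw [pow_succ]
    exact mul_le_of_le_one_left h1.le h2
  rw [morB, zero_add, pow_one]
  linarith

theorem le_morB (x : E4) : 3 * ijap x ≤ morB x := by
  have h1 := ijap_pos x
  rw [morB, zero_add, pow_one]
  linarith [pow_pos h1 (2 + 1)]

theorem abs_morB_le (x : E4) : |morB x| ≤ 4 := by
  rw [abs_of_nonneg (morB_nonneg x)]
  linarith [morB_le x, ijap_le_one x]

/-- The momentum of `v` in the direction of the gradient of `⟨x⟩`. -/
def momentum (v : E4 → ℂ) (dv : Fin 4 → E4 → ℂ) : ℝ := ∑ k, ∫ x, morA k x * (conj (v x) * dv k x).im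

/-- The contribution of the nonlinearity `N` to the growth of the momentum. -/
def morRate (v N : E4 → ℂ) (dv : Fin 4 → E4 → ℂ) : ℝ :=
  2 * ∑ k, (wint (morA k) (dv k) (fun x => conj (N x))).re + (wint morB v (fun x => conj (N x))).re

theorem enorm_re_wint_le {w : E4 → ℝ} {C : ℝ≥0∞} (hw : ∀ x, ‖w x‖ₑ ≤ C) (hC : C ≠ ⊤)
    (hf : AEStronglyMeasurable f) (hg : AEStronglyMeasurable g) :
    ‖(wint w f (fun x => conj (g x))).re‖ₑ ≤ C * (N[2] f * N[2] g) := by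
  calc _ ≤ ‖wint w f (fun x => conj (g x))‖ₑ := by
        rw [← ofReal_norm, ← ofReal_norm]
        exact ofReal_le_ofReal (abs_re_le_norm _)
    _ ≤ ∫⁻ x, ‖(w x : ℂ) * (f x * conj (g x))‖ₑ := enorm_integral_le_lintegral_enorm _
    _ ≤ ∫⁻ x, C * ‖f x * conj (g x)‖ₑ := by
        refine lintegral_mono fun x => ?_
        rw [enorm_mul]
        gcongr
        refine le_trans (le_of_eq ?_) (hw x)
        rw [← ofReal_norm, ← ofReal_norm, norm_real]
    _ = C * N[1] (fun x => f x * conj (g x)) := by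
        rw [lintegral_const_mul' _ _ hC, eLpNorm_one_eq_lintegral_enorm]
    _ ≤ _ := by
        gcongr
        exact (eLpNorm_one_mul_le hf hg.star).trans (mul_le_mul' le_rfl (eLpNorm_conj _ _).le)

theorem enorm_morRate_le {v N : E4 → ℂ} {dv : Fin 4 → E4 → ℂ} (hv : AEStronglyMeasurable v)
    (hN : AEStronglyMeasurable N) (hd : ∀ k, AEStronglyMeasurable (dv k)) {Φ : ℝ≥0∞}
    (h1 : N[2] v ≤ M) (h2 : ∀ k, N[2] (dv k) ≤ M)
    (h3 : N[2] N ≤ Φ) : ‖morRate v N dv‖ₑ ≤ 12 * M * Φ := by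
  have hA : ∀ k x, ‖morA k x‖ₑ ≤ 1 := fun k x => by
    rw [enorm_eq_ofReal_abs]
    exact ofReal_le_one.2 (abs_morA_le k x)
  have hB : ∀ x, ‖morB x‖ₑ ≤ 4 := fun x => by
    rw [enorm_eq_ofReal_abs]
    exact (ofReal_le_ofReal (abs_morB_le x)).trans (by simp)
  have b1 : ∀ k, ‖(wint (morA k) (dv k) (fun x => conj (N x))).re‖ₑ ≤ M * Φ := fun k =>
    (enorm_re_wint_le (hA k) (by simp) (hd k) hN).trans (by
      rw [one_mul]; exact mul_le_mul' (h2 k) h3)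
  have b2 : ‖(wint morB v (fun x => conj (N x))).re‖ₑ ≤ 4 * (M * Φ) :=
    (enorm_re_wint_le hB (by simp) hv hN).trans (by gcongr)
  calc _ ≤ 2 * ∑ k : Fin 4, M * Φ + 4 * (M * Φ) := by
        refine (enorm_add_le _ _).trans (add_le_add ?_ b2)
        rw [enorm_mul]
        refine mul_le_mul' (by rw [← ofReal_norm]; simp) ((enorm_sum_le _ _).trans
          (sum_le_sum fun k _ => b1 k))
    _ = _ := by simp; ring

theorem LpTendsto.wint {w : E4 → ℝ} (hw : Continuous w) (hb : ∃ C, ∀ x, |w x| ≤ C)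
    {f g : ℕ → E4 → ℂ} {f₀ g₀ : E4 → ℂ} (hf : LpTendsto 2 f f₀) (hg : LpTendsto 2 g g₀) :
    Tendsto (fun n => wint w (f n) (g n)) atTop (𝓝 (wint w f₀ g₀)) :=
  ((LpTendsto.const (memLp_weight hw hb)).mul le_rfl (hf.mul (r := 1) le_rfl hg)).integral

theorem LpTendsto.morRate {v N : ℕ → E4 → ℂ} {dv : ℕ → Fin 4 → E4 → ℂ} {v₀ N₀ : E4 → ℂ}
    {dv₀ : Fin 4 → E4 → ℂ} (hv : LpTendsto 2 v v₀) (hN : LpTendsto 2 N N₀)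
    (hd : ∀ k, LpTendsto 2 (fun n => dv n k) (dv₀ k)) :
    Tendsto (fun n => ForcedNLS.morRate (v n) (N n) (dv n)) atTop
      (𝓝 (ForcedNLS.morRate v₀ N₀ dv₀)) := by
  have hre := fun {f : ℕ → ℂ} {z : ℂ} (hf : Tendsto f atTop (𝓝 z)) =>
    (continuous_re.tendsto _).comp hf
  refine (Tendsto.const_mul 2 (tendsto_finsetSum Finset.univ fun k _ => ?_)).add ?_
  · exact hre ((hd k).wint (bddWeight_morA k).1.continuous (bddWeight_morA k).2.1 hN.conj)
  · exact hre (hv.wint bddWeight_morB.1.continuous bddWeight_morB.2.1 hN.conj)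

theorem LpTendsto.momentum {v : ℕ → E4 → ℂ} {dv : ℕ → Fin 4 → E4 → ℂ} {v₀ : E4 → ℂ}
    {dv₀ : Fin 4 → E4 → ℂ} (hv : LpTendsto 2 v v₀)
    (hd : ∀ k, LpTendsto 2 (fun n => dv n k) (dv₀ k)) :
    Tendsto (fun n => ForcedNLS.momentum (v n) (dv n)) atTop (𝓝 (ForcedNLS.momentum v₀ dv₀)) := by
  refine tendsto_finsetSum Finset.univ fun k _ => ?_
  have hc := (bddWeight_morA k).1.continuous
  have hb := (bddWeight_morA k).2.1
  have := (continuous_im.tendsto _).comp (hv.conj.wint hc hb (hd k))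
  rw [wint_im hc hb (memLp_conj hv.memLp_lim) (hd k).memLp_lim] at this
  refine this.congr fun n => ?_
  exact wint_im hc hb (memLp_conj (hv.memLp n)) ((hd k).memLp n)

theorem RegularL2.hasWeakDeriv_momentum_mo (h : RegularL2 a b v F dv dF M) (n : ℕ) :
    HasWeakDeriv a b (fun t => momentum (mo n (v t)) fun k => cv (rk (pd k (mol n))) (v t))
      (fun t => ∑ k, ∫ x, morA k x * (conj (flow (mol n) (v t) (cub fun x => F t x + v t x) x) *
            cv (rk (pd k (mol n))) (v t) x +
          conj (mo n (v t) x) * flow (pd k (mol n)) (v t) (cub fun x => F t x + v t x) x).im) := by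
  have hk := mol_contDiff n
  have hc := mol_hasCompactSupport n
  have hM := h.ne_top
  refine HasWeakDeriv.sum Finset.univ fun k => ?_
  have hkj := pd_contDiff hk k
  have hcj := pd_hasCompactSupport hc k
  have c1 := flow_const_ne_top hkj hcj hM
  have c2 := flow_const_ne_top hk hc hM
  refine hasWeakDeriv_integral_im h.hab (fun t => one_le_control _ _ _) h.control_lt hM
    (D := (N[1] (rk (lap (pd k (mol n)))) * M + N[1] (rk (pd k (mol n)))) +
      (N[1] (rk (lap (mol n))) * M + N[1] (rk (mol n))))
    (add_ne_top.2 ⟨c1, c2⟩)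
    (bddWeight_morA k).1.continuous (abs_morA_le k)
    (stronglyMeasurable_cv_test hk h.meas_v) (stronglyMeasurable_flow hk h.meas_v h.meas_cub)
    (stronglyMeasurable_cv_test hkj h.meas_v) (stronglyMeasurable_flow hkj h.meas_v h.meas_cub)
    (fun x => h.eq_v _ hk hc x) (fun x => h.eq_v _ hkj hcj x) ?_ ?_ ?_ ?_
  · filter_upwards [h.slice, h.v2_le] with t ht h2
    exact (eLpNorm_mo_le (by norm_num) ht.v4.1 n).trans h2
  · filter_upwards [h.slice] with t ht
    rw [(ht.hv k).cv_pd hk hc]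
    exact (eLpNorm_mo_le (by norm_num) (ht.dv2 k).1 n).trans (ht.dv2_le k)
  · filter_upwards [h.slice, h.v2_le] with t ht h2
    exact (eLpNorm_flow_le hk hc (ht.v2 hM h2) (MemLp.cub_six ht.u6) (one_le_control _ _ _)
        h2 ht.cub_le).trans (mul_le_mul' le_add_self le_rfl)
  · filter_upwards [h.slice, h.v2_le] with t ht h2
    exact (eLpNorm_flow_le hkj hcj (ht.v2 hM h2) (MemLp.cub_six ht.u6) (one_le_control _ _ _)
        h2 ht.cub_le).trans (mul_le_mul' le_self_add le_rfl)

/-- The growth of the regularized momentum is bounded from below. -/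
theorem Slice.morRate_le {v F : E4 → ℂ} {dv dF : Fin 4 → E4 → ℂ}
    (h : Slice v F dv dF M) (h2 : MemLp v 2) (n : ℕ) :
    morRate (mo n v) (mo n (cub fun x => F x + v x)) (fun k => mo n (dv k)) ≤ ∑ k, ∫ x, morA k x *
        (conj (flow (mol n) v (cub fun x => F x + v x) x) * cv (rk (pd k (mol n))) v x +
          conj (mo n v x) * flow (pd k (mol n)) v (cub fun x => F x + v x) x).im := by
  have hN := MemLp.cub_six h.u6
  have sw := smoothLp_mo (by norm_num) h2 n
  have sg := smoothLp_mo (by norm_num) hN n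
  have sf := sw.flow sg
  have key := morawetz_inequality sw sg
  have e : ∀ k, pd k (mo n v) = mo n (dv k) := fun k => (h.hv k).pd_mo n
  have e2 : ∀ k, cv (rk (pd k (mol n))) v = mo n (dv k) := fun k =>
    (h.hv k).cv_pd (mol_contDiff n) (mol_hasCompactSupport n)
  refine (le_of_eq ?_).trans (key.trans (le_of_eq ?_))
  · simp only [morRate, e]
  · refine sum_congr rfl fun k _ => ?_
    have hc := (bddWeight_morA k).1.continuous
    have hb := (bddWeight_morA k).2.1
    have i1 := integrable_wint hc hb (sw.pd k).memLp sf.conj.memLp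
    have i2 := integrable_wint hc hb sw.conj.memLp (sf.pd k).memLp
    rw [wint, wint, im_integral_add i1 i2]
    congr 1
    ext x
    rw [flow_mol (h.hv 0).1, flow_pd_mol h2 hN, e2, ← e]
    rw [← mul_add, Complex.im_ofReal_mul]
    congr 2
    ring

theorem stronglyMeasurable_wint {w : E4 → ℝ} (hw : Continuous w) {f g : ℝ → E4 → ℂ}
    (hf : StronglyMeasurable (uncurry f)) (hg : StronglyMeasurable (uncurry g)) :
    StronglyMeasurable fun t => (wint w (f t) (fun x => conj (g t x))).re := by
  refine continuous_re.comp_stronglyMeasurable ?_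
  have hwm : StronglyMeasurable (fun z : ℝ × E4 => (w z.2 : ℂ)) :=
    (continuous_ofReal.comp (hw.comp continuous_snd)).stronglyMeasurable
  exact (hwm.mul (hf.mul (continuous_conj.comp_stronglyMeasurable hg))).integral_prod_right'

theorem stronglyMeasurable_morRate {f g : ℝ → E4 → ℂ} {d : Fin 4 → ℝ → E4 → ℂ}
    (hf : StronglyMeasurable (uncurry f)) (hg : StronglyMeasurable (uncurry g))
    (hd : ∀ k, StronglyMeasurable (uncurry (d k))) :
    StronglyMeasurable fun t => morRate (f t) (g t) fun k => d k t := by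
  refine StronglyMeasurable.add (StronglyMeasurable.const_mul ?_ 2)
    (stronglyMeasurable_wint bddWeight_morB.1.continuous hf hg)
  exact Finset.stronglyMeasurable_fun_sum _ fun k _ =>
    stronglyMeasurable_wint (bddWeight_morA k).1.continuous (hd k) hg

theorem integrableOn_of_enorm_le {Φ : ℝ → ℝ≥0∞} (hΦ : ∫⁻ t in Ioo a b, Φ t < ⊤) {C : ℝ≥0∞}
    (hC : C ≠ ⊤) {f : ℝ → ℝ} (hf : AEStronglyMeasurable f (vol[a,b]))
    (h : ∀ᵐ t ∂vol[a,b], ‖f t‖ₑ ≤ C * Φ t) : IntegrableOn f (Ioo a b) := by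
  refine ⟨hf, ?_⟩
  calc ∫⁻ t in Ioo a b, ‖f t‖ₑ ≤ ∫⁻ t in Ioo a b, C * Φ t := lintegral_mono_ae h
    _ = C * ∫⁻ t in Ioo a b, Φ t := lintegral_const_mul' _ _ hC
    _ < ⊤ := mul_lt_top hC.lt_top hΦ

theorem RegularL2.integrableOn_morRate (h : RegularL2 a b v F dv dF M) :
    IntegrableOn (fun t => morRate (v t) (cub fun x => F t x + v t x) fun k => dv k t)
      (Ioo a b) := by
  have hM := h.ne_top
  refine integrableOn_of_enorm_le h.control_lt (C := 12 * M) (by finiteness)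
    (stronglyMeasurable_morRate h.meas_v h.meas_cub h.meas_dv).aestronglyMeasurable ?_
  filter_upwards [h.slice, h.v2_le] with t ht h2
  exact enorm_morRate_le ht.v4.1 (MemLp.cub_six ht.u6).1 (fun k => (ht.dv2 k).1) h2 ht.dv2_le
    ht.cub_le

/-- The Morawetz inequality for the solution. -/
theorem RegularL2.integral_morRate_le (h : RegularL2 a b v F dv dF M) :
    ∀ᵐ t₁ ∂vol[a,b], ∀ᵐ t₂ ∂vol[a,b], t₁ ≤ t₂ →
      ∫ t in t₁..t₂, morRate (v t) (cub fun x => F t x + v t x) (fun k => dv k t) ≤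
        momentum (v t₂) (fun k => dv k t₂) - momentum (v t₁) (fun k => dv k t₁) := by
  have hM := h.ne_top
  have hR : ∀ n, StronglyMeasurable fun t => morRate (mo n (v t))
      (mo n (cub fun x => F t x + v t x))
      (fun k => cv (rk (pd k (mol n))) (v t)) := fun n =>
    stronglyMeasurable_morRate (stronglyMeasurable_cv_test (mol_contDiff n) h.meas_v)
      (stronglyMeasurable_cv_test (mol_contDiff n) h.meas_cub)
      fun k => stronglyMeasurable_cv_test (pd_contDiff (mol_contDiff n) k) h.meas_v
  have e2 : ∀ᵐ t ∂vol[a,b], ∀ n k, cv (rk (pd k (mol n))) (v t) = mo n (dv k t) := by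
    filter_upwards [h.slice] with t ht n k
    exact (ht.hv k).cv_pd (mol_contDiff n) (mol_hasCompactSupport n)
  have hRb : ∀ᵐ t ∂vol[a,b], ∀ n, ‖morRate (mo n (v t)) (mo n (cub fun x => F t x + v t x))
        (fun k => cv (rk (pd k (mol n))) (v t))‖ₑ ≤
      12 * M * control (F t ⊞ v t) (fun j => dv j t) fun j => dF j t := by
    filter_upwards [h.slice, h.v2_le, e2] with t ht h2 he n
    simp only [he]
    have hN := MemLp.cub_six ht.u6
    exact enorm_morRate_le (smoothLp_mo (by norm_num) (ht.v2 hM h2) n).memLp.1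
      (smoothLp_mo (by norm_num) hN n).memLp.1
      (fun k => (smoothLp_mo (by norm_num) (ht.dv2 k) n).memLp.1)
      ((eLpNorm_mo_le (by norm_num) ht.v4.1 n).trans h2)
      (fun k => (eLpNorm_mo_le (by norm_num) (ht.dv2 k).1 n).trans (ht.dv2_le k))
      ((eLpNorm_mo_le (by norm_num) hN.1 n).trans ht.cub_le)
  have hRl : ∀ᵐ t ∂vol[a,b],
      Tendsto (fun n => morRate (mo n (v t)) (mo n (cub fun x => F t x + v t x))
        (fun k => cv (rk (pd k (mol n))) (v t))) atTop
        (𝓝 (morRate (v t) (cub fun x => F t x + v t x) fun k => dv k t)) := by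
    filter_upwards [h.slice, h.v2_le, e2] with t ht h2 he
    simp only [he]
    exact LpTendsto.morRate (LpTendsto.mol (by norm_num) (by simp) (ht.v2 hM h2))
      (LpTendsto.mol (by norm_num) (by simp) (MemLp.cub_six ht.u6))
      fun k => LpTendsto.mol (by norm_num) (by simp) (ht.dv2 k)
  have hMl : ∀ᵐ t ∂vol[a,b],
      Tendsto (fun n => momentum (mo n (v t)) (fun k => cv (rk (pd k (mol n))) (v t))) atTop
        (𝓝 (momentum (v t) fun k => dv k t)) := by
    filter_upwards [h.slice, h.v2_le, e2] with t ht h2 he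
    simp only [he]
    exact LpTendsto.momentum (LpTendsto.mol (by norm_num) (by simp) (ht.v2 hM h2))
      fun k => LpTendsto.mol (by norm_num) (by simp) (ht.dv2 k)
  have hle : ∀ n, ∀ᵐ t ∂vol[a,b], morRate (mo n (v t)) (mo n (cub fun x => F t x + v t x))
        (fun k => cv (rk (pd k (mol n))) (v t)) ≤ ∑ k, ∫ x, morA k x *
        (conj (flow (mol n) (v t) (cub fun x => F t x + v t x) x) * cv (rk (pd k (mol n))) (v t) x +
          conj (mo n (v t) x) * flow (pd k (mol n)) (v t) (cub fun x => F t x + v t x) x).im := by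
    intro n
    filter_upwards [h.slice, h.v2_le, e2] with t ht h2 he
    refine le_trans (le_of_eq ?_) (ht.morRate_le (ht.v2 hM h2) n)
    simp only [he]
  have hCΦ : ∫⁻ t in Ioo a b, 12 * M * control (F t ⊞ v t) (fun j => dv j t)
      (fun j => dF j t) < ⊤ := by
    rw [lintegral_const_mul' _ _ (by finiteness)]
    exact mul_lt_top (by finiteness) h.control_lt
  have hCm : Measurable fun t => 12 * M * control (F t ⊞ v t) (fun j => dv j t)
      (fun j => dF j t) := (measurable_control h.toRegular).const_mul _
  have hCi := integrable_toReal_of_lintegral_ne_top hCm.aemeasurable hCΦ.ne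
  have hfin := ae_lt_top hCm hCΦ.ne
  have h1 := fun n => (h.hasWeakDeriv_momentum_mo n).ae_sub_eq h.hab
  filter_upwards [ae_all_iff.2 h1, hMl, ae_restrict_mem measurableSet_Ioo] with t₁ k1 l1 m1
  filter_upwards [ae_all_iff.2 k1, hMl, ae_restrict_mem measurableSet_Ioo] with t₂ k2 l2 m2 hlt
  have hsub : Ioc t₁ t₂ ⊆ Ioo a b := fun s hs => ⟨m1.1.trans hs.1, hs.2.trans_lt m2.2⟩
  have hrestr : volume.restrict (Ioc t₁ t₂) ≤ vol[a,b] := Measure.restrict_mono hsub le_rfl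
  have hii : ∀ {f : ℝ → ℝ}, IntegrableOn f (Ioo a b) → IntervalIntegrable f volume t₁ t₂ :=
    fun hf => (intervalIntegrable_iff_integrableOn_Ioc_of_le hlt).2 (hf.mono_set hsub)
  have lim : Tendsto (fun n => ∫ t in t₁..t₂, morRate (mo n (v t))
      (mo n (cub fun x => F t x + v t x)) (fun k => cv (rk (pd k (mol n))) (v t))) atTop
      (𝓝 (∫ t in t₁..t₂, morRate (v t) (cub fun x => F t x + v t x) fun k => dv k t)) := by
    refine intervalIntegral.tendsto_integral_filter_of_dominated_convergence _
      (Eventually.of_forall fun n => (hR n).aestronglyMeasurable) ?_ (hii hCi) ?_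
    · refine Eventually.of_forall fun n => ?_
      rw [uIoc_of_le hlt, ← ae_restrict_iff' measurableSet_Ioc]
      filter_upwards [ae_mono hrestr hRb, ae_mono hrestr hfin] with t ht hf
      rw [← toReal_enorm]
      exact toReal_mono hf.ne (ht n)
    · rw [uIoc_of_le hlt, ← ae_restrict_iff' measurableSet_Ioc]
      exact ae_mono hrestr hRl
  refine le_of_tendsto_of_tendsto lim (l2.sub l1) (Eventually.of_forall fun n => ?_)
  simp only
  rw [k2 n]
  refine intervalIntegral.integral_mono_ae_restrict hlt ?_ ?_ ?_
  · exact hii (integrableOn_of_enorm_le h.control_lt (C := 12 * M) (by finiteness)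
      (hR n).aestronglyMeasurable (hRb.mono fun t ht => ht n))
  · exact hii (h.hasWeakDeriv_momentum_mo n).integrable_deriv
  · have : volume.restrict (Icc t₁ t₂) = volume.restrict (Ioc t₁ t₂) :=
      Measure.restrict_congr_set Ioc_ae_eq_Icc.symm
    rw [this]
    exact ae_mono hrestr (hle n)

/-- The contribution of the nonlinearity, expressed through `|u|⁴` and the forcing. -/
theorem Slice.morRate_eq {v F : E4 → ℂ} {dv dF : Fin 4 → E4 → ℂ}
    (h : Slice v F dv dF M) :
    morRate v (cub fun x => F x + v x) dv = (1 / 2) * (∫ x, morB x * ‖F x + v x‖ ^ 4) -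
      morRate F (cub fun x => F x + v x) dF := by
  have hN := MemLp.cub_four h.u4
  have hint : ∀ {w : E4 → ℝ} {f : E4 → ℂ}, Continuous w → (∃ C, ∀ x, |w x| ≤ C) → MemLp f 4 →
      Integrable fun x => (w x : ℂ) * (f x * conj (cub (F ⊞ v) x)) := by
    intro w f hw ⟨C, hC⟩ hf
    exact (integrable_fun_mul (p := 4) (q := p₄₃) hf (memLp_conj hN)).bdd_mul
      (c := C) (continuous_ofReal.comp hw).aestronglyMeasurable
      (ae_of_all _ fun x => by rw [norm_real]; exact hC x)
  have hadd : ∀ {w : E4 → ℝ} {f g : E4 → ℂ}, Continuous w → (∃ C, ∀ x, |w x| ≤ C) → MemLp f 4 →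
      MemLp g 4 → (wint w f (fun x => conj (cub (F ⊞ v) x))).re +
        (wint w g (fun x => conj (cub (F ⊞ v) x))).re =
      ∫ x, w x * (conj (cub (F ⊞ v) x) * (f x + g x)).re := by
    intro w f g hw hC hf hg
    have i1 := hint hw hC hf
    have i2 := hint hw hC hg
    rw [wint, wint, re_integral_add i1 i2]
    congr 1
    ext x
    rw [← mul_add, re_ofReal_mul]
    congr 2
    ring
  have hA : ∀ k, (wint (morA k) (dF k) (fun x => conj (cub (F ⊞ v) x))).re +
      (wint (morA k) (dv k) (fun x => conj (cub (F ⊞ v) x))).re =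
      -(1 / 4) * ∫ x, pd k (morA k) x * ‖F x + v x‖ ^ 4 := by
    intro k
    rw [hadd (bddWeight_morA k).1.continuous (bddWeight_morA k).2.1 (h.dF4 k) (h.dv4 k)]
    exact integral_weight_conj_cub (bddWeight_morA k) (h.hasWeakDer_u k) h.u4 (h.du4 k)
  have hB : (wint morB F (fun x => conj (cub (F ⊞ v) x))).re +
      (wint morB v (fun x => conj (cub (F ⊞ v) x))).re =
      ∫ x, morB x * ‖F x + v x‖ ^ 4 := by
    rw [hadd bddWeight_morB.1.continuous bddWeight_morB.2.1 h.F4 h.v4]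
    congr 1
    ext x
    have : conj (cub (F ⊞ v) x) * (F x + v x) = ((‖F x + v x‖ ^ 4 : ℝ) : ℂ) := by
      rw [cub, map_mul, conj_ofReal, mul_assoc, mul_comm (conj _),
        mul_conj, normSq_eq_norm_sq]
      push_cast; ring
    rw [this, ofReal_re]
  have h4 : Integrable fun x => ‖F x + v x‖ ^ 4 := by
    simpa using h.u4.integrable_norm_pow (p := 4) (by norm_num)
  have hS : ∑ k, ∫ x, pd k (morA k) x * ‖F x + v x‖ ^ 4 = ∫ x, morB x * ‖F x + v x‖ ^ 4 := by
    rw [← integral_finsetSum]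
    · congr 1
      ext x
      rw [← sum_mul, sum_pd_morA]
    · intro k _
      obtain ⟨C, hC⟩ := (bddWeight_morA k).2.2 k
      exact h4.bdd_mul (c := C) (pd_contDiff (bddWeight_morA k).1 k).continuous.aestronglyMeasurable
        (ae_of_all _ fun x => hC x)
  have hs := sum_congr rfl fun k (_ : k ∈ Finset.univ) => hA k
  rw [sum_add_distrib, ← mul_sum, hS] at hs
  simp only [morRate]
  linarith

end Morawetz

/-! ### The a priori energy bound -/

theorem lintegral_mul_le_sqrt {α : Type*} [MeasurableSpace α] {μ : Measure α} {f g : α → ℝ≥0∞}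
    (hf : AEMeasurable f μ) (hg : AEMeasurable g μ) :
    ∫⁻ x, f x * g x ∂μ ≤ (∫⁻ x, f x ^ 2 ∂μ) ^ (1 / 2 : ℝ) * (∫⁻ x, g x ^ 2 ∂μ) ^ (1 / 2 : ℝ) := by
  have h := ENNReal.lintegral_mul_le_Lp_mul_Lq μ (Real.HolderConjugate.two_two) hf hg
  simpa using h

/-- The weight `⟨x⟩⁻¹`. -/
def wt (x : E4) : ℝ≥0∞ := ofReal (ijap x)

theorem measurable_wt : Measurable wt :=
  ENNReal.measurable_ofReal.comp ijap_contDiff.continuous.measurable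

theorem wt_le_one (x : E4) : wt x ≤ 1 := ofReal_le_one.2 (ijap_le_one x)

/-- The weighted integral `∫ |u|⁴ / ⟨x⟩`. -/
def quartic (u : E4 → ℂ) : ℝ≥0∞ := ∫⁻ x, wt x * ‖u x‖ₑ ^ 4

theorem eLpNorm_two_eq (w : E4 → ℂ) : N[2] w = (∫⁻ x, ‖w x‖ₑ ^ 2) ^ (1 / 2 : ℝ) := by
  rw [← eLpNorm_two_sq, ← rpow_natCast, ← rpow_mul]
  norm_num

/-- Cauchy–Schwarz with the weight: if `|f| ≤ β ⟨x⟩^(-1/2)`, then `∫ |f| |u|² |w|` is at most `β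
‖⟨x⟩^(-1/2) |u|²‖₂ ‖w‖₂`. -/
theorem lintegral_weighted_le {β : ℝ≥0∞}
    (hf : ∀ᵐ x, ‖f x‖ₑ ≤ β * wt x ^ (1 / 2 : ℝ)) (hu : AEStronglyMeasurable u)
    (hw : AEStronglyMeasurable w) :
    ∫⁻ x, ‖f x‖ₑ * (‖u x‖ₑ ^ 2 * ‖w x‖ₑ) ≤ β * (quartic u ^ (1 / 2 : ℝ) * N[2] w) := by
  have hm : AEMeasurable (fun x => wt x ^ (1 / 2 : ℝ) * ‖u x‖ₑ ^ 2) volume :=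
    (measurable_wt.pow_const _).aemeasurable.mul (hu.enorm.pow_const 2)
  calc ∫⁻ x, ‖f x‖ₑ * (‖u x‖ₑ ^ 2 * ‖w x‖ₑ)
      ≤ ∫⁻ x, β * ((wt x ^ (1 / 2 : ℝ) * ‖u x‖ₑ ^ 2) * ‖w x‖ₑ) := by
        refine lintegral_mono_ae ?_
        filter_upwards [hf] with x hx
        calc _ ≤ β * wt x ^ (1 / 2 : ℝ) * (‖u x‖ₑ ^ 2 * ‖w x‖ₑ) := mul_le_mul' hx le_rfl
          _ = _ := by ring
    _ = β * ∫⁻ x, (wt x ^ (1 / 2 : ℝ) * ‖u x‖ₑ ^ 2) * ‖w x‖ₑ :=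
        lintegral_const_mul'' _ (hm.mul hw.enorm)
    _ ≤ _ := by
        gcongr
        refine (lintegral_mul_le_sqrt hm hw.enorm).trans (le_of_eq ?_)
        rw [eLpNorm_two_eq, quartic]
        congr 2
        refine lintegral_congr fun x => ?_
        rw [mul_pow, ← rpow_natCast, ← rpow_mul]
        norm_num
        ring

theorem lintegral_sq_sq_le (hf : AEStronglyMeasurable f)
    (hu : AEStronglyMeasurable u) :
    ∫⁻ x, ‖f x‖ₑ * (‖u x‖ₑ ^ 2 * ‖f x‖ₑ) ≤ N[4] f ^ 2 * N[4] u ^ 2 := by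
  have e : ∀ w : E4 → ℂ, (∫⁻ x, (‖w x‖ₑ ^ 2) ^ 2) ^ (1 / 2 : ℝ) = N[4] w ^ 2 := by
    intro w
    have : ∀ x, (‖w x‖ₑ ^ 2) ^ 2 = ‖w x‖ₑ ^ 4 := fun x => by ring
    simp only [this]
    rw [← eLpNorm_four_pow, ← rpow_natCast, ← rpow_mul, ← rpow_natCast]
    norm_num
  calc ∫⁻ x, ‖f x‖ₑ * (‖u x‖ₑ ^ 2 * ‖f x‖ₑ) = ∫⁻ x, ‖f x‖ₑ ^ 2 * ‖u x‖ₑ ^ 2 :=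
        lintegral_congr fun x => by ring
    _ ≤ _ := (lintegral_mul_le_sqrt (hf.enorm.pow_const 2) (hu.enorm.pow_const 2)).trans
        (le_of_eq (by rw [e, e]))

theorem norm_cub (u : E4 → ℂ) (x : E4) : ‖cub u x‖ₑ = ‖u x‖ₑ ^ 2 * ‖u x‖ₑ := by
  rw [cub, enorm_mul]
  congr 1
  rw [← ofReal_norm, norm_real, ofReal_norm, enorm_pow, enorm_norm]

theorem enorm_wint_cub_le {w : E4 → ℝ} {C : ℝ≥0∞} (hw : ∀ x, ‖w x‖ₑ ≤ C) (hC : C ≠ ⊤)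
    {β : ℝ≥0∞} (hf : ∀ᵐ x, ‖f x‖ₑ ≤ β * wt x ^ (1 / 2 : ℝ))
    (hu : AEStronglyMeasurable u) :
    ‖(wint w f (fun x => conj (cub u x))).re‖ₑ ≤ C * (β * (quartic u ^ (1 / 2 : ℝ) * N[2] u)) := by
  calc _ ≤ ‖wint w f (fun x => conj (cub u x))‖ₑ := by
        rw [← ofReal_norm, ← ofReal_norm]
        exact ofReal_le_ofReal (abs_re_le_norm _)
    _ ≤ ∫⁻ x, ‖(w x : ℂ) * (f x * conj (cub u x))‖ₑ := enorm_integral_le_lintegral_enorm _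
    _ ≤ ∫⁻ x, C * (‖f x‖ₑ * (‖u x‖ₑ ^ 2 * ‖u x‖ₑ)) := by
        refine lintegral_mono fun x => ?_
        rw [enorm_mul, enorm_mul, ← norm_cub]
        have h1 : ‖(w x : ℂ)‖ₑ ≤ C := by
          refine le_trans (le_of_eq ?_) (hw x)
          rw [← ofReal_norm, ← ofReal_norm, norm_real]
        have h2 : ‖conj (cub u x)‖ₑ = ‖cub u x‖ₑ := by
          rw [← ofReal_norm, ← ofReal_norm, RCLike.norm_conj]
        rw [h2]
        gcongr
    _ = C * ∫⁻ x, ‖f x‖ₑ * (‖u x‖ₑ ^ 2 * ‖u x‖ₑ) := lintegral_const_mul' _ _ hC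
    _ ≤ _ := mul_le_mul' le_rfl (lintegral_weighted_le hf hu hu)

theorem enorm_morRate_cub_le {α β : ℝ≥0∞}
    (hu : AEStronglyMeasurable u) (hF : ∀ᵐ x, ‖F x‖ₑ ≤ α * wt x ^ (1 / 2 : ℝ))
    (hdF : ∀ k, ∀ᵐ x, ‖dF k x‖ₑ ≤ β * wt x ^ (1 / 2 : ℝ)) :
    ‖morRate F (cub u) dF‖ₑ ≤ (8 * β + 4 * α) * quartic u ^ (1 / 2 : ℝ) * N[2] u := by
  have hA : ∀ k x, ‖morA k x‖ₑ ≤ 1 := fun k x => by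
    rw [enorm_eq_ofReal_abs]
    exact ofReal_le_one.2 (abs_morA_le k x)
  have hB : ∀ x, ‖morB x‖ₑ ≤ 4 := fun x => by
    rw [enorm_eq_ofReal_abs]
    exact (ofReal_le_ofReal (abs_morB_le x)).trans (by simp)
  calc _ ≤ 2 * ∑ k : Fin 4, 1 * (β * (quartic u ^ (1 / 2 : ℝ) * N[2] u)) +
        4 * (α * (quartic u ^ (1 / 2 : ℝ) * N[2] u)) := by
        refine (enorm_add_le _ _).trans (add_le_add ?_ (enorm_wint_cub_le hB (by simp) hF hu))
        rw [enorm_mul]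
        refine mul_le_mul' (by rw [← ofReal_norm]; simp) ((enorm_sum_le _ _).trans
          (sum_le_sum fun k _ => enorm_wint_cub_le (hA k) (by simp) (hdF k) hu))
    _ = _ := by simp; ring

/-- The rate of change of the modified energy: in the part with `∂ⱼv` the weighted bound for `∂ⱼF`
is used, in the part with `∂ⱼF` its bound in `L⁴`. -/
theorem enorm_energy_rate_le {β δ Y Z : ℝ≥0∞}
    (hu : AEStronglyMeasurable u) (hdv : ∀ k, AEStronglyMeasurable (dv k))
    (hdFm : ∀ k, AEStronglyMeasurable (dF k))
    (hdF : ∀ k, ∀ᵐ x, ‖dF k x‖ₑ ≤ β * wt x ^ (1 / 2 : ℝ))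
    (hδ : ∀ k, N[4] (dF k) ≤ δ) (hY : ∀ k, N[2] (dv k) ≤ Y)
    (hZ : N[4] u ^ 2 ≤ Z) :
    ‖∑ j, (∫ x, conj (dcub u (dF j ⊞ dv j) x) * dF j x).im‖ₑ ≤
      12 * (Y * (β * quartic u ^ (1 / 2 : ℝ)) + Z * δ ^ 2) := by
  have key : ∀ j, ‖(∫ x, conj (dcub u (dF j ⊞ dv j) x) * dF j x).im‖ₑ ≤
      3 * (Y * (β * quartic u ^ (1 / 2 : ℝ)) + Z * δ ^ 2) := by
    intro j
    have m1 : AEMeasurable (fun x => ‖dF j x‖ₑ * (‖u x‖ₑ ^ 2 * ‖dv j x‖ₑ)) volume :=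
      (hdFm j).enorm.mul ((hu.enorm.pow_const 2).mul (hdv j).enorm)
    calc _ ≤ ‖∫ x, conj (dcub u (dF j ⊞ dv j) x) * dF j x‖ₑ := by
          rw [← ofReal_norm, ← ofReal_norm]
          exact ofReal_le_ofReal (abs_im_le_norm _)
      _ ≤ ∫⁻ x, ‖conj (dcub u (dF j ⊞ dv j) x) * dF j x‖ₑ :=
          enorm_integral_le_lintegral_enorm _
      _ ≤ ∫⁻ x, 3 * (‖dF j x‖ₑ * (‖u x‖ₑ ^ 2 * ‖dv j x‖ₑ) +
            ‖dF j x‖ₑ * (‖u x‖ₑ ^ 2 * ‖dF j x‖ₑ)) := by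
          refine lintegral_mono fun x => ?_
          have h1 : ‖dcub u (dF j ⊞ dv j) x‖ₑ ≤
              3 * (‖u x‖ₑ * ‖u x‖ₑ * (‖dF j x‖ₑ + ‖dv j x‖ₑ)) := by
            have := ofReal_le_ofReal (norm_dcub_le u (dF j ⊞ dv j) x)
            rw [ofReal_mul (by norm_num), ofReal_mul (by positivity),
              ofReal_mul (norm_nonneg _), ofReal_norm, ofReal_norm, ofReal_norm] at this
            refine this.trans ?_
            rw [ofReal_ofNat]
            gcongr
            exact enorm_add_le _ _
          have h2 : ‖conj (dcub u (dF j ⊞ dv j) x)‖ₑ =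
              ‖dcub u (dF j ⊞ dv j) x‖ₑ := by
            rw [← ofReal_norm, ← ofReal_norm, RCLike.norm_conj]
          rw [enorm_mul, h2]
          calc _ ≤ 3 * (‖u x‖ₑ * ‖u x‖ₑ * (‖dF j x‖ₑ + ‖dv j x‖ₑ)) * ‖dF j x‖ₑ :=
                mul_le_mul' h1 le_rfl
            _ = _ := by ring
      _ = 3 * ((∫⁻ x, ‖dF j x‖ₑ * (‖u x‖ₑ ^ 2 * ‖dv j x‖ₑ)) +
            ∫⁻ x, ‖dF j x‖ₑ * (‖u x‖ₑ ^ 2 * ‖dF j x‖ₑ)) := by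
          rw [lintegral_const_mul' _ _ (by simp), lintegral_add_left' m1]
      _ ≤ 3 * (β * (quartic u ^ (1 / 2 : ℝ) * Y) + δ ^ 2 * Z) := by
          gcongr
          · exact (lintegral_weighted_le (hdF j) hu (hdv j)).trans (by gcongr; exact hY j)
          · exact (lintegral_sq_sq_le (hdFm j) hu).trans (by gcongr; exact hδ j)
      _ = _ := by ring
  refine (enorm_sum_le _ _).trans ((sum_le_sum fun j _ => key j).trans (le_of_eq ?_))
  simp
  ring

theorem enorm_momentum_le {m Y : ℝ≥0∞}
    (hv : AEStronglyMeasurable v) (hd : ∀ k, AEStronglyMeasurable (dv k))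
    (hm : N[2] v ≤ m) (hY : ∀ k, N[2] (dv k) ≤ Y) :
    ‖momentum v dv‖ₑ ≤ 4 * (m * Y) := by
  have key : ∀ k, ‖∫ x, morA k x * (conj (v x) * dv k x).im‖ₑ ≤ m * Y := by
    intro k
    refine (enorm_integral_le_lintegral_enorm _).trans ?_
    calc _ ≤ ∫⁻ x, ‖conj (v x) * dv k x‖ₑ := by
          refine lintegral_mono fun x => ?_
          rw [← ofReal_norm, ← ofReal_norm]
          refine ofReal_le_ofReal ?_
          rw [norm_mul]
          exact (mul_le_of_le_one_left (norm_nonneg _) (abs_morA_le k x)).trans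
            (abs_im_le_norm _)
      _ = N[1] (fun x => conj (v x) * dv k x) := eLpNorm_one_eq_lintegral_enorm.symm
      _ ≤ _ := (eLpNorm_one_mul_le hv.star (hd k)).trans
          (mul_le_mul' ((eLpNorm_conj _ _).le.trans hm) (hY k))
  refine (enorm_sum_le _ _).trans ((sum_le_sum fun j _ => key j).trans (le_of_eq ?_))
  simp

/-- A bound for the integral over almost all subintervals gives a bound over the interval. -/
theorem lintegral_Ioo_le_of_ae (hab : a < b) {f : ℝ → ℝ≥0∞} (hf : Measurable f)
    {R : ℝ≥0∞} (h : ∀ᵐ t₁ ∂vol[a,b], ∀ᵐ t₂ ∂vol[a,b], t₁ ≤ t₂ →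
      ∫⁻ t in Ioc t₁ t₂, f t ≤ R) : ∫⁻ t in Ioo a b, f t ≤ R := by
  have hex : ∀ {c d : ℝ}, a ≤ c → c < d → d ≤ b → ∀ {p : ℝ → Prop},
      (∀ᵐ t ∂vol[a,b], p t) → ∃ t ∈ Ioo c d, p t := by
    intro c d hc hcd hd p hp
    have hp1 : ∀ᵐ t ∂volume.restrict (Ioo c d), p t :=
      ae_mono (Measure.restrict_mono (Ioo_subset_Ioo hc hd) le_rfl) hp
    have hp' : ∀ᵐ t ∂volume.restrict (Ioo c d), p t ∧ t ∈ Ioo c d :=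
      hp1.and (ae_restrict_mem measurableSet_Ioo)
    have : NeBot (ae (volume.restrict (Ioo c d))) := by
      rw [ae_neBot, Ne, Measure.restrict_eq_zero]
      simp [hcd]
    obtain ⟨t, ht⟩ := hp'.exists
    exact ⟨t, ht.2, ht.1⟩
  set δ := (b - a) / 2 with hδ
  have hδ0 : 0 < δ := by rw [hδ]; linarith
  have hs : ∀ n : ℕ, ∃ t₁ t₂, t₁ ∈ Ioo a (a + δ / (n + 1)) ∧ t₂ ∈ Ioo (b - δ / (n + 1)) b ∧
      ∫⁻ t in Ioc t₁ t₂, f t ≤ R := by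
    intro n
    have hn : 0 < δ / ((n : ℝ) + 1) := by positivity
    have hn' : δ / ((n : ℝ) + 1) ≤ δ := div_le_self hδ0.le (by linarith [n.cast_nonneg (α := ℝ)])
    obtain ⟨t₁, h1, h2⟩ := hex le_rfl (by linarith : a < a + δ / ((n : ℝ) + 1)) (by linarith) h
    obtain ⟨t₂, h3, h4⟩ := hex (by linarith) (by linarith : b - δ / ((n : ℝ) + 1) < b) le_rfl h2
    exact ⟨t₁, t₂, h1, h3, h4 (by linarith [h1.2, h3.1])⟩
  choose t₁ t₂ h1 h2 h3 using hs
  have hlim : Tendsto (fun n : ℕ => δ / ((n : ℝ) + 1)) atTop (𝓝 0) := by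
    simpa [div_eq_mul_inv] using (tendsto_one_div_add_atTop_nhds_zero_nat (𝕜 := ℝ)).const_mul δ
  calc ∫⁻ t in Ioo a b, f t
      ≤ ∫⁻ t in Ioo a b, liminf (fun n => (Ioc (t₁ n) (t₂ n)).indicator f t) atTop := by
        refine setLIntegral_mono_ae' measurableSet_Ioo (ae_of_all _ fun t ht => ?_)
        have : ∀ᶠ n in atTop, (Ioc (t₁ n) (t₂ n)).indicator f t = f t := by
          have e1 : ∀ᶠ n : ℕ in atTop, δ / ((n : ℝ) + 1) < min (t - a) (b - t) :=
            hlim.eventually (Iio_mem_nhds (lt_min (by linarith [ht.1]) (by linarith [ht.2])))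
          filter_upwards [e1] with n hn
          have hmem : t ∈ Ioc (t₁ n) (t₂ n) :=
            ⟨by linarith [(h1 n).2, hn.trans_le (min_le_left _ _)],
              by linarith [(h2 n).1, hn.trans_le (min_le_right _ _)]⟩
          exact indicator_of_mem hmem f
        have h4 : Tendsto (fun n => (Ioc (t₁ n) (t₂ n)).indicator f t) atTop (𝓝 (f t)) :=
          tendsto_const_nhds.congr' (this.mono fun n hn => hn.symm)
        exact h4.liminf_eq.ge
    _ ≤ liminf (fun n => ∫⁻ t in Ioo a b, (Ioc (t₁ n) (t₂ n)).indicator f t) atTop :=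
        lintegral_liminf_le fun n => hf.indicator measurableSet_Ioc
    _ ≤ R := by
        refine liminf_le_of_le (by isBoundedDefault) fun y hy => ?_
        obtain ⟨n, hn⟩ := hy.exists
        refine hn.trans (le_trans ?_ (h3 n))
        rw [lintegral_indicator measurableSet_Ioc]
        exact lintegral_mono' (Measure.restrict_mono le_rfl Measure.restrict_le_self) le_rfl

/-- The energy `½ ∑ⱼ ‖∂ⱼv‖₂² + ¼ ‖u‖₄⁴`, in which only the potential part sees the full field
`u = F + v`. -/
def modEnergy (u : E4 → ℂ) (dv : Fin 4 → E4 → ℂ) : ℝ :=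
  (1 / 2) * ∑ j, (∫ x, ‖dv j x‖ ^ 2) + (1 / 4) * ∫ x, ‖u x‖ ^ 4

theorem eLpNorm_two_le_of_modEnergy_le {s : ℝ} (hs : 0 ≤ s)
    (h : modEnergy u dv ≤ s ^ 2) (hd : ∀ j, MemLp (dv j) 2) (k : Fin 4) :
    N[2] (dv k) ≤ ofReal (2 * s) := by
  have h1 : ∫ x, ‖dv k x‖ ^ 2 ≤ ∑ j, ∫ x, ‖dv j x‖ ^ 2 :=
    single_le_sum (f := fun j => ∫ x, ‖dv j x‖ ^ 2)
      (fun _ _ => integral_nonneg fun _ => sq_nonneg _) (Finset.mem_univ k)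
  have h2 : 0 ≤ ∫ x, ‖u x‖ ^ 4 := integral_nonneg fun _ => by positivity
  rw [modEnergy] at h
  rw [← ENNReal.pow_le_pow_left_iff two_ne_zero, eLpNorm_two_sq_eq (hd k),
    ← ofReal_pow (by positivity)]
  exact ofReal_le_ofReal (by nlinarith)

theorem eLpNorm_four_le_of_modEnergy_le {s : ℝ} (hs : 0 ≤ s)
    (h : modEnergy u dv ≤ s ^ 2) (hu : MemLp u 4) :
    N[4] u ^ 2 ≤ ofReal (2 * s) := by
  have h1 : 0 ≤ ∑ j, ∫ x, ‖dv j x‖ ^ 2 :=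
    sum_nonneg fun _ _ => integral_nonneg fun _ => sq_nonneg _
  rw [modEnergy] at h
  rw [← ENNReal.pow_le_pow_left_iff two_ne_zero, ← pow_mul, eLpNorm_four_pow_eq hu,
    ← ofReal_pow (by positivity)]
  exact ofReal_le_ofReal (by nlinarith)

/-- Quantitative control of the forcing term on `(a, b)`: the functions `α`, `β` majorise `F` and
its derivatives with the weight `⟨x⟩^(-1/2)`, `δ` majorises the derivatives in `L⁴`, and
`A`, `B`, `D` bound their `L²` norms in time. The number `m` bounds the masses of `v` and `F + v`. -/
structure ForcingBounds (a b : ℝ) (v F : ℝ → E4 → ℂ) (dF : Fin 4 → ℝ → E4 → ℂ)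
    (α β δ : ℝ → ℝ≥0∞) (m A B D : ℝ) : Prop where
  m_nonneg : 0 ≤ m
  A_nonneg : 0 ≤ A
  B_nonneg : 0 ≤ B
  meas_α : AEMeasurable α (vol[a,b])
  meas_β : AEMeasurable β (vol[a,b])
  v2 : ∀ᵐ t ∂vol[a,b], N[2] (v t) ≤ ofReal m
  u2 : ∀ᵐ t ∂vol[a,b], N[2] (F t ⊞ v t) ≤ ofReal m
  le_α : ∀ᵐ t ∂vol[a,b], ∀ᵐ x, ‖F t x‖ₑ ≤ α t * wt x ^ (1 / 2 : ℝ)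
  le_β : ∀ᵐ t ∂vol[a,b], ∀ k, ∀ᵐ x, ‖dF k t x‖ₑ ≤ β t * wt x ^ (1 / 2 : ℝ)
  le_δ : ∀ᵐ t ∂vol[a,b], ∀ k, N[4] (dF k t) ≤ δ t
  int_α : ∫⁻ t in Ioo a b, α t ^ 2 ≤ ofReal (A ^ 2)
  int_β : ∫⁻ t in Ioo a b, β t ^ 2 ≤ ofReal (B ^ 2)
  int_δ : ∫⁻ t in Ioo a b, δ t ^ 2 ≤ ofReal (D ^ 2)

section Apriori

variable {v F : ℝ → E4 → ℂ} {dv dF : Fin 4 → ℝ → E4 → ℂ}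
  {α β δ : ℝ → ℝ≥0∞} {m A B D s : ℝ}

theorem measurable_quartic {u : ℝ → E4 → ℂ} (hu : StronglyMeasurable (uncurry u)) :
    Measurable fun t => quartic (u t) :=
  ((measurable_wt.comp measurable_snd).mul (hu.measurable.enorm.pow_const 4)).lintegral_prod_right'

theorem quartic_le (u : E4 → ℂ) : quartic u ≤ N[4] u ^ 4 := by
  rw [eLpNorm_four_pow]
  exact lintegral_mono fun x => mul_le_of_le_one_left zero_le (wt_le_one x)

theorem quartic_le_integral_morB {u : E4 → ℂ} (hu : MemLp u 4) :
    ofReal (3 / 2) * quartic u ≤ ofReal ((1 / 2) * ∫ x, morB x * ‖u x‖ ^ 4) := by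
  have h4 : Integrable fun x => ‖u x‖ ^ 4 := by
    simpa using hu.integrable_norm_pow (p := 4) (by norm_num)
  have hi : Integrable fun x => morB x * ‖u x‖ ^ 4 :=
    h4.bdd_mul (c := 4) bddWeight_morB.1.continuous.aestronglyMeasurable
      (ae_of_all _ fun x => abs_morB_le x)
  rw [quartic, ← lintegral_const_mul' _ _ (by simp), ← integral_const_mul,
    ofReal_integral_eq_lintegral_ofReal (hi.const_mul _)
      (ae_of_all _ fun x => mul_nonneg (by norm_num) (mul_nonneg (morB_nonneg x) (by positivity)))]
  refine lintegral_mono fun x => ?_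
  rw [wt, ← ofReal_norm, ← ofReal_pow (norm_nonneg _),
    ← ofReal_mul (ijap_pos x).le, ← ofReal_mul (by norm_num)]
  refine ofReal_le_ofReal ?_
  nlinarith [mul_le_mul_of_nonneg_right (le_morB x) (by positivity : 0 ≤ ‖u x‖ ^ 4)]

theorem Regular.lintegral_quartic_ne_top (h : Regular a b v F dv dF M) :
    ∫⁻ t in Ioo a b, quartic (F t ⊞ v t) ≠ ⊤ := by
  have hM := h.ne_top
  refine ne_top_of_le_ne_top (b := (2 * M) ^ 4 * volume (Ioo a b)) (by
    rw [Real.volume_Ioo]; finiteness) ?_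
  rw [← setLIntegral_const]
  refine lintegral_mono_ae ?_
  filter_upwards [h.slice] with t ht
  exact (quartic_le _).trans (pow_le_pow_left' ht.u4_le 4)

/-- Cauchy–Schwarz in time. -/
theorem setLIntegral_mul_sqrt_le {f q : ℝ → ℝ≥0∞} (hf : AEMeasurable f (vol[a,b]))
    (hq : Measurable q) (hA : 0 ≤ A) (h : ∫⁻ t in Ioo a b, f t ^ 2 ≤ ofReal (A ^ 2)) :
    ∫⁻ t in Ioo a b, f t * q t ^ (1 / 2 : ℝ) ≤ ofReal A * (∫⁻ t in Ioo a b, q t) ^ (1 / 2 : ℝ) := by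
  refine (lintegral_mul_le_sqrt hf (hq.pow_const _).aemeasurable).trans ?_
  have h1 : ∀ t, (q t ^ (1 / 2 : ℝ)) ^ 2 = q t := fun t => by
    rw [← rpow_natCast, ← rpow_mul]; norm_num
  simp only [h1]
  gcongr
  refine (ENNReal.rpow_le_rpow h (by norm_num)).trans (le_of_eq ?_)
  rw [ofReal_pow hA, ← rpow_natCast, ← rpow_mul]
  norm_num

/-- The Morawetz bound for the weighted quartic space-time integral. -/
theorem RegularL2.lintegral_quartic_le (h : RegularL2 a b v F dv dF M)
    (hF : ForcingBounds a b v F dF α β δ m A B D) (hs : 0 ≤ s)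
    (hX : ∀ᵐ t ∂vol[a,b], modEnergy (F t ⊞ v t) (fun j => dv j t) ≤ s ^ 2) :
    ofReal (3 / 2) * ∫⁻ t in Ioo a b, quartic (F t ⊞ v t) ≤
      ofReal (16 * m * s) + (8 * ofReal B + 4 * ofReal A) *
        (∫⁻ t in Ioo a b, quartic (F t ⊞ v t)) ^ (1 / 2 : ℝ) * ofReal m := by
  have hq := measurable_quartic h.meas_u
  have hK := h.lintegral_quartic_ne_top
  set K := ∫⁻ t in Ioo a b, quartic (F t ⊞ v t) with hKdef
  -- the contribution of the forcing term
  set S : ℝ → ℝ := fun t => morRate (F t) (cub fun x => F t x + v t x) (fun k => dF k t) with hSdef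
  have hSm : StronglyMeasurable S := stronglyMeasurable_morRate h.meas_F h.meas_cub h.meas_dF
  have hS : ∫⁻ t in Ioo a b, ‖S t‖ₑ ≤
      (8 * ofReal B + 4 * ofReal A) * K ^ (1 / 2 : ℝ) * ofReal m := by
    have m1 : AEMeasurable (fun t => β t * quartic (F t ⊞ v t) ^ (1 / 2 : ℝ))
      (vol[a,b]) := hF.meas_β.mul (hq.pow_const _).aemeasurable
    calc ∫⁻ t in Ioo a b, ‖S t‖ₑ
        ≤ ∫⁻ t in Ioo a b, (8 * (β t * quartic (F t ⊞ v t) ^ (1 / 2 : ℝ)) +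
            4 * (α t * quartic (F t ⊞ v t) ^ (1 / 2 : ℝ))) * ofReal m := by
          refine lintegral_mono_ae ?_
          filter_upwards [h.slice, hF.u2, hF.le_α, hF.le_β] with t ht h2 h3 h4
          refine (enorm_morRate_cub_le ht.u4.1 h3 h4).trans (le_trans (mul_le_mul' le_rfl h2)
            (le_of_eq ?_))
          ring
      _ = (8 * (∫⁻ t in Ioo a b, β t * quartic (F t ⊞ v t) ^ (1 / 2 : ℝ)) +
            4 * ∫⁻ t in Ioo a b, α t * quartic (F t ⊞ v t) ^ (1 / 2 : ℝ)) *
              ofReal m := by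
          rw [lintegral_mul_const' _ _ (by simp), lintegral_add_left' (m1.const_mul _),
            lintegral_const_mul' _ _ (by simp), lintegral_const_mul' _ _ (by simp)]
      _ ≤ (8 * (ofReal B * K ^ (1 / 2 : ℝ)) + 4 * (ofReal A * K ^ (1 / 2 : ℝ))) * ofReal m := by
          gcongr
          · exact setLIntegral_mul_sqrt_le hF.meas_β hq hF.B_nonneg hF.int_β
          · exact setLIntegral_mul_sqrt_le hF.meas_α hq hF.A_nonneg hF.int_α
      _ = _ := by ring
  have hSi : IntegrableOn S (Ioo a b) := ⟨hSm.aestronglyMeasurable, hS.trans_lt (by finiteness)⟩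
  have hRi := h.integrableOn_morRate
  -- the boundary terms are only defined at almost every pair of times
  rw [hKdef, ← lintegral_const_mul' _ _ (by simp)]
  refine lintegral_Ioo_le_of_ae h.hab (hq.const_mul _) ?_
  have hmom : ∀ᵐ t ∂vol[a,b], ‖momentum (v t) (fun k => dv k t)‖ₑ ≤ ofReal (8 * m * s) := by
    filter_upwards [h.slice, hF.v2, hX] with t ht h2 h3
    refine (enorm_momentum_le ht.v4.1 (fun k => (ht.dv2 k).1) h2
      (eLpNorm_two_le_of_modEnergy_le hs h3 ht.dv2)).trans (le_of_eq ?_)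
    rw [← ofReal_mul hF.m_nonneg, ← ofReal_ofNat,
      ← ofReal_mul (by norm_num)]
    congr 1; ring
  have hpt : ∀ᵐ t ∂vol[a,b], ofReal (3 / 2) * quartic (F t ⊞ v t) ≤ ofReal
        (morRate (v t) (cub fun x => F t x + v t x) (fun k => dv k t) + S t) := by
    filter_upwards [h.slice] with t ht
    refine (quartic_le_integral_morB ht.u4).trans (ofReal_le_ofReal (le_of_eq ?_))
    rw [ht.morRate_eq, hSdef]
    ring
  have hpos : ∀ᵐ t ∂vol[a,b], 0 ≤
      morRate (v t) (cub fun x => F t x + v t x) (fun k => dv k t) + S t := by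
    filter_upwards [h.slice] with t ht
    rw [ht.morRate_eq, hSdef]
    have : 0 ≤ ∫ x, morB x * ‖F t x + v t x‖ ^ 4 :=
      integral_nonneg fun x => mul_nonneg (morB_nonneg x) (by positivity)
    simp only
    linarith
  filter_upwards [h.integral_morRate_le, hmom, ae_restrict_mem measurableSet_Ioo] with t₁ h1 l1 m1
  filter_upwards [h1, hmom, ae_restrict_mem measurableSet_Ioo] with t₂ h2 l2 m2 hlt
  have hsub : Ioc t₁ t₂ ⊆ Ioo a b := fun s hs => ⟨m1.1.trans hs.1, hs.2.trans_lt m2.2⟩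
  have hrestr : volume.restrict (Ioc t₁ t₂) ≤ vol[a,b] := Measure.restrict_mono hsub le_rfl
  have habs : ∀ {x y : ℝ}, 0 ≤ y → ‖x‖ₑ ≤ ofReal y → |x| ≤ y := fun hy hx => by
    rwa [enorm_eq_ofReal_abs, ENNReal.ofReal_le_ofReal_iff hy] at hx
  have hms : 0 ≤ 8 * m * s := by have := hF.m_nonneg; positivity
  have i1 := hRi.mono_set hsub
  have i2 := hSi.mono_set hsub
  have hpt' : ∀ᵐ t ∂volume.restrict (Ioc t₁ t₂),
      ofReal (3 / 2) * quartic (F t ⊞ v t) ≤ ofReal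
        (morRate (v t) (cub fun x => F t x + v t x) (fun k => dv k t) + S t) := ae_mono hrestr hpt
  have hpos' : ∀ᵐ t ∂volume.restrict (Ioc t₁ t₂), 0 ≤
      morRate (v t) (cub fun x => F t x + v t x) (fun k => dv k t) + S t := ae_mono hrestr hpos
  calc ∫⁻ t in Ioc t₁ t₂, ofReal (3 / 2) * quartic (F t ⊞ v t)
      ≤ ∫⁻ t in Ioc t₁ t₂, ofReal
          (morRate (v t) (cub fun x => F t x + v t x) (fun k => dv k t) + S t) :=
        lintegral_mono_ae hpt'
    _ = ofReal (∫ t in Ioc t₁ t₂,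
          (morRate (v t) (cub fun x => F t x + v t x) (fun k => dv k t) + S t)) :=
        (ofReal_integral_eq_lintegral_ofReal (i1.add i2) hpos').symm
    _ ≤ ofReal (16 * m * s + |∫ t in Ioc t₁ t₂, S t|) := by
        refine ofReal_le_ofReal ?_
        rw [integral_add i1 i2]
        have e1 := h2 hlt
        rw [intervalIntegral.integral_of_le hlt] at e1
        linarith [le_abs_self (∫ t in Ioc t₁ t₂, S t), abs_le.1 (habs hms l1),
          abs_le.1 (habs hms l2)]
    _ ≤ ofReal (16 * m * s) + ofReal |∫ t in Ioc t₁ t₂, S t| := ENNReal.ofReal_add_le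
    _ ≤ _ := by
        gcongr
        rw [← enorm_eq_ofReal_abs]
        exact (enorm_integral_le_lintegral_enorm _).trans ((lintegral_mono' hrestr le_rfl).trans hS)

/-- The growth of the energy is controlled by the weighted quartic space-time integral. -/
theorem RegularL2.modEnergy_le (h : RegularL2 a b v F dv dF M) (h0 : (0 : ℝ) ∈ Ioo a b)
    (hF : ForcingBounds a b v F dF α β δ m A B D) (hs : 0 ≤ s) {E₀ : ℝ}
    (hE₀ : ∀ᶠ t in nearZero, modEnergy (F t ⊞ v t) (fun j => dv j t) ≤ E₀)
    (hX : ∀ᵐ t ∂vol[a,b], modEnergy (F t ⊞ v t) (fun j => dv j t) ≤ s ^ 2) :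
    ∀ᵐ t ∂vol[a,b], modEnergy (F t ⊞ v t) (fun j => dv j t) ≤
      E₀ + 24 * s * (B * √(∫⁻ t in Ioo a b, quartic (F t ⊞ v t)).toReal + D ^ 2) := by
  have hq := measurable_quartic h.meas_u
  have hK := h.lintegral_quartic_ne_top
  set K := ∫⁻ t in Ioo a b, quartic (F t ⊞ v t) with hKdef
  have hD := hF.B_nonneg
  have hrate : ∫⁻ t in Ioo a b, ‖∑ j, (∫ x, conj (dcub (F t ⊞ v t)
      (fun x => dF j t x + dv j t x) x) * dF j t x).im‖ₑ ≤
        ofReal (24 * s * (B * √K.toReal + D ^ 2)) := by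
    have m1 : AEMeasurable (fun t => β t * quartic (F t ⊞ v t) ^ (1 / 2 : ℝ))
      (vol[a,b]) := hF.meas_β.mul (hq.pow_const _).aemeasurable
    calc _ ≤ ∫⁻ t in Ioo a b, ofReal (24 * s) *
            (β t * quartic (F t ⊞ v t) ^ (1 / 2 : ℝ) + δ t ^ 2) := by
          refine lintegral_mono_ae ?_
          filter_upwards [h.slice, hX, hF.le_β, hF.le_δ] with t ht h1 h2 h3
          refine (enorm_energy_rate_le ht.u4.1 (fun k => (ht.dv2 k).1) (fun k => (ht.dF4 k).1) h2 h3
            (eLpNorm_two_le_of_modEnergy_le hs h1 ht.dv2)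
            (eLpNorm_four_le_of_modEnergy_le hs h1 ht.u4)).trans (le_of_eq ?_)
          rw [← mul_add, ← mul_assoc, ← ofReal_ofNat, ← ofReal_mul (by norm_num)]
          congr 2; ring
      _ = ofReal (24 * s) * ((∫⁻ t in Ioo a b,
            β t * quartic (F t ⊞ v t) ^ (1 / 2 : ℝ)) + ∫⁻ t in Ioo a b, δ t ^ 2) := by
          rw [lintegral_const_mul' _ _ ofReal_ne_top, lintegral_add_left' m1]
      _ ≤ ofReal (24 * s) * (ofReal B * K ^ (1 / 2 : ℝ) + ofReal (D ^ 2)) := by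
          gcongr
          · exact setLIntegral_mul_sqrt_le hF.meas_β hq hF.B_nonneg hF.int_β
          · exact hF.int_δ
      _ = _ := by
          have : K ^ (1 / 2 : ℝ) = ofReal (√K.toReal) := by
            rw [Real.sqrt_eq_rpow, ← ofReal_rpow_of_nonneg (by simp) (by norm_num),
              ofReal_toReal hK]
          rw [this, ← ofReal_mul hD, ← ofReal_add (by positivity) (by positivity),
            ← ofReal_mul (by positivity)]
  have h1 := (h.hasWeakDeriv_energy.ae_sub_eq h.hab).and (ae_restrict_mem measurableSet_Ioo)
  obtain ⟨t₁, ⟨k1, m1⟩, e1⟩ := ((eventually_nearZero h0 h1).and hE₀).exists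
  filter_upwards [k1, ae_restrict_mem measurableSet_Ioo] with t₂ k2 m2
  have hsub := uIoc_subset_Ioo m1 m2
  have hb : |∫ t in t₁..t₂, ∑ j, (∫ x, conj (dcub (F t ⊞ v t)
      (fun x => dF j t x + dv j t x) x) * dF j t x).im| ≤ 24 * s * (B * √K.toReal + D ^ 2) := by
    rw [← ENNReal.ofReal_le_ofReal_iff (by positivity), ← enorm_eq_ofReal_abs]
    refine le_trans ?_ hrate
    rw [← ofReal_norm, intervalIntegral.norm_intervalIntegral_eq, ofReal_norm]
    exact (enorm_integral_le_lintegral_enorm _).trans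
      (lintegral_mono' (Measure.restrict_mono hsub le_rfl) le_rfl)
  change modEnergy _ _ - modEnergy _ _ = _ at k2
  linarith [le_abs_self (∫ t in t₁..t₂, ∑ j, (∫ x, conj (dcub (F t ⊞ v t)
      (fun x => dF j t x + dv j t x) x) * dF j t x).im)]

/-- The elementary inequality that closes the bootstrap between the energy `s²` and the Morawetz
norm `r²`. -/
theorem bootstrap {r s m A B D E₀ : ℝ} (hs : 0 ≤ s)
    (hE : 0 ≤ E₀) (h1 : (3 / 2) * r ^ 2 ≤ 16 * m * s + (8 * B + 4 * A) * r * m)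
    (h2 : s ^ 2 ≤ E₀ + 24 * s * (B * r + D ^ 2)) :
    s ^ 2 ≤ 8 * 10 ^ 8 * Real.exp (A ^ 2 + B ^ 2 + D ^ 2) * (E₀ + 1 + m ^ 2) := by
  set G := A ^ 2 + B ^ 2 + D ^ 2 with hG
  have hGA : A ^ 2 ≤ G := by nlinarith [sq_nonneg B, sq_nonneg D]
  have hGB : B ^ 2 ≤ G := by nlinarith [sq_nonneg A, sq_nonneg D]
  have hGD : D ^ 2 ≤ G := by nlinarith [sq_nonneg B, sq_nonneg A]
  have hG0 : 0 ≤ G := (sq_nonneg A).trans hGA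
  -- Young's inequality absorbs `r²` here, and `s² / 4` in three steps below
  have e1 : r ^ 2 ≤ 16 * (m * s) + 64 * (m ^ 2 * G) := by
    have p1 : (8 * B + 4 * A) ^ 2 ≤ 128 * G := by
      nlinarith [sq_nonneg (8 * B - 4 * A), sq_nonneg D, sq_nonneg A]
    have p2 : (8 * B + 4 * A) * r * m ≤ r ^ 2 / 2 + (8 * B + 4 * A) ^ 2 * m ^ 2 / 2 := by
      nlinarith [sq_nonneg (r - (8 * B + 4 * A) * m)]
    nlinarith [mul_le_mul_of_nonneg_right p1 (sq_nonneg m)]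
  have e2 : 24 * s * (B * r) ≤ s ^ 2 / 4 + 576 * (G * r ^ 2) := by
    nlinarith [sq_nonneg (s / 2 - 24 * (B * r)), mul_le_mul_of_nonneg_right hGB (sq_nonneg r)]
  have e3 : G * r ^ 2 ≤ 16 * (G * m * s) + 64 * (m ^ 2 * G ^ 2) := by
    nlinarith [mul_le_mul_of_nonneg_left e1 hG0]
  have e4 : 9216 * (G * m * s) ≤ s ^ 2 / 4 + 9216 ^ 2 * (m ^ 2 * G ^ 2) := by
    nlinarith [sq_nonneg (s / 2 - 9216 * (G * m))]
  have e5 : 24 * s * D ^ 2 ≤ s ^ 2 / 4 + 576 * G ^ 2 := by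
    nlinarith [sq_nonneg (s / 2 - 24 * G), mul_le_mul_of_nonneg_left hGD hs]
  have e6 : s ^ 2 ≤ 4 * E₀ + 4 * (36864 + 9216 ^ 2) * (m ^ 2 * G ^ 2) + 2304 * G ^ 2 := by nlinarith
  have e7 : G ^ 2 ≤ 2 * Real.exp G := by
    have := Real.quadratic_le_exp_of_nonneg hG0
    nlinarith
  have e8 : 1 ≤ Real.exp G := Real.one_le_exp hG0
  have e9 : m ^ 2 * G ^ 2 ≤ m ^ 2 * (2 * Real.exp G) := mul_le_mul_of_nonneg_left e7 (sq_nonneg m)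
  have e10 : E₀ ≤ Real.exp G * E₀ := le_mul_of_one_le_left hE e8
  have e11 : 0 ≤ m ^ 2 * Real.exp G := by positivity
  nlinarith

/-- The a priori bound for the modified energy. The constants do not depend on `M`, whose only role
is to make the supremum of the energy finite. -/
theorem RegularL2.energy_bound (h : RegularL2 a b v F dv dF M) (h0 : (0 : ℝ) ∈ Ioo a b)
    (hF : ForcingBounds a b v F dF α β δ m A B D) {E₀ : ℝ} (hE : 0 ≤ E₀)
    (hE₀ : ∀ᶠ t in nearZero, modEnergy (F t ⊞ v t) (fun j => dv j t) ≤ E₀) :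
    ∀ᵐ t ∂vol[a,b], modEnergy (F t ⊞ v t) (fun j => dv j t) ≤
      8 * 10 ^ 8 * Real.exp (A ^ 2 + B ^ 2 + D ^ 2) * (E₀ + 1 + m ^ 2) := by
  set 𝓔 : ℝ → ℝ := fun t => modEnergy (F t ⊞ v t) (fun j => dv j t) with h𝓔
  have hM := h.ne_top
  -- the energy is essentially bounded, so its essential supremum is a real number
  set X := essSup (fun t => ofReal (𝓔 t)) (vol[a,b]) with hX
  have hXle : ∀ᵐ t ∂vol[a,b], ofReal (𝓔 t) ≤ X := ENNReal.ae_le_essSup _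
  have hXtop : X ≠ ⊤ := by
    refine ne_top_of_le_ne_top (b := 2 * M ^ 2 + (2 * M) ^ 4) (by finiteness)
      (essSup_le_of_ae_le _ ?_)
    filter_upwards [h.slice] with t ht
    have p1 : ∀ j, ofReal (∫ x, ‖dv j t x‖ ^ 2) ≤ M ^ 2 := fun j => by
      rw [← eLpNorm_two_sq_eq (ht.dv2 j)]
      exact pow_le_pow_left' (ht.dv2_le j) 2
    have p2 : ofReal (∫ x, ‖F t x + v t x‖ ^ 4) ≤ (2 * M) ^ 4 := by
      rw [← eLpNorm_four_pow_eq ht.u4]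
      exact pow_le_pow_left' ht.u4_le 4
    have p3 : ofReal (∑ j, ∫ x, ‖dv j t x‖ ^ 2) ≤ 4 * M ^ 2 := by
      rw [ofReal_sum_of_nonneg fun _ _ => integral_nonneg fun _ => sq_nonneg _]
      exact (sum_le_sum fun j _ => p1 j).trans (le_of_eq (by simp))
    rw [h𝓔]
    refine ENNReal.ofReal_add_le.trans (add_le_add ?_ ?_)
    · rw [ofReal_mul (by norm_num)]
      refine (mul_le_mul' le_rfl p3).trans (le_of_eq ?_)
      rw [← mul_assoc, ← ofReal_ofNat 4, ← ofReal_mul (by norm_num)]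
      norm_num
    · rw [ofReal_mul (by norm_num)]
      exact (mul_le_mul' (ofReal_le_one.2 (by norm_num)) p2).trans (one_mul _).le
  set s := √X.toReal with hsdef
  have hs : 0 ≤ s := Real.sqrt_nonneg _
  have hs2 : s ^ 2 = X.toReal := Real.sq_sqrt toReal_nonneg
  have hle : ∀ᵐ t ∂vol[a,b], 𝓔 t ≤ s ^ 2 := by
    filter_upwards [hXle] with t ht
    rw [hs2]
    exact (ENNReal.ofReal_le_iff_le_toReal hXtop).1 ht
  have hup := h.modEnergy_le h0 hF hs hE₀ hle
  have hK := h.lintegral_quartic_ne_top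
  have hmor := h.lintegral_quartic_le hF hs hle
  set K := ∫⁻ t in Ioo a b, quartic (F t ⊞ v t) with hKdef
  set r := √K.toReal with hr
  have hr0 : 0 ≤ r := Real.sqrt_nonneg _
  have hr2 : r ^ 2 = K.toReal := Real.sq_sqrt toReal_nonneg
  have hB := hF.B_nonneg
  have hA := hF.A_nonneg
  have hm := hF.m_nonneg
  have b1 : (3 / 2) * r ^ 2 ≤ 16 * m * s + (8 * B + 4 * A) * r * m := by
    have hKr : K ^ (1 / 2 : ℝ) = ofReal r := by
      rw [hr, Real.sqrt_eq_rpow, ← ofReal_rpow_of_nonneg (by simp) (by norm_num),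
        ofReal_toReal hK]
    have hKr' : K = ofReal (r ^ 2) := by rw [hr2, ofReal_toReal hK]
    rw [hKr, hKr', ← ofReal_ofNat 8, ← ofReal_ofNat 4,
      ← ofReal_mul (by norm_num), ← ofReal_mul (by norm_num),
      ← ofReal_mul (by norm_num), ← ofReal_add (by positivity) (by positivity),
      ← ofReal_mul (by positivity), ← ofReal_mul (by positivity),
      ← ofReal_add (by positivity) (by positivity),
      ENNReal.ofReal_le_ofReal_iff (by positivity)] at hmor
    exact hmor
  have b2 : s ^ 2 ≤ E₀ + 24 * s * (B * r + D ^ 2) := by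
    rw [hs2]
    refine ENNReal.toReal_le_of_le_ofReal (by positivity) (essSup_le_of_ae_le _ ?_)
    filter_upwards [hup] with t ht using ofReal_le_ofReal ht
  filter_upwards [hle] with t ht
  exact ht.trans (bootstrap hs hE b1 b2)

end Apriori

/-! ### The class `C(I; Ḣ¹)` -/

theorem MemHdotOne.hasWeakGradient (h : MemHdotOne f) :
    HasWeakGradient f (weakGrad f) := hasWeakGradient_weakGrad (h.2.imp fun _ hg => hg.1)

theorem MemHdotOne.memLp_weakGrad (h : MemHdotOne f) : MemLp (weakGrad f) 2 := by
  obtain ⟨_, g, hg, hg2⟩ := h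
  exact (memLp_congr_ae (weakGrad_ae_eq hg)).2 hg2

theorem HasWeakGradient.sub {g g' : E4 → G4} (h : HasWeakGradient f g)
    (h' : HasWeakGradient f' g') :
    HasWeakGradient (fun x => f x - f' x) (fun x => g x - g' x) :=
  hasWeakGradient_of_hasWeakDer fun j => (h.hasWeakDer j).sub (h'.hasWeakDer j)

theorem MemHdotOne.sub (hf : MemHdotOne f) (hg : MemHdotOne g) :
    MemHdotOne fun x => f x - g x :=
  ⟨hf.1.sub hg.1, _, hf.hasWeakGradient.sub hg.hasWeakGradient,
    hf.memLp_weakGrad.sub hg.memLp_weakGrad⟩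

theorem eLpNorm_apply_le (g : E4 → G4) (p : ℝ≥0∞) (j : Fin 4) : N[p] (fun x => g x j) ≤ N[p] g :=
  eLpNorm_mono fun x => PiLp.norm_apply_le (g x) j

theorem memLp_apply {g : E4 → G4} (hg : MemLp g p) (j : Fin 4) :
    MemLp (fun x => g x j) p :=
  ⟨(PiLp.continuous_apply 2 _ j).comp_aestronglyMeasurable hg.1,
    (eLpNorm_apply_le g p j).trans_lt hg.2⟩

theorem exists_sobolev_weakGrad : ∃ C : ℝ≥0∞, C ≠ ⊤ ∧ ∀ f : E4 → ℂ, MemHdotOne f →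
    N[4] f ≤ C * N[2] (weakGrad f) := by
  obtain ⟨C, hC, h⟩ := exists_sobolev_two
  refine ⟨C * 4, by finiteness, fun f hf => ?_⟩
  refine (h f _ hf.1 hf.hasWeakGradient.hasWeakDer fun j => memLp_apply hf.memLp_weakGrad j).trans
      ?_
  rw [mul_assoc]
  gcongr
  exact (sum_le_sum fun j _ => eLpNorm_apply_le (weakGrad f) 2 j).trans (le_of_eq (by simp))

theorem tendsto_eLpNorm_of_sub {ι V : Type*} [NormedAddCommGroup V] {l : Filter ι}
    (hp : 1 ≤ p) {w : ι → E4 → V} {w₀ : E4 → V} (hw : ∀ᶠ i in l, AEStronglyMeasurable (w i))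
    (h₀ : AEStronglyMeasurable w₀)
    (h : Tendsto (fun i => N[p] (w i - w₀)) l (𝓝 0)) :
    Tendsto (fun i => N[p] (w i)) l (𝓝 (N[p] w₀)) := by
  have h1 : Tendsto (fun i => N[p] w₀ - N[p] (w i - w₀)) l (𝓝 (N[p] w₀ - 0)) :=
    ENNReal.Tendsto.sub tendsto_const_nhds h (Or.inr (by simp))
  have h2 := tendsto_const_nhds (x := N[p] w₀).add h
  rw [tsub_zero] at h1
  rw [add_zero] at h2
  refine tendsto_of_tendsto_of_tendsto_of_le_of_le' h1 h2 ?_ ?_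
  · filter_upwards [hw] with i hi
    rw [tsub_le_iff_right]
    calc N[p] w₀ = N[p] (w i - (w i - w₀)) := by rw [sub_sub_cancel]
      _ ≤ _ := eLpNorm_sub_le hi (hi.sub h₀) hp
  · filter_upwards [hw] with i hi
    calc N[p] (w i) = N[p] (w₀ + (w i - w₀)) := by rw [add_sub_cancel]
      _ ≤ _ := eLpNorm_add_le h₀ (hi.sub h₀) hp

theorem energy_eq (hf : AEStronglyMeasurable f) :
    energy f = (1 / 2) * N[2] (weakGrad f) ^ 2 + (1 / 4) * N[4] f ^ 4 := by
  rw [energy, lintegral_add_right' _ ((hf.enorm.pow_const 4).const_mul _),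
    lintegral_const_mul' _ _ (by finiteness), lintegral_const_mul' _ _ (by finiteness),
    eLpNorm_four_pow, eLpNorm_two_sq]

theorem energy_congr (h : f =ᵐ[volume] g) : energy f = energy g := by
  refine lintegral_congr_ae ?_
  filter_upwards [h, weakGrad_congr h] with x h1 h2
  rw [h1, h2]

section Continuity

variable {I : Set ℝ} {v : ℝ → E4 → ℂ} {t₀ : ℝ}

theorem ContinuousHdotOne.tendsto_sub_four (h : ContinuousHdotOne I v) (ht : t₀ ∈ I) :
    Tendsto (fun t => N[4] (v t - v t₀)) (𝓝[I] t₀) (𝓝 0) := by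
  obtain ⟨C, hC, hs⟩ := exists_sobolev_weakGrad
  have h1 := ENNReal.Tendsto.const_mul (a := C) (h.2 t₀ ht) (Or.inr hC)
  rw [mul_zero] at h1
  refine tendsto_of_tendsto_of_tendsto_of_le_of_le' tendsto_const_nhds h1
    (Eventually.of_forall fun _ => zero_le) ?_
  filter_upwards [self_mem_nhdsWithin] with t htI using hs _ ((h.1 t htI).sub (h.1 t₀ ht))

theorem ContinuousHdotOne.continuousOn_four (h : ContinuousHdotOne I v) :
    ContinuousOn (fun t => N[4] (v t)) I := fun t₀ ht =>
  tendsto_eLpNorm_of_sub (by norm_num) (eventually_mem_nhdsWithin.mono fun t htI => (h.1 t htI).1.1)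
    (h.1 t₀ ht).1.1 (h.tendsto_sub_four ht)

theorem ContinuousHdotOne.continuousOn_weakGrad (h : ContinuousHdotOne I v) :
    ContinuousOn (fun t => N[2] (weakGrad (v t))) I := fun t₀ ht => by
  refine tendsto_eLpNorm_of_sub (by norm_num)
    (eventually_mem_nhdsWithin.mono fun t htI => (h.1 t htI).memLp_weakGrad.1)
    (h.1 t₀ ht).memLp_weakGrad.1 ((h.2 t₀ ht).congr' ?_)
  filter_upwards [self_mem_nhdsWithin] with t htI
  exact eLpNorm_congr_ae (weakGrad_ae_eq
    ((h.1 t htI).hasWeakGradient.sub (h.1 t₀ ht).hasWeakGradient))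

theorem ContinuousHdotOne.continuousOn_energy (h : ContinuousHdotOne I v) :
    ContinuousOn (fun t => energy (v t)) I := by
  have h1 : ContinuousOn (fun t => (1 / 2) * N[2] (weakGrad (v t)) ^ 2 +
      (1 / 4) * N[4] (v t) ^ 4) I :=
    ((ENNReal.continuous_const_mul (by finiteness)).comp_continuousOn
      ((ENNReal.continuous_pow 2).comp_continuousOn h.continuousOn_weakGrad)).add
    ((ENNReal.continuous_const_mul (by finiteness)).comp_continuousOn
      ((ENNReal.continuous_pow 4).comp_continuousOn h.continuousOn_four))
  exact h1.congr fun t ht => energy_eq (h.1 t ht).1.1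

/-- On compact time intervals the solution is bounded in `L⁴` and its gradient in `L²`. -/
theorem ContinuousHdotOne.exists_bound (h : ContinuousHdotOne I v) (hI : Icc a b ⊆ I) :
    ∃ M : ℝ≥0∞, M ≠ ⊤ ∧ ∀ t ∈ Icc a b, N[4] (v t) ≤ M ∧ N[2] (weakGrad (v t)) ≤ M := by
  rcases (Icc a b).eq_empty_or_nonempty with he | hne
  · exact ⟨0, by simp, by simp [he]⟩
  obtain ⟨s, hs, h1⟩ := isCompact_Icc.exists_isMaxOn hne (h.continuousOn_four.mono hI)
  obtain ⟨r, hr, h2⟩ := isCompact_Icc.exists_isMaxOn hne (h.continuousOn_weakGrad.mono hI)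
  refine ⟨N[4] (v s) + N[2] (weakGrad (v r)),
    add_ne_top.2 ⟨(h.1 s (hI hs)).1.2.ne, (h.1 r (hI hr)).memLp_weakGrad.2.ne⟩,
    fun t ht => ⟨(h1 ht).trans le_self_add, (h2 ht).trans le_add_self⟩⟩

end Continuity

/-! ### Interpolation -/

theorem add_pow_le_two_pow_mul (x y : ℝ≥0∞) (n : ℕ) : (x + y) ^ n ≤ 2 ^ n * (x ^ n + y ^ n) := by
  rcases le_total x y with h | h
  · calc (x + y) ^ n ≤ (2 * y) ^ n := pow_le_pow_left' (by rw [two_mul]; gcongr) n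
      _ ≤ _ := by rw [mul_pow]; gcongr; exact le_add_self
  · calc (x + y) ^ n ≤ (2 * x) ^ n := pow_le_pow_left' (by rw [two_mul]; gcongr) n
      _ ≤ _ := by rw [mul_pow]; gcongr; exact le_self_add

theorem eLpNorm_interpolate (hg : AEStronglyMeasurable g) :
    N[((12 / 5 : NNReal) : ℝ≥0∞)] g ^ 6 ≤ N[2] g ^ 4 * N[4] g ^ 2 := by
  have h := ENNReal.lintegral_mul_norm_pow_le (μ := (volume : Measure E4)) (p := 4 / 5) (q := 1 / 5)
    (hg.enorm.pow_const 2) (hg.enorm.pow_const 4) (by norm_num) (by norm_num) (by norm_num)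
  have e : ∀ x, (‖g x‖ₑ ^ 2) ^ (4 / 5 : ℝ) * (‖g x‖ₑ ^ 4) ^ (1 / 5 : ℝ) =
      ‖g x‖ₑ ^ (12 / 5 : ℝ) := by
    intro x
    rw [← rpow_natCast, ← rpow_natCast, ← rpow_mul, ← rpow_mul,
      ← rpow_add_of_nonneg _ _ (by norm_num) (by norm_num)]
    norm_num
  have h2 := eLpNorm_nnreal_pow_eq_lintegral (f := g) (μ := (volume : Measure E4))
    (p := (12 / 5 : NNReal)) (by norm_num)
  have e2 : ((12 / 5 : NNReal) : ℝ) = 12 / 5 := by norm_num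
  rw [e2] at h2
  rw [lintegral_congr e, ← h2, ← eLpNorm_two_sq, ← eLpNorm_four_pow] at h
  have h3 := ENNReal.rpow_le_rpow h (by norm_num : (0 : ℝ) ≤ 5 / 2)
  rw [mul_rpow_of_nonneg _ _ (by norm_num)] at h3
  simp only [← rpow_natCast, ← rpow_mul] at h3 ⊢
  norm_num at h3 ⊢
  exact h3

theorem enorm_le_eLpNorm_weighted {V : Type*} [NormedAddCommGroup V] [NormedSpace ℝ V] (f : E4 → V)
    :
    ∀ᵐ x, ‖f x‖ₑ ≤ N[⊤] (fun x => (jap x ^ (1 / 2 : ℝ)) • f x) * wt x ^ (1 / 2 : ℝ) := by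
  rw [eLpNorm_exponent_top]
  filter_upwards [enorm_ae_le_eLpNormEssSup (fun x => (jap x ^ (1 / 2 : ℝ)) • f x) volume] with x hx
  have hj := jap_pos x
  have e : ofReal (jap x ^ (1 / 2 : ℝ)) * wt x ^ (1 / 2 : ℝ) = 1 := by
    rw [wt, ofReal_rpow_of_nonneg (ijap_pos x).le (by norm_num),
      ← ofReal_mul (by positivity), ← Real.mul_rpow hj.le (ijap_pos x).le, ijap,
      mul_inv_cancel₀ hj.ne', Real.one_rpow, ofReal_one]
  calc ‖f x‖ₑ = ‖f x‖ₑ * (ofReal (jap x ^ (1 / 2 : ℝ)) * wt x ^ (1 / 2 : ℝ)) := by rw [e, mul_one]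
    _ = ‖(jap x ^ (1 / 2 : ℝ)) • f x‖ₑ * wt x ^ (1 / 2 : ℝ) := by
        rw [enorm_smul, enorm_eq_ofReal (by positivity)]; ring
    _ ≤ _ := mul_le_mul' hx le_rfl

theorem ae_le_mixedNorm_top (F : ℝ → E4 → ℂ) :
    ∀ᵐ t, N[r] (F t) ≤ mixedNorm ⊤ r univ F := by
  rw [mixedNorm, Measure.restrict_univ, eLpNorm_exponent_top]
  exact enorm_ae_le_eLpNormEssSup (fun t => N[r] (F t)) volume

/-! ### Measurable representatives -/

/-- On `(a, b)` the functions `w` and `dw` are jointly measurable representatives of `v` and of the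
components of its weak gradient. -/
structure Rep (a b : ℝ) (v w : ℝ → E4 → ℂ) (dw : Fin 4 → ℝ → E4 → ℂ) : Prop where
  meas : StronglyMeasurable (uncurry w)
  meas_d : ∀ j, StronglyMeasurable (uncurry (dw j))
  ae_eq : ∀ᵐ t ∂vol[a,b], w t =ᵐ[volume] v t
  hasWeakDer : ∀ᵐ t ∂vol[a,b], ∀ j, HasWeakDer j (w t) (dw j t)
  grad : ∀ᵐ t ∂vol[a,b], (fun x => (WithLp.toLp 2 fun j => dw j t x : G4)) =ᵐ[volume] weakGrad (v t)

/-- Any jointly measurable modification of `v` has `derLim` as a jointly measurable gradient. -/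
theorem exists_rep {v : ℝ → E4 → ℂ}
    (hv : AEStronglyMeasurable (uncurry v) ((vol[a,b]).prod volume))
    (hd : ∀ᵐ t ∂vol[a,b], ∃ g, HasWeakGradient (v t) g) :
    ∃ w dw, Rep a b v w dw := by
  set w : ℝ → E4 → ℂ := fun t x => hv.mk _ (t, x) with hw
  have hws : StronglyMeasurable (uncurry w) := hv.stronglyMeasurable_mk
  have hae : ∀ᵐ t ∂vol[a,b], w t =ᵐ[volume] v t := by
    filter_upwards [Measure.ae_ae_of_ae_prod hv.ae_eq_mk] with t ht
    filter_upwards [ht] with x hx using hx.symm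
  have hg : ∀ᵐ t ∂vol[a,b], HasWeakGradient (w t) (weakGrad (v t)) := by
    filter_upwards [hae, hd] with t h1 h2
    exact (hasWeakGradient_weakGrad h2).congr_left h1.symm
  refine ⟨w, fun j => derLim j w, hws, fun j => stronglyMeasurable_derLim j hws, hae, ?_, ?_⟩
  · filter_upwards [hg] with t ht j
    exact (ht.hasWeakDer j).congr EventuallyEq.rfl (derLim_ae_eq (ht.hasWeakDer j)).symm
  · filter_upwards [hg] with t ht
    filter_upwards [ae_all_iff.2 fun j => derLim_ae_eq (ht.hasWeakDer j)] with x hx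
    ext j
    exact hx j

theorem stronglyMeasurable_toLp {d : Fin 4 → ℝ → E4 → ℂ}
    (h : ∀ j, StronglyMeasurable (uncurry (d j))) :
    StronglyMeasurable (uncurry fun t x => (WithLp.toLp 2 fun j => d j t x : G4)) :=
  (PiLp.continuous_toLp 2 _).comp_stronglyMeasurable
    (measurable_pi_lambda _ fun j => (h j).measurable).stronglyMeasurable

theorem setLIntegral_sq_le_mixedNorm {V : Type*} [NormedAddCommGroup V]
    {u w : ℝ → E4 → V} (h : ∀ᵐ t ∂vol[a,b], w t =ᵐ[volume] u t) :
    ∫⁻ t in Ioo a b, N[r] (w t) ^ 2 ≤ mixedNorm 2 r univ u ^ 2 := by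
  rw [← lintegral_eLpNorm_sq_eq]
  refine le_trans (le_of_eq (lintegral_congr_ae ?_))
    (lintegral_mono' (Measure.restrict_mono (subset_univ (Ioo a b)) le_rfl) le_rfl)
  filter_upwards [h] with t ht
  rw [eLpNorm_congr_ae ht]

theorem cv_congr {K : E4 → ℂ} (h : f =ᵐ[volume] g) : cv K f = cv K g := by
  ext x
  exact integral_congr_ae (h.mono fun y hy => by simp only [hy])

theorem sum_pow_le (x : Fin 4 → ℝ≥0∞) (n : ℕ) : (∑ j, x j) ^ n ≤ 4 ^ n * ∑ j, x j ^ n := by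
  obtain ⟨k, hk⟩ := Finite.exists_max x
  calc (∑ j, x j) ^ n ≤ (4 * x k) ^ n :=
        pow_le_pow_left' ((sum_le_sum fun j _ => hk j).trans (le_of_eq (by simp))) n
    _ ≤ _ := by
        rw [mul_pow]
        gcongr
        exact single_le_sum (f := fun j => x j ^ n) (fun _ _ => zero_le) (Finset.mem_univ k)

theorem exists_sobolev_six_pow : ∃ C : ℝ≥0∞, C ≠ ⊤ ∧ ∀ (f : E4 → ℂ) (g : Fin 4 → E4 → ℂ),
    MemLp f 4 → (∀ j, HasWeakDer j f (g j)) → (∀ j, MemLp (g j) 2) → (∀ j, MemLp (g j) 4) →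
      N[6] f ^ 6 ≤ C * ∑ j, N[2] (g j) ^ 4 * N[4] (g j) ^ 2 := by
  obtain ⟨C, hC, h⟩ := exists_sobolev_six
  refine ⟨C ^ 6 * 4 ^ 6, by finiteness, fun f g hf hg h2 h4 => ?_⟩
  have hi := fun j => eLpNorm_interpolate (h2 j).1
  have hm : ∀ j, MemLp (g j) ((12 / 5 : NNReal) : ℝ≥0∞) := fun j => by
    refine ⟨(h2 j).1, ?_⟩
    by_contra hn
    have := hi j
    rw [not_lt_top_iff.1 hn, ENNReal.top_pow (by norm_num), top_le_iff] at this
    exact mul_ne_top (pow_ne_top (h2 j).2.ne) (pow_ne_top (h4 j).2.ne) this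
  calc N[6] f ^ 6 ≤ (C * ∑ j, N[((12 / 5 : NNReal) : ℝ≥0∞)] (g j)) ^ 6 :=
        pow_le_pow_left' (h f g hf hg hm) 6
    _ ≤ C ^ 6 * (4 ^ 6 * ∑ j, N[((12 / 5 : NNReal) : ℝ≥0∞)] (g j) ^ 6) := by
        rw [mul_pow]
        gcongr
        exact sum_pow_le _ 6
    _ ≤ _ := by
        rw [← mul_assoc]
        gcongr with j
        exact hi j

theorem eLpNorm_six_pow_le {α : ℝ≥0∞} (hα : ∀ᵐ x, ‖f x‖ₑ ≤ α) (h4 : MemLp f 4) :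
    N[6] f ^ 6 ≤ α ^ 2 * N[4] f ^ 4 := by
  have h : N[6] f ^ 6 = ∫⁻ x, ‖f x‖ₑ ^ 6 := eLpNorm_pow_eq (n := 6) (by simp) f
  rw [h, eLpNorm_four_pow, ← lintegral_const_mul'' _ (h4.1.enorm.pow_const 4)]
  refine lintegral_mono_ae ?_
  filter_upwards [hα] with x hx
  calc ‖f x‖ₑ ^ 6 = ‖f x‖ₑ ^ 2 * ‖f x‖ₑ ^ 4 := by ring
    _ ≤ _ := mul_le_mul' (pow_le_pow_left' hx 2) le_rfl

/-! ### Reduction to regular data -/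

/-- The hypotheses on the forcing term. -/
structure Forcing (F : ℝ → E4 → ℂ) : Prop where
  meas : AEStronglyMeasurable (uncurry F) (volume.prod volume)
  eq : SolvesSchrodinger univ F fun _ _ => 0
  L2 : mixedNorm ⊤ 2 univ F < ⊤
  L4 : mixedNorm ⊤ 4 univ F < ⊤
  grad : ∀ᵐ t : ℝ, ∃ g, HasWeakGradient (F t) g
  weight : mixedNorm 2 ⊤ univ (weighted F) < ⊤
  weight_grad : mixedNorm 2 ⊤ univ (weighted fun t => weakGrad (F t)) < ⊤
  grad_four : mixedNorm 2 4 univ (fun t => weakGrad (F t)) < ⊤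

section Reduction

variable {S : Framework} {F v f w : ℝ → E4 → ℂ} {I : Set ℝ}
  {dv dF : Fin 4 → ℝ → E4 → ℂ}

theorem Regular.mono {M' : ℝ≥0∞} (h : Regular a b v F dv dF M) (hM : M ≤ M') (hM' : M' ≠ ⊤) :
    Regular a b v F dv dF M' :=
  { h with
    one_le := h.one_le.trans hM
    ne_top := hM'
    slice := h.slice.mono fun _ ht =>
      { ht with
        v4_le := ht.v4_le.trans hM
        F2_le := ht.F2_le.trans hM
        F4_le := ht.F4_le.trans hM
        dv2_le := fun j => (ht.dv2_le j).trans hM } }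

theorem Rep.weighted_ae_eq (hf : Rep a b F f dF) : ∀ᵐ t ∂vol[a,b],
    weighted f t =ᵐ[volume] weighted F t :=
  hf.ae_eq.mono fun t ht => ht.mono fun x hx => by simp only [weighted, hx]

theorem Rep.weighted_grad_ae_eq (hf : Rep a b F f dF) : ∀ᵐ t ∂vol[a,b],
    weighted (fun t x => (WithLp.toLp 2 fun j => dF j t x : G4)) t =ᵐ[volume]
      weighted (fun t => weakGrad (F t)) t :=
  hf.grad.mono fun t ht => ht.mono fun x hx => by simp only [weighted, hx]

theorem stronglyMeasurable_weighted {V : Type*} [NormedAddCommGroup V] [NormedSpace ℝ V]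
    {u : ℝ → E4 → V} (h : StronglyMeasurable (uncurry u)) :
    StronglyMeasurable (uncurry (weighted u)) := by
  have hc : Continuous fun z : ℝ × E4 => jap z.2 ^ (1 / 2 : ℝ) :=
    (jap_contDiff.continuous.comp continuous_snd).rpow_const fun z => Or.inl (jap_pos _).ne'
  exact hc.stronglyMeasurable.smul h

/-- On a compact time interval inside the interval of existence, a solution and the forcing term
have the regularity which the energy estimates use. -/
theorem IsSolution.exists_regular (h : IsSolution S F v₀ I v) (hF : Forcing F) (hab : a < b)
    (hI : Icc a b ⊆ I) (hw : Rep a b v w dv) (hf : Rep a b F f dF) :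
    ∃ M, Regular a b w f dv dF M := by
  obtain ⟨M₀, hM₀, hb⟩ := h.continuous.exists_bound hI
  obtain ⟨C, hC, h6⟩ := exists_sobolev_six_pow
  set M := M₀ + mixedNorm ⊤ 2 univ F + mixedNorm ⊤ 4 univ F + 1 with hMdef
  have hMt : M ≠ ⊤ := by have := hF.L2.ne; have := hF.L4.ne; finiteness
  have hM₀M : M₀ ≤ M := by rw [hMdef, add_assoc, add_assoc]; exact le_self_add
  have hsub : Ioo a b ⊆ Icc a b := Ioo_subset_Icc_self
  have hm := ae_restrict_mem (μ := volume) (measurableSet_Ioo (a := a) (b := b))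
  have hdv : ∀ᵐ t ∂vol[a,b], ∀ j, MemLp (dv j t) 2 ∧ N[2] (dv j t) ≤ M := by
    filter_upwards [hw.grad, hm] with t ht htm j
    have h1 := (h.continuous.1 t (hI (hsub htm))).memLp_weakGrad
    have h2 := memLp_apply ((memLp_congr_ae ht).2 h1) j
    refine ⟨h2, (eLpNorm_apply_le (fun x => (WithLp.toLp 2 fun j => dv j t x : G4)) 2 j).trans ?_⟩
    rw [eLpNorm_congr_ae ht]
    exact (hb t (hsub htm)).2.trans hM₀M
  have hv4 : ∀ᵐ t ∂vol[a,b], MemLp (w t) 4 ∧ N[4] (w t) ≤ M := by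
    filter_upwards [hw.ae_eq, hm] with t ht htm
    rw [memLp_congr_ae ht, eLpNorm_congr_ae ht]
    exact ⟨(h.continuous.1 t (hI (hsub htm))).1, (hb t (hsub htm)).1.trans hM₀M⟩
  have hFr : ∀ {r : ℝ≥0∞}, mixedNorm ⊤ r univ F < ⊤ → mixedNorm ⊤ r univ F ≤ M →
      ∀ᵐ t ∂vol[a,b], MemLp (f t) r ∧ N[r] (f t) ≤ M := by
    intro r h1 h2
    filter_upwards [ae_restrict_of_ae (ae_le_mixedNorm_top (r := r) F), hf.ae_eq, hf.hasWeakDer]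
      with t ht h3 h4
    rw [← eLpNorm_congr_ae h3] at ht
    exact ⟨⟨(h4 0).1.aestronglyMeasurable, ht.trans_lt h1⟩, ht.trans h2⟩
  have hF2 := hFr hF.L2 (by rw [hMdef, add_assoc, add_assoc]; exact le_self_add.trans le_add_self)
  have hF4 := hFr hF.L4 (by rw [hMdef, add_assoc]; exact le_self_add.trans le_add_self)
  -- the finiteness of the `X`-norm enters here
  have hdv4 : ∀ j, ∫⁻ t in Ioo a b, N[4] (dv j t) ^ 2 < ⊤ := by
    intro j
    have hJ : volume.restrict (Icc a b) = vol[a,b] := restrict_Ioo_eq_restrict_Icc.symm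
    rw [← hJ]
    have hmJ : ∀ {p : ℝ → Prop}, (∀ᵐ t ∂vol[a,b], p t) →
        ∀ᵐ t ∂volume.restrict (Icc a b), p t := by rw [hJ]; exact id
    refine S.lintegral_der_four_lt_top (v := v) (j := j) ?_ (hmJ ?_) (hmJ ?_)
      (hmJ (hdv.mono fun t ht => (ht j).1)) ?_
          (h.memX a (hI ⟨le_rfl, hab.le⟩) b (hI ⟨hab.le, le_rfl⟩))
    · exact h.aestronglyMeasurable.mono_measure
        (Measure.prod_mono (Measure.restrict_mono hI le_rfl) le_rfl)
    · filter_upwards [hm] with t htm using (h.continuous.1 t (hI (hsub htm))).1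
    · filter_upwards [hw.hasWeakDer, hw.ae_eq] with t h1 h2 using (h1 j).congr h2 EventuallyEq.rfl
    · rw [hJ]
      calc ∫⁻ t in Ioo a b, N[2] (dv j t) ^ 2 ≤ ∫⁻ t in Ioo a b, M ^ 2 :=
            lintegral_mono_ae (hdv.mono fun t ht => pow_le_pow_left' (ht j).2 2)
        _ < ⊤ := by rw [setLIntegral_const, Real.volume_Ioo]; finiteness
  have hmx : ∀ j, Measurable fun t => N[4] (dv j t) ^ 2 := fun j =>
    (measurable_eLpNorm_slice (hw.meas_d j) 4).pow_const 2
  have hdv4' : ∀ᵐ t ∂vol[a,b], ∀ j, MemLp (dv j t) 4 := by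
    filter_upwards [ae_all_iff.2 fun j => ae_lt_top (hmx j) (hdv4 j).ne, hdv] with t h1 h2 j
    exact ⟨(h2 j).1.1, (pow_lt_top_iff.1 (h1 j)).resolve_right (by norm_num)⟩
  set gF : ℝ → E4 → G4 := fun t x => WithLp.toLp 2 fun j => dF j t x with hgF
  have hmδ : Measurable fun t => N[4] (gF t) ^ 2 :=
    (measurable_eLpNorm_slice (stronglyMeasurable_toLp hf.meas_d) 4).pow_const 2
  have hδ : ∫⁻ t in Ioo a b, N[4] (gF t) ^ 2 < ⊤ :=
    (setLIntegral_sq_le_mixedNorm hf.grad).trans_lt (pow_lt_top hF.grad_four)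
  have hmα : Measurable fun t => N[⊤] (weighted f t) ^ 2 :=
    (measurable_eLpNorm_slice (stronglyMeasurable_weighted hf.meas) ⊤).pow_const 2
  have hα : ∫⁻ t in Ioo a b, N[⊤] (weighted f t) ^ 2 < ⊤ :=
    (setLIntegral_sq_le_mixedNorm hf.weighted_ae_eq).trans_lt (pow_lt_top hF.weight)
  have hdF4 : ∀ᵐ t ∂vol[a,b], ∀ j, MemLp (dF j t) 4 := by
    filter_upwards [ae_lt_top hmδ hδ.ne, hf.hasWeakDer] with t h1 h2 j
    exact ⟨(h2 j).2.1.aestronglyMeasurable, (eLpNorm_apply_le (gF t) 4 j).trans_lt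
      ((pow_lt_top_iff.1 h1).resolve_right (by norm_num))⟩
  have hf6 : ∀ᵐ t ∂vol[a,b], MemLp (f t) 4 ∧ N[6] (f t) ^ 6 ≤ N[⊤] (weighted f t) ^ 2 * M ^ 4 := by
    filter_upwards [hF4] with t h4
    refine ⟨h4.1, (eLpNorm_six_pow_le ?_ h4.1).trans (by gcongr; exact h4.2)⟩
    filter_upwards [enorm_le_eLpNorm_weighted (f t)] with x hx
    exact hx.trans (mul_le_of_le_one_right zero_le
        (ENNReal.rpow_le_one (wt_le_one x) (by norm_num)))
  have hw6 : ∀ᵐ t ∂vol[a,b], N[6] (w t) ^ 6 ≤ C * (M ^ 4 * ∑ j, N[4] (dv j t) ^ 2) := by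
    filter_upwards [hv4, hw.hasWeakDer, hdv, hdv4'] with t h1 h2 h3 h4
    refine (h6 _ _ h1.1 h2 (fun j => (h3 j).1) h4).trans (mul_le_mul' le_rfl ?_)
    rw [mul_sum]
    exact sum_le_sum fun j _ => mul_le_mul' (pow_le_pow_left' (h3 j).2 4) le_rfl
  have hfin : ∀ {x : ℝ≥0∞}, x ^ 6 < ⊤ → x < ⊤ := fun hx =>
    (pow_lt_top_iff.1 hx).resolve_right (by norm_num)
  refine ⟨M, hab, le_add_self, hMt, hw.meas, hf.meas, hw.meas_d, hf.meas_d, ?_, ?_, ?_, ?_⟩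
  · filter_upwards [hv4, hF2, hF4, hdv, hdv4', hdF4, hw.hasWeakDer, hf.hasWeakDer, hf6, hw6,
      ae_lt_top hmα hα.ne] with t k1 k2 k3 k4 k5 k6 k7 k8 k9 k10 k11
    have m1 : MemLp (f t) 6 := ⟨k3.1.1, hfin (k9.2.trans_lt
      (mul_lt_top k11 (pow_lt_top hMt.lt_top)))⟩
    have m2 : MemLp (w t) 6 := ⟨k1.1.1, hfin (k10.trans_lt (mul_lt_top hC.lt_top
      (mul_lt_top (pow_lt_top hMt.lt_top)
        (sum_lt_top.2 fun j _ => pow_lt_top (k5 j).2))))⟩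
    exact ⟨k1.1, k2.1, k3.1, m1.add m2, fun j => (k4 j).1, k5, k6, k7, k8, k1.2, k2.2, k3.2,
      fun j => (k4 j).2⟩
  · have hpt : ∀ᵐ t ∂vol[a,b],
        control (f t ⊞ w t) (fun j => dv j t) (fun j => dF j t) ≤
        (64 + 2 ^ 6 * (C * M ^ 4)) * ∑ j, N[4] (dv j t) ^ 2 + (256 * N[4] (gF t) ^ 2 +
            ((2 ^ 6 * M ^ 4) * N[⊤] (weighted f t) ^ 2 + 1)) := by
      filter_upwards [hv4, hf6, hw6] with t k1 k2 k3
      have c1 : (∑ j, (N[4] (dv j t) + N[4] (dF j t))) ^ 2 ≤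
          64 * ∑ j, N[4] (dv j t) ^ 2 + 256 * N[4] (gF t) ^ 2 := by
        calc _ ≤ 4 ^ 2 * ∑ j, (N[4] (dv j t) + N[4] (dF j t)) ^ 2 := sum_pow_le _ 2
          _ ≤ 4 ^ 2 * ∑ j, 2 ^ 2 * (N[4] (dv j t) ^ 2 + N[4] (gF t) ^ 2) := by
              gcongr with j
              refine (add_pow_le_two_pow_mul _ _ 2).trans ?_
              gcongr
              exact eLpNorm_apply_le (gF t) 4 j
          _ = _ := by
              rw [← mul_sum, sum_add_distrib]
              simp only [Finset.sum_const, Finset.card_univ, Fintype.card_fin, nsmul_eq_mul]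
              push_cast
              ring
      have c2 : N[6] (f t ⊞ w t) ^ 6 ≤ 2 ^ 6 * (N[⊤] (weighted f t) ^ 2 * M ^ 4 +
            C * (M ^ 4 * ∑ j, N[4] (dv j t) ^ 2)) :=
        (pow_le_pow_left' (eLpNorm_add_le k2.1.1 k1.1.1 (by norm_num)) 6).trans
          ((add_pow_le_two_pow_mul _ _ 6).trans (by gcongr; exact k2.2))
      refine (add_le_add (add_le_add c1 c2) le_rfl).trans (le_of_eq ?_)
      ring
    refine (lintegral_mono_ae hpt).trans_lt ?_
    rw [lintegral_add_left ((Finset.measurable_sum _ fun j _ => hmx j).const_mul _),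
      lintegral_add_left (hmδ.const_mul _), lintegral_add_left (hmα.const_mul _),
      lintegral_const_mul' _ _ (by finiteness), lintegral_const_mul' _ _ (by finiteness),
      lintegral_const_mul' _ _ (by finiteness), lintegral_finsetSum _ fun j _ => hmx j,
      setLIntegral_const, Real.volume_Ioo]
    have := sum_lt_top.2 fun j (_ : j ∈ Finset.univ) => hdv4 j
    finiteness
  · intro k hk hc x
    refine (h.equation.hasWeakDerivC hI hk hc x).congr ?_ ?_
    · filter_upwards [hw.ae_eq] with t ht using congrFun (cv_congr ht.symm) x
    · filter_upwards [hw.ae_eq, hf.ae_eq] with t ht h2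
      have e : forcedCubic F v t =ᵐ[volume] cub fun x => f t x + w t x := by
        filter_upwards [ht, h2] with x h3 h4
        simp only [forcedCubic, cub, h3, h4]
      rw [cv_congr ht.symm, cv_congr e]
  · intro k hk hc x
    refine (hF.eq.hasWeakDerivC (subset_univ (Icc a b)) hk hc x).congr ?_ ?_
    · filter_upwards [hf.ae_eq] with t ht using congrFun (cv_congr ht.symm) x
    · filter_upwards [hf.ae_eq] with t ht
      rw [cv_congr ht.symm]
      simp [cv]

end Reduction

section Conclusion

variable {S : Framework} {F v f w : ℝ → E4 → ℂ} {I : Set ℝ}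
  {dv dF : Fin 4 → ℝ → E4 → ℂ}

theorem IsSolution.tendsto_initial (h : IsSolution S F v₀ I v) (h0 : (0 : ℝ) ∈ Ioo a b)
    (hw : Rep a b v w dv) :
    Tendsto (fun t => N[4] (w t - v₀)) nearZero (𝓝 0) := by
  have h1 := h.continuous.tendsto_sub_four h.zero_mem
  rw [h.isOpen.nhdsWithin_eq h.zero_mem] at h1
  refine (h1.mono_left inf_le_left).congr' ?_
  filter_upwards [eventually_nearZero h0 hw.ae_eq] with t ht
  exact eLpNorm_congr_ae (ht.symm.sub h.initial)

theorem IsSolution.memLp_four_initial (h : IsSolution S F v₀ I v) : MemLp v₀ 4 :=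
  (memLp_congr_ae h.initial).1 (h.continuous.1 0 h.zero_mem).1

theorem IsSolution.energy_initial_ne_top (h : IsSolution S F v₀ I v) : energy v₀ ≠ ⊤ := by
  have hv0 : MemHdotOne (v 0) := h.continuous.1 0 h.zero_mem
  rw [← energy_congr h.initial, energy_eq hv0.1.1]
  have := hv0.memLp_weakGrad.2.ne
  have := hv0.1.2.ne
  finiteness

/-- Square integrability of the initial value propagates on bounded time intervals. -/
theorem IsSolution.exists_regularL2 (h : IsSolution S F v₀ I v) (hv₀ : MemLp v₀ 2) (hF : Forcing F)
    (h0 : (0 : ℝ) ∈ Ioo a b) (hI : Icc a b ⊆ I) (hw : Rep a b v w dv) (hf : Rep a b F f dF) :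
    ∃ M, RegularL2 a b w f dv dF M := by
  obtain ⟨M, hM⟩ := h.exists_regular hF (h0.1.trans h0.2) hI hw hf
  obtain ⟨C, hC, hmass⟩ := hM.mass_le h0 hv₀ h.memLp_four_initial (h.tendsto_initial h0 hw)
  set K : ℝ≥0∞ := N[2] v₀ ^ 2 + ofReal (C * (|a| + |b|))
  have hK : K ≠ ⊤ := add_ne_top.2 ⟨pow_ne_top hv₀.2.ne, ofReal_ne_top⟩
  have hMt := hM.ne_top
  refine ⟨M + (K + 1), hM.mono le_self_add (by finiteness), ?_⟩
  filter_upwards [hmass, ae_restrict_mem measurableSet_Ioo] with t ht htm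
  have h1 : |t| ≤ |a| + |b| := abs_le.2
    ⟨by linarith [neg_abs_le a, abs_nonneg b, htm.1], by linarith [le_abs_self b, abs_nonneg a, htm.2]⟩
  have h2 : N[2] (w t) ^ 2 ≤ K := ht.trans
    (add_le_add le_rfl (ofReal_le_ofReal (mul_le_mul_of_nonneg_left h1 hC)))
  refine le_trans ?_ (le_add_self : K + 1 ≤ M + (K + 1))
  rcases le_total (N[2] (w t)) 1 with h3 | h3
  · exact h3.trans le_add_self
  · exact ((le_self_pow₀ h3 two_ne_zero).trans h2).trans le_self_add

theorem IsSolution.forcingBounds (h : IsSolution S F v₀ I v) (hv₀ : MemLp v₀ 2) (hF : Forcing F)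
    (h0 : (0 : ℝ) ∈ Ioo a b) (hw : Rep a b v w dv) (hf : Rep a b F f dF)
    (hM : RegularL2 a b w f dv dF M) :
    ForcingBounds a b w f dF (fun t => N[⊤] (weighted f t))
      (fun t => N[⊤] (weighted (fun t x => (WithLp.toLp 2 fun j => dF j t x : G4)) t))
      (fun t => N[4] (fun x => (WithLp.toLp 2 fun j => dF j t x : G4)))
      ((N[2] v₀).toReal + 2 * (mixedNorm ⊤ 2 univ F).toReal)
      (mixedNorm 2 ⊤ univ (weighted F)).toReal
      (mixedNorm 2 ⊤ univ (weighted fun t => weakGrad (F t))).toReal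
      (mixedNorm 2 4 univ fun t => weakGrad (F t)).toReal := by
  have hsq : ∀ {x : ℝ≥0∞}, x < ⊤ → x ^ 2 ≤ ofReal (x.toReal ^ 2) := fun hx => by
    rw [ofReal_pow toReal_nonneg, ofReal_toReal hx.ne]
  have hf2 : ∀ᵐ t ∂vol[a,b], N[2] (f t) ≤ mixedNorm ⊤ 2 univ F := by
    filter_upwards [ae_restrict_of_ae (ae_le_mixedNorm_top (r := 2) F), hf.ae_eq] with t ht h3
    rwa [eLpNorm_congr_ae h3]
  have hu := hM.mass_le h0 hv₀ h.memLp_four_initial (h.tendsto_initial h0 hw) hf2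
  have hm : ofReal ((N[2] v₀).toReal + 2 * (mixedNorm ⊤ 2 univ F).toReal) =
      N[2] v₀ + 2 * mixedNorm ⊤ 2 univ F := by
    rw [ofReal_add (by positivity) (by positivity), ofReal_mul (by norm_num),
      ofReal_toReal hv₀.2.ne, ofReal_toReal hF.L2.ne, ofReal_ofNat]
  refine ⟨by positivity, by positivity, by positivity, ?_, ?_, ?_, ?_, ?_, ?_, ?_, ?_, ?_, ?_⟩
  · exact (measurable_eLpNorm_slice (stronglyMeasurable_weighted hf.meas) ⊤).aemeasurable
  · exact (measurable_eLpNorm_slice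
      (stronglyMeasurable_weighted (stronglyMeasurable_toLp hf.meas_d)) ⊤).aemeasurable
  · filter_upwards [hu, hf2, hM.slice, hM.v2_le] with t k1 k2 k3 k4
    rw [hm]
    calc N[2] (w t) = N[2] ((f t ⊞ w t) - f t) := by congr 1; ext x; simp
      _ ≤ _ := eLpNorm_sub_le k3.u4.1 k3.F2.1 (by norm_num)
      _ ≤ (mixedNorm ⊤ 2 univ F + N[2] v₀) + mixedNorm ⊤ 2 univ F := add_le_add k1 k2
      _ = _ := by ring
  · filter_upwards [hu] with t ht
    rw [hm, add_comm]
    refine ht.trans (add_le_add ?_ le_rfl)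
    rw [two_mul]
    exact le_self_add
  · exact ae_of_all _ fun t => enorm_le_eLpNorm_weighted (f t)
  · refine ae_of_all _ fun t k => ?_
    filter_upwards [enorm_le_eLpNorm_weighted fun x => (WithLp.toLp 2 fun j => dF j t x : G4)]
      with x hx
    refine le_trans ?_ hx
    rw [← ofReal_norm, ← ofReal_norm]
    exact ofReal_le_ofReal (PiLp.norm_apply_le (WithLp.toLp 2 fun j => dF j t x : G4) k)
  · exact ae_of_all _ fun t k => eLpNorm_apply_le (fun x => (WithLp.toLp 2 fun j => dF j t x : G4))
        4 k
  · exact (setLIntegral_sq_le_mixedNorm hf.weighted_ae_eq).trans (hsq hF.weight)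
  · exact (setLIntegral_sq_le_mixedNorm hf.weighted_grad_ae_eq).trans (hsq hF.weight_grad)
  · exact (setLIntegral_sq_le_mixedNorm hf.grad).trans (hsq hF.grad_four)

theorem eLpNorm_toLp_sq {g : Fin 4 → E4 → ℂ} (hg : ∀ j, AEStronglyMeasurable (g j)) :
    N[2] (fun x => (WithLp.toLp 2 fun j => g j x : G4)) ^ 2 = ∑ j, N[2] (g j) ^ 2 := by
  simp only [eLpNorm_two_sq]
  rw [← lintegral_finsetSum' _ fun j _ => (hg j).enorm.pow_const 2]
  refine lintegral_congr fun x => ?_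
  simp only [← ofReal_norm, ← ofReal_pow (norm_nonneg _)]
  rw [← ofReal_sum_of_nonneg fun _ _ => by positivity, EuclideanSpace.norm_sq_eq]

theorem ofReal_modEnergy {u : E4 → ℂ} {d : Fin 4 → E4 → ℂ} (hu : MemLp u 4)
    (hd : ∀ j, MemLp (d j) 2) : ofReal (modEnergy u d) =
      (1 / 2) * N[2] (fun x => (WithLp.toLp 2 fun j => d j x : G4)) ^ 2 + (1 / 4) * N[4] u ^ 4 := by
  have h0 : ∀ j, 0 ≤ ∫ x, ‖d j x‖ ^ 2 := fun j => integral_nonneg fun _ => sq_nonneg _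
  have h4 : 0 ≤ ∫ x, ‖u x‖ ^ 4 := integral_nonneg fun _ => by positivity
  rw [eLpNorm_toLp_sq fun j => (hd j).1, eLpNorm_four_pow_eq hu,
    sum_congr rfl fun j _ => eLpNorm_two_sq_eq (hd j),
    ← ofReal_sum_of_nonneg fun j _ => h0 j, modEnergy,
    ofReal_add (mul_nonneg (by norm_num) (sum_nonneg fun j _ => h0 j)) (by positivity),
    ofReal_mul (by norm_num), ofReal_mul (by norm_num),
    ENNReal.ofReal_div_of_pos (by norm_num), ENNReal.ofReal_div_of_pos (by norm_num)]
  simp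

/-- Energies with potential parts `¼ q⁴` and `¼ p⁴` are comparable up to `φ⁴` if `q` and `p` differ
by at most `φ`. -/
theorem energy_compare (x : ℝ≥0∞) {φ : ℝ≥0∞} (h : q ≤ φ + p) :
    (1 / 2) * x + (1 / 4) * q ^ 4 ≤ 16 * ((1 / 2) * x + (1 / 4) * p ^ 4) + 4 * φ ^ 4 := by
  have e : (1 / 4 : ℝ≥0∞) * 2 ^ 4 = 4 :=
    (toReal_eq_toReal_iff' (by finiteness) (by finiteness)).1 (by simp; norm_num)
  have e' : (16 : ℝ≥0∞) * (1 / 4) = 4 :=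
    (toReal_eq_toReal_iff' (by finiteness) (by finiteness)).1 (by simp; norm_num)
  calc (1 / 2) * x + (1 / 4) * q ^ 4
      ≤ 16 * ((1 / 2) * x) + (1 / 4) * (2 ^ 4 * (φ ^ 4 + p ^ 4)) := by
        refine add_le_add (le_mul_of_one_le_left zero_le (by norm_num)) (mul_le_mul' le_rfl ?_)
        exact (pow_le_pow_left' h 4).trans (add_pow_le_two_pow_mul φ p 4)
    _ = _ := by rw [← mul_assoc (1 / 4), e, mul_add 16, ← mul_assoc 16 (1 / 4), e']; ring

/-- The energy bound at almost every time of a compact subinterval, with constants that do not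
depend on the subinterval. -/
theorem IsSolution.ae_energy_le (h : IsSolution S F v₀ I v) (hv₀ : MemLp v₀ 2) (hF : Forcing F)
    (h0 : (0 : ℝ) ∈ Ioo a b) (hI : Icc a b ⊆ I) :
    ∀ᵐ t ∂vol[a,b], energy (v t) ≤
      16 * ofReal (8 * 10 ^ 8 * Real.exp ((mixedNorm 2 ⊤ univ (weighted F)).toReal ^ 2 +
        (mixedNorm 2 ⊤ univ (weighted fun t => weakGrad (F t))).toReal ^ 2 +
        (mixedNorm 2 4 univ fun t => weakGrad (F t)).toReal ^ 2) *
        ((16 * (energy v₀).toReal + 4 * (mixedNorm ⊤ 4 univ F).toReal ^ 4 + 1) + 1 +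
          ((N[2] v₀).toReal + 2 * (mixedNorm ⊤ 2 univ F).toReal) ^ 2)) +
      4 * mixedNorm ⊤ 4 univ F ^ 4 := by
  have hsub : Ioo a b ⊆ I := Ioo_subset_Icc_self.trans hI
  have hm := ae_restrict_mem (μ := volume) (measurableSet_Ioo (a := a) (b := b))
  obtain ⟨w, dv, hw⟩ := exists_rep (a := a) (b := b) (h.aestronglyMeasurable.mono_measure
    (Measure.prod_mono (Measure.restrict_mono hsub le_rfl) le_rfl))
    (hm.mono fun t ht => ⟨_, (h.continuous.1 t (hsub ht)).hasWeakGradient⟩)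
  obtain ⟨f, dF, hf⟩ := exists_rep (a := a) (b := b) (hF.meas.mono_measure
    (Measure.prod_mono Measure.restrict_le_self le_rfl)) (ae_restrict_of_ae hF.grad)
  obtain ⟨M, hM⟩ := h.exists_regularL2 hv₀ hF h0 hI hw hf
  have hcmp : ∀ᵐ t ∂vol[a,b], ofReal (modEnergy (f t ⊞ w t) (fun j => dv j t)) ≤
        16 * energy (v t) + 4 * mixedNorm ⊤ 4 univ F ^ 4 ∧
      energy (v t) ≤ 16 * ofReal (modEnergy (f t ⊞ w t) (fun j => dv j t)) +
        4 * mixedNorm ⊤ 4 univ F ^ 4 := by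
    filter_upwards [hw.ae_eq, hw.grad, hf.ae_eq, hM.slice, hm,
      ae_restrict_of_ae (ae_le_mixedNorm_top (r := 4) F)] with t k1 k2 k3 k4 k5 k6
    rw [ofReal_modEnergy k4.u4 k4.dv2, energy_eq (h.continuous.1 t (hsub k5)).1.1,
      eLpNorm_congr_ae k2, ← eLpNorm_congr_ae k1]
    rw [← eLpNorm_congr_ae k3] at k6
    refine ⟨energy_compare _ ?_, energy_compare _ ?_⟩
    · exact (eLpNorm_add_le k4.F4.1 k4.v4.1 (by norm_num)).trans (add_le_add k6 le_rfl)
    · calc N[4] (w t) = N[4] ((f t ⊞ w t) - f t) := by congr 1; ext x; simp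
        _ ≤ _ := eLpNorm_sub_le k4.u4.1 k4.F4.1 (by norm_num)
        _ ≤ _ := by rw [add_comm]; exact add_le_add k6 le_rfl
  have he0 : energy v₀ = energy (v 0) := (energy_congr h.initial).symm
  have hetop := h.energy_initial_ne_top
  have h4 := hF.L4.ne
  refine (hM.energy_bound h0 (h.forcingBounds hv₀ hF h0 hw hf hM)
    (E₀ := 16 * (energy v₀).toReal + 4 * (mixedNorm ⊤ 4 univ F).toReal ^ 4 + 1)
    (by positivity) ?_).mp ?_
  · -- the energy is continuous at the initial time; the margin `1` in `E₀` is for nearby times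
    have hc : Tendsto (fun t => energy (v t)) nearZero (𝓝 (energy v₀)) := by
      rw [he0]
      refine Tendsto.mono_left ?_ inf_le_left
      rw [← h.isOpen.nhdsWithin_eq h.zero_mem]
      exact h.continuous.continuousOn_energy 0 h.zero_mem
    have hlt : energy v₀ < energy v₀ + ofReal (1 / 16) := ENNReal.lt_add_right hetop (by simp)
    filter_upwards [eventually_nearZero h0 hcmp, hc.eventually (Iio_mem_nhds hlt)] with t k1 k2
    rw [← ENNReal.ofReal_le_ofReal_iff (by positivity)]
    refine k1.1.trans ((add_le_add (mul_le_mul' le_rfl (le_of_lt k2)) le_rfl).trans (le_of_eq ?_))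
    rw [ofReal_add (by positivity) (by norm_num),
      ofReal_add (by positivity) (by positivity), ofReal_mul (by norm_num),
      ofReal_mul (by norm_num), ofReal_pow (by positivity),
      ofReal_toReal hetop, ofReal_toReal h4, mul_add,
      ← ofReal_ofNat 16, ← ofReal_mul (by norm_num)]
    norm_num
    ring
  · filter_upwards [hcmp] with t k1 k2
    refine k1.2.trans (add_le_add (mul_le_mul' le_rfl (ofReal_le_ofReal k2)) le_rfl)

/-- A continuous function satisfies at every point a bound that holds almost everywhere. -/
theorem le_of_ae_le {e : ℝ → ℝ≥0∞} {R : ℝ≥0∞} {t₀ : ℝ} (ht : t₀ ∈ Ioo a b)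
    (he : ContinuousOn e (Ioo a b)) (h : ∀ᵐ t ∂vol[a,b], e t ≤ R) : e t₀ ≤ R := by
  by_contra hlt
  have h1 : ∀ᶠ t in 𝓝 t₀, t ∈ Ioo a b ∧ R < e t :=
    (isOpen_Ioo.eventually_mem ht).and ((he.continuousAt (isOpen_Ioo.mem_nhds ht)).eventually
      (Ioi_mem_nhds (not_le.1 hlt)))
  refine (Measure.measure_pos_of_mem_nhds volume h1).ne' ?_
  rw [ae_restrict_iff' measurableSet_Ioo, ae_iff] at h
  refine measure_mono_null (fun t ht => ?_) h
  simp only [mem_ofPred_eq, Classical.not_imp, not_le]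
  exact ht

theorem exists_Icc_subset (hI : IsOpen I) (hc : I.OrdConnected) {t : ℝ} (h0 : (0 : ℝ) ∈ I)
    (ht : t ∈ I) : ∃ a b, (0 : ℝ) ∈ Ioo a b ∧ t ∈ Ioo a b ∧ Icc a b ⊆ I := by
  have hmin : min 0 t ∈ I := by rcases min_choice 0 t with h | h <;> rw [h] <;> assumption
  have hmax : max 0 t ∈ I := by rcases max_choice 0 t with h | h <;> rw [h] <;> assumption
  obtain ⟨a, ha, haI⟩ := exists_Ioc_subset_of_mem_nhds (hI.mem_nhds hmin) ⟨_, sub_one_lt _⟩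
  obtain ⟨b, hb, hbI⟩ := exists_Ico_subset_of_mem_nhds (hI.mem_nhds hmax) ⟨_, lt_add_one _⟩
  refine ⟨(a + min 0 t) / 2, (max 0 t + b) / 2, ?_, ?_, hc.out (haI ?_) (hbI ?_)⟩
  · constructor <;> linarith [min_le_left 0 t, le_max_left 0 t]
  · constructor <;> linarith [min_le_right 0 t, le_max_right 0 t]
  · constructor <;> linarith
  · constructor <;> linarith

/-- The numerical constants combine into the asserted form. -/
theorem final_constant {e n p q G H : ℝ} (he : 0 ≤ e) (hG : 0 ≤ G) (hH : 0 ≤ H) :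
    16 * (8 * 10 ^ 8 * Real.exp G * ((16 * e + 4 * q ^ 4 + 1) + 1 + (n + 2 * p) ^ 2)) + 4 * q ^ 4 ≤
      10 ^ 12 * Real.exp (10 ^ 12 * (H + G)) * (e + 1 + n ^ 2 + p ^ 2 + q ^ 4) := by
  obtain ⟨T, hTd⟩ : ∃ T, T = e + 1 + n ^ 2 + p ^ 2 + q ^ 4 := ⟨_, rfl⟩
  rw [← hTd]
  have hT : 0 ≤ T := by rw [hTd]; positivity
  have h1 : (16 * e + 4 * q ^ 4 + 1) + 1 + (n + 2 * p) ^ 2 ≤ 16 * T := by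
    have : (n + 2 * p) ^ 2 ≤ 2 * n ^ 2 + 8 * p ^ 2 := by nlinarith [sq_nonneg (n - 2 * p)]
    have hq : 0 ≤ q ^ 4 := by positivity
    rw [hTd]
    linarith [sq_nonneg n, sq_nonneg p]
  have h2 : 4 * q ^ 4 ≤ 4 * T := by nlinarith [sq_nonneg n, sq_nonneg p]
  have h3 : Real.exp G ≤ Real.exp (10 ^ 12 * (H + G)) := Real.exp_le_exp.2 (by nlinarith)
  have h4 : 1 ≤ Real.exp G := Real.one_le_exp hG
  have h5 : 8 * 10 ^ 8 * Real.exp G * ((16 * e + 4 * q ^ 4 + 1) + 1 + (n + 2 * p) ^ 2) ≤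
      8 * 10 ^ 8 * Real.exp G * (16 * T) := by gcongr
  have h6 : T ≤ Real.exp G * T := le_mul_of_one_le_left hT h4
  calc _ ≤ 10 ^ 12 * (Real.exp G * T) := by nlinarith
    _ ≤ 10 ^ 12 * (Real.exp (10 ^ 12 * (H + G)) * T) := by gcongr
    _ = _ := by ring

end Conclusion

end ForcedNLS

end

theorem proposition7p1 :
    ∃ C : ℝ, 1 ≤ C ∧
      ∀ (S : ForcedNLS.Framework) (v₀ : ForcedNLS.E4 → ℂ) (F : ℝ → ForcedNLS.E4 → ℂ),
        ForcedNLS.MemHOne v₀ →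
        AEStronglyMeasurable (Function.uncurry F) (volume.prod volume) →
        ForcedNLS.SolvesSchrodinger univ F (fun _ _ => 0) →
        S.YNorm univ F < ⊤ →
        ForcedNLS.mixedNorm ⊤ 2 univ F < ⊤ →
        ForcedNLS.mixedNorm ⊤ 4 univ F < ⊤ →
        ForcedNLS.mixedNorm 3 6 univ F < ⊤ →
        (∀ᵐ t : ℝ, ∃ g, ForcedNLS.HasWeakGradient (F t) g) →
        ForcedNLS.mixedNorm 2 ⊤ univ (ForcedNLS.weighted F) < ⊤ →
        ForcedNLS.mixedNorm 2 ⊤ univ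
          (ForcedNLS.weighted (fun t => ForcedNLS.weakGrad (F t))) < ⊤ →
        ForcedNLS.mixedNorm 2 4 univ (fun t => ForcedNLS.weakGrad (F t)) < ⊤ →
        ∀ (I : Set ℝ) (v : ℝ → ForcedNLS.E4 → ℂ),
          ForcedNLS.IsMaximalSolution S F v₀ I v →
          (⨆ t ∈ I, ForcedNLS.energy (v t)) ≤
            ENNReal.ofReal (C * Real.exp (C *
              ((ForcedNLS.mixedNorm 3 6 univ F).toReal ^ 3 +
                (ForcedNLS.mixedNorm 2 ⊤ univ (ForcedNLS.weighted F)).toReal ^ 2 +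
                (ForcedNLS.mixedNorm 2 ⊤ univ
                  (ForcedNLS.weighted (fun t => ForcedNLS.weakGrad (F t)))).toReal ^ 2 +
                (ForcedNLS.mixedNorm 2 4 univ
                  (fun t => ForcedNLS.weakGrad (F t))).toReal ^ 2))) *
            (ForcedNLS.energy v₀ + 1 + eLpNorm v₀ 2 volume ^ 2 +
              ForcedNLS.mixedNorm ⊤ 2 univ F ^ 2 + ForcedNLS.mixedNorm ⊤ 4 univ F ^ 4) := by
  refine ⟨10 ^ 12, by norm_num, fun S v₀ F hv₀ hm heq _ h2 h4 _ hg hw hwg hg4 I v hsol => ?_⟩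
  have hF : ForcedNLS.Forcing F := ⟨hm, heq, h2, h4, hg, hw, hwg, hg4⟩
  have h := hsol.1
  refine iSup₂_le fun t ht => ?_
  obtain ⟨a, b, h0, htI, hI⟩ := ForcedNLS.exists_Icc_subset h.isOpen h.ordConnected h.zero_mem ht
  refine (ForcedNLS.le_of_ae_le htI (h.continuous.continuousOn_energy.mono
    (Ioo_subset_Icc_self.trans hI)) (h.ae_energy_le hv₀.1 hF h0 hI)).trans ?_
  have hn := hv₀.1.2.ne
  have he := h.energy_initial_ne_top
  have e : ForcedNLS.energy v₀ + 1 + eLpNorm v₀ 2 volume ^ 2 +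
      ForcedNLS.mixedNorm ⊤ 2 univ F ^ 2 + ForcedNLS.mixedNorm ⊤ 4 univ F ^ 4 =
      ENNReal.ofReal ((ForcedNLS.energy v₀).toReal + 1 + (eLpNorm v₀ 2 volume).toReal ^ 2 +
        (ForcedNLS.mixedNorm ⊤ 2 univ F).toReal ^ 2 +
        (ForcedNLS.mixedNorm ⊤ 4 univ F).toReal ^ 4) := by
    rw [ENNReal.ofReal_add (by positivity) (by positivity),
      ENNReal.ofReal_add (by positivity) (by positivity),
      ENNReal.ofReal_add (by positivity) (by positivity),
      ENNReal.ofReal_add (by positivity) (by positivity), ENNReal.ofReal_pow (by positivity),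
      ENNReal.ofReal_pow (by positivity), ENNReal.ofReal_pow (by positivity),
      ENNReal.ofReal_toReal hn, ENNReal.ofReal_toReal he, ENNReal.ofReal_toReal h2.ne,
      ENNReal.ofReal_toReal h4.ne, ENNReal.ofReal_one]
  have e4 : 4 * ForcedNLS.mixedNorm ⊤ 4 univ F ^ 4 =
      ENNReal.ofReal (4 * (ForcedNLS.mixedNorm ⊤ 4 univ F).toReal ^ 4) := by
    rw [ENNReal.ofReal_mul (by norm_num), ENNReal.ofReal_pow (by positivity),
      ENNReal.ofReal_toReal h4.ne, ENNReal.ofReal_ofNat]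
  rw [e, e4, ← ENNReal.ofReal_mul (by positivity), ← ENNReal.ofReal_ofNat 16,
    ← ENNReal.ofReal_mul (by norm_num), ← ENNReal.ofReal_add (by positivity) (by positivity)]
  refine ENNReal.ofReal_le_ofReal ((ForcedNLS.final_constant (by positivity) (by positivity)
    (by positivity : 0 ≤ (ForcedNLS.mixedNorm 3 6 univ F).toReal ^ 3)).trans (le_of_eq ?_))
  simp only [add_assoc]
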